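/- Let $\mathbb{T}^2=(\mathbb{R}/2\pi\mathbb{Z})^2$, $e_n(x)=\frac1{2\pi}e^{in\cdot x}$ and $\langle n\rangle=(1+|n|^2)^{1/2}$ for $n\in\mathbb{Z}^2$, and for $s\in\mathbb{R}$ let $W^{s,\infty}(\mathbb{T}^2)$ be the space of distributions $u$ on $\mathbb{T}^2$ with $\|u\|_{W^{s,\infty}}=\|\langle\nabla\rangle^{s}u\|_{L^\infty(\mathbb{T}^2)}<\infty$. Let $W(t)=\sum_{n\in\mathbb{Z}^2}B_n(t)e_n$ be a cylindrical Wiener process on the real space $L^2(\mathbb{T}^2)$, defined on a probability space $(\Omega,\mathbb{P})$: the $B_n$ are complex Brownian motions with $\mathbb{E}|B_n(t)|^2=t$, independent except for $B_{-n}=\overline{B_n}$ ($B_0$ is a standard real Brownian motion). For $\varepsilon>0$ let $\mathcal{D}_\varepsilon(t)$ be the Fourier multiplier whose symbol at $n$ is the solution $D$ of $\varepsilon^2D''+D'+\langle n\rangle^2D=0$, $D(0)=0$, $D'(0)=1$, that is, with $\lambda=\frac{\sqrt{1-4\langle n\rangle^2\varepsilon^2}}{2\varepsilon^2}$ and $\zeta=\frac{\sqrt{4\langle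 n\rangle^2\varepsilon^2-1}}{2\varepsilon^2}$, $$\widehat{\mathcal{D}_\varepsilon}(n,t)=e^{-\frac{t}{2\varepsilon^2}}\frac{\sinh(\lambda t)}{\lambda}\ \Big(\langle n\rangle<\tfrac1{2\varepsilon}\Big),\qquad e^{-\frac{t}{2\varepsilon^2}}\frac{\sin(\zeta t)}{\zeta}\ \Big(\langle n\rangle>\tfrac1{2\varepsilon}\Big),\qquad e^{-\frac{t}{2\varepsilon^2}}\,t\ \Big(\langle n\rangle=\tfrac1{2\varepsilon}\Big),$$ and let $P_0(t)=e^{(\Delta-1)t}$. Define the stochastic convolutions $$\Psi_\varepsilon(t)=\int_0^t\varepsilon^{-2}\mathcal{D}_\varepsilon(t-t')\,dW(t')\quad(\varepsilon>0),\qquad \Psi_0(t)=\int_0^tP_0(t-t')\,dW(t'),$$ where the Wiener integrals $\int_0^t f\,dB_n$ of the smooth deterministic kernels are understood pathwise, as limits of Riemann sums. Let $\chi:\mathbb{R}\to[0,\infty)$ be smooth with $\chi=1$ on $[-1,1]$ and $\operatorname{supp}\chi\subset[-2,2]$, let $\mathbf{P}_N$ be the Fourier multiplier with symbol $\chi(\langle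 n\rangle/N)$, and set, for integers $N\ge1$ and $\ell\ge0$, $\Psi_{\varepsilon,N}=\mathbf{P}_N\Psi_\varepsilon$, $\sigma_{\varepsilon,N}(t)=\mathbb{E}[\Psi_{\varepsilon,N}(t,x)^2]$ (independent of $x$) and $$:\!\Psi_{\varepsilon,N}^\ell(t,x)\!:\;=H_\ell\big(\Psi_{\varepsilon,N}(t,x);\sigma_{\varepsilon,N}(t)\big),\qquad e^{sx-\frac12\sigma s^2}=\sum_{k\ge0}\frac{s^k}{k!}H_k(x;\sigma).$$ Then for every $\ell$ there is a distribution-valued process $(\varepsilon,t)\mapsto\;:\!\Psi_\varepsilon^\ell(t)\!:$ such that, for all finite $p,q\ge1$, all $T>0$ and all $\sigma>0$, as $N\to\infty$: (i) for each $\varepsilon\in[0,1]$, $:\!\Psi_{\varepsilon,N}^\ell\!:$ converges to $:\!\Psi_\varepsilon^\ell\!:$ in $L^p\big(\Omega;L^q([0,T];W^{-\sigma,\infty}(\mathbb{T}^2))\big)$ (in particular the sequence is Cauchy there); (ii) $(\varepsilon,t)\mapsto\;:\!\Psi_{\varepsilon,N}^\ell(t)\!:$ converges to $(\varepsilon,t)\mapsto\;:\!\Psi_\varepsilon^\ell(t)\!:$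 in $L^p\big(\Omega;L^q([0,1]\times[0,T];W^{-\sigma,\infty}(\mathbb{T}^2))\big)$; (iii) almost surely, $(\varepsilon,t)\mapsto\;:\!\Psi_{\varepsilon,N}^\ell(t)\!:$ converges to $(\varepsilon,t)\mapsto\;:\!\Psi_\varepsilon^\ell(t)\!:$ in $C\big([0,1]\times[0,T];W^{-\sigma,\infty}(\mathbb{T}^2)\big)$. In particular the limit is almost surely jointly continuous in $(\varepsilon,t)$, including at $\varepsilon=0$. -/

import Mathlib

open MeasureTheory Filter Topology
open ProbabilityTheory (IsBrownianReal IndepFun iIndepFun)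
open scoped ENNReal NNReal ComplexConjugate

noncomputable section

namespace WickDampedWave

/-! ### The torus, its Fourier basis and the spaces `W^{s,∞}` -/

instance factTwoPiPos : Fact (0 < 2 * Real.pi) := ⟨Real.two_pi_pos⟩

/-- The torus `𝕋² = (ℝ / 2πℤ)²`; its `volume` is the Lebesgue measure, of total mass `(2π)²`. -/
abbrev Torus : Type := Fin 2 → AddCircle (2 * Real.pi)

/-- Frequencies `n ∈ ℤ²`. -/
abbrev Freq : Type := Fin 2 → ℤ

/-- A distribution on `𝕋²`, given by the family `(û(n))ₙ` of its Fourier coefficients, so that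
`u = ∑ₙ û(n) eₙ`.  (No growth condition is imposed here; membership in one of the spaces
`W^{s,∞}` below forces polynomial growth.) -/
abbrev Dist : Type := Freq → ℂ

/-- `∏ᵢ e^{i nᵢ xᵢ} = e^{i n · x}` as a continuous function on the torus. -/
def mono (n : Freq) : C(Torus, ℂ) where
  toFun x := ∏ i, fourier (n i) (x i)
  continuous_toFun := by fun_prop

/-- The orthonormal basis `eₙ(x) = (2π)⁻¹ e^{i n · x}` of `L²(𝕋²)`. -/
def basisFun (n : Freq) (x : Torus) : ℂ := (2 * Real.pi : ℂ)⁻¹ * mono n x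

/-- Fourier coefficients `f̂(n) = ∫ f(x) conj(eₙ(x)) dx`. -/
def torusCoeff (f : Torus → ℂ) : Dist := fun n => ∫ x, f x * conj (basisFun n x)

/-- The Japanese bracket `⟨n⟩ = (1 + |n|²)^{1/2}`. -/
def bracket (n : Freq) : ℝ := Real.sqrt (1 + (n 0 : ℝ) ^ 2 + (n 1 : ℝ) ^ 2)

lemma bracket_pos (n : Freq) : 0 < bracket n := Real.sqrt_pos.2 (by positivity)

/-- `L^∞(𝕋²)` (complex valued, as are the function spaces below). -/
abbrev LInfty : Type := Lp ℂ ∞ (volume : Measure Torus)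

lemma continuous_basisFun (n : Freq) : Continuous (basisFun n) :=
  continuous_const.mul (mono n).continuous

lemma integrable_mul_conj_basisFun (g : LInfty) (n : Freq) :
    Integrable (fun x => g x * conj (basisFun n x)) := by
  have hg : Integrable (fun x => g x) := (Lp.memLp g).integrable le_top
  obtain ⟨C, hC⟩ := isCompact_univ.exists_bound_of_continuousOn
    (f := fun x => conj (basisFun n x))
    (Complex.continuous_conj.comp (continuous_basisFun n)).continuousOn
  exact hg.mul_bdd (c := C)
    (Complex.continuous_conj.comp (continuous_basisFun n)).aestronglyMeasurable
    (Eventually.of_forall fun x => hC x trivial)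

/-- The map `g ↦ ⟨∇⟩^{-s} g` from `L^∞(𝕋²)` to distributions: the `n`-th Fourier coefficient of
the image is `⟨n⟩^{-s} ĝ(n)`. -/
def besselMap (s : ℝ) : LInfty →ₗ[ℂ] Dist where
  toFun g := fun n => ((bracket n ^ (-s) : ℝ) : ℂ) * torusCoeff g n
  map_add' g h := by
    funext n
    have : torusCoeff (g + h : LInfty) n = torusCoeff g n + torusCoeff h n := by
      simp only [torusCoeff]
      rw [← integral_add (integrable_mul_conj_basisFun g n) (integrable_mul_conj_basisFun h n)]
      refine integral_congr_ae ?_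
      filter_upwards [Lp.coeFn_add g h] with x hx
      rw [hx, Pi.add_apply, add_mul]
    simp only [this, Pi.add_apply, mul_add]
  map_smul' c g := by
    funext n
    have : torusCoeff (c • g : LInfty) n = c * torusCoeff g n := by
      simp only [torusCoeff]
      rw [← integral_const_mul]
      refine integral_congr_ae ?_
      filter_upwards [Lp.coeFn_smul c g] with x hx
      rw [hx, Pi.smul_apply, smul_eq_mul, mul_assoc]
    simp only [this, RingHom.id_apply, Pi.smul_apply, smul_eq_mul]
    ring

lemma mono_neg (n : Freq) (x : Torus) : mono (-n) x = conj (mono n x) := by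
  simp only [mono, Pi.neg_apply, fourier_neg, ContinuousMap.coe_mk, map_prod]

lemma mono_add (m n : Freq) (x : Torus) : mono (m + n) x = mono m x * mono n x := by
  simp only [mono, Pi.add_apply, fourier_add, ContinuousMap.coe_mk, ← Finset.prod_mul_distrib]

/-- The star subalgebra of `C(𝕋²)` spanned by the characters. -/
def monoSubalgebra : StarSubalgebra ℂ C(Torus, ℂ) where
  toSubalgebra := Algebra.adjoin ℂ (Set.range mono)
  star_mem' := by
    change Algebra.adjoin ℂ (Set.range mono) ≤ star (Algebra.adjoin ℂ (Set.range mono))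
    refine Algebra.adjoin_le ?_
    rintro _ ⟨n, rfl⟩
    refine Algebra.subset_adjoin ⟨-n, ?_⟩
    ext1 x
    simp only [mono_neg, starRingEnd_apply, ContinuousMap.star_apply]

lemma monoSubalgebra_coe :
    Subalgebra.toSubmodule monoSubalgebra.toSubalgebra
      = Submodule.span ℂ (Set.range mono) := by
  apply Algebra.adjoin_eq_span_of_subset
  refine .trans (fun x ↦ Submonoid.closure_induction (fun _ ↦ id) ⟨0, ?_⟩ ?_)
    Submodule.subset_span
  · ext x
    simp [mono]
  · rintro _ _ _ _ ⟨m, rfl⟩ ⟨n, rfl⟩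
    refine ⟨m + n, ?_⟩
    ext x
    simp [mono_add]

lemma monoSubalgebra_separatesPoints : monoSubalgebra.SeparatesPoints := by
  intro x y hxy
  rw [Ne, funext_iff, not_forall] at hxy
  obtain ⟨i, hi⟩ := hxy
  refine ⟨_, ⟨mono (Pi.single i 1), Algebra.subset_adjoin ⟨Pi.single i 1, rfl⟩, rfl⟩, ?_⟩
  have key : ∀ z : Torus, mono (Pi.single i 1) z = fourier 1 (z i) := by
    intro z
    simp only [mono, ContinuousMap.coe_mk]
    rw [Finset.prod_eq_single i]
    · simp
    · intro j _ hj
      simp [Pi.single_eq_of_ne hj]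
    · simp
  dsimp only
  rw [key, key, fourier_one, fourier_one]
  intro h
  exact hi (AddCircle.injective_toCircle Real.two_pi_pos.ne' (Circle.coe_injective h))

lemma span_mono_closure_eq_top :
    (Submodule.span ℂ (Set.range mono)).topologicalClosure = ⊤ := by
  rw [← monoSubalgebra_coe]
  exact congr_arg (Subalgebra.toSubmodule <| StarSubalgebra.toSubalgebra ·)
    (ContinuousMap.starSubalgebra_topologicalClosure_eq_top_of_separatesPoints _
      monoSubalgebra_separatesPoints)

/-- A bounded function is determined by its Fourier coefficients. -/
lemma eq_zero_of_torusCoeff (g : LInfty) (h : ∀ n, torusCoeff g n = 0) : g = 0 := by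
  have hg2 : MemLp (fun x => g x) 2 (volume : Measure Torus) :=
    (Lp.memLp g).mono_exponent le_top
  set g2 : Lp ℂ 2 (volume : Measure Torus) := hg2.toLp _ with hg2def
  have hspan : (Submodule.span ℂ (Set.range fun n =>
      ContinuousMap.toLp (E := ℂ) 2 (volume : Measure Torus) ℂ (mono n))).topologicalClosure
        = ⊤ := by
    simpa only [Submodule.map_span, ContinuousLinearMap.coe_coe, ← Set.range_comp,
      Function.comp_def] using
      (ContinuousMap.toLp_denseRange ℂ (volume : Measure Torus) ℂ
        (p := 2) (by simp)).topologicalClosure_map_submodule span_mono_closure_eq_top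
  have hinner : ∀ n, inner ℂ
      (ContinuousMap.toLp (E := ℂ) 2 (volume : Measure Torus) ℂ (mono n)) g2 = 0 := by
    intro n
    rw [L2.inner_def]
    have h2 : (2 * Real.pi : ℂ)⁻¹ ≠ 0 := by
      have := Real.pi_ne_zero
      simp [this]
    have h1 := h n
    simp only [torusCoeff, basisFun, map_mul] at h1
    have h3 : ∫ x, g x * (conj ((2 * Real.pi : ℂ)⁻¹) * conj (mono n x))
        = conj ((2 * Real.pi : ℂ)⁻¹) * ∫ x, g x * conj (mono n x) := by
      rw [← integral_const_mul]
      congr 1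
      funext x
      ring
    rw [h3, mul_eq_zero] at h1
    have h4 := h1.resolve_left (by simp)
    rw [← h4]
    refine integral_congr_ae ?_
    filter_upwards [ContinuousMap.coeFn_toLp (𝕜 := ℂ) (p := 2) (volume : Measure Torus) (mono n),
      hg2.coeFn_toLp] with x hx1 hx2
    rw [hx1, hx2]
    simp [RCLike.inner_apply]
  have hzero : g2 = 0 := by
    have hd : Dense ((Submodule.span ℂ (Set.range fun n =>
      ContinuousMap.toLp (E := ℂ) 2 (volume : Measure Torus) ℂ (mono n)) :
        Submodule ℂ (Lp ℂ 2 (volume : Measure Torus))) : Set (Lp ℂ 2 (volume : Measure Torus))) :=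
      (Submodule.dense_iff_topologicalClosure_eq_top).2 hspan
    refine hd.eq_zero_of_inner_right ℂ (fun v hv => ?_)
    rw [SetLike.mem_coe] at hv
    induction hv using Submodule.span_induction with
    | mem x hx => obtain ⟨n, rfl⟩ := hx; exact hinner n
    | zero => simp
    | add x y _ _ hx hy => simp_all [inner_add_left]
    | smul a x _ hx => simp_all [inner_smul_left]
  refine Lp.ext ?_
  have e1 := hg2.coeFn_toLp
  rw [← hg2def, hzero] at e1
  filter_upwards [e1, Lp.coeFn_zero ℂ 2 (volume : Measure Torus),
    Lp.coeFn_zero ℂ ∞ (volume : Measure Torus)] with x h1 h2 h3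
  rw [h3, ← h1, h2]

lemma besselMap_injective (s : ℝ) : Function.Injective (besselMap s) := by
  refine (injective_iff_map_eq_zero (besselMap s)).2 fun g hg => eq_zero_of_torusCoeff g fun n => ?_
  have h := congrFun hg n
  have hb : ((bracket n ^ (-s) : ℝ) : ℂ) ≠ 0 :=
    Complex.ofReal_ne_zero.2 (Real.rpow_pos_of_pos (bracket_pos n) _).ne'
  exact (mul_eq_zero.1 h).resolve_left hb

/-- The Sobolev space `W^{s,∞}(𝕋²)` of all distributions `u` for which `⟨∇⟩^s u` is a bounded
function, that is, `u = ⟨∇⟩^{-s} g` with `g ∈ L^∞(𝕋²)`; the norm is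
`‖u‖_{W^{s,∞}} = ‖⟨∇⟩^s u‖_{L^∞}`. -/
def SobolevInfty (s : ℝ) : Type := ↥(LinearMap.range (besselMap s))

instance (s : ℝ) : AddCommGroup (SobolevInfty s) :=
  inferInstanceAs (AddCommGroup ↥(LinearMap.range (besselMap s)))

instance (s : ℝ) : Module ℂ (SobolevInfty s) :=
  inferInstanceAs (Module ℂ ↥(LinearMap.range (besselMap s)))

/-- The linear bijection `u ↦ ⟨∇⟩^s u` from `W^{s,∞}(𝕋²)` onto `L^∞(𝕋²)`. -/
def besselEquiv (s : ℝ) : SobolevInfty s ≃ₗ[ℂ] LInfty :=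
  (LinearEquiv.ofInjective (besselMap s) (besselMap_injective s)).symm

instance (s : ℝ) : NormedAddCommGroup (SobolevInfty s) :=
  NormedAddCommGroup.induced (SobolevInfty s) LInfty (besselEquiv s) (besselEquiv s).injective

instance (s : ℝ) : NormedSpace ℂ (SobolevInfty s) :=
  NormedSpace.induced ℂ (SobolevInfty s) LInfty (besselEquiv s)

/-- The inclusion of `W^{s,∞}(𝕋²)` into the distributions. -/
def SobolevInfty.toDist {s : ℝ} (u : SobolevInfty s) : Dist :=
  (show ↥(LinearMap.range (besselMap s)) from u).1

/-! ### Noise and stochastic convolutions -/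

/-- One representative of each pair `{n, -n}`, `n ∈ ℤ²`. -/
def halfLattice : Set Freq := {n | 0 < n 0 ∨ (n 0 = 0 ∧ 0 ≤ n 1)}

/-- The Fourier coefficients `(Bₙ)` of a cylindrical Wiener process `W(t) = ∑ₙ Bₙ(t) eₙ` on the
real space `L²(𝕋²)`: complex Brownian motions with `E|Bₙ(t)|² = t`, subject to
`B₋ₙ = conj Bₙ` (so that `B₀` is real) and independent otherwise. -/
structure IsCylindricalWiener {Ω : Type*} [MeasurableSpace Ω]
    (B : Freq → ℝ≥0 → Ω → ℂ) (P : Measure Ω) : Prop where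
  conj_symm : ∀ n, ∀ᵐ ω ∂P, ∀ t, B (-n) t ω = conj (B n t ω)
  zero : IsBrownianReal (fun t ω => (B 0 t ω).re) P
  re : ∀ n, n ≠ 0 → IsBrownianReal (fun t ω => Real.sqrt 2 * (B n t ω).re) P
  im : ∀ n, n ≠ 0 → IsBrownianReal (fun t ω => Real.sqrt 2 * (B n t ω).im) P
  re_im : ∀ n, n ≠ 0 → IndepFun (fun ω t => (B n t ω).re) (fun ω t => (B n t ω).im) P
  indep : iIndepFun (fun (n : halfLattice) ω t => B n t ω) P

/-- The Wiener integral `∫₀ᵗ f(t') db(t')` of a deterministic integrand along a path `b`, as the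
limit of its Riemann sums over the uniform partitions of `[0,t]`.  For continuously differentiable
`f`, the only integrands used below, the limit exists for each continuous path `b`. -/
def wienerIntegral (f : ℝ → ℝ) (b : ℝ≥0 → ℂ) (t : ℝ) : ℂ :=
  limUnder atTop fun k : ℕ => ∑ j ∈ Finset.range k,
    (f (t * j / k) : ℂ) * (b (t * (j + 1) / k).toNNReal - b (t * j / k).toNNReal)

/-- The symbol of `𝒟_ε(t)`, the propagator of `ε² ∂ₜ² + ∂ₜ + (1 - Δ)`, at frequency `n`: with
`λ = √(1 - 4⟨n⟩²ε²) / (2ε²)` and `ζ = √(4⟨n⟩²ε² - 1) / (2ε²)` it is `e^{-t/(2ε²)} sinh(λt)/λ` if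
`⟨n⟩ < (2ε)⁻¹`, `e^{-t/(2ε²)} sin(ζt)/ζ` if `⟨n⟩ > (2ε)⁻¹`, and `e^{-t/(2ε²)} t` (the common limit)
if `⟨n⟩ = (2ε)⁻¹`. -/
def waveSymbol (ε : ℝ) (n : Freq) (t : ℝ) : ℝ :=
  let lam := Real.sqrt (1 - 4 * bracket n ^ 2 * ε ^ 2) / (2 * ε ^ 2)
  let zet := Real.sqrt (4 * bracket n ^ 2 * ε ^ 2 - 1) / (2 * ε ^ 2)
  Real.exp (-t / (2 * ε ^ 2)) *
    if bracket n < (2 * ε)⁻¹ then Real.sinh (lam * t) / lam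
    else if (2 * ε)⁻¹ < bracket n then Real.sin (zet * t) / zet
    else t

/-- The symbol of the Duhamel kernel: `ε⁻² 𝒟_ε(t)` for `ε ≠ 0` and the heat propagator
`P₀(t) = e^{(Δ - 1) t}` for `ε = 0`. -/
def kernel (ε : ℝ) (n : Freq) (t : ℝ) : ℝ :=
  if ε = 0 then Real.exp (-t * bracket n ^ 2) else (ε ^ 2)⁻¹ * waveSymbol ε n t

variable {Ω : Type*}

/-- The stochastic convolution `Ψ_ε(t) = ∫₀ᵗ ε⁻² 𝒟_ε(t - t') dW(t')`, resp.
`Ψ₀(t) = ∫₀ᵗ P₀(t - t') dW(t')`, given by its Fourier coefficients. -/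
def stochConv (B : Freq → ℝ≥0 → Ω → ℂ) (ε t : ℝ) (ω : Ω) : Dist :=
  fun n => wienerIntegral (fun t' => kernel ε n (t - t')) (fun s => B n s ω) t

/-- A smooth cutoff: `χ ≥ 0`, `χ = 1` on `[-1,1]` and `supp χ ⊆ [-2,2]`. -/
structure IsCutoff (χ : ℝ → ℝ) : Prop where
  smooth : ContDiff ℝ ((⊤ : ℕ∞) : WithTop ℕ∞) χ
  nonneg : ∀ x, 0 ≤ χ x
  eq_one : ∀ x, |x| ≤ 1 → χ x = 1
  supp : tsupport χ ⊆ Set.Icc (-2) 2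

/-- The truncated stochastic convolution `Ψ_{ε,N} = P_N Ψ_ε`, where `P_N` is the Fourier
multiplier with symbol `χ(⟨n⟩/N)`.  For `N ≥ 1` the sum is finite; it is almost surely real. -/
def truncConv (χ : ℝ → ℝ) (B : Freq → ℝ≥0 → Ω → ℂ) (N : ℕ) (ε t : ℝ) (ω : Ω) (x : Torus) : ℝ :=
  (∑' n : Freq, (χ (bracket n / N) : ℂ) * stochConv B ε t ω n * basisFun n x).re

/-- The Hermite polynomials `H_k(x; σ)` with variance parameter `σ`, whose generating function is
`e^{sx - σs²/2} = ∑_k (s^k / k!) H_k(x; σ)`. -/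
def hermiteVar : ℕ → ℝ → ℝ → ℝ
  | 0, _, _ => 1
  | 1, x, _ => x
  | k + 2, x, σ => x * hermiteVar (k + 1) x σ - (k + 1) * σ * hermiteVar k x σ

/-- The Wick power `:Ψ_{ε,N}^ℓ(t,x): = H_ℓ(Ψ_{ε,N}(t,x); σ_{ε,N}(t))` with
`σ_{ε,N}(t) = E[Ψ_{ε,N}(t,x)²]`, as a function of `x` (the variance does not depend on `x`). -/
def wickFun [MeasurableSpace Ω] (P : Measure Ω) (χ : ℝ → ℝ) (B : Freq → ℝ≥0 → Ω → ℂ)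
    (ℓ N : ℕ) (ε t : ℝ) (ω : Ω) (x : Torus) : ℝ :=
  hermiteVar ℓ (truncConv χ B N ε t ω x) (∫ ω', truncConv χ B N ε t ω' x ^ 2 ∂P)

/-- The Wick power `:Ψ_{ε,N}^ℓ(t):` as a distribution on `𝕋²`. -/
def wickDist [MeasurableSpace Ω] (P : Measure Ω) (χ : ℝ → ℝ) (B : Freq → ℝ≥0 → Ω → ℂ)
    (ℓ N : ℕ) (ε t : ℝ) (ω : Ω) : Dist :=
  torusCoeff fun x => (wickFun P χ B ℓ N ε t ω x : ℂ)

/-! ### Modes of convergence -/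

/-- `U_N → V` in `L^p(Ω; L^q(S; W^{s,∞}))`, for distribution-valued processes `U_N`, `N ≥ 1`, and
`V` on a measure space `(S, μ)`.  All these processes are required to define elements of that
Bochner space. -/
def TendstoLpLq [MeasurableSpace Ω] {S : Type*} [MeasurableSpace S] (P : Measure Ω)
    (μ : Measure S) (s : ℝ) (p q : ℝ≥0∞) [Fact (1 ≤ p)] [Fact (1 ≤ q)]
    (U : ℕ → S → Ω → Dist) (V : S → Ω → Dist) : Prop :=
  ∃ (X : ℕ → Lp (Lp (SobolevInfty s) q μ) p P) (Y : Lp (Lp (SobolevInfty s) q μ) p P),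
    (∀ N, 1 ≤ N → ∀ᵐ ω ∂P, ∀ᵐ z ∂μ, (X N ω z).toDist = U N z ω) ∧
    (∀ᵐ ω ∂P, ∀ᵐ z ∂μ, (Y ω z).toDist = V z ω) ∧
    Tendsto X atTop (𝓝 Y)

/-- `u_N → v` in `C(K; W^{s,∞})`, uniformly on the compact space `K`, for distribution-valued
functions `u_N`, `N ≥ 1`, and `v`; all of them are required to be continuous into `W^{s,∞}`. -/
def TendstoC {K : Type*} [TopologicalSpace K] (s : ℝ) (u : ℕ → K → Dist) (v : K → Dist) : Prop :=
  ∃ (F : ℕ → C(K, SobolevInfty s)) (G : C(K, SobolevInfty s)),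
    (∀ N, 1 ≤ N → ∀ z, (F N z).toDist = u N z) ∧ (∀ z, (G z).toDist = v z) ∧
    Tendsto F atTop (𝓝 G)

end WickDampedWave

end

open WickDampedWave

namespace WickDampedWave

/-! ### The damped wave kernel -/

/-! Write w = ⟨n⟩. The Duhamel kernel K solves ε²K'' + K' + w²K = 0. In terms of the flux F = ε²K' +
K this reads F' = -w²K, with F(0) = 1 and εK(0) = 0, a form that still makes sense at ε = 0, where
it is the heat equation. Differentiating F² + ε²w²K² gives 2w² ∫₀ᵗ K² = 1 - F(t)² - ε²w²K(t)²
(`IsDampedKernel.integral_sq`). Hence ∫K² ≤ 1/(2w²), uniformly in ε and t, with no separate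
treatment of the overdamped and the oscillating frequencies. The same identity for time increments
of K, together with an energy estimate for the primitive of the difference of two kernels, makes the
kernels Hölder continuous in (ε,t) with values in L², with a loss that is polynomial in n
(`integral_duhamel_sub_sq_le`).

After integration by parts, the Wiener integral along a continuous path is Lipschitz in the path for
the sup norm, uniformly in ε, because the total variation of K is bounded uniformly in ε.
Approximating the path by smooth ones shows that every mode is jointly continuous in (ε,t),
including at ε = 0 (`continuousOn_pathConv`). Its Riemann sums are Gaussian and the Itô isometry
passes to the limit (`hasGaussianLaw_modeSum`). So the values of the truncated convolutions at
several truncations, parameters and points are jointly Gaussian, and the Fourier coefficients of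
their covariance are O(⟨n⟩⁻²).

By Wick's formula the second moment of a linear functional of an ℓ-th Wick power is an ℓ-fold
lattice sum, controlled by ∑ ∏⟨nᵢ⟩^{-2+η} ⟨∑nᵢ⟩^{-s}. In dimension two this is bounded for every s >
0 once η is small (`exists_sum_prod_bracket_le`). For differences in (ε,t) or in N, the ℓ-fold
products of covariances telescope, and interpolation yields a power of the distance or of 1/N at the
price of ⟨n⟩^η. To remain among finite Gaussian vectors, a linear functional of the Wick power,
which is a trigonometric polynomial in x, is written as a finite combination of its point values
(`exists_quadrature`). Hypercontractivity, proved from Gaussian integration by parts and Hölder's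
inequality (`gaussE_hermiteComb_pow_le`), upgrades second moments to all even moments.

Finally (ε,t,x) is encoded by the four-dimensional unit cube and a Kolmogorov chaining argument
bounds high moments of the sup norm of ⟨∇⟩^{-s} applied to the Wick powers and to their differences
(`exists_lintegral_enorm_wickPath_le`). The decay in N then gives convergence almost surely and in
every L^p(Ω), in the single space C([0,1]×[0,T]; C(𝕋²)) (`exists_limit_of_lintegral_pow_le`). All
three assertions follow by applying continuous linear maps to that convergence. The limit is
identified through its Fourier coefficients, so that one process serves all T, σ, p and q. -/

lemma one_le_bracket (n : Freq) : 1 ≤ bracket n :=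
  Real.one_le_sqrt.2 (by nlinarith [sq_nonneg (n 0 : ℝ), sq_nonneg (n 1 : ℝ)])

lemma hasDerivAt_of_eq {f g : ℝ → ℝ} {f' g' x : ℝ} (h : HasDerivAt f f' x) (hfg : ∀ s, g s = f s)
    (hd : g' = f') : HasDerivAt g g' x := by
  rw [funext hfg, hd]; exact h

/-- `K` solves `ε² K'' + K' + w² K = 0` in the integrated form `(ε² K' + K)' = - w² K`, with data
`ε² K'(0) + K(0) = 1` and `ε K(0) = 0`.  The case `ε = 0` is the heat equation. -/
structure IsDampedKernel (ε w : ℝ) (K K' : ℝ → ℝ) : Prop where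
  deriv : ∀ t, HasDerivAt K (K' t) t
  flux : ∀ t, HasDerivAt (fun s => ε ^ 2 * K' s + K s) (-(w ^ 2 * K t)) t
  cont : Continuous K'
  flux_zero : ε ^ 2 * K' 0 + K 0 = 1
  zero : ε * K 0 = 0

lemma isDampedKernel_zero (w : ℝ) :
    IsDampedKernel 0 w (fun t => Real.exp (-t * w ^ 2)) (fun t => -w ^ 2 * Real.exp (-t * w ^ 2)) := by
  have h : ∀ t, HasDerivAt (fun t => Real.exp (-t * w ^ 2)) (-w ^ 2 * Real.exp (-t * w ^ 2)) t := by
    intro t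
    exact hasDerivAt_of_eq (((hasDerivAt_id' t).neg).mul_const (w ^ 2)).exp
      (fun s => by simp) (by simp; ring)
  refine ⟨h, fun t => ?_, by fun_prop, by simp, by simp⟩
  exact hasDerivAt_of_eq (h t) (fun s => by simp) (by ring)

/-- Factoring out e^{-t/(2ε²)} removes the damping and leaves S'' = cS with c = (1 - 4w²ε²)/(4ε⁴).
The sign of c selects sinh, the identity or sin, and the three regimes of the symbol are treated at
once. -/
lemma isDampedKernel_of_oscillator {ε w : ℝ} (hε : ε ≠ 0) {S C : ℝ → ℝ}
    (hS : ∀ t, HasDerivAt S (C t) t)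
    (hC : ∀ t, HasDerivAt C ((1 - 4 * w ^ 2 * ε ^ 2) / (4 * ε ^ 4) * S t) t)
    (hS0 : S 0 = 0) (hC0 : C 0 = 1) :
    IsDampedKernel ε w (fun t => (ε ^ 2)⁻¹ * (Real.exp (-t / (2 * ε ^ 2)) * S t))
      (fun t => (ε ^ 2)⁻¹ * (Real.exp (-t / (2 * ε ^ 2)) * (C t - S t / (2 * ε ^ 2)))) := by
  have hE : ∀ t, HasDerivAt (fun t => Real.exp (-t / (2 * ε ^ 2)))
      (-(1 / (2 * ε ^ 2)) * Real.exp (-t / (2 * ε ^ 2))) t := by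
    intro t
    exact hasDerivAt_of_eq (((hasDerivAt_id' t).neg).div_const (2 * ε ^ 2)).exp
      (fun s => by simp) (by simp; ring)
  have cS : Continuous S := continuous_iff_continuousAt.2 fun t => (hS t).continuousAt
  have cC : Continuous C := continuous_iff_continuousAt.2 fun t => (hC t).continuousAt
  refine ⟨fun t => ?_, fun t => ?_, by fun_prop, ?_, ?_⟩
  · exact hasDerivAt_of_eq (((hE t).mul (hS t)).const_mul ((ε ^ 2)⁻¹)) (fun s => by simp)
      (by field_simp; ring)
  · exact hasDerivAt_of_eq ((hE t).mul ((hC t).add ((hS t).div_const (2 * ε ^ 2))))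
      (fun s => by simp only [Pi.mul_apply, Pi.add_apply]; field_simp; ring)
      (by simp only [Pi.add_apply]; field_simp; ring)
  · simp [hS0, hC0, hε]
  · simp [hS0]

lemma exists_isDampedKernel {ε : ℝ} (hε : 0 ≤ ε) (n : Freq) :
    ∃ K', IsDampedKernel ε (bracket n) (kernel ε n) K' := by
  rcases hε.eq_or_lt with rfl | hε
  · have h : kernel 0 n = fun t => Real.exp (-t * bracket n ^ 2) := by funext t; simp [kernel]
    rw [h]
    exact ⟨_, isDampedKernel_zero (bracket n)⟩
  · have hb := bracket_pos n
    suffices ∃ S C : ℝ → ℝ, (∀ t, HasDerivAt S (C t) t) ∧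
        (∀ t, HasDerivAt C ((1 - 4 * bracket n ^ 2 * ε ^ 2) / (4 * ε ^ 4) * S t) t) ∧
        S 0 = 0 ∧ C 0 = 1 ∧
        ∀ t, waveSymbol ε n t = Real.exp (-t / (2 * ε ^ 2)) * S t by
      obtain ⟨S, C, hS, hC, hS0, hC0, h⟩ := this
      have h : kernel ε n = fun t => (ε ^ 2)⁻¹ * (Real.exp (-t / (2 * ε ^ 2)) * S t) := by
        funext t; simp [kernel, h, hε.ne']
      rw [h]
      exact ⟨_, isDampedKernel_of_oscillator hε.ne' hS hC hS0 hC0⟩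
    rcases lt_trichotomy (bracket n) ((2 * ε)⁻¹) with h | h | h
    · have h1 : 0 < 1 - 4 * bracket n ^ 2 * ε ^ 2 := by
        have : bracket n * (2 * ε) < 1 := by rwa [← lt_inv_mul_iff₀' (by positivity), mul_one]
        nlinarith [mul_pos hb hε]
      set l := Real.sqrt (1 - 4 * bracket n ^ 2 * ε ^ 2) / (2 * ε ^ 2) with hl
      have hl0 : 0 < l := div_pos (Real.sqrt_pos.2 h1) (by positivity)
      have hl2 : l ^ 2 = (1 - 4 * bracket n ^ 2 * ε ^ 2) / (4 * ε ^ 4) := by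
        rw [hl, div_pow, Real.sq_sqrt h1.le]; ring
      refine ⟨fun t => Real.sinh (l * t) / l, fun t => Real.cosh (l * t), fun t => ?_,
        fun t => ?_, by simp, by simp, fun t => by simp only [waveSymbol]; rw [if_pos h]⟩
      · exact hasDerivAt_of_eq ((((hasDerivAt_id' t).const_mul l).sinh).div_const l) (fun s => rfl)
          (by field_simp)
      · exact hasDerivAt_of_eq (((hasDerivAt_id' t).const_mul l).cosh) (fun s => rfl)
          (by rw [← hl2]; field_simp)
    · have h1 : 1 - 4 * bracket n ^ 2 * ε ^ 2 = 0 := by rw [h]; field_simp; norm_num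
      refine ⟨fun t => t, fun _ => 1, fun t => hasDerivAt_id' t, fun t => ?_, rfl, rfl, fun t => ?_⟩
      · rw [h1]; simpa using hasDerivAt_const t (1 : ℝ)
      · simp only [waveSymbol]; rw [if_neg h.not_lt, if_neg h.not_gt]
    · have h1 : 0 < 4 * bracket n ^ 2 * ε ^ 2 - 1 := by
        have : 1 < bracket n * (2 * ε) := by rwa [inv_lt_iff_one_lt_mul₀ (by positivity)] at h
        nlinarith [mul_pos hb hε]
      set l := Real.sqrt (4 * bracket n ^ 2 * ε ^ 2 - 1) / (2 * ε ^ 2) with hl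
      have hl0 : 0 < l := div_pos (Real.sqrt_pos.2 h1) (by positivity)
      have hl2 : l ^ 2 = -((1 - 4 * bracket n ^ 2 * ε ^ 2) / (4 * ε ^ 4)) := by
        rw [hl, div_pow, Real.sq_sqrt h1.le]; ring
      refine ⟨fun t => Real.sin (l * t) / l, fun t => Real.cos (l * t), fun t => ?_,
        fun t => ?_, by simp, by simp, fun t => by
          simp only [waveSymbol]; rw [if_neg h.not_gt, if_pos h]⟩
      · exact hasDerivAt_of_eq ((((hasDerivAt_id' t).const_mul l).sin).div_const l) (fun s => rfl)
          (by field_simp)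
      · exact hasDerivAt_of_eq (((hasDerivAt_id' t).const_mul l).cos) (fun s => rfl)
          (by rw [← neg_eq_iff_eq_neg.2 hl2]; field_simp)

/-- The functional F² + ε²w²K², with F the flux, has derivative exactly -2w²K²: the cross terms in
KK' cancel. The initial data are left free because the identity is also applied to time increments
of the kernel. -/
lemma integral_sq_of_flux {ε w : ℝ} {K K' : ℝ → ℝ} (hK : ∀ t, HasDerivAt K (K' t) t)
    (hf : ∀ t, HasDerivAt (fun s => ε ^ 2 * K' s + K s) (-(w ^ 2 * K t)) t) (t : ℝ) :
    2 * w ^ 2 * ∫ s in (0 : ℝ)..t, K s ^ 2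
      = (ε ^ 2 * K' 0 + K 0) ^ 2 + ε ^ 2 * w ^ 2 * K 0 ^ 2
        - (ε ^ 2 * K' t + K t) ^ 2 - ε ^ 2 * w ^ 2 * K t ^ 2 := by
  have cK : Continuous K := continuous_iff_continuousAt.2 fun t => (hK t).continuousAt
  have h : ∀ s ∈ Set.uIcc 0 t, HasDerivAt
      (fun s => -((ε ^ 2 * K' s + K s) ^ 2 + ε ^ 2 * w ^ 2 * K s ^ 2))
      (2 * w ^ 2 * K s ^ 2) s := by
    intro s _
    exact hasDerivAt_of_eq (((hf s).pow 2).add (((hK s).pow 2).const_mul (ε ^ 2 * w ^ 2))).neg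
      (fun s => by simp) (by simp; ring)
  have := intervalIntegral.integral_eq_sub_of_hasDerivAt h
    (Continuous.intervalIntegrable (by fun_prop) _ _)
  rw [intervalIntegral.integral_const_mul] at this
  rw [this]; ring

namespace IsDampedKernel

variable {ε w : ℝ} {K K' : ℝ → ℝ}

lemma continuous (h : IsDampedKernel ε w K K') : Continuous K :=
  continuous_iff_continuousAt.2 fun t => (h.deriv t).continuousAt

lemma integral_sq (h : IsDampedKernel ε w K K') (t : ℝ) :
    2 * w ^ 2 * ∫ s in (0 : ℝ)..t, K s ^ 2
      = 1 - (ε ^ 2 * K' t + K t) ^ 2 - ε ^ 2 * w ^ 2 * K t ^ 2 := by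
  rw [integral_sq_of_flux h.deriv h.flux, h.flux_zero]
  have : ε ^ 2 * w ^ 2 * K 0 ^ 2 = w ^ 2 * (ε * K 0) ^ 2 := by ring
  rw [this, h.zero]; ring

lemma integral_sq_nonneg {K : ℝ → ℝ} {t : ℝ} (ht : 0 ≤ t) : 0 ≤ ∫ s in (0 : ℝ)..t, K s ^ 2 :=
  intervalIntegral.integral_nonneg ht fun _ _ => sq_nonneg _

lemma abs_flux_le (h : IsDampedKernel ε w K K') {t : ℝ} (ht : 0 ≤ t) :
    |ε ^ 2 * K' t + K t| ≤ 1 := by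
  have h1 := h.integral_sq t
  have h2 : 0 ≤ 2 * w ^ 2 * ∫ s in (0 : ℝ)..t, K s ^ 2 :=
    mul_nonneg (by positivity) (integral_sq_nonneg ht)
  have h3 : 0 ≤ ε ^ 2 * w ^ 2 * K t ^ 2 := by positivity
  rw [← sq_le_one_iff_abs_le_one]; linarith

/-- Both boundary terms at time t have a favourable sign. The resulting bound is that of the heat
kernel and depends neither on ε nor on t. -/
lemma integral_sq_le (h : IsDampedKernel ε w K K') (hw : 0 < w) (t : ℝ) :
    ∫ s in (0 : ℝ)..t, K s ^ 2 ≤ (w ^ 2)⁻¹ / 2 := by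
  have h1 := h.integral_sq t
  have h3 : 0 ≤ ε ^ 2 * w ^ 2 * K t ^ 2 := by positivity
  have h4 := sq_nonneg (ε ^ 2 * K' t + K t)
  have : (w ^ 2)⁻¹ / 2 = 1 / (2 * w ^ 2) := by field_simp
  rw [this, le_div_iff₀ (by positivity)]; linarith

lemma hasDerivAt_exp_mul (ε : ℝ) (t : ℝ) : HasDerivAt (fun t => Real.exp (t / ε ^ 2))
    ((ε ^ 2)⁻¹ * Real.exp (t / ε ^ 2)) t := by
  exact hasDerivAt_of_eq ((hasDerivAt_id' t).div_const (ε ^ 2)).exp (fun s => rfl) (by ring)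

/-- For ε ≠ 0 the function e^{t/ε²}K has derivative ε⁻²e^{t/ε²}F with |F| ≤ 1, so it is dominated by
e^{t/ε²}. For ε = 0 the flux is K itself. -/
lemma abs_le_one (h : IsDampedKernel ε w K K') {t : ℝ} (ht : 0 ≤ t) : |K t| ≤ 1 := by
  rcases eq_or_ne ε 0 with rfl | hε
  · simpa using h.abs_flux_le ht
  have hd : ∀ s, HasDerivAt (fun s => Real.exp (s / ε ^ 2) * K s)
      ((ε ^ 2)⁻¹ * Real.exp (s / ε ^ 2) * (ε ^ 2 * K' s + K s)) s := by
    intro s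
    exact hasDerivAt_of_eq ((hasDerivAt_exp_mul ε s).mul (h.deriv s)) (fun s => rfl)
      (by field_simp; ring)
  have h0 : K 0 = 0 := (mul_eq_zero.1 h.zero).resolve_left hε
  have key := image_norm_le_of_norm_deriv_right_le_deriv_boundary'
    (f := fun s => Real.exp (s / ε ^ 2) * K s) (a := 0) (b := t)
    (f' := fun s => (ε ^ 2)⁻¹ * Real.exp (s / ε ^ 2) * (ε ^ 2 * K' s + K s))
    (B := fun s => Real.exp (s / ε ^ 2))
    (B' := fun s => (ε ^ 2)⁻¹ * Real.exp (s / ε ^ 2))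
    (fun s _ => (hd s).continuousAt.continuousWithinAt)
    (fun s _ => (hd s).hasDerivWithinAt) (by simp [h0])
    (fun s _ => (hasDerivAt_exp_mul ε s).continuousAt.continuousWithinAt)
    (fun s _ => (hasDerivAt_exp_mul ε s).hasDerivWithinAt)
    (fun s hs => by
      rw [norm_mul, Real.norm_of_nonneg (r := (ε ^ 2)⁻¹ * Real.exp (s / ε ^ 2)) (by positivity)]
      exact mul_le_of_le_one_right (by positivity) (h.abs_flux_le hs.1))
    (Set.right_mem_Icc.2 ht)
  simp only [norm_mul, Real.norm_eq_abs, Real.abs_exp] at key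
  exact (mul_le_iff_le_one_right (Real.exp_pos _)).1 key

lemma hasDerivAt_deriv (h : IsDampedKernel ε w K K') (hε : ε ≠ 0) (t : ℝ) :
    HasDerivAt K' (-(w ^ 2 * K t + K' t) / ε ^ 2) t := by
  exact hasDerivAt_of_eq (((h.flux t).sub (h.deriv t)).div_const (ε ^ 2))
    (fun s => by simp only [Pi.sub_apply]; field_simp; ring) (by ring)

lemma deriv_eq_of_eps_zero (h : IsDampedKernel 0 w K K') (t : ℝ) : K' t = -(w ^ 2 * K t) := by
  refine (h.deriv t).unique ?_
  exact hasDerivAt_of_eq (h.flux t) (fun s => by simp) rfl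

/-- The function e^{t/ε²}K' has derivative -ε⁻²e^{t/ε²}w²K, and |K| ≤ 1. The first term of the bound
is the initial layer, in which K rises from 0 on the time scale ε². -/
lemma abs_deriv_le (h : IsDampedKernel ε w K K') (hε : ε ≠ 0) {t : ℝ} (ht : 0 ≤ t) :
    |K' t| ≤ (ε ^ 2)⁻¹ * Real.exp (-(t / ε ^ 2)) + w ^ 2 := by
  have h0 : K 0 = 0 := (mul_eq_zero.1 h.zero).resolve_left hε
  have h0' : K' 0 = (ε ^ 2)⁻¹ := by
    have := h.flux_zero
    rw [h0, add_zero] at this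
    exact eq_inv_of_mul_eq_one_right this
  have hd : ∀ s, HasDerivAt (fun s => Real.exp (s / ε ^ 2) * K' s)
      ((ε ^ 2)⁻¹ * Real.exp (s / ε ^ 2) * (- (w ^ 2 * K s))) s := by
    intro s
    exact hasDerivAt_of_eq ((hasDerivAt_exp_mul ε s).mul (h.hasDerivAt_deriv hε s)) (fun s => rfl)
      (by field_simp; ring)
  have hB : ∀ s, HasDerivAt (fun s => w ^ 2 * Real.exp (s / ε ^ 2) + (ε ^ 2)⁻¹)
      (w ^ 2 * ((ε ^ 2)⁻¹ * Real.exp (s / ε ^ 2))) s := fun s =>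
    ((hasDerivAt_exp_mul ε s).const_mul (w ^ 2)).add_const _
  have key := image_norm_le_of_norm_deriv_right_le_deriv_boundary'
    (a := 0) (b := t)
    (fun s _ => (hd s).continuousAt.continuousWithinAt)
    (fun s _ => (hd s).hasDerivWithinAt)
    (by
      simp only [zero_div, Real.exp_zero, one_mul, h0']
      rw [Real.norm_of_nonneg (by positivity)]
      nlinarith [sq_nonneg w])
    (fun s _ => (hB s).continuousAt.continuousWithinAt)
    (fun s _ => (hB s).hasDerivWithinAt)
    (fun s hs => by
      rw [norm_mul, Real.norm_of_nonneg (r := (ε ^ 2)⁻¹ * Real.exp (s / ε ^ 2)) (by positivity),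
        norm_neg, norm_mul, Real.norm_of_nonneg (sq_nonneg w), Real.norm_eq_abs]
      have := h.abs_le_one hs.1
      have h2 : 0 ≤ (ε ^ 2)⁻¹ * Real.exp (s / ε ^ 2) * w ^ 2 := by positivity
      nlinarith)
    (Set.right_mem_Icc.2 ht)
  simp only [norm_mul, Real.norm_eq_abs, Real.abs_exp] at key
  rw [Real.exp_neg]
  have he := Real.exp_pos (t / ε ^ 2)
  rw [← mul_le_mul_iff_right₀ he]
  calc _ ≤ _ := key
    _ = _ := by field_simp; ring

/-- The initial layer ε⁻²e^{-t/ε²} has mass at most 1, so the total variation of the kernel is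
bounded uniformly in ε although K' itself is not. -/
lemma integral_abs_deriv_le (h : IsDampedKernel ε w K K') {t : ℝ} (ht : 0 ≤ t) :
    ∫ s in (0 : ℝ)..t, |K' s| ≤ 1 + w ^ 2 * t := by
  have hc : Continuous fun s => |K' s| := h.cont.abs
  rcases eq_or_ne ε 0 with rfl | hε
  · calc _ ≤ ∫ _ in (0 : ℝ)..t, w ^ 2 := by
          refine intervalIntegral.integral_mono_on ht (hc.intervalIntegrable _ _) (by simp) ?_
          intro s hs
          rw [h.deriv_eq_of_eps_zero, abs_neg, abs_mul, abs_of_nonneg (sq_nonneg w)]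
          exact mul_le_of_le_one_right (sq_nonneg w) (h.abs_le_one hs.1)
      _ ≤ _ := by simp; linarith
  · have hB : ∀ s, HasDerivAt (fun s => -Real.exp (-(s / ε ^ 2)) + w ^ 2 * s)
        ((ε ^ 2)⁻¹ * Real.exp (-(s / ε ^ 2)) + w ^ 2) s := by
      intro s
      exact hasDerivAt_of_eq (((((hasDerivAt_id' s).div_const (ε ^ 2)).neg.exp).neg).add
        ((hasDerivAt_id' s).const_mul (w ^ 2))) (fun s => by simp) (by simp; ring)
    calc _ ≤ ∫ s in (0 : ℝ)..t, ((ε ^ 2)⁻¹ * Real.exp (-(s / ε ^ 2)) + w ^ 2) := by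
          refine intervalIntegral.integral_mono_on ht (hc.intervalIntegrable _ _)
            (Continuous.intervalIntegrable (by fun_prop) _ _) ?_
          intro s hs
          exact h.abs_deriv_le hε hs.1
      _ ≤ _ := by
        rw [intervalIntegral.integral_eq_sub_of_hasDerivAt (fun s _ => hB s)
          (Continuous.intervalIntegrable (by fun_prop) _ _)]
        simp only [zero_div, neg_zero, Real.exp_zero, mul_zero, add_zero]
        have := Real.exp_pos (-(t / ε ^ 2))
        linarith

lemma integral_sq_le_self (h : IsDampedKernel ε w K K') {t : ℝ} (ht : 0 ≤ t) :
    ∫ s in (0 : ℝ)..t, K s ^ 2 ≤ t := by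
  have hc := h.continuous
  calc _ ≤ ∫ _ in (0 : ℝ)..t, (1 : ℝ) := by
        refine intervalIntegral.integral_mono_on ht
          (Continuous.intervalIntegrable (by fun_prop) _ _) (by simp) ?_
        intro s hs
        exact (sq_le_one_iff_abs_le_one _).2 (h.abs_le_one hs.1)
    _ = t := by simp

lemma abs_flux_sub_one_le (h : IsDampedKernel ε w K K') {t : ℝ} (ht : 0 ≤ t) :
    |ε ^ 2 * K' t + K t - 1| ≤ w ^ 2 * t := by
  have hc := h.continuous
  have := intervalIntegral.integral_eq_sub_of_hasDerivAt (a := 0) (b := t) (fun s _ => h.flux s)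
    (Continuous.intervalIntegrable (by fun_prop) _ _)
  rw [h.flux_zero] at this
  rw [← this]
  have := intervalIntegral.norm_integral_le_of_norm_le_const (a := 0) (b := t) (C := w ^ 2)
    (f := fun s => -(w ^ 2 * K s)) (fun s hs => by
      rw [Set.uIoc_of_le ht] at hs
      rw [norm_neg, norm_mul, Real.norm_of_nonneg (sq_nonneg w)]
      exact mul_le_of_le_one_right (sq_nonneg w) (h.abs_le_one hs.1.le))
  simpa [abs_of_nonneg ht] using this

/-- The increment K(· + r) - K solves the same linear equation, so its energy identity bounds the
integral by the initial energy (F(r) - 1)² + ε²w²K(r)². The first term is at most (w²r)². By the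
energy identity at time r the second is at most 1 - F(r)² ≤ 2w²r. -/
lemma integral_sub_shift_sq_le (h : IsDampedKernel ε w K K') (hw : 0 < w) {t r : ℝ} (hr : 0 ≤ r) :
    ∫ s in (0 : ℝ)..t, (K (s + r) - K s) ^ 2 ≤ w ^ 2 * r ^ 2 / 2 + r := by
  have key := integral_sq_of_flux (ε := ε) (w := w) (K := fun s => K (s + r) - K s)
    (K' := fun s => K' (s + r) - K' s)
    (fun s => ((h.deriv (s + r)).comp_add_const s r).sub (h.deriv s))
    (fun s => by
      exact hasDerivAt_of_eq (((h.flux (s + r)).comp_add_const s r).sub (h.flux s))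
        (fun s => by simp only [Pi.sub_apply]; ring) (by ring)) t
  simp only [zero_add] at key
  have h1 := h.integral_sq r
  have h2 : 0 ≤ 2 * w ^ 2 * ∫ s in (0 : ℝ)..r, K s ^ 2 :=
    mul_nonneg (by positivity) (integral_sq_nonneg hr)
  have h3 := h.abs_flux_sub_one_le hr
  have h4 := h.abs_flux_le hr
  have h5 : ε ^ 2 * w ^ 2 * (K r - K 0) ^ 2 = ε ^ 2 * w ^ 2 * K r ^ 2 := by
    have : ε ^ 2 * w ^ 2 * (K r - K 0) ^ 2
      = ε ^ 2 * w ^ 2 * K r ^ 2 - 2 * ε * w ^ 2 * K r * (ε * K 0) + w ^ 2 * (ε * K 0) ^ 2 := by ring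
    rw [this, h.zero]; ring
  have h6 : (ε ^ 2 * (K' r - K' 0) + (K r - K 0)) ^ 2 = (ε ^ 2 * K' r + K r - 1) ^ 2 := by
    rw [← h.flux_zero]; ring
  have h7 : (ε ^ 2 * K' r + K r - 1) ^ 2 ≤ (w ^ 2 * r) ^ 2 := by
    rw [← sq_abs]; exact pow_le_pow_left₀ (abs_nonneg _) h3 2
  have h8 : 1 - (ε ^ 2 * K' r + K r) ^ 2 ≤ 2 * (w ^ 2 * r) := by
    rw [abs_le] at h3 h4
    nlinarith
  have h9 : 0 ≤ (ε ^ 2 * (K' (t + r) - K' t) + (K (t + r) - K t)) ^ 2 := sq_nonneg _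
  have h10 : 0 ≤ ε ^ 2 * w ^ 2 * (K (t + r) - K t) ^ 2 := by positivity
  have h11 : 2 * w ^ 2 * ∫ s in (0 : ℝ)..t, (K (s + r) - K s) ^ 2
      ≤ 2 * w ^ 2 * (w ^ 2 * r ^ 2 / 2 + r) := by
    rw [key, h5, h6]; nlinarith
  exact le_of_mul_le_mul_left h11 (by positivity)

/-- This comes from the classical energy ε²K'² + w²K², which starts at ε⁻² and decreases at rate
2K'². -/
lemma integral_deriv_sq_le (h : IsDampedKernel ε w K K') (hε : ε ≠ 0) (t : ℝ) :
    ∫ s in (0 : ℝ)..t, K' s ^ 2 ≤ (ε ^ 2)⁻¹ / 2 := by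
  have h0 : K 0 = 0 := (mul_eq_zero.1 h.zero).resolve_left hε
  have h0' : K' 0 = (ε ^ 2)⁻¹ := by
    have := h.flux_zero
    rw [h0, add_zero] at this
    exact eq_inv_of_mul_eq_one_right this
  have hc := h.cont
  have hd : ∀ s, HasDerivAt (fun s => -(ε ^ 2 * K' s ^ 2 + w ^ 2 * K s ^ 2) / 2) (K' s ^ 2) s := by
    intro s
    exact hasDerivAt_of_eq ((((((h.hasDerivAt_deriv hε s).pow 2).const_mul (ε ^ 2)).add
      (((h.deriv s).pow 2).const_mul (w ^ 2))).neg).div_const 2) (fun s => by simp)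
      (by simp; field_simp; ring)
  rw [intervalIntegral.integral_eq_sub_of_hasDerivAt (fun s _ => hd s)
    (Continuous.intervalIntegrable (by fun_prop) _ _), h0, h0']
  have h1 : ε ^ 2 * ((ε ^ 2)⁻¹) ^ 2 = (ε ^ 2)⁻¹ := by field_simp
  have h2 : 0 ≤ ε ^ 2 * K' t ^ 2 + w ^ 2 * K t ^ 2 := by positivity
  nlinarith

/-- Stability of the kernel in `ε`, by the energy estimate for the primitive of the difference. -/
lemma integral_sub_sq_le_of_le {δ : ℝ} {L L' : ℝ → ℝ} (h : IsDampedKernel ε w K K')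
    (hL : IsDampedKernel δ w L L') (hε : 0 ≤ ε) (hεδ : ε ≤ δ) {t : ℝ} (ht : 0 ≤ t) :
    ∫ s in (0 : ℝ)..t, (K s - L s) ^ 2 ≤ 2 * (ε - δ) ^ 2 := by
  have cK := h.continuous
  have cL := hL.continuous
  have cL' := hL.cont
  set D : ℝ → ℝ := fun t => ∫ s in (0 : ℝ)..t, (K s - L s) with hD
  have hDd : ∀ s, HasDerivAt D (K s - L s) s := fun s =>
    intervalIntegral.integral_hasDerivAt_right (Continuous.intervalIntegrable (by fun_prop) _ _)
      (Continuous.stronglyMeasurableAtFilter (by fun_prop) _ _) (Continuous.continuousAt (by fun_prop))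
  -- the integrated equation
  have heq : ∀ s, ε ^ 2 * (K' s - L' s) + (K s - L s) + w ^ 2 * D s = (δ ^ 2 - ε ^ 2) * L' s := by
    intro s
    have h1 : ∀ s, HasDerivAt (fun s => (ε ^ 2 * K' s + K s) - (δ ^ 2 * L' s + L s) + w ^ 2 * D s)
        0 s := fun s => by
      exact hasDerivAt_of_eq (((h.flux s).sub (hL.flux s)).add ((hDd s).const_mul (w ^ 2)))
        (fun s => rfl) (by ring)
    have h2 := is_const_of_deriv_eq_zero (fun s => (h1 s).differentiableAt)
      (fun s => (h1 s).deriv) s 0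
    simp only [h.flux_zero, hL.flux_zero] at h2
    have h3 : D 0 = 0 := by simp [hD]
    rw [h3] at h2
    linarith
  -- energy
  have hE : ∀ s, HasDerivAt (fun s => (ε ^ 2 * (K s - L s) ^ 2 + w ^ 2 * D s ^ 2) / 2)
      ((δ ^ 2 - ε ^ 2) * L' s * (K s - L s) - (K s - L s) ^ 2) s := by
    intro s
    refine hasDerivAt_of_eq (((((((h.deriv s).sub (hL.deriv s)).pow 2).const_mul (ε ^ 2)).add
      (((hDd s).pow 2).const_mul (w ^ 2)))).div_const 2) (fun s => by simp) ?_
    rw [← heq s]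
    simp only [Nat.cast_ofNat, Pi.sub_apply]; ring
  have hint := intervalIntegral.integral_eq_sub_of_hasDerivAt (a := 0) (b := t) (fun s _ => hE s)
    (Continuous.intervalIntegrable (by fun_prop) _ _)
  have hD0 : D 0 = 0 := by simp [hD]
  have h5 : ε ^ 2 * (K 0 - L 0) ^ 2 = 0 := by
    have h1 : ε * L 0 = 0 := by
      rcases (hε.trans hεδ).eq_or_lt with h0 | h0
      · rw [le_antisymm (h0 ▸ hεδ) hε, zero_mul]
      · rw [(mul_eq_zero.1 hL.zero).resolve_left h0.ne', mul_zero]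
    rw [← mul_pow, mul_sub, h.zero, h1]; ring
  -- The energy vanishes at time 0, the case ε = 0 being covered by the factor ε², and it is
  -- nonnegative at time t.
  have h6 : 0 ≤ ∫ s in (0 : ℝ)..t,
      ((δ ^ 2 - ε ^ 2) * L' s * (K s - L s) - (K s - L s) ^ 2) := by
    rw [hint, h5, hD0]
    have : 0 ≤ (ε ^ 2 * (K t - L t) ^ 2 + w ^ 2 * D t ^ 2) / 2 := by positivity
    linarith
  have h7 : ∫ s in (0 : ℝ)..t, ((δ ^ 2 - ε ^ 2) * L' s * (K s - L s) - (K s - L s) ^ 2)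
      ≤ ∫ s in (0 : ℝ)..t, ((δ ^ 2 - ε ^ 2) ^ 2 / 2 * L' s ^ 2 - (1 / 2) * (K s - L s) ^ 2) := by
    refine intervalIntegral.integral_mono_on ht (Continuous.intervalIntegrable (by fun_prop) _ _)
      (Continuous.intervalIntegrable (by fun_prop) _ _) fun s _ => ?_
    nlinarith [sq_nonneg ((δ ^ 2 - ε ^ 2) * L' s - (K s - L s))]
  replace h7 := h6.trans h7
  rw [intervalIntegral.integral_sub (Continuous.intervalIntegrable (by fun_prop) _ _)
    (Continuous.intervalIntegrable (by fun_prop) _ _), intervalIntegral.integral_const_mul,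
    intervalIntegral.integral_const_mul] at h7
  have h8 : (δ ^ 2 - ε ^ 2) ^ 2 * ∫ s in (0 : ℝ)..t, L' s ^ 2 ≤ 2 * (ε - δ) ^ 2 := by
    rcases (hε.trans hεδ).eq_or_lt with h0 | hδ
    · have : ε = 0 := le_antisymm (h0 ▸ hεδ) hε
      simp [this, ← h0]
    refine (mul_le_mul_of_nonneg_left (hL.integral_deriv_sq_le hδ.ne' t)
      (sq_nonneg (δ ^ 2 - ε ^ 2))).trans ?_
    have : (δ ^ 2 - ε ^ 2) ^ 2 * ((δ ^ 2)⁻¹ / 2) = (ε - δ) ^ 2 * ((δ + ε) ^ 2 / (2 * δ ^ 2)) := by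
      field_simp; ring
    rw [this]
    -- The source term contains the derivative of the kernel with the larger parameter, which costs
    -- δ⁻². Since ε ≤ δ, this is absorbed by (δ + ε)² ≤ 4δ².
    have : (δ + ε) ^ 2 / (2 * δ ^ 2) ≤ 2 := by
      rw [div_le_iff₀ (by positivity)]; nlinarith
    nlinarith [sq_nonneg (ε - δ)]
  linarith

end IsDampedKernel

lemma isDampedKernel_kernel {ε : ℝ} (hε : 0 ≤ ε) (n : Freq) :
    IsDampedKernel ε (bracket n) (kernel ε n) (deriv (kernel ε n)) := by
  obtain ⟨K', h⟩ := exists_isDampedKernel hε n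
  rwa [show deriv (kernel ε n) = K' from funext fun t => (h.deriv t).deriv]

/-! ### The Duhamel kernels as elements of `L²(ℝ)` -/

/-- The integrand `s ↦ K(t - s) 1_{[0,t)}(s)` of the stochastic convolution at `z = (ε, t)`. -/
noncomputable def duhamel (z : ℝ × ℝ) (n : Freq) : ℝ → ℝ :=
  (Set.Ico 0 z.2).indicator fun s => kernel z.1 n (z.2 - s)

lemma abs_duhamel_le {z : ℝ × ℝ} (hε : 0 ≤ z.1) (n : Freq) (s : ℝ) :
    |duhamel z n s| ≤ (Set.Ico 0 z.2).indicator 1 s := by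
  unfold duhamel
  by_cases hs : s ∈ Set.Ico 0 z.2
  · simp only [Set.indicator_of_mem hs, Pi.one_apply]
    exact (isDampedKernel_kernel hε n).abs_le_one (by linarith [hs.2])
  · simp [Set.indicator_of_notMem hs]

lemma measurable_duhamel {z : ℝ × ℝ} (hε : 0 ≤ z.1) (n : Freq) : Measurable (duhamel z n) := by
  have := (isDampedKernel_kernel hε n).continuous
  exact Measurable.indicator (Continuous.measurable (by fun_prop)) measurableSet_Ico

lemma memLp_duhamel {z : ℝ × ℝ} (hε : 0 ≤ z.1) (n : Freq) : MemLp (duhamel z n) 2 := by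
  refine MemLp.of_le (g := (Set.Ico 0 z.2).indicator fun _ => (1 : ℝ)) ?_
    (measurable_duhamel hε n).aestronglyMeasurable (Eventually.of_forall fun s => ?_)
  · exact memLp_indicator_const 2 measurableSet_Ico (1 : ℝ) (Or.inr (by simp))
  · rw [Real.norm_eq_abs]
    exact (abs_duhamel_le hε n s).trans (le_abs_self _)

lemma integral_indicator_Ico_eq {f : ℝ → ℝ} {a b : ℝ} (hab : a ≤ b) :
    ∫ s, (Set.Ico a b).indicator f s = ∫ s in a..b, f s := by
  rw [integral_indicator measurableSet_Ico, integral_Ico_eq_integral_Ioc,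
    intervalIntegral.integral_of_le hab]

lemma integral_duhamel_sq {z : ℝ × ℝ} (ht : 0 ≤ z.2) (n : Freq) :
    ∫ s, duhamel z n s ^ 2 = ∫ s in (0 : ℝ)..z.2, kernel z.1 n s ^ 2 := by
  have : ∀ s, duhamel z n s ^ 2
      = (Set.Ico 0 z.2).indicator (fun s => kernel z.1 n (z.2 - s) ^ 2) s := by
    intro s
    by_cases hs : s ∈ Set.Ico 0 z.2 <;> simp [duhamel, hs]
  simp_rw [this]
  rw [integral_indicator_Ico_eq ht,
    intervalIntegral.integral_comp_sub_left (fun s => kernel z.1 n s ^ 2)]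
  simp

lemma integral_duhamel_sq_le {z : ℝ × ℝ} (hε : 0 ≤ z.1) (ht : 0 ≤ z.2) (n : Freq) :
    ∫ s, duhamel z n s ^ 2 ≤ (bracket n ^ 2)⁻¹ / 2 := by
  rw [integral_duhamel_sq ht]
  exact (isDampedKernel_kernel hε n).integral_sq_le (bracket_pos n) _

lemma integral_duhamel_sub_sq_eps {ε ε' t : ℝ} (hε : 0 ≤ ε) (hε' : 0 ≤ ε') (ht : 0 ≤ t)
    (n : Freq) :
    ∫ s, (duhamel (ε, t) n s - duhamel (ε', t) n s) ^ 2 ≤ 2 * (ε - ε') ^ 2 := by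
  have : ∀ s, (duhamel (ε, t) n s - duhamel (ε', t) n s) ^ 2
      = (Set.Ico 0 t).indicator (fun s => (kernel ε n (t - s) - kernel ε' n (t - s)) ^ 2) s := by
    intro s
    by_cases hs : s ∈ Set.Ico 0 t <;> simp [duhamel, hs]
  simp_rw [this]
  rw [integral_indicator_Ico_eq ht,
    intervalIntegral.integral_comp_sub_left (fun s => (kernel ε n s - kernel ε' n s) ^ 2)]
  simp only [sub_self, sub_zero]
  rcases le_total ε ε' with h | h
  · exact (isDampedKernel_kernel hε n).integral_sub_sq_le_of_le (isDampedKernel_kernel hε' n) hε h ht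
  · have := (isDampedKernel_kernel hε' n).integral_sub_sq_le_of_le (isDampedKernel_kernel hε n)
      hε' h ht
    have e1 : ∀ s, (kernel ε n s - kernel ε' n s) ^ 2 = (kernel ε' n s - kernel ε n s) ^ 2 :=
      fun s => by ring
    simp_rw [e1]
    linarith [show (ε - ε') ^ 2 = (ε' - ε) ^ 2 by ring]

/-- On [0,t) the difference is a time increment of the kernel. On [t,t') only one kernel is present,
and there |K| ≤ 1. -/
lemma integral_duhamel_sub_sq_time_of_le {ε t t' : ℝ} (hε : 0 ≤ ε) (ht : 0 ≤ t) (htt : t ≤ t')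
    (n : Freq) :
    ∫ s, (duhamel (ε, t) n s - duhamel (ε, t') n s) ^ 2
      ≤ bracket n ^ 2 * (t' - t) ^ 2 / 2 + 2 * (t' - t) := by
  have hK := isDampedKernel_kernel hε n
  have hc := hK.continuous
  have : ∀ s, (duhamel (ε, t) n s - duhamel (ε, t') n s) ^ 2
      = (Set.Ico 0 t).indicator (fun s => (kernel ε n (t' - s) - kernel ε n (t - s)) ^ 2) s
        + (Set.Ico t t').indicator (fun s => kernel ε n (t' - s) ^ 2) s := by
    intro s
    simp only [duhamel, Set.indicator_apply, Set.mem_Ico]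
    by_cases h0 : 0 ≤ s
    · by_cases h1 : s < t
      · have h2 : s < t' := h1.trans_le htt
        simp [h0, h1, h2, not_le.2 h1]
        ring
      · by_cases h2 : s < t' <;> simp [h0, h1, h2, not_lt.1 h1]
    · have : ¬ t ≤ s := fun h => h0 (ht.trans h)
      simp [h0, this]
  simp_rw [this]
  rw [integral_add, integral_indicator_Ico_eq ht, integral_indicator_Ico_eq htt]
  · have e1 : ∫ s in (0 : ℝ)..t, (kernel ε n (t' - s) - kernel ε n (t - s)) ^ 2
        = ∫ s in (0 : ℝ)..t, (kernel ε n (s + (t' - t)) - kernel ε n s) ^ 2 := by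
      have := intervalIntegral.integral_comp_sub_left (a := 0) (b := t)
        (fun s => (kernel ε n (s + (t' - t)) - kernel ε n s) ^ 2) t
      simp only [sub_self, sub_zero] at this
      rw [← this]
      refine intervalIntegral.integral_congr fun s _ => ?_
      rw [show t - s + (t' - t) = t' - s by ring]
    have e2 : ∫ s in t..t', kernel ε n (t' - s) ^ 2 = ∫ s in (0 : ℝ)..(t' - t), kernel ε n s ^ 2 := by
      rw [intervalIntegral.integral_comp_sub_left (fun s => kernel ε n s ^ 2)]
      simp
    rw [e1, e2]
    have h1 := hK.integral_sub_shift_sq_le (bracket_pos n) (t := t) (sub_nonneg.2 htt)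
    have h2 := hK.integral_sq_le_self (sub_nonneg.2 htt)
    linarith
  · rw [integrable_indicator_iff measurableSet_Ico]
    exact (Continuous.integrableOn_Icc (by fun_prop)).mono_set Set.Ico_subset_Icc_self
  · rw [integrable_indicator_iff measurableSet_Ico]
    exact (Continuous.integrableOn_Icc (by fun_prop)).mono_set Set.Ico_subset_Icc_self

lemma integral_duhamel_sub_sq_time {ε t t' : ℝ} (hε : 0 ≤ ε) (ht : 0 ≤ t) (ht' : 0 ≤ t')
    (n : Freq) :
    ∫ s, (duhamel (ε, t) n s - duhamel (ε, t') n s) ^ 2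
      ≤ bracket n ^ 2 * |t - t'| ^ 2 / 2 + 2 * |t - t'| := by
  rcases le_total t t' with h | h
  · rw [abs_sub_comm, abs_of_nonneg (sub_nonneg.2 h)]
    exact integral_duhamel_sub_sq_time_of_le hε ht h n
  · rw [abs_of_nonneg (sub_nonneg.2 h)]
    have e1 : ∀ s, (duhamel (ε, t) n s - duhamel (ε, t') n s) ^ 2
      = (duhamel (ε, t') n s - duhamel (ε, t) n s) ^ 2 := fun s => by ring
    simp_rw [e1]
    exact integral_duhamel_sub_sq_time_of_le hε ht' h n

/-- Hölder continuity of the Duhamel kernels in `L²`, with a loss polynomial in the frequency. -/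
lemma integral_duhamel_sub_sq_le {T : ℝ} {z z' : ℝ × ℝ}
    (hz : z ∈ Set.Icc (0 : ℝ) 1 ×ˢ Set.Icc (0 : ℝ) T)
    (hz' : z' ∈ Set.Icc (0 : ℝ) 1 ×ˢ Set.Icc (0 : ℝ) T) (n : Freq) :
    ∫ s, (duhamel z n s - duhamel z' n s) ^ 2 ≤ (T + 8) * bracket n ^ 2 * dist z z' := by
  obtain ⟨ε, t⟩ := z
  obtain ⟨ε', t'⟩ := z'
  obtain ⟨⟨he0, he1⟩, ht0, htT⟩ := hz
  obtain ⟨⟨he0', he1'⟩, ht0', htT'⟩ := hz'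
  simp only at he0 he1 ht0 htT he0' he1' ht0' htT'
  have h1 := integral_duhamel_sub_sq_eps he0 he0' ht0 n
  have h2 := integral_duhamel_sub_sq_time he0' ht0 ht0' n
  have i1 : Integrable fun s => (duhamel (ε, t) n s - duhamel (ε', t) n s) ^ 2 :=
    ((memLp_duhamel (z := (ε, t)) he0 n).sub (memLp_duhamel (z := (ε', t)) he0' n)).integrable_sq
  have i2 : Integrable fun s => (duhamel (ε', t) n s - duhamel (ε', t') n s) ^ 2 :=
    ((memLp_duhamel (z := (ε', t)) he0' n).sub (memLp_duhamel (z := (ε', t')) he0' n)).integrable_sq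
  have h3 : ∫ s, (duhamel (ε, t) n s - duhamel (ε', t') n s) ^ 2
      ≤ ∫ s, (2 * (duhamel (ε, t) n s - duhamel (ε', t) n s) ^ 2
        + 2 * (duhamel (ε', t) n s - duhamel (ε', t') n s) ^ 2) := by
    refine integral_mono ?_ ((i1.const_mul 2).add (i2.const_mul 2)) fun s => ?_
    · exact ((memLp_duhamel (z := (ε, t)) he0 n).sub
        (memLp_duhamel (z := (ε', t')) he0' n)).integrable_sq
    · simp only
      nlinarith [sq_nonneg ((duhamel (ε, t) n s - duhamel (ε', t) n s)
        - (duhamel (ε', t) n s - duhamel (ε', t') n s))]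
  rw [integral_add (i1.const_mul 2) (i2.const_mul 2), integral_const_mul, integral_const_mul] at h3
  have hw := one_le_bracket n
  have hw2 : 1 ≤ bracket n ^ 2 := one_le_pow₀ hw
  have d1 : |ε - ε'| ≤ dist (ε, t) (ε', t') := by
    rw [Prod.dist_eq, Real.dist_eq]; exact le_max_left _ _
  have d2 : |t - t'| ≤ dist (ε, t) (ε', t') := by
    rw [Prod.dist_eq]; simp only [Real.dist_eq]; exact le_max_right _ _
  set D := dist (ε, t) (ε', t')
  have hD : 0 ≤ D := dist_nonneg
  have e1 : (ε - ε') ^ 2 ≤ D := by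
    have : |ε - ε'| ≤ 1 := by rw [abs_le]; constructor <;> linarith
    rw [← sq_abs]; nlinarith [abs_nonneg (ε - ε')]
  have hT : 0 ≤ T := ht0.trans htT
  have e2 : |t - t'| ^ 2 ≤ T * D := by
    have : |t - t'| ≤ T := by rw [abs_le]; constructor <;> linarith
    nlinarith [abs_nonneg (t - t')]
  have e3 : bracket n ^ 2 * |t - t'| ^ 2 ≤ bracket n ^ 2 * (T * D) :=
    mul_le_mul_of_nonneg_left e2 (by positivity)
  have e4 : D ≤ bracket n ^ 2 * D := le_mul_of_one_le_left hD hw2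
  nlinarith

/-- The covariance kernel `∫ K_z K_{z'}` of the `n`-th Fourier mode. -/
noncomputable def modeCov (n : Freq) (z z' : ℝ × ℝ) : ℝ := ∫ s, duhamel z n s * duhamel z' n s

lemma modeCov_comm (n : Freq) (z z' : ℝ × ℝ) : modeCov n z z' = modeCov n z' z := by
  simp only [modeCov, mul_comm]

lemma abs_integral_mul_le {f g : ℝ → ℝ} (hf : MemLp f 2) (hg : MemLp g 2) :
    |∫ s, f s * g s| ≤ Real.sqrt (∫ s, f s ^ 2) * Real.sqrt (∫ s, g s ^ 2) := by
  have h := integral_mul_norm_le_Lp_mul_Lq (μ := (volume : Measure ℝ)) (f := f) (g := g)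
    Real.HolderConjugate.two_two (by simpa using hf) (by simpa using hg)
  simp only [Real.norm_eq_abs, Real.rpow_two, sq_abs, ← Real.sqrt_eq_rpow] at h
  refine le_trans ?_ h
  refine (abs_integral_le_integral_abs).trans (le_of_eq ?_)
  simp only [abs_mul]

lemma abs_modeCov_le {z z' : ℝ × ℝ} (hε : 0 ≤ z.1) (ht : 0 ≤ z.2) (hε' : 0 ≤ z'.1)
    (ht' : 0 ≤ z'.2) (n : Freq) : |modeCov n z z'| ≤ (bracket n ^ 2)⁻¹ := by
  have hb := bracket_pos n
  refine (abs_integral_mul_le (memLp_duhamel hε n) (memLp_duhamel hε' n)).trans ?_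
  have h : ∀ {z : ℝ × ℝ}, 0 ≤ z.1 → 0 ≤ z.2 →
      Real.sqrt (∫ s, duhamel z n s ^ 2) ≤ (bracket n)⁻¹ := by
    intro z hε ht
    refine Real.sqrt_le_iff.2 ⟨by positivity, (integral_duhamel_sq_le hε ht n).trans ?_⟩
    rw [inv_pow]
    exact half_le_self (by positivity)
  calc _ ≤ (bracket n)⁻¹ * (bracket n)⁻¹ :=
        mul_le_mul (h hε ht) (h hε' ht') (Real.sqrt_nonneg _) (by positivity)
    _ = _ := by rw [← mul_inv, sq]

/-- By Cauchy–Schwarz, the size ⟨n⟩⁻¹ of the fixed kernel compensates the loss ⟨n⟩ in the Hölder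
bound for the other, which makes the estimate uniform in n. -/
lemma abs_modeCov_sub_le {T : ℝ} {z z' z'' : ℝ × ℝ}
    (hz : z ∈ Set.Icc (0 : ℝ) 1 ×ˢ Set.Icc (0 : ℝ) T)
    (hz' : z' ∈ Set.Icc (0 : ℝ) 1 ×ˢ Set.Icc (0 : ℝ) T)
    (hz'' : z'' ∈ Set.Icc (0 : ℝ) 1 ×ˢ Set.Icc (0 : ℝ) T) (n : Freq) :
    |modeCov n z'' z - modeCov n z'' z'| ≤ Real.sqrt (T + 8) * Real.sqrt (dist z z') := by
  have hb := bracket_pos n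
  have m := memLp_duhamel (z := z) hz.1.1 n
  have m' := memLp_duhamel (z := z') hz'.1.1 n
  have m'' := memLp_duhamel (z := z'') hz''.1.1 n
  have e : modeCov n z'' z - modeCov n z'' z'
      = ∫ s, duhamel z'' n s * (duhamel z n s - duhamel z' n s) := by
    simp only [mul_sub]
    exact (integral_sub (m''.integrable_mul m) (m''.integrable_mul m')).symm
  rw [e]
  refine (abs_integral_mul_le m'' (m.sub m')).trans ?_
  have h1 : Real.sqrt (∫ s, duhamel z'' n s ^ 2) ≤ (bracket n)⁻¹ := by
    refine Real.sqrt_le_iff.2 ⟨by positivity,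
      (integral_duhamel_sq_le hz''.1.1 hz''.2.1 n).trans ?_⟩
    rw [inv_pow]
    exact half_le_self (by positivity)
  have h2 : Real.sqrt (∫ s, (duhamel z n s - duhamel z' n s) ^ 2)
      ≤ Real.sqrt (T + 8) * bracket n * Real.sqrt (dist z z') := by
    have hT : 0 ≤ T + 8 := by linarith [hz.2.1.trans hz.2.2]
    refine (Real.sqrt_le_sqrt (integral_duhamel_sub_sq_le hz hz' n)).trans (le_of_eq ?_)
    rw [Real.sqrt_mul (by positivity), Real.sqrt_mul hT, Real.sqrt_sq hb.le]
  calc _ ≤ (bracket n)⁻¹ * (Real.sqrt (T + 8) * bracket n * Real.sqrt (dist z z')) :=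
        mul_le_mul h1 h2 (Real.sqrt_nonneg _) (by positivity)
    _ = _ := by field_simp

/-! ### Pathwise Wiener integrals -/

/-- The Riemann sums defining the Wiener integral. -/
noncomputable def wienerSum (f : ℝ → ℝ) (b : ℝ≥0 → ℂ) (t : ℝ) (k : ℕ) : ℂ :=
  ∑ j ∈ Finset.range k,
    (f (t * j / k) : ℂ) * (b (t * (j + 1) / k).toNNReal - b (t * j / k).toNNReal)

/-- Summation by parts moves the increments onto f. The remaining error is at most the oscillation
of the path over one cell times the total variation of f. No quadratic variation enters, since f is
continuously differentiable. -/
lemma tendsto_wienerSum {f f' : ℝ → ℝ} (hf : ∀ s, HasDerivAt f (f' s) s) (hf' : Continuous f')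
    {b : ℝ≥0 → ℂ} (hb : Continuous b) {t : ℝ} (ht : 0 ≤ t) :
    Tendsto (wienerSum f b t) atTop
      (𝓝 (f t * b t.toNNReal - f 0 * b 0 - ∫ s in (0 : ℝ)..t, (f' s : ℂ) * b s.toNNReal)) := by
  set β : ℝ → ℂ := fun s => b s.toNNReal with hβ
  have cβ : Continuous β := hb.comp continuous_real_toNNReal
  have hint : ∀ u v : ℝ, IntervalIntegrable (fun s => (f' s : ℂ) * β s) volume u v := fun u v =>
    Continuous.intervalIntegrable (by fun_prop) _ _
  have hint' : ∀ (c : ℂ) (u v : ℝ), IntervalIntegrable (fun s => (f' s : ℂ) * c) volume u v :=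
    fun c u v => Continuous.intervalIntegrable (by fun_prop) _ _
  -- summation by parts
  have hsum : ∀ k : ℕ, k ≠ 0 → wienerSum f b t k
      - (f t * b t.toNNReal - f 0 * b 0 - ∫ s in (0 : ℝ)..t, (f' s : ℂ) * b s.toNNReal)
      = ∑ j ∈ Finset.range k, ∫ s in (t * j / k)..(t * (j + 1) / k),
          (f' s : ℂ) * (β s - β (t * (j + 1) / k)) := by
    intro k hk
    have hk' : (k : ℝ) ≠ 0 := by exact_mod_cast hk
    have h1 : ∑ j ∈ Finset.range k, ∫ s in (t * j / k)..(t * (j + 1) / k), (f' s : ℂ) * β s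
        = ∫ s in (0 : ℝ)..t, (f' s : ℂ) * β s := by
      have := intervalIntegral.sum_integral_adjacent_intervals (n := k) (μ := volume)
        (f := fun s => (f' s : ℂ) * β s) (a := fun j : ℕ => t * j / k)
        (fun j _ => hint _ _)
      simp only [Nat.cast_add, Nat.cast_one, Nat.cast_zero, mul_zero, zero_div] at this
      rw [this, mul_div_assoc, div_self hk', mul_one]
    have h2 : ∀ j : ℕ, ∫ s in (t * j / k)..(t * (j + 1) / k), (f' s : ℂ) * (β s - β (t * (j + 1) / k))
        = (∫ s in (t * j / k)..(t * (j + 1) / k), (f' s : ℂ) * β s)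
          - (f (t * (j + 1) / k) - f (t * j / k)) * β (t * (j + 1) / k) := by
      intro j
      simp only [mul_sub]
      rw [intervalIntegral.integral_sub (hint _ _) (hint' _ _ _),
        intervalIntegral.integral_mul_const, intervalIntegral.integral_ofReal,
        intervalIntegral.integral_eq_sub_of_hasDerivAt (fun s _ => hf s)
          (hf'.intervalIntegrable _ _)]
      push_cast; ring
    have h3 : ∑ j ∈ Finset.range k, ((f (t * (j + 1) / k) : ℂ) * β (t * (j + 1) / k)
        - f (t * j / k) * β (t * j / k)) = f t * β t - f 0 * β 0 := by
      have := Finset.sum_range_sub (fun j : ℕ => (f (t * j / k) : ℂ) * β (t * j / k)) k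
      simp only [Nat.cast_add, Nat.cast_one, Nat.cast_zero, mul_zero, zero_div] at this
      rw [this, mul_div_assoc, div_self hk', mul_one]
    simp_rw [h2]
    rw [Finset.sum_sub_distrib, h1]
    have h4 : β 0 = b 0 := by simp [hβ]
    have h5 : wienerSum f b t k = (f t * β t - f 0 * β 0)
        - ∑ j ∈ Finset.range k, ((f (t * (j + 1) / k) : ℂ) - f (t * j / k)) * β (t * (j + 1) / k) := by
      rw [← h3, ← Finset.sum_sub_distrib, wienerSum]
      refine Finset.sum_congr rfl fun j _ => ?_
      simp only [hβ]; ring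
    rw [h5, h4]
    ring
  rw [Metric.tendsto_atTop]
  intro δ hδ
  set M : ℝ := ∫ s in (0 : ℝ)..t, |f' s| with hM
  have hM0 : 0 ≤ M := intervalIntegral.integral_nonneg ht fun _ _ => abs_nonneg _
  have huc := isCompact_Icc.uniformContinuousOn_of_continuous (cβ.continuousOn (s := Set.Icc 0 t))
  rw [Metric.uniformContinuousOn_iff] at huc
  obtain ⟨η, hη, huc⟩ := huc (δ / (M + 1)) (by positivity)
  obtain ⟨k₀, hk₀⟩ := exists_nat_gt (t / η)
  refine ⟨k₀ + 1, fun k hk => ?_⟩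
  have hkpos : (0 : ℝ) < k := by
    have : 0 < k := by omega
    exact_mod_cast this
  have hk0 : k ≠ 0 := by omega
  have hmesh : t / k < η := by
    rw [div_lt_iff₀ hkpos]
    rw [div_lt_iff₀ hη] at hk₀
    have : (k₀ : ℝ) < k := by exact_mod_cast (by omega : k₀ < k)
    nlinarith
  rw [dist_eq_norm, hsum k hk0]
  have hle : ∀ j : ℕ, t * j / k ≤ t * (j + 1) / k := fun j => by
    have : t * j ≤ t * (j + 1) := by nlinarith
    exact div_le_div_of_nonneg_right this hkpos.le
  have hbound : ∀ j ∈ Finset.range k, ‖∫ s in (t * j / k)..(t * (j + 1) / k),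
      (f' s : ℂ) * (β s - β (t * (j + 1) / k))‖
      ≤ ∫ s in (t * j / k)..(t * (j + 1) / k), |f' s| * (δ / (M + 1)) := by
    intro j hj
    refine intervalIntegral.norm_integral_le_of_norm_le (hle j) ?_
      (Continuous.intervalIntegrable (by fun_prop) _ _)
    refine Eventually.of_forall fun s hs => ?_
    rw [norm_mul, Complex.norm_real, Real.norm_eq_abs]
    refine mul_le_mul_of_nonneg_left ?_ (abs_nonneg _)
    rw [← dist_eq_norm]
    have hj' : ((j : ℝ) + 1) ≤ k := by
      have := Finset.mem_range.1 hj
      exact_mod_cast this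
    have hr : t * (j + 1) / k ≤ t := by
      rw [div_le_iff₀ hkpos]; nlinarith
    have hl : 0 ≤ t * j / k := by positivity
    refine (huc s ⟨hl.trans hs.1.le, hs.2.trans hr⟩ _ ⟨hl.trans (hle j), hr⟩ ?_).le
    rw [Real.dist_eq, abs_sub_comm, abs_of_nonneg (sub_nonneg.2 hs.2)]
    have : t * (j + 1) / k - t * j / k = t / k := by ring
    linarith [hs.1]
  calc _ ≤ ∑ j ∈ Finset.range k, ∫ s in (t * j / k)..(t * (j + 1) / k), |f' s| * (δ / (M + 1)) :=
        (norm_sum_le _ _).trans (Finset.sum_le_sum hbound)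
    _ = M * (δ / (M + 1)) := by
      have := intervalIntegral.sum_integral_adjacent_intervals (n := k) (μ := volume)
        (f := fun s => |f' s| * (δ / (M + 1))) (a := fun j : ℕ => t * j / k)
        (fun j _ => Continuous.intervalIntegrable (by fun_prop) _ _)
      simp only [Nat.cast_add, Nat.cast_one, Nat.cast_zero, mul_zero, zero_div] at this
      rw [this, mul_div_assoc, div_self hkpos.ne', mul_one, intervalIntegral.integral_mul_const]
    _ < δ := by
      rw [mul_div_assoc', div_lt_iff₀ (by positivity)]
      nlinarith

/-- The stochastic convolution along a continuous path, after integration by parts. -/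
noncomputable def pathConv (z : ℝ × ℝ) (n : Freq) (β : ℝ → ℂ) : ℂ :=
  kernel z.1 n 0 * β z.2 - kernel z.1 n z.2 * β 0
    + ∫ s in (0 : ℝ)..z.2, ((deriv (kernel z.1 n) (z.2 - s) : ℝ) : ℂ) * β s

lemma tendsto_wienerSum_kernel {z : ℝ × ℝ} (hε : 0 ≤ z.1) (ht : 0 ≤ z.2) (n : Freq)
    {b : ℝ≥0 → ℂ} (hb : Continuous b) :
    Tendsto (wienerSum (fun s => kernel z.1 n (z.2 - s)) b z.2) atTop
      (𝓝 (pathConv z n fun s => b s.toNNReal)) := by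
  have hK := isDampedKernel_kernel hε n
  have hc := hK.cont
  have := tendsto_wienerSum (f := fun s => kernel z.1 n (z.2 - s))
    (f' := fun s => -deriv (kernel z.1 n) (z.2 - s))
    (fun s => (hK.deriv (z.2 - s)).comp_const_sub z.2 s) (by fun_prop) hb ht
  convert this using 2
  simp only [pathConv, sub_self, sub_zero, Real.toNNReal_zero, Complex.ofReal_neg, neg_mul,
    intervalIntegral.integral_neg]
  ring

lemma wienerIntegral_kernel {z : ℝ × ℝ} (hε : 0 ≤ z.1) (ht : 0 ≤ z.2) (n : Freq)
    {b : ℝ≥0 → ℂ} (hb : Continuous b) :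
    wienerIntegral (fun s => kernel z.1 n (z.2 - s)) b z.2 = pathConv z n fun s => b s.toNNReal :=
  (tendsto_wienerSum_kernel hε ht n hb).limUnder_eq

/-- The constant collects |K(0)| ≤ 1, |K(t)| ≤ 1 and the total variation 1 + w²t. It does not depend
on ε, so approximations of the path are uniform in the parameters. -/
lemma norm_pathConv_sub_le {z : ℝ × ℝ} (hε : 0 ≤ z.1) (ht : 0 ≤ z.2) (n : Freq) {β γ : ℝ → ℂ}
    (hβ : Continuous β) (hγ : Continuous γ) {δ : ℝ} (h : ∀ s ∈ Set.Icc 0 z.2, ‖β s - γ s‖ ≤ δ) :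
    ‖pathConv z n β - pathConv z n γ‖ ≤ (3 + bracket n ^ 2 * z.2) * δ := by
  have hK := isDampedKernel_kernel hε n
  have hc := hK.cont
  have hδ : 0 ≤ δ := (norm_nonneg _).trans (h 0 ⟨le_rfl, ht⟩)
  have e : pathConv z n β - pathConv z n γ = kernel z.1 n 0 * (β z.2 - γ z.2)
      - kernel z.1 n z.2 * (β 0 - γ 0)
      + ∫ s in (0 : ℝ)..z.2, ((deriv (kernel z.1 n) (z.2 - s) : ℝ) : ℂ) * (β s - γ s) := by
    simp only [mul_sub]
    rw [intervalIntegral.integral_sub (Continuous.intervalIntegrable (by fun_prop) _ _)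
      (Continuous.intervalIntegrable (by fun_prop) _ _), pathConv, pathConv]
    ring
  have h1 : ‖(kernel z.1 n 0 : ℂ) * (β z.2 - γ z.2)‖ ≤ δ := by
    rw [norm_mul, Complex.norm_real, Real.norm_eq_abs]
    exact (mul_le_of_le_one_left (norm_nonneg _) (hK.abs_le_one le_rfl)).trans
      (h _ ⟨ht, le_rfl⟩)
  have h2 : ‖(kernel z.1 n z.2 : ℂ) * (β 0 - γ 0)‖ ≤ δ := by
    rw [norm_mul, Complex.norm_real, Real.norm_eq_abs]
    exact (mul_le_of_le_one_left (norm_nonneg _) (hK.abs_le_one ht)).trans (h _ ⟨le_rfl, ht⟩)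
  have h3 : ‖∫ s in (0 : ℝ)..z.2, ((deriv (kernel z.1 n) (z.2 - s) : ℝ) : ℂ) * (β s - γ s)‖
      ≤ (1 + bracket n ^ 2 * z.2) * δ := by
    calc _ ≤ ∫ s in (0 : ℝ)..z.2, |deriv (kernel z.1 n) (z.2 - s)| * δ := by
          refine intervalIntegral.norm_integral_le_of_norm_le ht ?_
            (Continuous.intervalIntegrable (by fun_prop) _ _)
          refine Eventually.of_forall fun s hs => ?_
          rw [norm_mul, Complex.norm_real, Real.norm_eq_abs]
          exact mul_le_mul_of_nonneg_left (h s ⟨hs.1.le, hs.2⟩) (abs_nonneg _)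
      _ ≤ _ := by
          rw [intervalIntegral.integral_mul_const,
            intervalIntegral.integral_comp_sub_left (fun s => |deriv (kernel z.1 n) s|)]
          simp only [sub_self, sub_zero]
          exact mul_le_mul_of_nonneg_right (hK.integral_abs_deriv_le ht) hδ
  rw [e]
  calc _ ≤ δ + δ + (1 + bracket n ^ 2 * z.2) * δ :=
        (norm_add_le _ _).trans (add_le_add ((norm_sub_le _ _).trans (add_le_add h1 h2)) h3)
    _ = _ := by ring

/-- For a differentiable path the integration by parts can be undone. What remains involves the
kernel only as an element of L², where its dependence on (ε,t) is under control. -/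
lemma pathConv_eq_integral_of_hasDerivAt {z : ℝ × ℝ} (hε : 0 ≤ z.1) (ht : 0 ≤ z.2) (n : Freq)
    {β β' : ℝ → ℂ} (hβ : ∀ s, HasDerivAt β (β' s) s) (hβ' : Continuous β') :
    pathConv z n β = ∫ s, (duhamel z n s : ℂ) * β' s := by
  have hK := isDampedKernel_kernel hε n
  have hc := hK.cont
  have hc' := hK.continuous
  have hd : ∀ s, HasDerivAt (fun s => (kernel z.1 n (z.2 - s) : ℂ))
      (-((deriv (kernel z.1 n) (z.2 - s) : ℝ) : ℂ)) s := by
    intro s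
    have := ((hK.deriv (z.2 - s)).comp_const_sub z.2 s).ofReal_comp
    simpa using this
  have hparts := intervalIntegral.integral_mul_deriv_eq_deriv_mul (a := 0) (b := z.2)
    (fun s _ => hd s) (fun s _ => hβ s)
    (Continuous.intervalIntegrable (by fun_prop) _ _) (hβ'.intervalIntegrable _ _)
  have e : ∫ s, (duhamel z n s : ℂ) * β' s
      = ∫ s in (0 : ℝ)..z.2, (kernel z.1 n (z.2 - s) : ℂ) * β' s := by
    have : ∀ s, (duhamel z n s : ℂ) * β' s
        = (Set.Ico 0 z.2).indicator (fun s => (kernel z.1 n (z.2 - s) : ℂ) * β' s) s := by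
      intro s
      by_cases hs : s ∈ Set.Ico 0 z.2 <;> simp [duhamel, hs]
    simp_rw [this]
    rw [integral_indicator measurableSet_Ico, integral_Ico_eq_integral_Ioc,
      intervalIntegral.integral_of_le ht]
  rw [e, hparts, pathConv]
  simp only [sub_self, sub_zero, neg_mul, intervalIntegral.integral_neg]
  ring

/-- The terms of `pathConv` are not separately continuous at ε = 0: K(0) is 0 for ε > 0 and 1 for ε
= 0. In the form ∫ K β' the continuity follows from Cauchy–Schwarz and the Hölder bound in L². -/
lemma continuousOn_pathConv_of_hasDerivAt (T : ℝ) (n : Freq) {β β' : ℝ → ℂ}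
    (hβ : ∀ s, HasDerivAt β (β' s) s) (hβ' : Continuous β') :
    ContinuousOn (fun z => pathConv z n β) (Set.Icc (0 : ℝ) 1 ×ˢ Set.Icc (0 : ℝ) T) := by
  obtain ⟨M, hM⟩ := isCompact_Icc.exists_bound_of_continuousOn (hβ'.continuousOn (s := Set.Icc 0 T))
  have key : ∀ z ∈ Set.Icc (0 : ℝ) 1 ×ˢ Set.Icc (0 : ℝ) T,
      ∀ z' ∈ Set.Icc (0 : ℝ) 1 ×ˢ Set.Icc (0 : ℝ) T,
      dist (pathConv z n β) (pathConv z' n β)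
        ≤ Real.sqrt ((T + 8) * bracket n ^ 2 * dist z z') * (Real.sqrt T * |M|) := by
    intro z hz z' hz'
    have hT : 0 ≤ T := hz.2.1.trans hz.2.2
    have m := memLp_duhamel (z := z) hz.1.1 n
    have m' := memLp_duhamel (z := z') hz'.1.1 n
    have mi : MemLp ((Set.Ico 0 T).indicator fun _ => |M|) 2 (volume : Measure ℝ) :=
      memLp_indicator_const 2 measurableSet_Ico _ (Or.inr (by simp))
    have hi : ∀ {z : ℝ × ℝ}, z ∈ Set.Icc (0 : ℝ) 1 ×ˢ Set.Icc (0 : ℝ) T →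
        Integrable fun s => (duhamel z n s : ℂ) * β' s := by
      intro z hz
      have hK := (isDampedKernel_kernel hz.1.1 n).continuous
      have : ∀ s, (duhamel z n s : ℂ) * β' s
        = (Set.Ico 0 z.2).indicator (fun s => (kernel z.1 n (z.2 - s) : ℂ) * β' s) s := by
        intro s
        by_cases hs : s ∈ Set.Ico 0 z.2 <;> simp [duhamel, hs]
      simp_rw [this]
      rw [integrable_indicator_iff measurableSet_Ico]
      exact (Continuous.integrableOn_Icc (by fun_prop)).mono_set Set.Ico_subset_Icc_self
    rw [dist_eq_norm, pathConv_eq_integral_of_hasDerivAt hz.1.1 hz.2.1 n hβ hβ',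
      pathConv_eq_integral_of_hasDerivAt hz'.1.1 hz'.2.1 n hβ hβ', ← integral_sub (hi hz) (hi hz')]
    have hb : ‖∫ s, ((duhamel z n s : ℂ) * β' s - (duhamel z' n s : ℂ) * β' s)‖
        ≤ ∫ s, |duhamel z n s - duhamel z' n s| * (Set.Ico 0 T).indicator (fun _ => |M|) s := by
      refine norm_integral_le_of_norm_le ((m.sub m').abs.integrable_mul mi)
        (Eventually.of_forall fun s => ?_)
      rw [← sub_mul, norm_mul, ← Complex.ofReal_sub, Complex.norm_real, Real.norm_eq_abs]
      by_cases hs : s ∈ Set.Ico 0 T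
      · rw [Set.indicator_of_mem hs]
        exact mul_le_mul_of_nonneg_left ((hM s ⟨hs.1, hs.2.le⟩).trans (le_abs_self M))
          (abs_nonneg _)
      · have h1 : ∀ {z : ℝ × ℝ}, z ∈ Set.Icc (0 : ℝ) 1 ×ˢ Set.Icc (0 : ℝ) T → duhamel z n s = 0 :=
          fun hz => Set.indicator_of_notMem (fun h => hs ⟨h.1, h.2.trans_le hz.2.2⟩) _
        simp [h1 hz, h1 hz']
    refine hb.trans ((le_abs_self _).trans ((abs_integral_mul_le (m.sub m').abs mi).trans ?_))
    refine mul_le_mul (Real.sqrt_le_sqrt ?_) (le_of_eq ?_) (Real.sqrt_nonneg _) (Real.sqrt_nonneg _)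
    · simpa only [Pi.abs_apply, Pi.sub_apply, sq_abs] using integral_duhamel_sub_sq_le hz hz' n
    · have : ∀ s, ((Set.Ico 0 T).indicator (fun _ => |M|) s) ^ 2
          = (Set.Ico 0 T).indicator (fun _ => M ^ 2) s := by
        intro s
        by_cases hs : s ∈ Set.Ico 0 T <;> simp [hs]
      simp_rw [this]
      rw [integral_indicator_Ico_eq hT, intervalIntegral.integral_const, sub_zero, smul_eq_mul,
        Real.sqrt_mul hT, Real.sqrt_sq_eq_abs]
  intro z hz
  rw [ContinuousWithinAt, tendsto_iff_dist_tendsto_zero]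
  refine squeeze_zero' (Eventually.of_forall fun _ => dist_nonneg)
    (eventually_nhdsWithin_of_forall fun z' hz' => key z' hz' z hz) ?_
  have : Continuous fun z' => Real.sqrt ((T + 8) * bracket n ^ 2 * dist z' z)
      * (Real.sqrt T * |M|) := by fun_prop
  have h0 := this.tendsto z
  simp only [dist_self, mul_zero, Real.sqrt_zero, zero_mul] at h0
  exact h0.mono_left nhdsWithin_le_nhds

/-- The approximation is the average of the path over a window of length η to the right, which
uniform continuity on [0, T + 1] keeps close to the path. -/
lemma exists_smooth_approx {β : ℝ → ℂ} (hβ : Continuous β) (T : ℝ) {δ : ℝ} (hδ : 0 < δ) :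
    ∃ γ γ' : ℝ → ℂ, (∀ s, HasDerivAt γ (γ' s) s) ∧ Continuous γ' ∧
      ∀ s ∈ Set.Icc 0 T, ‖β s - γ s‖ ≤ δ := by
  have huc := isCompact_Icc.uniformContinuousOn_of_continuous
    (hβ.continuousOn (s := Set.Icc 0 (T + 1)))
  rw [Metric.uniformContinuousOn_iff] at huc
  obtain ⟨η', hη', huc⟩ := huc δ hδ
  set η := min (η' / 2) 1 with hη
  have hη0 : 0 < η := by positivity
  have hη1 : η ≤ 1 := min_le_right _ _
  have hη2 : η < η' := (min_le_left _ _).trans_lt (by linarith)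
  have hii : ∀ u v, IntervalIntegrable β volume u v := fun u v => hβ.intervalIntegrable _ _
  have hP : ∀ s, HasDerivAt (fun s => ∫ r in (0 : ℝ)..s, β r) (β s) s := fun s =>
    intervalIntegral.integral_hasDerivAt_right (hii _ _)
      (hβ.stronglyMeasurableAtFilter _ _) hβ.continuousAt
  refine ⟨fun s => (η⁻¹ : ℝ) • ((∫ r in (0 : ℝ)..(s + η), β r) - ∫ r in (0 : ℝ)..s, β r),
    fun s => (η⁻¹ : ℝ) • (β (s + η) - β s), fun s => ?_, by fun_prop, fun s hs => ?_⟩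
  · exact (((hP (s + η)).comp_add_const s η).sub (hP s)).const_smul (η⁻¹ : ℝ)
  · beta_reduce
    rw [intervalIntegral.integral_interval_sub_left (hii _ _) (hii _ _)]
    have e : β s - (η⁻¹ : ℝ) • ∫ r in s..(s + η), β r
        = (η⁻¹ : ℝ) • ∫ r in s..(s + η), (β s - β r) := by
      rw [intervalIntegral.integral_sub (by simp) (hii _ _), intervalIntegral.integral_const,
        smul_sub, add_sub_cancel_left, smul_smul, inv_mul_cancel₀ hη0.ne', one_smul]
    rw [e, norm_smul, Real.norm_of_nonneg (by positivity)]
    have := intervalIntegral.norm_integral_le_of_norm_le_const (a := s) (b := s + η) (C := δ)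
      (f := fun r => β s - β r) (fun r hr => by
        rw [Set.uIoc_of_le (by linarith)] at hr
        rw [← dist_eq_norm]
        refine (huc s ⟨hs.1, by linarith [hs.2]⟩ r ⟨hs.1.trans hr.1.le, by linarith [hr.2, hs.2]⟩ ?_).le
        rw [Real.dist_eq, abs_sub_comm, abs_of_nonneg (by linarith [hr.1])]
        linarith [hr.2])
    rw [add_sub_cancel_left, abs_of_nonneg hη0.le] at this
    rw [inv_mul_le_iff₀ hη0]
    linarith

/-- A uniform limit of continuous functions: smooth paths give continuity, and the Lipschitz bound
in the path is uniform over the rectangle. This is the source of the pathwise continuity at ε = 0.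
-/
lemma continuousOn_pathConv (T : ℝ) (n : Freq) {β : ℝ → ℂ} (hβ : Continuous β) :
    ContinuousOn (fun z => pathConv z n β) (Set.Icc (0 : ℝ) 1 ×ˢ Set.Icc (0 : ℝ) T) := by
  refine continuousOn_of_uniform_approx_of_continuousOn fun u hu => ?_
  obtain ⟨δ, hδ, hu⟩ := Metric.mem_uniformity_dist.1 hu
  set A : ℝ := 3 + bracket n ^ 2 * |T| with hA
  have hA0 : 0 < A := by positivity
  obtain ⟨γ, γ', hγ, hγ', hclose⟩ := exists_smooth_approx hβ T (δ := δ / (2 * A)) (by positivity)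
  refine ⟨_, continuousOn_pathConv_of_hasDerivAt T n hγ hγ', fun z hz => hu ?_⟩
  rw [dist_eq_norm]
  have cγ : Continuous γ := continuous_iff_continuousAt.2 fun t => (hγ t).continuousAt
  calc _ ≤ (3 + bracket n ^ 2 * z.2) * (δ / (2 * A)) :=
        norm_pathConv_sub_le hz.1.1 hz.2.1 n hβ cγ
          fun s hs => hclose s ⟨hs.1, hs.2.trans hz.2.2⟩
    _ ≤ A * (δ / (2 * A)) := by
        refine mul_le_mul_of_nonneg_right ?_ (by positivity)
        have := hz.2.2.trans (le_abs_self T)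
        have := mul_le_mul_of_nonneg_left this (sq_nonneg (bracket n))
        linarith
    _ = δ / 2 := by field_simp
    _ < δ := by linarith

/-! ### Gaussian expectations of polynomials and Stein's identity -/

open ProbabilityTheory in
/-- Gaussian integration by parts for monomials. -/
lemma integral_pow_succ_gaussianReal (m : ℕ) :
    ∫ x, x ^ (m + 1) ∂(gaussianReal 0 1) = m * ∫ x, x ^ (m - 1) ∂(gaussianReal 0 1) := by
  have hint : ∀ k : ℕ, Integrable (fun x : ℝ => x ^ k * gaussianPDFReal 0 1 x) := by
    intro k
    have h1 : Integrable (fun x : ℝ => x ^ k) (gaussianReal 0 1) := by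
      rw [← integrable_norm_iff (by fun_prop)]
      simp only [norm_pow]
      exact (memLp_id_gaussianReal' (μ := 0) (v := 1) k (by simp)).integrable_norm_pow'
    rw [gaussianReal_of_var_ne_zero _ one_ne_zero,
      integrable_withDensity_iff (measurable_gaussianPDF _ _)
        (Eventually.of_forall fun _ => gaussianPDF_lt_top)] at h1
    simpa [toReal_gaussianPDF] using h1
  have hd : ∀ x, HasDerivAt (gaussianPDFReal 0 1) (-x * gaussianPDFReal 0 1 x) x := by
    intro x
    have e : gaussianPDFReal 0 1 = fun x => (Real.sqrt (2 * Real.pi))⁻¹ * Real.exp (-x ^ 2 / 2) := by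
      funext x; simp [gaussianPDFReal]
    rw [e]
    exact hasDerivAt_of_eq (((((hasDerivAt_id' x).pow 2).neg.div_const 2).exp).const_mul
      (Real.sqrt (2 * Real.pi))⁻¹) (fun s => by simp) (by simp; ring)
  have key := integral_eq_zero_of_hasDerivAt_of_integrable
    (f := fun x => x ^ m * gaussianPDFReal 0 1 x)
    (f' := fun x => m * (x ^ (m - 1) * gaussianPDFReal 0 1 x) - x ^ (m + 1) * gaussianPDFReal 0 1 x)
    (fun x => hasDerivAt_of_eq ((hasDerivAt_pow m x).mul (hd x)) (fun s => rfl) (by ring))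
    (((hint _).const_mul _).sub (hint _)) (hint _)
  rw [integral_sub ((hint _).const_mul _) (hint _), integral_const_mul, sub_eq_zero] at key
  rw [integral_gaussianReal_eq_integral_smul one_ne_zero,
    integral_gaussianReal_eq_integral_smul one_ne_zero]
  simp only [smul_eq_mul, mul_comm (gaussianPDFReal _ _ _)]
  exact key.symm

section Polynomials

open MvPolynomial

variable {ι : Type*} [Fintype ι]

/-- The standard Gaussian measure on `ℝ^ι`. -/
noncomputable abbrev stdGauss (ι : Type*) [Fintype ι] : Measure (ι → ℝ) :=
  Measure.pi fun _ => ProbabilityTheory.gaussianReal 0 1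

/-- The induction runs over all finite exponents at once, because a product with a variable is
treated by Hölder's inequality with doubled exponents. -/
lemma memLp_eval_stdGauss (p : MvPolynomial ι ℝ) :
    ∀ q : ℝ≥0∞, q ≠ ∞ → MemLp (fun x => eval x p) q (stdGauss ι) := by
  induction p using MvPolynomial.induction_on with
  | C a => intro q _; simpa using memLp_const a
  | add p r hp hr =>
    intro q hq
    simpa only [map_add] using! (hp q hq).add (hr q hq)
  | mul_X p i hp =>
    intro q hq
    have hX : MemLp (fun x : ι → ℝ => x i) (q * 2) (stdGauss ι) :=
      (ProbabilityTheory.memLp_id_gaussianReal' (μ := 0) (v := 1) (q * 2)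
        (ENNReal.mul_ne_top hq (by simp))).comp_measurePreserving
          (measurePreserving_eval (fun _ : ι => ProbabilityTheory.gaussianReal 0 1) i)
    have hp' := hp (q * 2) (ENNReal.mul_ne_top hq (by simp))
    have : ENNReal.HolderTriple (q * 2) (q * 2) q := ⟨by
      rw [ENNReal.mul_inv (by simp) (by simp), ← mul_add, ENNReal.inv_two_add_inv_two, mul_one]⟩
    simpa only [map_mul, eval_X] using! MemLp.mul hX hp' (r := q)

lemma integrable_eval_stdGauss (p : MvPolynomial ι ℝ) :
    Integrable (fun x => eval x p) (stdGauss ι) :=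
  memLp_one_iff_integrable.1 (memLp_eval_stdGauss p 1 (by simp))

/-- Gaussian expectation of a polynomial. -/
noncomputable def gaussE : MvPolynomial ι ℝ →ₗ[ℝ] ℝ where
  toFun p := ∫ x, eval x p ∂(stdGauss ι)
  map_add' p q := by
    simp only [map_add]
    exact integral_add (integrable_eval_stdGauss p) (integrable_eval_stdGauss q)
  map_smul' c p := by
    simp only [smul_eval, RingHom.id_apply, smul_eq_mul]
    exact integral_const_mul _ _

lemma gaussE_apply (p : MvPolynomial ι ℝ) : gaussE p = ∫ x, eval x p ∂(stdGauss ι) := rfl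

lemma gaussE_C_mul (c : ℝ) (p : MvPolynomial ι ℝ) : gaussE (C c * p) = c * gaussE p := by
  rw [← MvPolynomial.smul_eq_C_mul, map_smul, smul_eq_mul]

lemma gaussE_C (c : ℝ) : gaussE (C c : MvPolynomial ι ℝ) = c := by
  simp [gaussE_apply]

/-- Stein's identity. -/
lemma gaussE_X_mul (i : ι) (p : MvPolynomial ι ℝ) : gaussE (X i * p) = gaussE (pderiv i p) := by
  classical
  induction p using MvPolynomial.induction_on' with
  | add p q hp hq => rw [mul_add, map_add, map_add, map_add, hp, hq]
  | monomial m c =>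
    have hmon : ∀ (m : ι →₀ ℕ) (c : ℝ), gaussE (monomial m c)
        = c * ∏ j, ∫ x, x ^ m j ∂(ProbabilityTheory.gaussianReal 0 1) := by
      intro m c
      rw [gaussE_apply]
      simp only [eval_monomial, Finsupp.prod_fintype _ _ (fun j => pow_zero _)]
      rw [integral_const_mul]
      congr 1
      exact integral_fintype_prod_eq_prod (fun j (x : ℝ) => x ^ m j)
    have e1 : X i * monomial m c = monomial (Finsupp.single i 1 + m) c := by
      rw [X, monomial_mul, one_mul]
    rw [e1, pderiv_monomial, hmon, hmon, mul_assoc]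
    congr 1
    rw [← Finset.mul_prod_erase (a := i) _ (fun j => ∫ x, x ^ ((Finsupp.single i 1 + m : ι →₀ ℕ) j)
        ∂(ProbabilityTheory.gaussianReal 0 1)) (Finset.mem_univ i),
      ← Finset.mul_prod_erase (a := i) _ (fun j => ∫ x, x ^ ((m - Finsupp.single i 1 : ι →₀ ℕ) j)
        ∂(ProbabilityTheory.gaussianReal 0 1)) (Finset.mem_univ i), ← mul_assoc]
    congr 1
    · have := integral_pow_succ_gaussianReal (m i)
      simpa [add_comm] using this
    · refine Finset.prod_congr rfl fun j hj => ?_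
      have : i ≠ j := (Finset.ne_of_mem_erase hj).symm
      simp [this]

end Polynomials

/-! ### Hermite polynomials over a ring -/

/-- The Hermite polynomials with variance parameter, over a commutative ring. -/
def hermiteRing {A : Type*} [CommRing A] : ℕ → A → A → A
  | 0, _, _ => 1
  | 1, x, _ => x
  | k + 2, x, s => x * hermiteRing (k + 1) x s - (k + 1) * s * hermiteRing k x s

lemma hermiteRing_real (k : ℕ) (x s : ℝ) : hermiteRing k x s = hermiteVar k x s := by
  induction k using Nat.twoStepInduction with
  | zero => rfl
  | one => rfl
  | more k h1 h2 => rw [hermiteRing, hermiteVar, h1, h2]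

lemma map_hermiteRing {A A' : Type*} [CommRing A] [CommRing A'] (φ : A →+* A') (k : ℕ) (x s : A) :
    φ (hermiteRing k x s) = hermiteRing k (φ x) (φ s) := by
  induction k using Nat.twoStepInduction with
  | zero => simp [hermiteRing]
  | one => rfl
  | more k h1 h2 => simp [hermiteRing, h1, h2]

lemma derivation_hermiteRing {A : Type*} [CommRing A] [Algebra ℝ A] (D : Derivation ℝ A A)
    (k : ℕ) (x s : A) (hs : D s = 0) :
    D (hermiteRing (k + 1) x s) = (k + 1) * hermiteRing k x s * D x := by
  induction k using Nat.twoStepInduction with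
  | zero => simp [hermiteRing]
  | one =>
    simp only [hermiteRing, map_sub, Derivation.leibniz, smul_eq_mul, hs]
    simp; ring
  | more k h1 h2 =>
    have e : hermiteRing (k + 2 + 1) x s
        = x * hermiteRing (k + 2) x s - ((k + 1 : ℕ) + 1) * s * hermiteRing (k + 1) x s := rfl
    have e' : hermiteRing (k + 2) x s
        = x * hermiteRing (k + 1) x s - (k + 1) * s * hermiteRing k x s := rfl
    have hc : D (((k + 1 : ℕ) : A) + 1) = 0 := by
      rw [map_add, Derivation.map_natCast, Derivation.map_one_eq_zero, add_zero]
    rw [e, map_sub, Derivation.leibniz, Derivation.leibniz, Derivation.leibniz, h2, h1, hs, hc]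
    simp only [smul_eq_mul]
    rw [e']
    push_cast
    ring

/-! ### Wick's formula and hypercontractivity -/

section Chaos

open MvPolynomial

variable {ι : Type*} [Fintype ι]

/-- The linear form `∑ aᵢ Xᵢ`. -/
noncomputable def linForm (a : ι → ℝ) : MvPolynomial ι ℝ := ∑ i, C (a i) * X i

/-- The Hermite polynomial `H_ℓ(a·X; |a|²)`. -/
noncomputable def hermiteForm (ℓ : ℕ) (a : ι → ℝ) : MvPolynomial ι ℝ :=
  hermiteRing ℓ (linForm a) (C (∑ i, a i ^ 2))

lemma pderiv_linForm (a : ι → ℝ) (i : ι) : pderiv i (linForm a) = C (a i) := by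
  classical
  simp [linForm, pderiv_X, Pi.single_apply]

lemma pderiv_hermiteForm (ℓ : ℕ) (a : ι → ℝ) (i : ι) :
    pderiv i (hermiteForm (ℓ + 1) a) = C (((ℓ : ℝ) + 1) * a i) * hermiteForm ℓ a := by
  rw [hermiteForm, derivation_hermiteRing _ _ _ _ (by simp), pderiv_linForm, hermiteForm]
  simp only [map_mul, map_add, map_natCast, map_one]; ring

lemma gaussE_linForm_mul (a : ι → ℝ) (p : MvPolynomial ι ℝ) :
    gaussE (linForm a * p) = ∑ i, a i * gaussE (pderiv i p) := by
  rw [linForm, Finset.sum_mul, map_sum]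
  simp_rw [mul_assoc, gaussE_C_mul, gaussE_X_mul]

/-- Integration by parts against a Hermite polynomial. -/
lemma gaussE_hermiteForm_succ_mul (ℓ : ℕ) (a : ι → ℝ) (p : MvPolynomial ι ℝ) :
    gaussE (hermiteForm (ℓ + 1) a * p) = ∑ i, a i * gaussE (hermiteForm ℓ a * pderiv i p) := by
  cases ℓ with
  | zero =>
    have h1 : hermiteForm 1 a = linForm a := rfl
    have h0 : hermiteForm 0 a = 1 := rfl
    simp only [h1, h0, zero_add, one_mul, gaussE_linForm_mul]
  | succ k =>
    have e : hermiteForm (k + 2) a * p = linForm a * (hermiteForm (k + 1) a * p)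
        - C (((k : ℝ) + 1) * ∑ i, a i ^ 2) * (hermiteForm k a * p) := by
      have : hermiteForm (k + 2) a = linForm a * hermiteForm (k + 1) a
        - ((k : MvPolynomial ι ℝ) + 1) * C (∑ i, a i ^ 2) * hermiteForm k a := rfl
      rw [this]
      simp only [map_mul, map_add, map_natCast, map_one]; ring
    rw [e, map_sub, gaussE_linForm_mul, gaussE_C_mul]
    have e2 : ∀ i, a i * gaussE (pderiv i (hermiteForm (k + 1) a * p))
        = a i * gaussE (hermiteForm (k + 1) a * pderiv i p)
          + (k + 1) * a i ^ 2 * gaussE (hermiteForm k a * p) := by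
      intro i
      rw [Derivation.leibniz, pderiv_hermiteForm]
      simp only [smul_eq_mul, map_add]
      rw [show p * (C (((k : ℝ) + 1) * a i) * hermiteForm k a)
        = C (((k : ℝ) + 1) * a i) * (hermiteForm k a * p) by ring, gaussE_C_mul]
      ring
    simp_rw [e2]
    rw [Finset.sum_add_distrib, ← Finset.sum_mul, ← Finset.mul_sum]
    ring

/-- Wick's formula `E[H_ℓ(a·ξ) H_ℓ(b·ξ)] = ℓ! (a·b)^ℓ`. -/
lemma gaussE_hermiteForm_mul_hermiteForm (ℓ : ℕ) (a b : ι → ℝ) :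
    gaussE (hermiteForm ℓ a * hermiteForm ℓ b) = ℓ.factorial * (∑ i, a i * b i) ^ ℓ := by
  induction ℓ with
  | zero =>
    have h0 : ∀ a : ι → ℝ, hermiteForm 0 a = C 1 := fun a => (map_one C).symm
    rw [h0, h0, ← C_mul, gaussE_C]; simp
  | succ k ih =>
    rw [gaussE_hermiteForm_succ_mul]
    have : ∀ i, a i * gaussE (hermiteForm k a * pderiv i (hermiteForm (k + 1) b))
        = (a i * b i) * ((k + 1) * (k.factorial * (∑ i, a i * b i) ^ k)) := by
      intro i
      rw [pderiv_hermiteForm, show hermiteForm k a * (C (((k : ℝ) + 1) * b i) * hermiteForm k b)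
        = C (((k : ℝ) + 1) * b i) * (hermiteForm k a * hermiteForm k b) by ring, gaussE_C_mul, ih]
      ring
    simp_rw [this]
    rw [← Finset.sum_mul, Nat.factorial_succ]
    push_cast; ring

variable {J : Type*} [Fintype J]

/-- A linear combination of Hermite polynomials of linear forms. -/
noncomputable def hermiteComb (ℓ : ℕ) (a : J → ι → ℝ) (w : J → ℝ) : MvPolynomial ι ℝ :=
  ∑ j, C (w j) * hermiteForm ℓ (a j)

lemma pderiv_hermiteComb (ℓ : ℕ) (a : J → ι → ℝ) (w : J → ℝ) (i : ι) :
    pderiv i (hermiteComb (ℓ + 1) a w)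
      = C ((ℓ : ℝ) + 1) * hermiteComb ℓ a (fun j => w j * a j i) := by
  rw [hermiteComb, map_sum, hermiteComb, Finset.mul_sum]
  refine Finset.sum_congr rfl fun j _ => ?_
  rw [Derivation.leibniz, pderiv_hermiteForm, pderiv_C]
  simp only [smul_eq_mul, map_mul, mul_zero, add_zero]
  ring

lemma gaussE_hermiteComb_succ_mul (ℓ : ℕ) (a : J → ι → ℝ) (w : J → ℝ) (p : MvPolynomial ι ℝ) :
    gaussE (hermiteComb (ℓ + 1) a w * p)
      = ∑ i, gaussE (hermiteComb ℓ a (fun j => w j * a j i) * pderiv i p) := by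
  simp only [hermiteComb, Finset.sum_mul, map_sum, mul_assoc, gaussE_C_mul,
    gaussE_hermiteForm_succ_mul, Finset.mul_sum]
  rw [Finset.sum_comm]

/-- Integration by parts lowers the order of one factor and differentiates the other m. The
derivative of each is again a combination of lower order, with the same weights up to the factor ℓ +
1, hence the square. For m = 0 the truncated exponent m - 1 is harmless, since the prefactor
vanishes. -/
lemma gaussE_hermiteComb_pow (ℓ m : ℕ) (a : J → ι → ℝ) (w : J → ℝ) :
    gaussE (hermiteComb (ℓ + 1) a w ^ (m + 1))
      = m * (ℓ + 1) * ∑ i, gaussE (hermiteComb (ℓ + 1) a w ^ (m - 1)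
          * hermiteComb ℓ a (fun j => w j * a j i) ^ 2) := by
  rw [pow_succ', gaussE_hermiteComb_succ_mul, Finset.mul_sum]
  refine Finset.sum_congr rfl fun i _ => ?_
  rw [Derivation.leibniz_pow, pderiv_hermiteComb]
  rw [show hermiteComb ℓ a (fun j => w j * a j i) * (m • hermiteComb (ℓ + 1) a w ^ (m - 1)
      • (C ((ℓ : ℝ) + 1) * hermiteComb ℓ a (fun j => w j * a j i)))
    = C ((m : ℝ) * (ℓ + 1)) * (hermiteComb (ℓ + 1) a w ^ (m - 1)
          * hermiteComb ℓ a (fun j => w j * a j i) ^ 2) by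
      simp only [smul_eq_mul, nsmul_eq_mul, map_mul, map_natCast]; ring]
  exact gaussE_C_mul _ _

lemma gaussE_nonneg {p : MvPolynomial ι ℝ} (h : ∀ x, 0 ≤ eval x p) : 0 ≤ gaussE p :=
  integral_nonneg h

/-- Hölder's inequality with the conjugate exponents (k+1)/k and k+1. -/
lemma gaussE_pow_mul_sq_le (k : ℕ) (p q : MvPolynomial ι ℝ) :
    gaussE (p ^ (2 * k) * q ^ 2) ≤ gaussE (p ^ (2 * (k + 1))) ^ ((k : ℝ) / (k + 1))
      * gaussE (q ^ (2 * (k + 1))) ^ ((1 : ℝ) / (k + 1)) := by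
  rcases Nat.eq_zero_or_pos k with rfl | hk
  · simp
  have hk' : (0 : ℝ) < k := by exact_mod_cast hk
  have hpq : Real.HolderConjugate (((k : ℝ) + 1) / k) (k + 1) := by
    rw [Real.holderConjugate_iff]
    refine ⟨by rw [lt_div_iff₀ hk']; linarith, ?_⟩
    field_simp
  have h := integral_mul_le_Lp_mul_Lq_of_nonneg (μ := stdGauss ι) hpq
    (f := fun x => eval x (p ^ (2 * k))) (g := fun x => eval x (q ^ 2))
    (Eventually.of_forall fun x => by
      simp only [map_pow, pow_mul]; positivity)
    (Eventually.of_forall fun x => by simp only [map_pow]; positivity)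
    (memLp_eval_stdGauss _ _ (by simp)) (memLp_eval_stdGauss _ _ (by simp))
  simp only [gaussE_apply, map_mul]
  refine h.trans (le_of_eq ?_)
  congr 1
  · rw [one_div_div]
    congr 1
    refine integral_congr_ae (Eventually.of_forall fun x => ?_)
    simp only [map_pow, pow_mul]
    rw [← Real.rpow_natCast, ← Real.rpow_mul (sq_nonneg _), mul_div_cancel₀ _ hk'.ne']
    exact_mod_cast rfl
  · congr 1
    refine integral_congr_ae (Eventually.of_forall fun x => ?_)
    simp only [map_pow, pow_mul]
    exact_mod_cast rfl

/-- Hypercontractivity on a fixed homogeneous chaos. -/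
lemma gaussE_hermiteComb_pow_le (ℓ k : ℕ) (a : J → ι → ℝ) (w : J → ℝ) :
    gaussE (hermiteComb ℓ a w ^ (2 * (k + 1)))
      ≤ ((2 * k + 1 : ℝ) ^ ℓ * gaussE (hermiteComb ℓ a w ^ 2)) ^ (k + 1) := by
  induction ℓ generalizing w with
  | zero =>
    have h0 : hermiteComb 0 a w = C (∑ j, w j) := by
      simp [hermiteComb, hermiteForm, hermiteRing]
    rw [h0, ← map_pow, gaussE_C, ← map_pow, gaussE_C, pow_zero, one_mul, pow_mul]
  | succ ℓ ih =>
    set F := hermiteComb (ℓ + 1) a w with hF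
    set g : ι → MvPolynomial ι ℝ := fun i => hermiteComb ℓ a (fun j => w j * a j i) with hg
    have hpos : ∀ (p : MvPolynomial ι ℝ) (m : ℕ), 0 ≤ gaussE (p ^ (2 * m)) := fun p m =>
      gaussE_nonneg fun x => by simp only [map_pow, pow_mul]; positivity
    set M := gaussE (F ^ (2 * (k + 1))) with hM
    -- The case m = 1 of the integration by parts: the second moments of the lower order
    -- combinations add up to that of F, which lets the induction close with the constant
    -- (2k+1)^(ℓ+1).
    have hQ : gaussE (F ^ 2) = (ℓ + 1) * ∑ i, gaussE (g i ^ 2) := by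
      have := gaussE_hermiteComb_pow ℓ 1 a w
      simpa using this
    have hM' : M = (2 * k + 1 : ℕ) * (ℓ + 1) * ∑ i, gaussE (F ^ (2 * k) * g i ^ 2) := by
      have := gaussE_hermiteComb_pow ℓ (2 * k + 1) a w
      simpa only [add_tsub_cancel_right] using! this
    have hM0 : 0 ≤ M := hpos _ _
    have hq0 : ∀ i, 0 ≤ gaussE (g i ^ 2) := fun i => hpos (g i) 1
    have hstep : ∀ i, gaussE (F ^ (2 * k) * g i ^ 2)
        ≤ M ^ ((k : ℝ) / (k + 1)) * ((2 * k + 1 : ℝ) ^ ℓ * gaussE (g i ^ 2)) := by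
      intro i
      refine (gaussE_pow_mul_sq_le k F (g i)).trans ?_
      refine mul_le_mul_of_nonneg_left ?_ (Real.rpow_nonneg hM0 _)
      have h1 := Real.rpow_le_rpow (hpos (g i) (k + 1)) (ih fun j => w j * a j i)
        (z := (1 : ℝ) / (k + 1)) (by positivity)
      refine h1.trans (le_of_eq ?_)
      rw [← Real.rpow_natCast, ← Real.rpow_mul (mul_nonneg (by positivity) (hq0 i))]
      rw [show ((k + 1 : ℕ) : ℝ) * (1 / ((k : ℝ) + 1)) = 1 by push_cast; field_simp, Real.rpow_one]
    -- M appears on both sides, on the right only with exponent k/(k+1). Dividing, when M > 0,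
    -- leaves a bound on M^{1/(k+1)}.
    have hle : M ≤ M ^ ((k : ℝ) / (k + 1)) * ((2 * k + 1 : ℝ) ^ (ℓ + 1) * gaussE (F ^ 2)) := by
      calc M = (2 * k + 1 : ℕ) * (ℓ + 1) * ∑ i, gaussE (F ^ (2 * k) * g i ^ 2) := hM'
        _ ≤ (2 * k + 1 : ℕ) * (ℓ + 1) * ∑ i,
            M ^ ((k : ℝ) / (k + 1)) * ((2 * k + 1 : ℝ) ^ ℓ * gaussE (g i ^ 2)) :=
          mul_le_mul_of_nonneg_left (Finset.sum_le_sum fun i _ => hstep i) (by positivity)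
        _ = _ := by
          rw [hQ, ← Finset.mul_sum, ← Finset.mul_sum]; push_cast; ring
    have hc0 : 0 ≤ (2 * k + 1 : ℝ) ^ (ℓ + 1) * gaussE (F ^ 2) :=
      mul_nonneg (by positivity) (hpos F 1)
    rcases hM0.eq_or_lt with h0 | h0
    · rw [← h0]; exact pow_nonneg hc0 _
    have h2 : M ^ ((1 : ℝ) / (k + 1)) ≤ (2 * k + 1 : ℝ) ^ (ℓ + 1) * gaussE (F ^ 2) := by
      have hp : 0 < M ^ ((k : ℝ) / (k + 1)) := Real.rpow_pos_of_pos h0 _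
      rw [← mul_le_mul_iff_right₀ hp]
      refine le_trans (le_of_eq ?_) hle
      rw [← Real.rpow_add h0, ← add_div, div_self (by positivity), Real.rpow_one]
    calc M = (M ^ ((1 : ℝ) / (k + 1))) ^ (k + 1) := by
          rw [← Real.rpow_natCast, ← Real.rpow_mul hM0]
          rw [show (1 : ℝ) / (k + 1) * ((k + 1 : ℕ) : ℝ) = 1 by push_cast; field_simp, Real.rpow_one]
      _ ≤ _ := pow_le_pow_left₀ (Real.rpow_nonneg hM0 _) h2 _

end Chaos

/-! ### From Gaussian vectors to polynomials in standard Gaussians -/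

section Transfer

open ProbabilityTheory
open scoped Matrix MatrixOrder

variable {Ω : Type*} [MeasurableSpace Ω] {P : Measure Ω} {J : Type*} [Fintype J] {X : J → Ω → ℝ}

/-- A centred Gaussian vector is a linear image of a standard Gaussian vector. -/
lemma exists_map_eq_stdGauss_map (hX : HasGaussianLaw (fun ω j => X j ω) P)
    (h0 : ∀ j, ∫ ω, X j ω ∂P = 0) :
    ∃ a : J → J → ℝ, P.map (fun ω j => X j ω)
      = (stdGauss J).map (fun x j => ∑ i, a j i * x i) := by
  classical
  have := hX.isProbabilityMeasure
  have hm2 : ∀ j, MemLp (X j) 2 P := fun j => (hX.eval j).memLp_two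
  have hae : AEMeasurable (fun ω j => X j ω) P := hX.aemeasurable
  set S : Matrix J J ℝ := Matrix.of fun i j => cov[X i, X j; P] with hS
  set μ₁ : Measure (EuclideanSpace ℝ J) := P.map (fun ω => WithLp.toLp 2 fun j => X j ω) with hμ₁
  have hg : HasGaussianLaw (fun ω => WithLp.toLp 2 fun j => X j ω) P := hX.toLp_pi 2
  have hgI : IsGaussian μ₁ := hg.isGaussian_map
  have hb : ∀ x y : EuclideanSpace ℝ J, covarianceBilin μ₁ x y = x ⬝ᵥ S *ᵥ y := by
    intro x y
    rw [hμ₁, covarianceBilin_apply_pi hm2]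
    simp only [dotProduct, Matrix.mulVec, hS, Matrix.of_apply, Finset.mul_sum]
    exact Finset.sum_congr rfl fun i _ => Finset.sum_congr rfl fun j _ => by ring
  have hSps : S.PosSemidef := by
    refine Matrix.PosSemidef.of_dotProduct_mulVec_nonneg ?_ fun x => ?_
    · ext i j
      simp [hS, covariance_comm]
    · have h1 := hb (WithLp.toLp 2 x) (WithLp.toLp 2 x)
      have h2 := (isPosSemidef_covarianceBilin (μ := μ₁)).nonneg (WithLp.toLp 2 x)
      simp only [ContinuousLinearMap.toBilinForm_apply] at h2
      rw [h1] at h2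
      simpa using h2
  have hμ : μ₁ = multivariateGaussian 0 S := by
    refine IsGaussian.ext ?_ ?_
    · rw [integral_id_multivariateGaussian', hμ₁, integral_map hg.aemeasurable (by fun_prop)]
      ext j
      simp only [id]
      have := (EuclideanSpace.proj (𝕜 := ℝ) j).integral_comp_comm hg.integrable
      simp only [PiLp.proj_apply] at this
      rw [← this]
      simpa using h0 j
    · ext x y
      rw [hb, covarianceBilin_multivariateGaussian hSps]
  -- The positive square root exists for every positive semidefinite covariance, so degenerate
  -- vectors are allowed. They do occur, for instance when two of the evaluation points coincide.
  refine ⟨fun j i => CFC.sqrt S j i, ?_⟩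
  have h3 : P.map (fun ω j => X j ω) = μ₁.map (WithLp.ofLp) := by
    rw [hμ₁, AEMeasurable.map_map_of_aemeasurable (by fun_prop) hg.aemeasurable]
    rfl
  rw [h3, hμ, multivariateGaussian, ← map_pi_eq_stdGaussian, Measure.map_map (by fun_prop)
    (by fun_prop), Measure.map_map (by fun_prop) (by fun_prop)]
  congr 1
  funext x j
  simp [Matrix.mulVec, dotProduct]

open MvPolynomial in
-- The vector is replaced by linear forms in standard Gaussians. Any continuous function of it that
-- becomes a polynomial in these variables has all its moments, and its expectation is computed by
-- `gaussE`.
lemma exists_gaussE_representation (hX : HasGaussianLaw (fun ω j => X j ω) P)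
    (h0 : ∀ j, ∫ ω, X j ω ∂P = 0) :
    ∃ a : J → J → ℝ, (∀ i j, ∫ ω, X i ω * X j ω ∂P = ∑ k, a i k * a j k) ∧
      (∀ (Φ : (J → ℝ) → ℝ) (p : MvPolynomial J ℝ), Continuous Φ →
        (∀ x : J → ℝ, Φ (fun j => ∑ i, a j i * x i) = eval x p) →
        ∫ ω, Φ (fun j => X j ω) ∂P = gaussE p ∧
        ∀ q : ℝ≥0∞, q ≠ ∞ → MemLp (fun ω => Φ (fun j => X j ω)) q P) := by
  obtain ⟨a, ha⟩ := exists_map_eq_stdGauss_map hX h0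
  have hm : Measurable fun (x : J → ℝ) (j : J) => ∑ i, a j i * x i := by fun_prop
  have key : ∀ (Φ : (J → ℝ) → ℝ) (p : MvPolynomial J ℝ), Continuous Φ →
        (∀ x : J → ℝ, Φ (fun j => ∑ i, a j i * x i) = eval x p) →
        ∫ ω, Φ (fun j => X j ω) ∂P = gaussE p ∧
        ∀ q : ℝ≥0∞, q ≠ ∞ → MemLp (fun ω => Φ (fun j => X j ω)) q P := by
    intro Φ p hΦ hp
    refine ⟨?_, fun q hq => ?_⟩
    · rw [← integral_map (φ := fun ω j => X j ω) (f := Φ) hX.aemeasurable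
        hΦ.aestronglyMeasurable, ha, integral_map hm.aemeasurable hΦ.aestronglyMeasurable,
        gaussE_apply]
      simp only [hp]
    · have h1 : MemLp Φ q (P.map fun ω j => X j ω) := by
        rw [ha]
        refine (memLp_map_measure_iff hΦ.aestronglyMeasurable hm.aemeasurable).2 ?_
        simpa only [Function.comp_def, hp] using memLp_eval_stdGauss p q hq
      exact (memLp_map_measure_iff hΦ.aestronglyMeasurable hX.aemeasurable).1 h1
  refine ⟨a, fun i j => ?_, key⟩
  have h := (key (fun x => x i * x j) (linForm (a i) * linForm (a j)) (by fun_prop)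
    (fun x => by simp [linForm])).1
  rw [h, gaussE_linForm_mul]
  refine Finset.sum_congr rfl fun k _ => ?_
  rw [pderiv_linForm, gaussE_C]

lemma continuous_hermiteVar (ℓ : ℕ) (s : ℝ) : Continuous fun x => hermiteVar ℓ x s := by
  induction ℓ using Nat.twoStepInduction with
  | zero => exact continuous_const
  | one => exact continuous_id
  | more k h1 h2 => simp only [hermiteVar]; fun_prop

open MvPolynomial in
lemma eval_hermiteForm (ℓ : ℕ) (a : J → ℝ) (x : J → ℝ) :
    eval x (hermiteForm ℓ a) = hermiteVar ℓ (∑ i, a i * x i) (∑ i, a i ^ 2) := by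
  rw [hermiteForm, map_hermiteRing, hermiteRing_real]
  simp [linForm]

lemma integral_hermiteVar_mul_hermiteVar (hX : HasGaussianLaw (fun ω j => X j ω) P)
    (h0 : ∀ j, ∫ ω, X j ω ∂P = 0) (ℓ : ℕ) (i j : J) :
    ∫ ω, hermiteVar ℓ (X i ω) (∫ ω', X i ω' ^ 2 ∂P)
        * hermiteVar ℓ (X j ω) (∫ ω', X j ω' ^ 2 ∂P) ∂P
      = ℓ.factorial * (∫ ω, X i ω * X j ω ∂P) ^ ℓ := by
  obtain ⟨a, hcov, key⟩ := exists_gaussE_representation hX h0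
  have hv : ∀ i, ∫ ω, X i ω ^ 2 ∂P = ∑ k, a i k ^ 2 := fun i => by simp_rw [sq, hcov]
  simp_rw [hv]
  have h := (key (fun x => hermiteVar ℓ (x i) (∑ k, a i k ^ 2) * hermiteVar ℓ (x j) (∑ k, a j k ^ 2))
    (hermiteForm ℓ (a i) * hermiteForm ℓ (a j))
    (((continuous_hermiteVar _ _).comp (continuous_apply i)).mul
      ((continuous_hermiteVar _ _).comp (continuous_apply j)))
    (fun x => by simp [eval_hermiteForm])).1
  rw [h, gaussE_hermiteForm_mul_hermiteForm, hcov]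

lemma integral_hermite_sum_pow_le (hX : HasGaussianLaw (fun ω j => X j ω) P)
    (h0 : ∀ j, ∫ ω, X j ω ∂P = 0) (ℓ k : ℕ) (w : J → ℝ) :
    ∫ ω, (∑ j, w j * hermiteVar ℓ (X j ω) (∫ ω', X j ω' ^ 2 ∂P)) ^ (2 * (k + 1)) ∂P
      ≤ ((2 * k + 1 : ℝ) ^ ℓ
        * ∫ ω, (∑ j, w j * hermiteVar ℓ (X j ω) (∫ ω', X j ω' ^ 2 ∂P)) ^ 2 ∂P) ^ (k + 1) := by
  obtain ⟨a, hcov, key⟩ := exists_gaussE_representation hX h0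
  have hv : ∀ i, ∫ ω, X i ω ^ 2 ∂P = ∑ k, a i k ^ 2 := fun i => by simp_rw [sq, hcov]
  simp_rw [hv]
  have hc : Continuous fun x : J → ℝ => ∑ j, w j * hermiteVar ℓ (x j) (∑ k, a j k ^ 2) :=
    continuous_finsetSum _ fun j _ => continuous_const.mul
      ((continuous_hermiteVar _ _).comp (continuous_apply j))
  have h : ∀ m, ∫ ω, (∑ j, w j * hermiteVar ℓ (X j ω) (∑ k, a j k ^ 2)) ^ m ∂P
      = gaussE (hermiteComb ℓ a w ^ m) := fun m =>
    (key (fun x => (∑ j, w j * hermiteVar ℓ (x j) (∑ k, a j k ^ 2)) ^ m)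
      (hermiteComb ℓ a w ^ m) (hc.pow m)
      (fun x => by simp [hermiteComb, eval_hermiteForm])).1
  rw [h, h]
  exact gaussE_hermiteComb_pow_le ℓ k a w

lemma memLp_hermiteVar (hX : HasGaussianLaw (fun ω j => X j ω) P)
    (h0 : ∀ j, ∫ ω, X j ω ∂P = 0) (ℓ : ℕ) (j : J) {q : ℝ≥0∞} (hq : q ≠ ∞) :
    MemLp (fun ω => hermiteVar ℓ (X j ω) (∫ ω', X j ω' ^ 2 ∂P)) q P := by
  obtain ⟨a, hcov, key⟩ := exists_gaussE_representation hX h0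
  have hv : ∀ i, ∫ ω, X i ω ^ 2 ∂P = ∑ k, a i k ^ 2 := fun i => by simp_rw [sq, hcov]
  simp_rw [hv]
  exact (key (fun x => hermiteVar ℓ (x j) (∑ k, a j k ^ 2)) (hermiteForm ℓ (a j))
    ((continuous_hermiteVar _ _).comp (continuous_apply j))
    (fun x => by simp [eval_hermiteForm])).2 q hq

end Transfer

/-! ### The Fourier modes of a cylindrical Wiener process -/

section Wiener

open ProbabilityTheory

variable {Ω : Type*} [MeasurableSpace Ω] {P : Measure Ω}
  {B : Freq → ℝ≥0 → Ω → ℂ}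

lemma neg_mem_halfLattice {n : Freq} (hn : n ∉ halfLattice) : -n ∈ halfLattice := by
  simp only [halfLattice, Set.mem_ofPred_eq, Pi.neg_apply] at hn ⊢
  omega

namespace IsCylindricalWiener

lemma ae_im_zero (hB : IsCylindricalWiener B P) : ∀ᵐ ω ∂P, ∀ t, (B 0 t ω).im = 0 := by
  filter_upwards [hB.conj_symm 0] with ω h t
  have := congrArg Complex.im (h t)
  rw [neg_zero, Complex.conj_im] at this
  linarith

lemma ae_continuous (hB : IsCylindricalWiener B P) :
    ∀ᵐ ω ∂P, ∀ n, Continuous fun t => B n t ω := by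
  rw [ae_all_iff]
  intro n
  by_cases hn : n = 0
  · subst hn
    filter_upwards [hB.ae_im_zero, hB.zero.cont] with ω h1 h2
    have : (fun t => B 0 t ω) = fun t => (((B 0 t ω).re : ℝ) : ℂ) := by
      funext t
      exact Complex.ext (by simp) (by simp [h1 t])
    rw [this]
    exact Complex.continuous_ofReal.comp h2
  · filter_upwards [(hB.re n hn).cont, (hB.im n hn).cont] with ω h1 h2
    have h0 : Real.sqrt 2 ≠ 0 := by positivity
    have : (fun t => B n t ω) = fun t => (((Real.sqrt 2)⁻¹ * (Real.sqrt 2 * (B n t ω).re) : ℝ) : ℂ)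
        + ((Real.sqrt 2)⁻¹ * (Real.sqrt 2 * (B n t ω).im) : ℝ) * Complex.I := by
      funext t
      rw [inv_mul_cancel_left₀ h0, inv_mul_cancel_left₀ h0, Complex.re_add_im]
    rw [this]
    fun_prop


/-- For n ≠ 0 the real and imaginary parts are Gaussian processes, and their independence makes the
pair jointly Gaussian. The zero mode is real almost surely. -/
lemma isGaussianProcess_mode (hB : IsCylindricalWiener B P) (n : Freq) :
    IsGaussianProcess (B n) P := by
  by_cases hn : n = 0
  · subst hn
    refine (hB.zero.toIsPreBrownianReal.isGaussianProcess.comp_left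
      fun _ => Complex.ofRealCLM).congr fun t => ?_
    filter_upwards [hB.ae_im_zero] with ω h
    exact Complex.ext (by simp) (by simp [h t])
  · have h0 : Real.sqrt 2 ≠ 0 := by positivity
    have hre : IsGaussianProcess (fun t ω => (B n t ω).re) P := by
      have hpre := (hB.re n hn).toIsPreBrownianReal
      have := hpre.isGaussianProcess.smul fun _ => (Real.sqrt 2)⁻¹
      simpa only [smul_eq_mul, inv_mul_cancel_left₀ h0] using this
    have him : IsGaussianProcess (fun t ω => (B n t ω).im) P := by
      have hpre := (hB.im n hn).toIsPreBrownianReal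
      have := hpre.isGaussianProcess.smul fun _ => (Real.sqrt 2)⁻¹
      simpa only [smul_eq_mul, inv_mul_cancel_left₀ h0] using this
    refine ⟨fun I => ?_⟩
    have hind := (hB.re_im n hn).comp (φ := I.restrict) (ψ := I.restrict)
      (Finset.measurable_restrict (X := fun _ => ℝ) I)
      (Finset.measurable_restrict (X := fun _ => ℝ) I)
    have hg := (hind.hasGaussianLaw (hre.hasGaussianLaw I) (him.hasGaussianLaw I)).map_fun
      (ContinuousLinearMap.pi fun i : I =>
        Complex.ofRealCLM.comp ((ContinuousLinearMap.proj i).comp (ContinuousLinearMap.fst ℝ _ _))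
        + Complex.I • Complex.ofRealCLM.comp
          ((ContinuousLinearMap.proj i).comp (ContinuousLinearMap.snd ℝ (I → ℝ) (I → ℝ))))
    have e : (fun ω => I.restrict fun t => B n t ω) = fun ω => (ContinuousLinearMap.pi fun i : I =>
        Complex.ofRealCLM.comp ((ContinuousLinearMap.proj i).comp (ContinuousLinearMap.fst ℝ _ _))
        + Complex.I • Complex.ofRealCLM.comp
          ((ContinuousLinearMap.proj i).comp (ContinuousLinearMap.snd ℝ (I → ℝ) (I → ℝ))))
        (I.restrict fun t => (B n t ω).re, I.restrict fun t => (B n t ω).im) := by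
      funext ω i
      simp [mul_comm Complex.I]
    rw [e]
    exact hg

lemma isGaussianProcess_halfLattice [IsProbabilityMeasure P] (hB : IsCylindricalWiener B P) :
    IsGaussianProcess (fun (i : halfLattice × ℝ≥0) ω => B i.1 i.2 ω) P := by
  classical
  refine ⟨fun I => ?_⟩
  set A := I.image Prod.fst
  set S := I.image Prod.snd
  have hind : iIndepFun (fun (n : A) ω => S.restrict fun t => B n.1 t ω) P :=
    (hB.indep.precomp (g := fun n : A => n.1) Subtype.val_injective).comp
      (fun _ => S.restrict) (fun _ => Finset.measurable_restrict S)
  have hg := (hind.hasGaussianLaw fun n => (hB.isGaussianProcess_mode n.1).hasGaussianLaw S).map_fun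
    (ContinuousLinearMap.pi fun i : I =>
      (ContinuousLinearMap.proj (φ := fun _ : S => ℂ) (R := ℝ)
          ⟨i.1.2, Finset.mem_image_of_mem _ i.2⟩).comp
        (ContinuousLinearMap.proj (φ := fun _ : A => (S → ℂ)) ⟨i.1.1, Finset.mem_image_of_mem _ i.2⟩))
  exact hg

/-- The modes of a cylindrical Wiener process are jointly Gaussian. -/
lemma isGaussianProcess [IsProbabilityMeasure P] (hB : IsCylindricalWiener B P) :
    IsGaussianProcess (fun (i : Freq × ℝ≥0) ω => B i.1 i.2 ω) P := by
  classical
  have h : IsGaussianProcess (fun (i : Freq × ℝ≥0) ω =>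
      if h : i.1 ∈ halfLattice then B i.1 i.2 ω else conj (B (-i.1) i.2 ω)) P := by
    refine hB.isGaussianProcess_halfLattice.of_isGaussianProcess fun i => ?_
    by_cases h : i.1 ∈ halfLattice
    · exact ⟨{(⟨i.1, h⟩, i.2)}, ContinuousLinearMap.proj ⟨(⟨i.1, h⟩, i.2), by simp⟩,
        fun ω => by simp [h]⟩
    · exact ⟨{(⟨-i.1, neg_mem_halfLattice h⟩, i.2)},
        (Complex.conjCLE : ℂ →L[ℝ] ℂ).comp
          (ContinuousLinearMap.proj ⟨(⟨-i.1, neg_mem_halfLattice h⟩, i.2), by simp⟩),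
        fun ω => by simp [h]⟩
  refine h.congr fun i => ?_
  filter_upwards [hB.conj_symm i.1] with ω hω
  split_ifs with hi
  · rfl
  · rw [hω, Complex.conj_conj]

lemma integral_re_im (hB : IsCylindricalWiener B P) (n : Freq) (t : ℝ≥0) :
    ∫ ω, (B n t ω).re ∂P = 0 ∧ ∫ ω, (B n t ω).im ∂P = 0 := by
  by_cases hn : n = 0
  · subst hn
    refine ⟨hB.zero.toIsPreBrownianReal.integral_eval t, ?_⟩
    refine integral_eq_zero_of_ae ?_
    filter_upwards [hB.ae_im_zero] with ω h using h t
  · have h0 : Real.sqrt 2 ≠ 0 := by positivity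
    have h1 := (hB.re n hn).toIsPreBrownianReal.integral_eval t
    have h2 := (hB.im n hn).toIsPreBrownianReal.integral_eval t
    rw [integral_const_mul] at h1 h2
    exact ⟨(mul_eq_zero.1 h1).resolve_left h0, (mul_eq_zero.1 h2).resolve_left h0⟩

lemma memLp_two (hB : IsCylindricalWiener B P) (n : Freq) (t : ℝ≥0) : MemLp (B n t) 2 P :=
  ((hB.isGaussianProcess_mode n).hasGaussianLaw_eval t).memLp_two

variable [IsProbabilityMeasure P]

lemma integral_eval (hB : IsCylindricalWiener B P) (n : Freq) (t : ℝ≥0) :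
    ∫ ω, B n t ω ∂P = 0 := by
  have hi : Integrable (B n t) P := (hB.memLp_two n t).integrable (by norm_num)
  have h1 : (∫ ω, B n t ω ∂P).re = ∫ ω, (B n t ω).re ∂P := (integral_re hi).symm
  have h2 : (∫ ω, B n t ω ∂P).im = ∫ ω, (B n t ω).im ∂P := (integral_im hi).symm
  exact Complex.ext (by rw [h1, (hB.integral_re_im n t).1]; rfl)
    (by rw [h2, (hB.integral_re_im n t).2]; rfl)

lemma integral_mul_of_isBrownianReal {β : ℝ≥0 → Ω → ℝ} (h : IsBrownianReal β P) (s t : ℝ≥0) :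
    ∫ ω, β s ω * β t ω ∂P = min s t := by
  have hpre := h.toIsPreBrownianReal
  have h1 := hpre.covariance_eval s t
  have hm : ∀ r, MemLp (β r) 2 P := fun r =>
    (hpre.isGaussianProcess.hasGaussianLaw_eval r).memLp_two
  rw [covariance_eq_sub (hm s) (hm t), hpre.integral_eval, hpre.integral_eval] at h1
  simpa using h1

/-- The second moments of a single mode. -/
lemma integral_mode (hB : IsCylindricalWiener B P) {n : Freq} (hn : n ≠ 0) (s t : ℝ≥0) :
    ∫ ω, B n s ω * conj (B n t ω) ∂P = ((min s t : ℝ≥0) : ℝ) ∧ ∫ ω, B n s ω * B n t ω ∂P = 0 := by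
  have h2 : (Real.sqrt 2) * (Real.sqrt 2) = 2 := Real.mul_self_sqrt (by norm_num)
  have mre : ∀ r, MemLp (fun ω => (B n r ω).re) 2 P := fun r => (hB.memLp_two n r).re
  have mim : ∀ r, MemLp (fun ω => (B n r ω).im) 2 P := fun r => (hB.memLp_two n r).im
  have e1 : ∫ ω, (B n s ω).re * (B n t ω).re ∂P = ((min s t : ℝ≥0) : ℝ) / 2 := by
    have := integral_mul_of_isBrownianReal (hB.re n hn) s t
    have e : ∀ ω, Real.sqrt 2 * (B n s ω).re * (Real.sqrt 2 * (B n t ω).re)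
        = 2 * ((B n s ω).re * (B n t ω).re) := fun ω => by
      linear_combination ((B n s ω).re * (B n t ω).re) * h2
    simp_rw [e] at this
    rw [integral_const_mul] at this
    linarith
  have e2 : ∫ ω, (B n s ω).im * (B n t ω).im ∂P = ((min s t : ℝ≥0) : ℝ) / 2 := by
    have := integral_mul_of_isBrownianReal (hB.im n hn) s t
    have e : ∀ ω, Real.sqrt 2 * (B n s ω).im * (Real.sqrt 2 * (B n t ω).im)
        = 2 * ((B n s ω).im * (B n t ω).im) := fun ω => by
      linear_combination ((B n s ω).im * (B n t ω).im) * h2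
    simp_rw [e] at this
    rw [integral_const_mul] at this
    linarith
  have e3 : ∀ r r', ∫ ω, (B n r ω).re * (B n r' ω).im ∂P = 0 := fun r r' => by
    have hi : IndepFun (fun ω => (B n r ω).re) (fun ω => (B n r' ω).im) P :=
      (hB.re_im n hn).comp (measurable_pi_apply r) (measurable_pi_apply r')
    rw [hi.integral_fun_mul_eq_mul_integral (mre r).aestronglyMeasurable
      (mim r').aestronglyMeasurable, (hB.integral_re_im n r).1, zero_mul]
  have i1 : Integrable (fun ω => (B n s ω).re * (B n t ω).re) P := (mre s).integrable_mul (mre t)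
  have i2 : Integrable (fun ω => (B n s ω).im * (B n t ω).im) P := (mim s).integrable_mul (mim t)
  have i3 : Integrable (fun ω => (B n s ω).re * (B n t ω).im) P := (mre s).integrable_mul (mim t)
  have i4 : Integrable (fun ω => (B n t ω).re * (B n s ω).im) P := (mre t).integrable_mul (mim s)
  have hc : MemLp (fun ω => conj (B n t ω)) 2 P := (hB.memLp_two n t).star
  have j1 : Integrable (fun ω => B n s ω * conj (B n t ω)) P := (hB.memLp_two n s).integrable_mul hc
  have j2 : Integrable (fun ω => B n s ω * B n t ω) P :=
    (hB.memLp_two n s).integrable_mul (hB.memLp_two n t)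
  have k1 : (∫ ω, B n s ω * conj (B n t ω) ∂P).re = ∫ ω, (B n s ω * conj (B n t ω)).re ∂P :=
    (integral_re j1).symm
  have k2 : (∫ ω, B n s ω * conj (B n t ω) ∂P).im = ∫ ω, (B n s ω * conj (B n t ω)).im ∂P :=
    (integral_im j1).symm
  have k3 : (∫ ω, B n s ω * B n t ω ∂P).re = ∫ ω, (B n s ω * B n t ω).re ∂P :=
    (integral_re j2).symm
  have k4 : (∫ ω, B n s ω * B n t ω ∂P).im = ∫ ω, (B n s ω * B n t ω).im ∂P :=
    (integral_im j2).symm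
  constructor
  · refine Complex.ext ?_ ?_
    · rw [k1, Complex.ofReal_re]
      have e : ∀ ω, (B n s ω * conj (B n t ω)).re
          = (B n s ω).re * (B n t ω).re + (B n s ω).im * (B n t ω).im := fun ω => by simp
      simp_rw [e]
      rw [integral_add i1 i2, e1, e2]
      ring
    · rw [k2, Complex.ofReal_im]
      have e : ∀ ω, (B n s ω * conj (B n t ω)).im
          = (B n t ω).re * (B n s ω).im - (B n s ω).re * (B n t ω).im := fun ω => by simp; ring
      simp_rw [e]
      rw [integral_sub i4 i3, e3, e3, sub_zero]
  · refine Complex.ext ?_ ?_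
    · rw [k3, Complex.zero_re]
      have e : ∀ ω, (B n s ω * B n t ω).re
          = (B n s ω).re * (B n t ω).re - (B n s ω).im * (B n t ω).im := fun ω => by simp
      simp_rw [e]
      rw [integral_sub i1 i2, e1, e2, sub_self]
    · rw [k4, Complex.zero_im]
      have e : ∀ ω, (B n s ω * B n t ω).im
          = (B n s ω).re * (B n t ω).im + (B n t ω).re * (B n s ω).im := fun ω => by simp; ring
      simp_rw [e]
      rw [integral_add i3 i4, e3, e3, add_zero]

/-- The second moments of two modes from different pairs `{n, -n}`. -/
lemma integral_mode_of_ne (hB : IsCylindricalWiener B P) {n m : Freq} (hn : n ∈ halfLattice)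
    (hm : m ∈ halfLattice) (hnm : n ≠ m) (s t : ℝ≥0) :
    ∫ ω, B n s ω * conj (B m t ω) ∂P = 0 ∧ ∫ ω, B n s ω * B m t ω ∂P = 0 := by
  have hi := hB.indep.indepFun (i := ⟨n, hn⟩) (j := ⟨m, hm⟩) (by simpa using hnm)
  have h1 : IndepFun (fun ω => B n s ω) (fun ω => B m t ω) P :=
    hi.comp (measurable_pi_apply s) (measurable_pi_apply t)
  have h2 : IndepFun (fun ω => B n s ω) (fun ω => conj (B m t ω)) P :=
    h1.comp measurable_id Complex.continuous_conj.measurable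
  refine ⟨?_, ?_⟩
  · rw [h2.integral_fun_mul_eq_mul_integral (hB.memLp_two n s).aestronglyMeasurable
      (hB.memLp_two m t).star.aestronglyMeasurable, hB.integral_eval, zero_mul]
  · rw [h1.integral_fun_mul_eq_mul_integral (hB.memLp_two n s).aestronglyMeasurable
      (hB.memLp_two m t).aestronglyMeasurable, hB.integral_eval, zero_mul]

/-- `E[Bₙ(s) conj(Bₘ(t))] = δₙₘ min(s, t)`. -/
lemma integral_mul_conj (hB : IsCylindricalWiener B P) (n m : Freq) (s t : ℝ≥0) :
    ∫ ω, B n s ω * conj (B m t ω) ∂P = if n = m then (((min s t : ℝ≥0) : ℝ) : ℂ) else 0 := by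
  have hconj : ∀ f : Ω → ℂ, ∫ ω, conj (f ω) ∂P = conj (∫ ω, f ω ∂P) := fun f => integral_conj
  have hneg : ∀ n m, ∫ ω, B (-n) s ω * conj (B m t ω) ∂P = conj (∫ ω, B n s ω * B m t ω ∂P) := by
    intro n m
    rw [← hconj]
    refine integral_congr_ae ?_
    filter_upwards [hB.conj_symm n] with ω h
    simp [h]
  have hneg' : ∀ n m, ∫ ω, B n s ω * conj (B (-m) t ω) ∂P = ∫ ω, B n s ω * B m t ω ∂P := by
    intro n m
    refine integral_congr_ae ?_
    filter_upwards [hB.conj_symm m] with ω h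
    simp [h]
  have hneg2 : ∀ n m, ∫ ω, B (-n) s ω * conj (B (-m) t ω) ∂P
      = conj (∫ ω, B n s ω * conj (B m t ω) ∂P) := by
    intro n m
    rw [← hconj]
    refine integral_congr_ae ?_
    filter_upwards [hB.conj_symm n, hB.conj_symm m] with ω h h'
    simp [h, h']
  -- On the half lattice everything follows from independence and from the law of one mode; the
  -- other sign patterns reduce to it by conjugation. The pair (0,0) is excluded from the vanishing
  -- of E[BₙBₘ], because the zero mode is real.
  have key : ∀ n m, n ∈ halfLattice → m ∈ halfLattice →
      ∫ ω, B n s ω * conj (B m t ω) ∂P = (if n = m then (((min s t : ℝ≥0) : ℝ) : ℂ) else 0) ∧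
      (¬ (n = 0 ∧ m = 0) → ∫ ω, B n s ω * B m t ω ∂P = 0) := by
    intro n m hn hm
    by_cases hnm : n = m
    · subst hnm
      by_cases h0 : n = 0
      · subst h0
        refine ⟨?_, fun h => absurd ⟨rfl, rfl⟩ h⟩
        rw [if_pos rfl, ← integral_mul_of_isBrownianReal hB.zero s t, ← integral_complex_ofReal]
        refine integral_congr_ae ?_
        filter_upwards [hB.ae_im_zero] with ω h
        refine Complex.ext ?_ ?_ <;> simp [h]
      · rw [if_pos rfl]
        exact ⟨(hB.integral_mode h0 s t).1, fun _ => (hB.integral_mode h0 s t).2⟩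
    · rw [if_neg hnm]
      exact ⟨(hB.integral_mode_of_ne hn hm hnm s t).1,
        fun _ => (hB.integral_mode_of_ne hn hm hnm s t).2⟩
  have hz : ∀ n, n ∉ halfLattice → n ≠ 0 := by
    rintro n hn rfl
    exact hn (by simp [halfLattice])
  by_cases hn : n ∈ halfLattice <;> by_cases hm : m ∈ halfLattice
  · exact (key n m hn hm).1
  · have hm' := neg_mem_halfLattice hm
    rw [if_neg (fun h : n = m => hm (h ▸ hn)), ← neg_neg m, hneg']
    exact (key n (-m) hn hm').2 fun h => hz m hm (neg_eq_zero.1 h.2)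
  · have hn' := neg_mem_halfLattice hn
    rw [if_neg (fun h : n = m => hn (h ▸ hm)), ← neg_neg n, hneg, (key (-n) m hn' hm).2
      fun h => hz n hn (neg_eq_zero.1 h.1), map_zero]
  · rw [← neg_neg n, ← neg_neg m, hneg2,
      (key _ _ (neg_mem_halfLattice hn) (neg_mem_halfLattice hm)).1]
    simp only [neg_inj, neg_neg]
    split_ifs <;> simp

end IsCylindricalWiener

end Wiener

/-! ### The Itô isometry -/

section Ito

open ProbabilityTheory

/-- The step function whose Wiener integral is `wienerSum f b t k`. -/
noncomputable def stepFun (f : ℝ → ℝ) (t : ℝ) (k : ℕ) (s : ℝ) : ℝ :=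
  ∑ j ∈ Finset.range k, f (t * j / k) * (Set.Ico (t * j / k) (t * (j + 1) / k)).indicator 1 s

lemma stepFun_eq (f : ℝ → ℝ) {t : ℝ} (ht : 0 < t) {k : ℕ} (hk : 0 < k) (s : ℝ) :
    stepFun f t k s = (Set.Ico 0 t).indicator (fun s => f (t * ⌊s * k / t⌋₊ / k)) s := by
  have hk' : (0 : ℝ) < k := by exact_mod_cast hk
  have hmem : ∀ j : ℕ, s ∈ Set.Ico (t * j / k) (t * (j + 1) / k) ↔
      (j : ℝ) ≤ s * k / t ∧ s * k / t < j + 1 := by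
    intro j
    rw [Set.mem_Ico, div_le_iff₀ hk', lt_div_iff₀ hk', le_div_iff₀ ht, div_lt_iff₀ ht,
      mul_comm t, mul_comm t]
  by_cases hs : s ∈ Set.Ico 0 t
  · have h0 : 0 ≤ s * k / t := div_nonneg (mul_nonneg hs.1 hk'.le) ht.le
    rw [Set.indicator_of_mem hs, stepFun, Finset.sum_eq_single ⌊s * k / t⌋₊]
    · rw [Set.indicator_of_mem ((hmem _).2 ⟨Nat.floor_le h0, Nat.lt_floor_add_one _⟩)]
      simp
    · intro j _ hj
      rw [Set.indicator_of_notMem, mul_zero]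
      intro h
      exact hj ((Nat.floor_eq_iff h0).2 ((hmem j).1 h)).symm
    · intro h
      exfalso
      refine h (Finset.mem_range.2 ((Nat.floor_lt h0).2 ?_))
      rw [div_lt_iff₀ ht, mul_comm]
      exact mul_lt_mul_of_pos_left hs.2 hk'
  · rw [Set.indicator_of_notMem hs, stepFun]
    refine Finset.sum_eq_zero fun j hj => ?_
    rw [Set.indicator_of_notMem, mul_zero]
    intro h
    refine hs ⟨le_trans (by positivity) h.1, h.2.trans_le ?_⟩
    have : ((j : ℝ) + 1) ≤ k := by exact_mod_cast Finset.mem_range.1 hj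
    rw [div_le_iff₀ hk']
    exact mul_le_mul_of_nonneg_left this ht.le

lemma stepFun_zero (f : ℝ → ℝ) (k : ℕ) (s : ℝ) : stepFun f 0 k s = 0 := by
  simp [stepFun]

lemma measurable_stepFun (f : ℝ → ℝ) (t : ℝ) (k : ℕ) : Measurable (stepFun f t k) := by
  unfold stepFun
  exact Finset.measurable_fun_sum _ fun j _ =>
    measurable_const.mul (measurable_one.indicator measurableSet_Ico)

lemma abs_stepFun_kernel_le {z : ℝ × ℝ} (hε : 0 ≤ z.1) (ht : 0 ≤ z.2) (n : Freq) {k : ℕ}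
    (hk : 0 < k) (s : ℝ) :
    |stepFun (fun s => kernel z.1 n (z.2 - s)) z.2 k s| ≤ (Set.Ico 0 z.2).indicator 1 s := by
  rcases ht.eq_or_lt with h | h
  · rw [← h, stepFun_zero]; simp
  · rw [stepFun_eq _ h hk]
    have hk' : (0 : ℝ) < k := by exact_mod_cast hk
    by_cases hs : s ∈ Set.Ico 0 z.2
    · rw [Set.indicator_of_mem hs, Set.indicator_of_mem hs, Pi.one_apply]
      refine (isDampedKernel_kernel hε n).abs_le_one ?_
      have h1 := Nat.floor_le (div_nonneg (mul_nonneg hs.1 hk'.le) h.le : 0 ≤ s * k / z.2)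
      rw [sub_nonneg, div_le_iff₀ hk']
      rw [le_div_iff₀ h] at h1
      nlinarith [hs.2]
    · rw [Set.indicator_of_notMem hs, Set.indicator_of_notMem hs, abs_zero]

lemma tendsto_stepFun_kernel {z : ℝ × ℝ} (hε : 0 ≤ z.1) (ht : 0 ≤ z.2) (n : Freq) (s : ℝ) :
    Tendsto (fun k : ℕ => stepFun (fun s => kernel z.1 n (z.2 - s)) z.2 k s) atTop
      (𝓝 (duhamel z n s)) := by
  rcases ht.eq_or_lt with h | h
  · simp [← h, stepFun_zero, duhamel]
  · have hev : (fun k : ℕ => stepFun (fun s => kernel z.1 n (z.2 - s)) z.2 k s) =ᶠ[atTop]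
        fun k => (Set.Ico 0 z.2).indicator
          (fun s => kernel z.1 n (z.2 - z.2 * ⌊s * k / z.2⌋₊ / k)) s := by
      filter_upwards [eventually_gt_atTop 0] with k hk
      exact stepFun_eq _ h hk s
    refine Tendsto.congr' hev.symm ?_
    by_cases hs : s ∈ Set.Ico 0 z.2
    · simp only [Set.indicator_of_mem hs, duhamel]
      have hc := (isDampedKernel_kernel hε n).continuous
      refine (hc.tendsto _).comp (tendsto_const_nhds.sub ?_)
      have h1 := (tendsto_nat_floor_mul_div_atTop (R := ℝ) (div_nonneg hs.1 h.le)).comp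
        tendsto_natCast_atTop_atTop
      have h2 := h1.const_mul z.2
      rw [mul_div_cancel₀ _ h.ne'] at h2
      refine h2.congr fun k => ?_
      simp only [Function.comp]
      rw [mul_div_assoc, div_mul_eq_mul_div]
    · simp only [Set.indicator_of_notMem hs, duhamel]
      exact tendsto_const_nhds

/-- Dominated convergence: since |K| ≤ 1, each step function is dominated by the indicator of its
time interval. -/
lemma tendsto_integral_stepFun_mul {z z' : ℝ × ℝ} (hε : 0 ≤ z.1) (ht : 0 ≤ z.2)
    (hε' : 0 ≤ z'.1) (ht' : 0 ≤ z'.2) (n : Freq) :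
    Tendsto (fun k : ℕ => ∫ s, stepFun (fun s => kernel z.1 n (z.2 - s)) z.2 k s
        * stepFun (fun s => kernel z'.1 n (z'.2 - s)) z'.2 k s) atTop (𝓝 (modeCov n z z')) := by
  refine tendsto_integral_filter_of_dominated_convergence ((Set.Ico 0 z.2).indicator 1) ?_ ?_ ?_ ?_
  · exact Eventually.of_forall fun k =>
      ((measurable_stepFun _ _ _).mul (measurable_stepFun _ _ _)).aestronglyMeasurable
  · filter_upwards [eventually_gt_atTop 0] with k hk
    refine Eventually.of_forall fun s => ?_
    rw [norm_mul, Real.norm_eq_abs, Real.norm_eq_abs]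
    have h1 := abs_stepFun_kernel_le hε ht n hk s
    have h2 := abs_stepFun_kernel_le hε' ht' n hk s
    have h3 : (Set.Ico 0 z'.2).indicator (1 : ℝ → ℝ) s ≤ 1 :=
      Set.indicator_le_self' (fun _ _ => zero_le_one) s
    calc _ ≤ (Set.Ico 0 z.2).indicator 1 s * 1 :=
          mul_le_mul h1 (h2.trans h3) (abs_nonneg _) ((abs_nonneg _).trans h1)
      _ = _ := mul_one _
  · exact (integrable_indicator_iff measurableSet_Ico).2
      (integrableOn_const (C := (1 : ℝ)) (by simp))
  · exact Eventually.of_forall fun s =>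
      (tendsto_stepFun_kernel hε ht n s).mul (tendsto_stepFun_kernel hε' ht' n s)

/-- The right-hand side is the covariance of two Brownian increments, and the left-hand side is the
length of the overlap of their intervals. This is the Itô isometry for indicators. -/
lemma integral_indicator_Ico_mul_indicator_Ico {a b a' b' : ℝ} (hab : a ≤ b) (hab' : a' ≤ b') :
    ∫ s, (Set.Ico a b).indicator (1 : ℝ → ℝ) s * (Set.Ico a' b').indicator (1 : ℝ → ℝ) s
      = min b b' - min b a' - min a b' + min a a' := by
  have h : ∀ s, (Set.Ico a b).indicator (1 : ℝ → ℝ) s * (Set.Ico a' b').indicator (1 : ℝ → ℝ) s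
      = (Set.Ico (max a a') (min b b')).indicator 1 s := by
    intro s
    rw [← Set.Ico_inter_Ico, ← Set.inter_indicator_mul]
    simp [Set.indicator]
  simp_rw [h]
  rw [integral_indicator_one measurableSet_Ico, Measure.real, Real.volume_Ico,
    ENNReal.toReal_ofReal']
  simp only [min_def, max_def]
  split_ifs <;> linarith

variable {Ω : Type*} [MeasurableSpace Ω] {P : Measure Ω}
  {B : Freq → ℝ≥0 → Ω → ℂ}

namespace IsCylindricalWiener

lemma memLp_wienerSum (hB : IsCylindricalWiener B P) (n : Freq) (f : ℝ → ℝ) (t : ℝ) (k : ℕ) :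
    MemLp (fun ω => wienerSum f (fun s => B n s ω) t k) 2 P :=
  memLp_finsetSum _ fun _ _ => ((hB.memLp_two n _).sub (hB.memLp_two n _)).const_mul _

variable [IsProbabilityMeasure P]

lemma integral_increment_mul_conj (hB : IsCylindricalWiener B P) (n m : Freq) {a b a' b' : ℝ}
    (ha : 0 ≤ a) (hab : a ≤ b) (ha' : 0 ≤ a') (hab' : a' ≤ b') :
    ∫ ω, (B n b.toNNReal ω - B n a.toNNReal ω)
        * conj (B m b'.toNNReal ω - B m a'.toNNReal ω) ∂P
      = if n = m then ((∫ s, (Set.Ico a b).indicator (1 : ℝ → ℝ) s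
          * (Set.Ico a' b').indicator (1 : ℝ → ℝ) s : ℝ) : ℂ) else 0 := by
  have hi : ∀ s t, Integrable (fun ω => B n s ω * conj (B m t ω)) P := fun s t =>
    (hB.memLp_two n s).integrable_mul (hB.memLp_two m t).star
  have e : ∀ ω, (B n b.toNNReal ω - B n a.toNNReal ω)
      * conj (B m b'.toNNReal ω - B m a'.toNNReal ω)
      = B n b.toNNReal ω * conj (B m b'.toNNReal ω) - B n b.toNNReal ω * conj (B m a'.toNNReal ω)
        - B n a.toNNReal ω * conj (B m b'.toNNReal ω)
        + B n a.toNNReal ω * conj (B m a'.toNNReal ω) := fun ω => by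
    rw [map_sub]; ring
  simp_rw [e]
  have hi2 : ∀ s t s' t', Integrable (fun ω => B n s ω * conj (B m t ω)
      - B n s' ω * conj (B m t' ω)) P := fun s t s' t' => (hi s t).sub (hi s' t')
  have hi3 : ∀ s t s' t' s'' t'', Integrable (fun ω => B n s ω * conj (B m t ω)
      - B n s' ω * conj (B m t' ω) - B n s'' ω * conj (B m t'' ω)) P := fun s t s' t' s'' t'' =>
    (hi2 s t s' t').sub (hi s'' t'')
  rw [integral_add (hi3 _ _ _ _ _ _) (hi _ _), integral_sub (hi2 _ _ _ _) (hi _ _),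
    integral_sub (hi _ _) (hi _ _)]
  simp only [hB.integral_mul_conj]
  split_ifs
  · rw [integral_indicator_Ico_mul_indicator_Ico hab hab']
    push_cast [NNReal.coe_min, Real.coe_toNNReal _ ha, Real.coe_toNNReal _ (ha.trans hab),
      Real.coe_toNNReal _ ha', Real.coe_toNNReal _ (ha'.trans hab')]
    ring
  · ring

lemma integral_wienerSum (hB : IsCylindricalWiener B P) (n : Freq) (f : ℝ → ℝ) (t : ℝ) (k : ℕ) :
    ∫ ω, wienerSum f (fun s => B n s ω) t k ∂P = 0 := by
  have hi : ∀ s, Integrable (fun ω => B n s ω) P := fun s =>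
    (hB.memLp_two n s).integrable (by norm_num)
  have hD : ∀ s t, Integrable (fun ω => B n s ω - B n t ω) P := fun s t => (hi s).sub (hi t)
  simp only [wienerSum]
  rw [integral_finsetSum _ fun j _ => (hD _ _).const_mul _]
  refine Finset.sum_eq_zero fun j _ => ?_
  rw [integral_const_mul, integral_sub (hi _) (hi _), hB.integral_eval, hB.integral_eval]
  simp

/-- The Itô isometry for step functions, by bilinearity from the case of two increments. The final
times, and hence the partitions, may differ: covariances between different times are needed. -/
lemma integral_wienerSum_mul_conj (hB : IsCylindricalWiener B P) (n m : Freq) (f g : ℝ → ℝ)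
    {t t' : ℝ} (ht : 0 ≤ t) (ht' : 0 ≤ t') (k : ℕ) :
    ∫ ω, wienerSum f (fun s => B n s ω) t k * conj (wienerSum g (fun s => B m s ω) t' k) ∂P
      = if n = m then ((∫ s, stepFun f t k s * stepFun g t' k s : ℝ) : ℂ) else 0 := by
  have hmono : ∀ {t : ℝ}, 0 ≤ t → ∀ j : ℕ, 0 ≤ t * j / k ∧ t * j / k ≤ t * (j + 1) / k :=
    fun {t} ht j => ⟨by positivity, by gcongr; linarith⟩
  have hD : ∀ n s t, MemLp (fun ω => B n s ω - B n t ω) 2 P := fun n s t =>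
    (hB.memLp_two n s).sub (hB.memLp_two n t)
  have hi : ∀ s t s' t', Integrable
      (fun ω => (B n s ω - B n t ω) * conj (B m s' ω - B m t' ω)) P := fun s t s' t' =>
    (hD n s t).integrable_mul (hD m s' t').star
  simp only [wienerSum, stepFun, map_sum, Finset.sum_mul_sum, map_mul, Complex.conj_ofReal]
  have e : ∀ (i j : ℕ) ω, (f (t * i / k) : ℂ) * (B n (t * (i + 1) / k).toNNReal ω
        - B n (t * i / k).toNNReal ω) * ((g (t' * j / k) : ℂ)
        * conj (B m (t' * (j + 1) / k).toNNReal ω - B m (t' * j / k).toNNReal ω))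
      = ((f (t * i / k) * g (t' * j / k) : ℝ) : ℂ) * ((B n (t * (i + 1) / k).toNNReal ω
        - B n (t * i / k).toNNReal ω)
        * conj (B m (t' * (j + 1) / k).toNNReal ω - B m (t' * j / k).toNNReal ω)) := by
    intro i j ω
    push_cast
    ring
  have e' : ∀ (i j : ℕ) s, f (t * i / k) * (Set.Ico (t * i / k) (t * (i + 1) / k)).indicator 1 s
        * (g (t' * j / k) * (Set.Ico (t' * j / k) (t' * (j + 1) / k)).indicator 1 s)
      = (f (t * i / k) * g (t' * j / k))
        * ((Set.Ico (t * i / k) (t * (i + 1) / k)).indicator (1 : ℝ → ℝ) s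
        * (Set.Ico (t' * j / k) (t' * (j + 1) / k)).indicator (1 : ℝ → ℝ) s) := by
    intro i j s
    ring
  have hind : ∀ a b a' b' : ℝ, Integrable fun s => (Set.Ico a b).indicator (1 : ℝ → ℝ) s
      * (Set.Ico a' b').indicator (1 : ℝ → ℝ) s := by
    intro a b a' b'
    have h : ∀ s, (Set.Ico a b).indicator (1 : ℝ → ℝ) s * (Set.Ico a' b').indicator (1 : ℝ → ℝ) s
        = (Set.Ico a b ∩ Set.Ico a' b').indicator 1 s := by
      intro s
      rw [← Set.inter_indicator_mul]
      simp [Set.indicator]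
    simp_rw [h]
    exact (integrable_indicator_iff (measurableSet_Ico.inter measurableSet_Ico)).2
      ((integrableOn_const (C := (1 : ℝ)) (by simp : volume (Set.Ico a b) ≠ ∞)).mono_set
        Set.inter_subset_left)
  simp_rw [e, e']
  rw [integral_finsetSum _ fun i _ => integrable_finsetSum _ fun j _ => (hi _ _ _ _).const_mul _,
    integral_finsetSum _ fun i _ => integrable_finsetSum _ fun j _ => (hind _ _ _ _).const_mul _]
  have hL : ∀ i ∈ Finset.range k, (∫ ω, ∑ j ∈ Finset.range k,
      ((f (t * i / k) * g (t' * j / k) : ℝ) : ℂ) * ((B n (t * (i + 1) / k).toNNReal ω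
        - B n (t * i / k).toNNReal ω)
        * conj (B m (t' * (j + 1) / k).toNNReal ω - B m (t' * j / k).toNNReal ω)) ∂P)
      = if n = m then ((∫ s, ∑ j ∈ Finset.range k, (f (t * i / k) * g (t' * j / k))
        * ((Set.Ico (t * i / k) (t * (i + 1) / k)).indicator (1 : ℝ → ℝ) s
        * (Set.Ico (t' * j / k) (t' * (j + 1) / k)).indicator (1 : ℝ → ℝ) s) : ℝ) : ℂ) else 0 := by
    intro i _
    rw [integral_finsetSum _ fun j _ => (hi _ _ _ _).const_mul _,
      integral_finsetSum _ fun j _ => (hind _ _ _ _).const_mul _]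
    simp_rw [integral_const_mul]
    have hj : ∀ j ∈ Finset.range k, _ := fun j _ => hB.integral_increment_mul_conj n m
      (hmono ht i).1 (hmono ht i).2 (hmono ht' j).1 (hmono ht' j).2
    split_ifs with hnm
    · push_cast
      refine Finset.sum_congr rfl fun j hj' => ?_
      have := hj j hj'
      rw [if_pos hnm] at this
      rw [this]
    · refine Finset.sum_eq_zero fun j hj' => ?_
      have := hj j hj'
      rw [if_neg hnm] at this
      rw [this, mul_zero]
  rw [Finset.sum_congr rfl hL]
  split_ifs
  · push_cast; rfl
  · simp

end IsCylindricalWiener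

end Ito

/-! ### Limits of Gaussian vectors -/

section GaussianLimit

open ProbabilityTheory

variable {Ω : Type*} [MeasurableSpace Ω] {P : Measure Ω}

/-- Almost sure limits of centred Gaussian variables are Gaussian. -/
lemma map_eq_gaussianReal_of_tendsto [IsProbabilityMeasure P] {Y : ℕ → Ω → ℝ} {Z : Ω → ℝ}
    {v : ℕ → ℝ≥0} {w : ℝ≥0} (hY : ∀ k, AEMeasurable (Y k) P)
    (hG : ∀ k, P.map (Y k) = gaussianReal 0 (v k))
    (hv : Tendsto v atTop (𝓝 w)) (hlim : ∀ᵐ ω ∂P, Tendsto (fun k => Y k ω) atTop (𝓝 (Z ω))) :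
    P.map Z = gaussianReal 0 w := by
  have hZ : AEMeasurable Z P := aemeasurable_of_tendsto_metrizable_ae atTop hY hlim
  have hZm : IsProbabilityMeasure (P.map Z) := Measure.isProbabilityMeasure_map hZ
  refine Measure.ext_of_charFun (funext fun t => ?_)
  have hint : ∀ {X : Ω → ℝ}, AEMeasurable X P →
      charFun (P.map X) t = ∫ ω, Complex.exp (t * X ω * Complex.I) ∂P := by
    intro X hX
    rw [charFun_apply_real, integral_map hX (by fun_prop)]
  have h1 : Tendsto (fun k => ∫ ω, Complex.exp (t * Y k ω * Complex.I) ∂P) atTop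
      (𝓝 (∫ ω, Complex.exp (t * Z ω * Complex.I) ∂P)) := by
    refine tendsto_integral_of_dominated_convergence (fun _ => 1) (fun k => ?_)
      (integrable_const _) (fun k => Eventually.of_forall fun ω => ?_) ?_
    · have := (hY k).aestronglyMeasurable
      exact (Complex.measurable_exp.comp_aemeasurable ((((hY k).complex_ofReal).const_mul
        (t : ℂ)).mul_const Complex.I)).aestronglyMeasurable
    · rw [← Complex.ofReal_mul, Complex.norm_exp_ofReal_mul_I]
    · filter_upwards [hlim] with ω hω
      have hc : Continuous fun x : ℝ => Complex.exp (t * x * Complex.I) := by fun_prop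
      exact (hc.tendsto _).comp hω
  have h2 : Tendsto (fun k => charFun (gaussianReal 0 (v k)) t) atTop
      (𝓝 (charFun (gaussianReal 0 w) t)) := by
    simp only [charFun_gaussianReal]
    have hc : Continuous fun x : ℝ≥0 => Complex.exp (t * (0 : ℝ) * Complex.I
        - ((x : ℝ) : ℂ) * t ^ 2 / 2) := by fun_prop
    exact (hc.tendsto _).comp hv
  have h3 : (fun k => charFun (gaussianReal 0 (v k)) t)
      = fun k => ∫ ω, Complex.exp (t * Y k ω * Complex.I) ∂P := by
    funext k
    rw [← hG k, hint (hY k)]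
  rw [h3] at h2
  rw [hint hZ]
  exact tendsto_nhds_unique h1 h2

/-- Almost sure limits of centred Gaussian vectors with convergent covariances. -/
lemma hasGaussianLaw_of_tendsto {J : Type*} [Fintype J] {Y : ℕ → J → Ω → ℝ} {Z : J → Ω → ℝ}
    {c : J → J → ℝ} (hG : ∀ k, HasGaussianLaw (fun ω j => Y k j ω) P)
    (h0 : ∀ k j, ∫ ω, Y k j ω ∂P = 0)
    (hc : ∀ i j, Tendsto (fun k => ∫ ω, Y k i ω * Y k j ω ∂P) atTop (𝓝 (c i j)))
    (hlim : ∀ᵐ ω ∂P, ∀ j, Tendsto (fun k => Y k j ω) atTop (𝓝 (Z j ω))) :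
    HasGaussianLaw (fun ω j => Z j ω) P ∧ (∀ j, ∫ ω, Z j ω ∂P = 0) ∧
      ∀ i j, ∫ ω, Z i ω * Z j ω ∂P = c i j := by
  classical
  have hP : IsProbabilityMeasure P := (hG 0).isProbabilityMeasure
  have hm : ∀ k j, MemLp (Y k j) 2 P := fun k j => ((hG k).eval j).memLp_two
  have hZm : AEMeasurable (fun ω j => Z j ω) P := by
    refine aemeasurable_pi_lambda _ fun j => ?_
    refine aemeasurable_of_tendsto_metrizable_ae atTop
      (fun k => ((hG k).eval j).aemeasurable) ?_
    filter_upwards [hlim] with ω h using h j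
  -- Cramér–Wold: every linear form has an identified one-dimensional Gaussian limit law, since its
  -- variance converges by hypothesis.
  have hsum : ∀ a : J → ℝ, P.map (fun ω => ∑ j, a j * Z j ω)
      = gaussianReal 0 (∑ i, ∑ j, a i * a j * c i j).toNNReal := by
    intro a
    have hL : ∀ k, HasGaussianLaw (fun ω => ∑ j, a j * Y k j ω) P := by
      intro k
      have := (hG k).map_fun (∑ j, a j • ContinuousLinearMap.proj (R := ℝ) (φ := fun _ : J => ℝ) j)
      simpa using! this
    have hmean : ∀ k, ∫ ω, ∑ j, a j * Y k j ω ∂P = 0 := by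
      intro k
      rw [integral_finsetSum _ fun j _ => ((hm k j).integrable (by norm_num)).const_mul _]
      simp [integral_const_mul, h0]
    have hvar : ∀ k, Var[fun ω => ∑ j, a j * Y k j ω; P]
        = ∑ i, ∑ j, a i * a j * ∫ ω, Y k i ω * Y k j ω ∂P := by
      intro k
      have hi : ∀ i j, Integrable (fun ω => Y k i ω * Y k j ω) P := fun i j =>
        (hm k i).integrable_mul (hm k j)
      rw [variance_of_integral_eq_zero (hL k).aemeasurable (hmean k)]
      have e : ∀ ω, (∑ j, a j * Y k j ω) ^ 2 = ∑ i, ∑ j, a i * a j * (Y k i ω * Y k j ω) := by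
        intro ω
        rw [sq, Finset.sum_mul_sum]
        exact Finset.sum_congr rfl fun i _ => Finset.sum_congr rfl fun j _ => by ring
      simp_rw [e]
      rw [integral_finsetSum _ fun i _ => integrable_finsetSum _ fun j _ => (hi i j).const_mul _]
      refine Finset.sum_congr rfl fun i _ => ?_
      rw [integral_finsetSum _ fun j _ => (hi i j).const_mul _]
      simp_rw [integral_const_mul]
    refine map_eq_gaussianReal_of_tendsto (Y := fun k ω => ∑ j, a j * Y k j ω)
      (v := fun k => (Var[fun ω => ∑ j, a j * Y k j ω; P]).toNNReal)
      (fun k => (hL k).aemeasurable) (fun k => ?_) ?_ ?_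
    · have := (hL k).map_eq_gaussianReal
      rwa [hmean k] at this
    · refine (continuous_real_toNNReal.tendsto _).comp ?_
      simp_rw [hvar]
      exact tendsto_finsetSum _ fun i _ => tendsto_finsetSum _ fun j _ => (hc i j).const_mul _
    · filter_upwards [hlim] with ω h
      exact tendsto_finsetSum _ fun j _ => (h j).const_mul _
  have hgauss : HasGaussianLaw (fun ω j => Z j ω) P := by
    refine ⟨⟨fun L => ?_⟩⟩
    have hLm : Measurable L := L.continuous.measurable
    have hL : ∀ x : J → ℝ, L x = ∑ j, L (Pi.single j 1) * x j := by
      intro x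
      conv_lhs => rw [pi_eq_sum_univ' x]
      rw [map_sum]
      refine Finset.sum_congr rfl fun j _ => ?_
      rw [map_smul, smul_eq_mul, mul_comm]
    have h1 : (P.map fun ω j => Z j ω).map L
        = gaussianReal 0 (∑ i, ∑ j, L (Pi.single i 1) * L (Pi.single j 1) * c i j).toNNReal := by
      rw [AEMeasurable.map_map_of_aemeasurable hLm.aemeasurable hZm, ← hsum]
      congr 1
      funext ω
      exact hL _
    have h2 : ∫ x, L x ∂(P.map fun ω j => Z j ω) = 0 := by
      have := integral_map (μ := P.map fun ω j => Z j ω) (φ := L) (f := fun x => x)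
        hLm.aemeasurable (by fun_prop)
      rw [← this, h1, integral_id_gaussianReal]
    have h3 : Var[L; P.map fun ω j => Z j ω]
        = (∑ i, ∑ j, L (Pi.single i 1) * L (Pi.single j 1) * c i j).toNNReal := by
      have := variance_map (μ := P.map fun ω j => Z j ω) (Y := L) (X := id) (by fun_prop)
        hLm.aemeasurable
      rw [Function.id_comp] at this
      rw [← this, h1, variance_id_gaussianReal]
    rw [h1, h2, h3, Real.toNNReal_coe]
  have hZ2 : ∀ j, MemLp (Z j) 2 P := fun j => (hgauss.eval j).memLp_two
  have hquad : ∀ a : J → ℝ, ∫ ω, ∑ j, a j * Z j ω ∂P = 0 ∧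
      ∫ ω, (∑ j, a j * Z j ω) ^ 2 ∂P = (∑ i, ∑ j, a i * a j * c i j).toNNReal := by
    intro a
    have hma : AEMeasurable (fun ω => ∑ j, a j * Z j ω) P :=
      Finset.aemeasurable_fun_sum _ fun j _ => ((hgauss.eval j).aemeasurable).const_mul _
    have h1 : ∫ ω, ∑ j, a j * Z j ω ∂P = 0 := by
      have := integral_map (f := fun x : ℝ => x) hma (by fun_prop)
      rw [← this, hsum, integral_id_gaussianReal]
    refine ⟨h1, ?_⟩
    rw [← variance_of_integral_eq_zero hma h1]
    have := variance_map (μ := P) (X := id) (by fun_prop) hma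
    rw [Function.id_comp] at this
    rw [← this, hsum, variance_id_gaussianReal]
  have hcsymm : ∀ i j, c i j = c j i := fun i j => by
    refine tendsto_nhds_unique (hc i j) ?_
    simpa only [mul_comm] using hc j i
  -- A limit of covariance forms is nonnegative, so the truncation in `Real.toNNReal` does not
  -- change the variance.
  have hpos : ∀ a : J → ℝ, 0 ≤ ∑ i, ∑ j, a i * a j * c i j := by
    intro a
    refine ge_of_tendsto' (f := fun k => ∑ i, ∑ j, a i * a j * ∫ ω, Y k i ω * Y k j ω ∂P)
      (tendsto_finsetSum _ fun i _ => tendsto_finsetSum _ fun j _ => (hc i j).const_mul _)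
      fun k => ?_
    have hi : ∀ i j, Integrable (fun ω => Y k i ω * Y k j ω) P := fun i j =>
        (hm k i).integrable_mul (hm k j)
    have : 0 ≤ ∫ ω, (∑ j, a j * Y k j ω) ^ 2 ∂P := integral_nonneg fun ω => sq_nonneg _
    have e : ∀ ω, (∑ j, a j * Y k j ω) ^ 2 = ∑ i, ∑ j, a i * a j * (Y k i ω * Y k j ω) := by
      intro ω
      rw [sq, Finset.sum_mul_sum]
      exact Finset.sum_congr rfl fun i _ => Finset.sum_congr rfl fun j _ => by ring
    simp_rw [e] at this
    rw [integral_finsetSum _ fun i _ => integrable_finsetSum _ fun j _ => (hi i j).const_mul _]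
      at this
    refine this.trans_eq (Finset.sum_congr rfl fun i _ => ?_)
    rw [integral_finsetSum _ fun j _ => (hi i j).const_mul _]
    simp_rw [integral_const_mul]
  refine ⟨hgauss, fun j => ?_, fun i j => ?_⟩
  · have := (hquad (Pi.single j 1)).1
    simpa [Pi.single_apply] using this
  -- The covariances are recovered from the variances by polarization, on the vectors eⱼ and eᵢ +
  -- eⱼ.
  · have hq : ∀ a : J → ℝ, ∫ ω, (∑ j, a j * Z j ω) ^ 2 ∂P = ∑ i, ∑ j, a i * a j * c i j :=
      fun a => by rw [(hquad a).2, Real.coe_toNNReal _ (hpos a)]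
    have q1 : ∀ j, ∫ ω, Z j ω ^ 2 ∂P = c j j := fun j => by
      simpa [Pi.single_apply] using hq (Pi.single j 1)
    have q2 := hq (Pi.single i 1 + Pi.single j 1)
    simp only [Pi.add_apply, add_mul, Finset.sum_add_distrib, mul_add, Pi.single_apply, ite_mul,
      one_mul, zero_mul, Finset.sum_ite_eq', Finset.mem_univ, if_true, mul_ite, mul_one,
      mul_zero] at q2
    have e : ∀ ω, (Z i ω + Z j ω) ^ 2 = Z i ω ^ 2 + 2 * (Z i ω * Z j ω) + Z j ω ^ 2 :=
      fun ω => by ring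
    have i1 : ∀ j, Integrable (fun ω => Z j ω ^ 2) P := fun j => (hZ2 j).integrable_sq
    have i2 : Integrable (fun ω => 2 * (Z i ω * Z j ω)) P :=
      ((hZ2 i).integrable_mul (hZ2 j)).const_mul 2
    simp_rw [e] at q2
    have i3 : Integrable (fun ω => Z i ω ^ 2 + 2 * (Z i ω * Z j ω)) P := (i1 i).add i2
    rw [integral_add i3 (i1 j), integral_add (i1 i) i2, integral_const_mul, q1, q1,
      hcsymm j i] at q2
    linarith

end GaussianLimit

/-! ### Gaussianity and covariances of combinations of modes -/

section ModeSum

open ProbabilityTheory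

variable {Ω : Type*} {B : Freq → ℝ≥0 → Ω → ℂ}

/-- The real part of a finite linear combination of the stochastic convolutions of the modes. -/
noncomputable def modeSum (B : Freq → ℝ≥0 → Ω → ℂ) (F : Finset Freq) (a : Freq → ℂ) (z : ℝ × ℝ)
    (ω : Ω) : ℝ :=
  (∑ n ∈ F, a n * pathConv z n fun s => B n s.toNNReal ω).re

/-- The approximation of `modeSum` by Riemann sums. -/
noncomputable def modeWienerSum (B : Freq → ℝ≥0 → Ω → ℂ) (F : Finset Freq) (a : Freq → ℂ)
    (z : ℝ × ℝ) (k : ℕ) (ω : Ω) : ℂ :=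
  ∑ n ∈ F, a n * wienerSum (fun s => kernel z.1 n (z.2 - s)) (fun s => B n s ω) z.2 k

lemma bracket_neg (n : Freq) : bracket (-n) = bracket n := by
  simp [bracket]

lemma kernel_neg (ε : ℝ) (n : Freq) : kernel ε (-n) = kernel ε n := by
  funext t
  simp only [kernel, waveSymbol, bracket_neg]

/-- A finite linear combination of values of a process. -/
def IsFiniteCombination {T : Type*} (X : T → Ω → ℂ) (Y : Ω → ℂ) : Prop :=
  ∃ (I : Finset T) (L : (I → ℂ) →L[ℝ] ℂ), ∀ ω, Y ω = L (I.restrict (X · ω))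

lemma IsFiniteCombination.single {T : Type*} (X : T → Ω → ℂ) (t : T) :
    IsFiniteCombination X (X t) :=
  ⟨{t}, ContinuousLinearMap.proj ⟨t, by simp⟩, fun _ => rfl⟩

lemma IsFiniteCombination.const_mul {T : Type*} {X : T → Ω → ℂ} {Y : Ω → ℂ}
    (h : IsFiniteCombination X Y) (a : ℂ) : IsFiniteCombination X fun ω => a * Y ω := by
  obtain ⟨I, L, h⟩ := h
  exact ⟨I, a • L, fun ω => by simp [h]⟩

lemma IsFiniteCombination.add {T : Type*} {X : T → Ω → ℂ} {Y Z : Ω → ℂ}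
    (hY : IsFiniteCombination X Y) (hZ : IsFiniteCombination X Z) :
    IsFiniteCombination X fun ω => Y ω + Z ω := by
  classical
  obtain ⟨I, L, hL⟩ := hY
  obtain ⟨J, M, hM⟩ := hZ
  refine ⟨I ∪ J, L.comp (ContinuousLinearMap.pi fun i : I =>
      ContinuousLinearMap.proj ⟨i.1, Finset.mem_union_left _ i.2⟩)
    + M.comp (ContinuousLinearMap.pi fun i : J =>
      ContinuousLinearMap.proj ⟨i.1, Finset.mem_union_right _ i.2⟩), fun ω => ?_⟩
  simp only [hL, hM]
  rfl

lemma IsFiniteCombination.sum {T ι : Type*} {X : T → Ω → ℂ} {Y : ι → Ω → ℂ} (s : Finset ι)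
    (h : ∀ i ∈ s, IsFiniteCombination X (Y i)) : IsFiniteCombination X fun ω => ∑ i ∈ s, Y i ω := by
  classical
  induction s using Finset.induction_on with
  | empty => exact ⟨∅, 0, fun ω => by simp⟩
  | insert i s hi ih =>
    simp only [Finset.sum_insert hi]
    exact (h i (Finset.mem_insert_self _ _)).add
      (ih fun j hj => h j (Finset.mem_insert_of_mem hj))

lemma isFiniteCombination_modeWienerSum (F : Finset Freq) (a : Freq → ℂ) (z : ℝ × ℝ) (k : ℕ) :
    IsFiniteCombination (fun (i : Freq × ℝ≥0) ω => B i.1 i.2 ω)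
      (modeWienerSum B F a z k) := by
  refine IsFiniteCombination.sum F fun n _ => IsFiniteCombination.const_mul ?_ _
  refine IsFiniteCombination.sum _ fun j _ => IsFiniteCombination.const_mul ?_ _
  simp only [sub_eq_add_neg]
  refine (IsFiniteCombination.single (fun (i : Freq × ℝ≥0) ω => B i.1 i.2 ω) (n, _)).add ?_
  simpa only [neg_one_mul] using
    (IsFiniteCombination.single (fun (i : Freq × ℝ≥0) ω => B i.1 i.2 ω) (n, _)).const_mul (-1)

variable [MeasurableSpace Ω] {P : Measure Ω}

namespace IsCylindricalWiener

lemma memLp_modeWienerSum (hB : IsCylindricalWiener B P) (F : Finset Freq) (a : Freq → ℂ)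
    (z : ℝ × ℝ) (k : ℕ) : MemLp (modeWienerSum B F a z k) 2 P :=
  memLp_finsetSum _ fun n _ => (hB.memLp_wienerSum n _ _ _).const_mul _

lemma modeWienerSum_ae_real (hB : IsCylindricalWiener B P) {F : Finset Freq}
    (hF : ∀ n ∈ F, -n ∈ F) {a : Freq → ℂ} (ha : ∀ n, a (-n) = conj (a n)) (z : ℝ × ℝ) (k : ℕ) :
    ∀ᵐ ω ∂P, conj (modeWienerSum B F a z k ω) = modeWienerSum B F a z k ω := by
  have h : ∀ᵐ ω ∂P, ∀ n t, B (-n) t ω = conj (B n t ω) := ae_all_iff.2 hB.conj_symm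
  filter_upwards [h] with ω h
  simp only [modeWienerSum, map_sum, map_mul]
  refine Finset.sum_nbij' (fun n => -n) (fun n => -n) hF hF (fun n _ => neg_neg n)
    (fun n _ => neg_neg n) fun n _ => ?_
  rw [ha, kernel_neg]
  congr 1
  simp only [wienerSum, map_sum, map_mul, map_sub, Complex.conj_ofReal, h]

variable [IsProbabilityMeasure P]

lemma hasGaussianLaw_modeWienerSum (hB : IsCylindricalWiener B P) {J : Type*} [Fintype J]
    (F : Finset Freq) (a : J → Freq → ℂ) (z : J → ℝ × ℝ) (k : ℕ) :
    HasGaussianLaw (fun ω i => (modeWienerSum B F (a i) (z i) k ω).re) P := by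
  have h : IsGaussianProcess (fun i ω => (modeWienerSum B F (a i) (z i) k ω).re) P := by
    refine hB.isGaussianProcess.of_isGaussianProcess fun i => ?_
    obtain ⟨I, L, hL⟩ := isFiniteCombination_modeWienerSum (B := B) F (a i) (z i) k
    exact ⟨I, Complex.reCLM.comp L, fun ω => by rw [hL]; rfl⟩
  exact (h.hasGaussianLaw Finset.univ).map_fun (ContinuousLinearMap.pi fun j : J =>
    ContinuousLinearMap.proj (R := ℝ) (φ := fun _ : (Finset.univ : Finset J) => ℝ)
      ⟨j, Finset.mem_univ j⟩)

lemma integral_modeWienerSum (hB : IsCylindricalWiener B P) (F : Finset Freq) (a : Freq → ℂ)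
    (z : ℝ × ℝ) (k : ℕ) : ∫ ω, modeWienerSum B F a z k ω ∂P = 0 := by
  simp only [modeWienerSum]
  rw [integral_finsetSum _ fun n _ =>
    ((hB.memLp_wienerSum n _ _ _).integrable (by norm_num)).const_mul _]
  simp [integral_const_mul, hB.integral_wienerSum]

lemma integral_modeWienerSum_mul_conj (hB : IsCylindricalWiener B P) (F : Finset Freq)
    (a b : Freq → ℂ) {z z' : ℝ × ℝ} (hz : 0 ≤ z.2) (hz' : 0 ≤ z'.2) (k : ℕ) :
    ∫ ω, modeWienerSum B F a z k ω * conj (modeWienerSum B F b z' k ω) ∂P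
      = ∑ n ∈ F, a n * conj (b n) * ((∫ s, stepFun (fun s => kernel z.1 n (z.2 - s)) z.2 k s
        * stepFun (fun s => kernel z'.1 n (z'.2 - s)) z'.2 k s : ℝ) : ℂ) := by
  have hi : ∀ n m, Integrable (fun ω =>
      wienerSum (fun s => kernel z.1 n (z.2 - s)) (fun s => B n s ω) z.2 k
      * conj (wienerSum (fun s => kernel z'.1 m (z'.2 - s)) (fun s => B m s ω) z'.2 k)) P :=
    fun n m => (hB.memLp_wienerSum n _ _ _).integrable_mul (hB.memLp_wienerSum m _ _ _).star
  have e : ∀ ω, modeWienerSum B F a z k ω * conj (modeWienerSum B F b z' k ω)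
      = ∑ n ∈ F, ∑ m ∈ F, a n * conj (b m)
        * (wienerSum (fun s => kernel z.1 n (z.2 - s)) (fun s => B n s ω) z.2 k
        * conj (wienerSum (fun s => kernel z'.1 m (z'.2 - s)) (fun s => B m s ω) z'.2 k)) := by
    intro ω
    simp only [modeWienerSum, map_sum, map_mul, Finset.sum_mul_sum]
    exact Finset.sum_congr rfl fun n _ => Finset.sum_congr rfl fun m _ => by ring
  simp_rw [e]
  rw [integral_finsetSum _ fun n _ => integrable_finsetSum _ fun m _ => (hi n m).const_mul _]
  refine Finset.sum_congr rfl fun n hn => ?_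
  rw [integral_finsetSum _ fun m _ => (hi n m).const_mul _, Finset.sum_eq_single n]
  · rw [integral_const_mul, hB.integral_wienerSum_mul_conj n n _ _ hz hz', if_pos rfl]
  · intro m _ hm
    rw [integral_const_mul, hB.integral_wienerSum_mul_conj n m _ _ hz hz', if_neg hm.symm, mul_zero]
  · exact fun h => absurd hn h

lemma integral_re_modeWienerSum_mul (hB : IsCylindricalWiener B P) {F : Finset Freq}
    (hF : ∀ n ∈ F, -n ∈ F) {a b : Freq → ℂ} (ha : ∀ n, a (-n) = conj (a n))
    (hb : ∀ n, b (-n) = conj (b n)) {z z' : ℝ × ℝ} (hz : 0 ≤ z.2) (hz' : 0 ≤ z'.2) (k : ℕ) :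
    ∫ ω, (modeWienerSum B F a z k ω).re * (modeWienerSum B F b z' k ω).re ∂P
      = (∑ n ∈ F, a n * conj (b n) * ((∫ s, stepFun (fun s => kernel z.1 n (z.2 - s)) z.2 k s
        * stepFun (fun s => kernel z'.1 n (z'.2 - s)) z'.2 k s : ℝ) : ℂ)).re := by
  rw [← hB.integral_modeWienerSum_mul_conj F a b hz hz' k, ← Complex.ofReal_re (∫ ω, _ ∂P),
    ← integral_complex_ofReal]
  congr 1
  refine integral_congr_ae ?_
  filter_upwards [hB.modeWienerSum_ae_real hF ha z k, hB.modeWienerSum_ae_real hF hb z' k]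
    with ω h1 h2
  rw [h2, Complex.ofReal_mul, Complex.conj_eq_iff_re.1 h1, Complex.conj_eq_iff_re.1 h2]

/-- Joint Gaussianity and covariances of linear combinations of stochastic convolutions. -/
theorem hasGaussianLaw_modeSum (hB : IsCylindricalWiener B P) {J : Type*} [Fintype J]
    {F : Finset Freq} (hF : ∀ n ∈ F, -n ∈ F) {a : J → Freq → ℂ}
    (ha : ∀ i n, a i (-n) = conj (a i n)) {z : J → ℝ × ℝ}
    (hz : ∀ i, 0 ≤ (z i).1 ∧ 0 ≤ (z i).2) :
    HasGaussianLaw (fun ω i => modeSum B F (a i) (z i) ω) P ∧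
      (∀ i, ∫ ω, modeSum B F (a i) (z i) ω ∂P = 0) ∧
      ∀ i j, ∫ ω, modeSum B F (a i) (z i) ω * modeSum B F (a j) (z j) ω ∂P
        = (∑ n ∈ F, a i n * conj (a j n) * modeCov n (z i) (z j)).re := by
  refine hasGaussianLaw_of_tendsto (Y := fun k i ω => (modeWienerSum B F (a i) (z i) k ω).re)
    (hB.hasGaussianLaw_modeWienerSum F a z) (fun k i => ?_) (fun i j => ?_) ?_
  · have hi := (hB.memLp_modeWienerSum F (a i) (z i) k).integrable (by norm_num)
    have h1 : (∫ ω, modeWienerSum B F (a i) (z i) k ω ∂P).re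
      = ∫ ω, (modeWienerSum B F (a i) (z i) k ω).re ∂P := (integral_re hi).symm
    rw [← h1, hB.integral_modeWienerSum, Complex.zero_re]
  · simp_rw [hB.integral_re_modeWienerSum_mul hF (ha i) (ha j) (hz i).2 (hz j).2]
    refine (Complex.continuous_re.tendsto _).comp ?_
    exact tendsto_finsetSum _ fun n _ => ((Complex.continuous_ofReal.tendsto _).comp
      (tendsto_integral_stepFun_mul (hz i).1 (hz i).2 (hz j).1 (hz j).2 n)).const_mul _
  · filter_upwards [hB.ae_continuous] with ω h i
    refine (Complex.continuous_re.tendsto _).comp ?_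
    exact tendsto_finsetSum _ fun n _ =>
      (tendsto_wienerSum_kernel (hz i).1 (hz i).2 n (h n)).const_mul _

end IsCylindricalWiener

end ModeSum

/-! ### The truncated stochastic convolution is a centred Gaussian field -/

/-- The frequencies with both components of size at most `R`. -/
noncomputable def freqBox (R : ℕ) : Finset Freq := Fintype.piFinset fun _ => Finset.Icc (-(R : ℤ)) R

lemma mem_freqBox {R : ℕ} {n : Freq} : n ∈ freqBox R ↔ ∀ i, |n i| ≤ R := by
  simp [freqBox, abs_le]

lemma neg_mem_freqBox {R : ℕ} {n : Freq} (h : n ∈ freqBox R) : -n ∈ freqBox R := by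
  simpa [mem_freqBox] using h

lemma abs_le_bracket (n : Freq) (i : Fin 2) : |(n i : ℝ)| ≤ bracket n := by
  refine Real.le_sqrt_of_sq_le ?_
  rw [sq_abs]
  fin_cases i <;> simp <;> nlinarith [sq_nonneg (n 0 : ℝ), sq_nonneg (n 1 : ℝ)]

lemma IsCutoff.eq_zero {χ : ℝ → ℝ} (hχ : IsCutoff χ) {x : ℝ} (hx : 2 < x) : χ x = 0 := by
  by_contra h
  exact absurd (hχ.supp (subset_tsupport χ h)).2 (not_le.2 hx)

lemma IsCutoff.eq_zero_of_notMem {χ : ℝ → ℝ} (hχ : IsCutoff χ) {N R : ℕ} (hN : 1 ≤ N)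
    (hR : 2 * N ≤ R) {n : Freq} (hn : n ∉ freqBox R) : χ (bracket n / N) = 0 := by
  rw [mem_freqBox, not_forall] at hn
  obtain ⟨i, hi⟩ := hn
  refine hχ.eq_zero ?_
  have hN' : (0 : ℝ) < N := by exact_mod_cast hN
  rw [lt_div_iff₀ hN']
  have h1 : (R : ℝ) < |(n i : ℝ)| := by
    rw [← Int.cast_abs]
    exact_mod_cast not_le.1 hi
  have h2 : (2 * N : ℝ) ≤ R := by exact_mod_cast hR
  linarith [abs_le_bracket n i]

lemma basisFun_neg (n : Freq) (x : Torus) : basisFun (-n) x = conj (basisFun n x) := by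
  simp only [basisFun, mono_neg, map_mul, map_inv₀, Complex.conj_ofReal, map_ofNat]

section Trunc

open ProbabilityTheory

variable {Ω : Type*} {B : Freq → ℝ≥0 → Ω → ℂ} {χ : ℝ → ℝ}

lemma stochConv_eq_pathConv {z : ℝ × ℝ} (hz : 0 ≤ z.1 ∧ 0 ≤ z.2) {ω : Ω} (n : Freq)
    (hω : Continuous fun t => B n t ω) :
    stochConv B z.1 z.2 ω n = pathConv z n fun s => B n s.toNNReal ω :=
  wienerIntegral_kernel hz.1 hz.2 n hω

lemma truncConv_eq_modeSum (hχ : IsCutoff χ) {N R : ℕ} (hN : 1 ≤ N) (hR : 2 * N ≤ R)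
    {z : ℝ × ℝ} (hz : 0 ≤ z.1 ∧ 0 ≤ z.2) {ω : Ω} (hω : ∀ n, Continuous fun t => B n t ω)
    (x : Torus) :
    truncConv χ B N z.1 z.2 ω x
      = modeSum B (freqBox R) (fun n => χ (bracket n / N) * basisFun n x) z ω := by
  rw [truncConv, modeSum, tsum_eq_sum (s := freqBox R)]
  · congr 1
    refine Finset.sum_congr rfl fun n _ => ?_
    rw [stochConv_eq_pathConv hz n (hω n)]
    ring
  · intro n hn
    rw [hχ.eq_zero_of_notMem hN hR hn]
    simp

variable [MeasurableSpace Ω] {P : Measure Ω} [IsProbabilityMeasure P]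

/-- One frequency box serves all truncations at once, because the cutoffs annihilate the superfluous
modes. The covariance between two truncation levels is what the Cauchy estimate in N requires. -/
theorem hasGaussianLaw_truncConv (hB : IsCylindricalWiener B P) (hχ : IsCutoff χ)
    {J : Type*} [Fintype J] {N : J → ℕ} {R : ℕ} (hN : ∀ i, 1 ≤ N i) (hR : ∀ i, 2 * N i ≤ R)
    {z : J → ℝ × ℝ} (hz : ∀ i, 0 ≤ (z i).1 ∧ 0 ≤ (z i).2) (x : J → Torus) :
    HasGaussianLaw (fun ω i => truncConv χ B (N i) (z i).1 (z i).2 ω (x i)) P ∧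
      (∀ i, ∫ ω, truncConv χ B (N i) (z i).1 (z i).2 ω (x i) ∂P = 0) ∧
      ∀ i j, ((∫ ω, truncConv χ B (N i) (z i).1 (z i).2 ω (x i)
          * truncConv χ B (N j) (z j).1 (z j).2 ω (x j) ∂P : ℝ) : ℂ)
        = ∑ n ∈ freqBox R, ((χ (bracket n / N i) * χ (bracket n / N j) * modeCov n (z i) (z j) : ℝ)
          : ℂ) * (basisFun n (x i) * conj (basisFun n (x j))) := by
  have ha : ∀ i n, (fun n => (χ (bracket n / N i) : ℂ) * basisFun n (x i)) (-n)
      = conj ((fun n => (χ (bracket n / N i) : ℂ) * basisFun n (x i)) n) := by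
    intro i n
    simp [bracket_neg, basisFun_neg]
  obtain ⟨h1, h2, h3⟩ := hB.hasGaussianLaw_modeSum (F := freqBox R) (fun _ => neg_mem_freqBox)
    (a := fun i n => (χ (bracket n / N i) : ℂ) * basisFun n (x i)) ha hz
  have hae : ∀ᵐ ω ∂P, ∀ i, truncConv χ B (N i) (z i).1 (z i).2 ω (x i)
      = modeSum B (freqBox R) (fun n => χ (bracket n / N i) * basisFun n (x i)) (z i) ω := by
    filter_upwards [hB.ae_continuous] with ω hω i
    exact truncConv_eq_modeSum hχ (hN i) (hR i) (hz i) hω (x i)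
  refine ⟨h1.congr ?_, fun i => ?_, fun i j => ?_⟩
  · filter_upwards [hae] with ω hω
    funext i
    exact (hω i).symm
  · rw [← h2 i]
    refine integral_congr_ae ?_
    filter_upwards [hae] with ω hω using hω i
  · have e : ∫ ω, truncConv χ B (N i) (z i).1 (z i).2 ω (x i)
          * truncConv χ B (N j) (z j).1 (z j).2 ω (x j) ∂P
        = (∑ n ∈ freqBox R, ((χ (bracket n / N i) * χ (bracket n / N j) * modeCov n (z i) (z j) : ℝ)
          : ℂ) * (basisFun n (x i) * conj (basisFun n (x j)))).re := by
      have e1 : ∀ n, ((χ (bracket n / N i) * χ (bracket n / N j) * modeCov n (z i) (z j) : ℝ)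
          : ℂ) * (basisFun n (x i) * conj (basisFun n (x j)))
          = ((χ (bracket n / N i) : ℂ) * basisFun n (x i))
            * conj ((χ (bracket n / N j) : ℂ) * basisFun n (x j)) * modeCov n (z i) (z j) := by
        intro n
        simp only [map_mul, Complex.conj_ofReal]
        push_cast
        ring
      simp_rw [e1]
      rw [← h3 i j]
      refine integral_congr_ae ?_
      filter_upwards [hae] with ω hω
      rw [hω i, hω j]
    -- The sum is real by the symmetry n ↦ -n, under which the basis functions are conjugated and
    -- the coefficients invariant.
    rw [e, ← Complex.conj_eq_iff_re, map_sum]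
    refine Finset.sum_nbij' (fun n => -n) (fun n => -n) (fun _ => neg_mem_freqBox)
      (fun _ => neg_mem_freqBox) (fun n _ => neg_neg n) (fun n _ => neg_neg n) fun n _ => ?_
    have hm : modeCov (-n) (z i) (z j) = modeCov n (z i) (z j) := by
      simp only [modeCov, duhamel, kernel_neg]
    simp only [map_mul, bracket_neg, basisFun_neg, Complex.conj_conj, Complex.conj_ofReal, hm]

end Trunc

/-! ### Lattice sums -/

section Lattice

lemma bracket_add_le (n m : Freq) : bracket (n + m) ≤ bracket n + bracket m := by
  have h1 := one_le_bracket n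
  have h2 := one_le_bracket m
  have e1 : bracket n ^ 2 = 1 + (n 0 : ℝ) ^ 2 + (n 1 : ℝ) ^ 2 := Real.sq_sqrt (by positivity)
  have e2 : bracket m ^ 2 = 1 + (m 0 : ℝ) ^ 2 + (m 1 : ℝ) ^ 2 := Real.sq_sqrt (by positivity)
  have hcs : (n 0 : ℝ) * m 0 + (n 1 : ℝ) * m 1 ≤ bracket n * bracket m := by
    refine le_of_sq_le_sq ?_ (by positivity)
    rw [mul_pow, e1, e2]
    nlinarith [sq_nonneg ((n 0 : ℝ) * m 1 - n 1 * m 0), sq_nonneg (n 0 : ℝ), sq_nonneg (n 1 : ℝ),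
      sq_nonneg (m 0 : ℝ), sq_nonneg (m 1 : ℝ)]
  refine Real.sqrt_le_iff.2 ⟨by positivity, ?_⟩
  simp only [Pi.add_apply, Int.cast_add]
  nlinarith

lemma norm_le_bracket (n : Freq) : ‖n‖ ≤ bracket n := by
  refine (pi_norm_le_iff_of_nonneg (bracket_pos n).le).2 fun i => ?_
  rw [Int.norm_eq_abs]
  exact abs_le_bracket n i

/-- Two is the dimension of the lattice; the comparison is with the sum of ‖n‖^{-s} known from
Eisenstein series. -/
lemma summable_bracket_rpow {s : ℝ} (hs : 2 < s) : Summable fun n : Freq => bracket n ^ (-s) := by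
  refine Summable.of_norm_bounded_eventually (EisensteinSeries.summable_one_div_norm_rpow hs) ?_
  filter_upwards [(Set.finite_singleton (0 : Freq)).compl_mem_cofinite] with n hn
  rw [Real.norm_of_nonneg (Real.rpow_nonneg (bracket_pos n).le _)]
  exact Real.rpow_le_rpow_of_nonpos (norm_pos_iff.2 hn) (norm_le_bracket n) (by linarith)

lemma rpow_neg_mul_rpow_neg_le {x y p q : ℝ} (hx : 0 < x) (hy : 0 < y) (hp : 0 ≤ p) (hq : 0 ≤ q) :
    x ^ (-p) * y ^ (-q) ≤ x ^ (-(p + q)) + y ^ (-(p + q)) := by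
  have hx' := Real.rpow_nonneg hx.le (-(p + q))
  have hy' := Real.rpow_nonneg hy.le (-(p + q))
  rcases le_total x y with h | h
  · calc _ ≤ x ^ (-p) * x ^ (-q) :=
          mul_le_mul_of_nonneg_left (Real.rpow_le_rpow_of_nonpos hx h (by linarith))
            (Real.rpow_nonneg hx.le _)
      _ = x ^ (-(p + q)) := by rw [← Real.rpow_add hx]; ring_nf
      _ ≤ _ := by linarith
  · calc _ ≤ y ^ (-p) * y ^ (-q) :=
          mul_le_mul_of_nonneg_right (Real.rpow_le_rpow_of_nonpos hy h (by linarith))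
            (Real.rpow_nonneg hy.le _)
      _ = y ^ (-(p + q)) := by rw [← Real.rpow_add hy]; ring_nf
      _ ≤ _ := by linarith

/-- Since ⟨m⟩ ≤ ⟨n⟩ + ⟨n+m⟩, the weight ⟨m⟩^{a-2η} can be transferred to one of the two factors. In
either case the remaining exponents add up to 2 + η, so the product is bounded by two summable
terms. One convolution costs 2η of decay. -/
lemma sum_bracket_convolution_le {η a : ℝ} (hη : 0 < η) (h2 : 2 * η ≤ a) (ha : a ≤ 1)
    (S : Finset Freq) (m : Freq) :
    ∑ n ∈ S, bracket n ^ (-2 + η) * bracket (n + m) ^ (-a)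
      ≤ 8 * (∑' n, bracket n ^ (-(2 + η))) * bracket m ^ (-(a - 2 * η)) := by
  set Z := ∑' n, bracket n ^ (-(2 + η)) with hZ
  have hs := summable_bracket_rpow (s := 2 + η) (by linarith)
  have hnn : ∀ n, 0 ≤ bracket n ^ (-(2 + η)) := fun n => Real.rpow_nonneg (bracket_pos n).le _
  have hS : ∑ n ∈ S, bracket n ^ (-(2 + η)) ≤ Z := hs.sum_le_tsum S fun n _ => hnn n
  have hS' : ∑ n ∈ S, bracket (n + m) ^ (-(2 + η)) ≤ Z := by
    have hs' : Summable fun n => bracket (n + m) ^ (-(2 + η)) :=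
      hs.comp_injective (add_left_injective m)
    refine (hs'.sum_le_tsum S fun n _ => hnn _).trans_eq ?_
    exact (Equiv.addRight m).tsum_eq fun n => bracket n ^ (-(2 + η))
  have hm := bracket_pos m
  have key : ∀ n, bracket n ^ (-2 + η) * bracket (n + m) ^ (-a) * bracket m ^ (a - 2 * η)
      ≤ 4 * (bracket n ^ (-(2 + η)) + bracket (n + m) ^ (-(2 + η))) := by
    intro n
    have hx := bracket_pos n
    have hy := bracket_pos (n + m)
    have h1 : bracket m ≤ bracket n + bracket (n + m) := by
      have := bracket_add_le (-n) (n + m)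
      rwa [neg_add_cancel_left, bracket_neg] at this
    have h3 : bracket m ^ (a - 2 * η)
        ≤ 2 * (bracket n ^ (a - 2 * η) + bracket (n + m) ^ (a - 2 * η)) := by
      have hM : bracket m ≤ 2 * max (bracket n) (bracket (n + m)) := by
        linarith [le_max_left (bracket n) (bracket (n + m)),
          le_max_right (bracket n) (bracket (n + m))]
      have hmax : 0 < max (bracket n) (bracket (n + m)) := lt_max_of_lt_left hx
      calc bracket m ^ (a - 2 * η) ≤ (2 * max (bracket n) (bracket (n + m))) ^ (a - 2 * η) :=
            Real.rpow_le_rpow hm.le hM (by linarith)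
        _ = 2 ^ (a - 2 * η) * max (bracket n) (bracket (n + m)) ^ (a - 2 * η) :=
            Real.mul_rpow (by norm_num) hmax.le
        _ ≤ 2 * (bracket n ^ (a - 2 * η) + bracket (n + m) ^ (a - 2 * η)) := by
            refine mul_le_mul ?_ ?_ (Real.rpow_nonneg hmax.le _) (by norm_num)
            · calc (2 : ℝ) ^ (a - 2 * η) ≤ 2 ^ (1 : ℝ) :=
                  Real.rpow_le_rpow_of_exponent_le (by norm_num) (by linarith)
                _ = 2 := Real.rpow_one 2
            · have g1 := Real.rpow_nonneg hx.le (a - 2 * η)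
              have g2 := Real.rpow_nonneg hy.le (a - 2 * η)
              rcases max_choice (bracket n) (bracket (n + m)) with h | h <;> rw [h] <;> linarith
    have h4 : bracket n ^ (-(2 - a + η)) * bracket (n + m) ^ (-a)
        ≤ bracket n ^ (-(2 + η)) + bracket (n + m) ^ (-(2 + η)) := by
      have := rpow_neg_mul_rpow_neg_le (p := 2 - a + η) (q := a) hx hy (by linarith) (by linarith)
      rwa [show 2 - a + η + a = 2 + η by ring] at this
    have h5 : bracket n ^ (-(2 - η)) * bracket (n + m) ^ (-(2 * η))
        ≤ bracket n ^ (-(2 + η)) + bracket (n + m) ^ (-(2 + η)) := by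
      have := rpow_neg_mul_rpow_neg_le (p := 2 - η) (q := 2 * η) hx hy (by linarith) (by linarith)
      rwa [show 2 - η + 2 * η = 2 + η by ring] at this
    have e1 : bracket n ^ (-2 + η) * bracket n ^ (a - 2 * η) = bracket n ^ (-(2 - a + η)) := by
      rw [← Real.rpow_add hx]; ring_nf
    have e2 : bracket (n + m) ^ (-a) * bracket (n + m) ^ (a - 2 * η)
        = bracket (n + m) ^ (-(2 * η)) := by
      rw [← Real.rpow_add hy]; ring_nf
    have e3 : bracket n ^ (-2 + η) = bracket n ^ (-(2 - η)) := by ring_nf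
    have hp : 0 ≤ bracket n ^ (-2 + η) * bracket (n + m) ^ (-a) := by positivity
    calc _ ≤ bracket n ^ (-2 + η) * bracket (n + m) ^ (-a)
          * (2 * (bracket n ^ (a - 2 * η) + bracket (n + m) ^ (a - 2 * η))) :=
          mul_le_mul_of_nonneg_left h3 hp
      _ = 2 * ((bracket n ^ (-2 + η) * bracket n ^ (a - 2 * η)) * bracket (n + m) ^ (-a)
          + bracket n ^ (-2 + η) * (bracket (n + m) ^ (-a) * bracket (n + m) ^ (a - 2 * η))) := by
          ring
      _ ≤ _ := by rw [e1, e2, e3]; linarith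
  have hsum : (∑ n ∈ S, bracket n ^ (-2 + η) * bracket (n + m) ^ (-a)) * bracket m ^ (a - 2 * η)
      ≤ 8 * Z := by
    rw [Finset.sum_mul]
    refine (Finset.sum_le_sum fun n _ => key n).trans ?_
    rw [← Finset.mul_sum, Finset.sum_add_distrib]
    linarith
  rw [Real.rpow_neg hm.le, ← div_eq_mul_inv, le_div_iff₀ (Real.rpow_pos_of_pos hm _)]
  exact hsum

lemma sum_piFinset_succ {M : Type*} [AddCommMonoid M] (ℓ : ℕ) (S : Finset Freq)
    (f : (Fin (ℓ + 1) → Freq) → M) :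
    ∑ v ∈ Fintype.piFinset (fun _ : Fin (ℓ + 1) => S), f v
      = ∑ n ∈ S, ∑ v ∈ Fintype.piFinset (fun _ : Fin ℓ => S), f (Fin.cons n v) := by
  rw [← Finset.sum_product']
  refine Finset.sum_nbij' (fun v => (v 0, Fin.tail v)) (fun p => Fin.cons p.1 p.2) ?_ ?_ ?_ ?_ ?_
  · intro v hv
    rw [Fintype.mem_piFinset] at hv
    exact Finset.mem_product.2 ⟨hv 0, Fintype.mem_piFinset.2 fun i => hv i.succ⟩
  · intro p hp
    rw [Finset.mem_product, Fintype.mem_piFinset] at hp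
    exact Fintype.mem_piFinset.2 (Fin.cases hp.1 hp.2)
  · intro v _
    exact Fin.cons_self_tail v
  · intro p _
    simp
  · intro v _
    rw [Fin.cons_self_tail]

/-- Induction on ℓ with the shift m left free: the inner ℓ frequencies are summed at the shift n +
m, and the sum over n is then one more convolution. The decay lost is 2η per frequency. -/
lemma sum_prod_bracket_le {η : ℝ} (hη : 0 < η) (S : Finset Freq) (ℓ : ℕ) :
    ∀ a : ℝ, 2 * ℓ * η ≤ a → a ≤ 1 → ∀ m : Freq,
    ∑ v ∈ Fintype.piFinset (fun _ : Fin ℓ => S), (∏ i, bracket (v i) ^ (-2 + η))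
        * bracket ((∑ i, v i) + m) ^ (-a)
      ≤ (8 * ∑' n, bracket n ^ (-(2 + η))) ^ ℓ * bracket m ^ (-(a - 2 * ℓ * η)) := by
  induction ℓ with
  | zero => intro a _ _ m; simp
  | succ ℓ ih =>
    intro a h2 ha m
    push_cast at h2 ⊢
    have hZ : 0 ≤ 8 * ∑' n, bracket n ^ (-(2 + η)) :=
      mul_nonneg (by norm_num) (tsum_nonneg fun n => Real.rpow_nonneg (bracket_pos n).le _)
    rw [sum_piFinset_succ]
    have hstep : ∀ n ∈ S, ∑ v ∈ Fintype.piFinset (fun _ : Fin ℓ => S),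
        (∏ i, bracket ((Fin.cons n v : Fin (ℓ + 1) → Freq) i) ^ (-2 + η))
          * bracket ((∑ i, (Fin.cons n v : Fin (ℓ + 1) → Freq) i) + m) ^ (-a)
        ≤ (8 * ∑' n, bracket n ^ (-(2 + η))) ^ ℓ
          * (bracket n ^ (-2 + η) * bracket (n + m) ^ (-(a - 2 * ℓ * η))) := by
      intro n _
      have h := mul_le_mul_of_nonneg_left (ih a (by nlinarith) ha (n + m))
        (Real.rpow_nonneg (bracket_pos n).le (-2 + η))
      rw [Finset.mul_sum] at h
      refine le_trans (le_of_eq (Finset.sum_congr rfl fun v _ => ?_)) (h.trans_eq (by ring))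
      rw [Fin.prod_univ_succ, Fin.sum_univ_succ]
      simp only [Fin.cons_zero, Fin.cons_succ]
      rw [show n + ∑ i, v i + m = ∑ i, v i + (n + m) by abel]
      ring
    refine (Finset.sum_le_sum hstep).trans ?_
    rw [← Finset.mul_sum]
    have h := sum_bracket_convolution_le hη (a := a - 2 * ℓ * η) (by linarith)
      (by nlinarith [(Nat.cast_nonneg ℓ : (0 : ℝ) ≤ ℓ)]) S m
    refine (mul_le_mul_of_nonneg_left h (pow_nonneg hZ ℓ)).trans_eq ?_
    rw [show a - 2 * ℓ * η - 2 * η = a - 2 * (ℓ + 1) * η by ring]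
    ring

/-- Uniform bound for the lattice sums that control `ℓ`-th Wick powers in `W^{-s/2,∞}`. -/
theorem exists_sum_prod_bracket_le (ℓ : ℕ) {s : ℝ} (hs : 0 < s) :
    ∃ η : ℝ, 0 < η ∧ η ≤ 1 ∧ ∃ C : ℝ, 0 ≤ C ∧ ∀ S : Finset Freq,
      ∑ v ∈ Fintype.piFinset (fun _ : Fin ℓ => S), (∏ i, bracket (v i) ^ (-2 + η))
        * bracket (∑ i, v i) ^ (-s) ≤ C := by
  have hs1 : 0 < min s 1 := lt_min hs one_pos
  -- Chosen so that the total loss 2ℓη stays below min s 1. The sum is evaluated at shift 0, where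
  -- ⟨0⟩ = 1.
  set η := min s 1 / (2 * (ℓ + 1)) with hη
  have hη0 : 0 < η := by positivity
  have hηs : 2 * (ℓ + 1) * η = min s 1 := by rw [hη]; field_simp
  have hℓ : (0 : ℝ) ≤ ℓ := Nat.cast_nonneg ℓ
  refine ⟨η, hη0, ?_, (8 * ∑' n, bracket n ^ (-(2 + η))) ^ ℓ, ?_, fun S => ?_⟩
  · nlinarith [min_le_right s 1]
  · exact pow_nonneg (mul_nonneg (by norm_num)
      (tsum_nonneg fun n => Real.rpow_nonneg (bracket_pos n).le _)) ℓ
  · have h := sum_prod_bracket_le hη0 S ℓ (min s 1) (by nlinarith) (min_le_right _ _) 0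
    have h1 : bracket 0 = 1 := by simp [bracket]
    rw [h1, Real.one_rpow, mul_one] at h
    refine le_trans (Finset.sum_le_sum fun v _ => ?_) h
    rw [add_zero]
    refine mul_le_mul_of_nonneg_left ?_
      (Finset.prod_nonneg fun i _ => Real.rpow_nonneg (bracket_pos _).le _)
    exact Real.rpow_le_rpow_of_exponent_le (one_le_bracket _) (by linarith [min_le_left s 1])

/-- Telescoping: exchanging one factor costs κ relative to the majorant, and there are as many
exchanges as factors. -/
lemma abs_prod_sub_prod_le {ι : Type*} (s : Finset ι) {a b A : ι → ℝ} {κ : ℝ}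
    (ha : ∀ i ∈ s, |a i| ≤ A i) (hb : ∀ i ∈ s, |b i| ≤ A i)
    (hab : ∀ i ∈ s, |a i - b i| ≤ κ * A i) :
    |∏ i ∈ s, a i - ∏ i ∈ s, b i| ≤ s.card * κ * ∏ i ∈ s, A i := by
  classical
  induction s using Finset.induction_on with
  | empty => simp
  | insert i s hi ih =>
    simp only [Finset.forall_mem_insert] at ha hb hab
    rw [Finset.prod_insert hi, Finset.prod_insert hi, Finset.prod_insert hi,
      Finset.card_insert_of_notMem hi]
    have hP : |∏ j ∈ s, a j| ≤ ∏ j ∈ s, A j := by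
      rw [Finset.abs_prod]
      exact Finset.prod_le_prod (fun j _ => abs_nonneg _) ha.2
    have e : a i * ∏ j ∈ s, a j - b i * ∏ j ∈ s, b j
        = (a i - b i) * ∏ j ∈ s, a j + b i * (∏ j ∈ s, a j - ∏ j ∈ s, b j) := by ring
    have h0 : 0 ≤ A i := (abs_nonneg _).trans ha.1
    rw [e]
    refine (abs_add_le _ _).trans ?_
    rw [abs_mul, abs_mul]
    have h1 := mul_le_mul hab.1 hP (abs_nonneg _) ((abs_nonneg _).trans hab.1)
    have h2 := mul_le_mul hb.1 (ih ha.2 hb.2 hab.2) (abs_nonneg _) h0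
    push_cast
    linarith

end Lattice

/-! ### Trigonometric polynomials -/

section Trig

lemma mono_zero (x : Torus) : mono 0 x = 1 := by simp [mono]

lemma norm_mono (n : Freq) (x : Torus) : ‖mono n x‖ = 1 := by
  simp [mono, fourier_apply, Circle.norm_coe]

lemma mono_add_apply (n : Freq) (x y : Torus) : mono n (x + y) = mono n x * mono n y := by
  simp only [mono, ContinuousMap.coe_mk, Pi.add_apply, ← Finset.prod_mul_distrib]
  refine Finset.prod_congr rfl fun i _ => ?_
  simp [fourier_apply, AddCircle.toCircle_add, smul_add]

/-- Translation by half a period in a coordinate with nᵢ ≠ 0 changes the sign of the character and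
preserves the integral. -/
lemma integral_mono_eq_zero {n : Freq} (hn : n ≠ 0) : ∫ x, mono n x = 0 := by
  obtain ⟨i, hi⟩ := Function.ne_iff.1 hn
  set h : Torus := Pi.single i ((2 * Real.pi / 2 / (n i) : ℝ) : AddCircle (2 * Real.pi)) with hh
  have hh1 : mono n h = -1 := by
    simp only [mono, ContinuousMap.coe_mk]
    rw [Finset.prod_eq_single i]
    · have := fourier_add_half_inv_index (T := 2 * Real.pi) (hn := hi)
        Real.two_pi_pos (0 : AddCircle (2 * Real.pi))
      rw [zero_add] at this
      rw [hh, Pi.single_eq_same, this]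
      simp
    · intro j _ hj
      simp [hh, Pi.single_eq_of_ne hj]
    · simp
  have h1 : ∫ x, mono n (x + h) = ∫ x, mono n x :=
    integral_add_right_eq_self (μ := (volume : Measure Torus)) (fun x => mono n x) h
  simp only [mono_add_apply, hh1] at h1
  rw [integral_mul_const] at h1
  have h2 : (2 : ℂ) * ∫ x, mono n x = 0 := by linear_combination -h1
  exact (mul_eq_zero.1 h2).resolve_left two_ne_zero

lemma volume_real_torus : (volume : Measure Torus).real Set.univ = (2 * Real.pi) ^ 2 := by
  rw [Measure.real, volume_pi, Measure.pi_univ]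
  simp only [AddCircle.measure_univ, Finset.prod_const, Finset.card_univ, Fintype.card_fin]
  rw [ENNReal.toReal_pow, ENNReal.toReal_ofReal Real.two_pi_pos.le]

lemma integral_basisFun_mul_conj (m n : Freq) :
    ∫ x, basisFun m x * conj (basisFun n x) = if m = n then 1 else 0 := by
  have h2 : (2 * Real.pi : ℂ) ≠ 0 := by
    exact_mod_cast Real.two_pi_pos.ne'
  have e : ∀ x, basisFun m x * conj (basisFun n x)
      = (2 * Real.pi : ℂ)⁻¹ * (2 * Real.pi : ℂ)⁻¹ * mono (m - n) x := by
    intro x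
    rw [← basisFun_neg, sub_eq_add_neg, mono_add]
    simp only [basisFun]
    ring
  simp_rw [e]
  rw [integral_const_mul]
  split_ifs with h
  · subst h
    simp only [sub_self, mono_zero, integral_const, volume_real_torus]
    rw [Complex.real_smul]
    push_cast
    field_simp
  · rw [integral_mono_eq_zero (sub_ne_zero.2 h), mul_zero]

lemma integrable_torus {f : Torus → ℂ} (hf : Continuous f) : Integrable f :=
  hf.integrable_of_hasCompactSupport (HasCompactSupport.of_compactSpace f)

lemma torusCoeff_sum {ι : Type*} (s : Finset ι) {f : ι → Torus → ℂ} (hf : ∀ i ∈ s, Continuous (f i))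
    (c : ι → ℂ) (n : Freq) :
    torusCoeff (fun x => ∑ i ∈ s, c i * f i x) n = ∑ i ∈ s, c i * torusCoeff (f i) n := by
  simp only [torusCoeff, Finset.sum_mul, mul_assoc]
  rw [integral_finsetSum]
  · simp_rw [integral_const_mul]
  · intro i hi
    exact (integrable_torus ((hf i hi).mul (Complex.continuous_conj.comp
      (continuous_basisFun n)))).const_mul _

lemma torusCoeff_basisFun_sum (F : Finset Freq) (c : Freq → ℂ) (n : Freq) :
    torusCoeff (fun x => ∑ m ∈ F, c m * basisFun m x) n = if n ∈ F then c n else 0 := by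
  rw [torusCoeff_sum F (fun m _ => continuous_basisFun m)]
  simp only [torusCoeff, integral_basisFun_mul_conj, mul_ite, mul_one, mul_zero,
    Finset.sum_ite_eq']

/-- Trigonometric polynomials with frequencies in `freqBox R`. -/
noncomputable def trigPoly (R : ℕ) : Submodule ℂ (Torus → ℂ) :=
  Submodule.span ℂ (basisFun '' (freqBox R : Set Freq))

lemma basisFun_mem_trigPoly {R : ℕ} {n : Freq} (h : n ∈ freqBox R) : basisFun n ∈ trigPoly R :=
  Submodule.subset_span ⟨n, h, rfl⟩

lemma basisFun_mul (m n : Freq) (x : Torus) :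
    basisFun m x * basisFun n x = (2 * Real.pi : ℂ)⁻¹ * basisFun (m + n) x := by
  simp only [basisFun, mono_add]
  ring

lemma trigPoly_eq_sum {R : ℕ} {f : Torus → ℂ} (hf : f ∈ trigPoly R) (x : Torus) :
    f x = ∑ n ∈ freqBox R, torusCoeff f n * basisFun n x := by
  obtain ⟨c, hc⟩ : ∃ c : Freq → ℂ, f = fun x => ∑ n ∈ freqBox R, c n * basisFun n x := by
    rw [trigPoly] at hf
    induction hf using Submodule.span_induction with
    | mem f hf =>
      obtain ⟨m, hm, rfl⟩ := hf
      refine ⟨Pi.single m 1, ?_⟩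
      funext x
      rw [Finset.sum_eq_single m]
      · simp
      · intro n _ hn
        simp [Pi.single_eq_of_ne hn]
      · exact fun h => absurd hm h
    | zero => exact ⟨0, by funext x; simp⟩
    | add f g _ _ hf hg =>
      obtain ⟨c, rfl⟩ := hf
      obtain ⟨d, rfl⟩ := hg
      exact ⟨c + d, by funext x; simp [add_mul, Finset.sum_add_distrib]⟩
    | smul a f _ hf =>
      obtain ⟨c, rfl⟩ := hf
      exact ⟨a • c, by funext x; simp [Finset.mul_sum, mul_assoc]⟩
  rw [hc]
  refine Finset.sum_congr rfl fun n hn => ?_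
  rw [torusCoeff_basisFun_sum, if_pos hn]

lemma torusCoeff_eq_zero {R : ℕ} {f : Torus → ℂ} (hf : f ∈ trigPoly R) {n : Freq}
    (hn : n ∉ freqBox R) : torusCoeff f n = 0 := by
  have : f = fun x => ∑ n ∈ freqBox R, torusCoeff f n * basisFun n x :=
    funext fun x => trigPoly_eq_sum hf x
  rw [this, torusCoeff_basisFun_sum, if_neg hn]

lemma sum_mem_trigPoly {R : ℕ} {F : Finset Freq} (hF : F ⊆ freqBox R) (c : Freq → ℂ) :
    (fun x => ∑ n ∈ F, c n * basisFun n x) ∈ trigPoly R := by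
  have : (fun x => ∑ n ∈ F, c n * basisFun n x) = ∑ n ∈ F, c n • basisFun n := by
    funext x
    simp
  rw [this]
  exact Submodule.sum_mem _ fun n hn => Submodule.smul_mem _ _ (basisFun_mem_trigPoly (hF hn))

lemma trigPoly_mono {R S : ℕ} (h : R ≤ S) : trigPoly R ≤ trigPoly S := by
  refine Submodule.span_mono (Set.image_mono ?_)
  intro n hn
  rw [Finset.mem_coe, mem_freqBox] at hn ⊢
  exact fun i => (hn i).trans (by exact_mod_cast h)

lemma add_mem_freqBox {R S : ℕ} {m n : Freq} (hm : m ∈ freqBox R) (hn : n ∈ freqBox S) :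
    m + n ∈ freqBox (R + S) := by
  rw [mem_freqBox] at *
  intro i
  push_cast
  exact (abs_add_le _ _).trans (add_le_add (hm i) (hn i))

lemma sum_mem_freqBox {ℓ R : ℕ} {v : Fin ℓ → Freq} (hv : ∀ i, v i ∈ freqBox R) :
    ∑ i, v i ∈ freqBox (ℓ * R) := by
  rw [mem_freqBox]
  intro i
  rw [Finset.sum_apply]
  refine (Finset.abs_sum_le_sum_abs _ _).trans ?_
  refine (Finset.sum_le_card_nsmul _ _ (R : ℤ) fun j _ => mem_freqBox.1 (hv j) i).trans ?_
  simp

lemma mul_mem_trigPoly {R S : ℕ} {f g : Torus → ℂ} (hf : f ∈ trigPoly R) (hg : g ∈ trigPoly S) :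
    (fun x => f x * g x) ∈ trigPoly (R + S) := by
  have e : (fun x => f x * g x) = ∑ m ∈ freqBox R, ∑ n ∈ freqBox S,
      (torusCoeff f m * torusCoeff g n * (2 * Real.pi : ℂ)⁻¹) • basisFun (m + n) := by
    funext x
    rw [trigPoly_eq_sum hf x, trigPoly_eq_sum hg x, Finset.sum_mul_sum, Finset.sum_apply]
    refine Finset.sum_congr rfl fun m _ => ?_
    rw [Finset.sum_apply]
    refine Finset.sum_congr rfl fun n _ => ?_
    rw [Pi.smul_apply, smul_eq_mul, mul_mul_mul_comm, basisFun_mul]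
    ring
  rw [e]
  exact Submodule.sum_mem _ fun m hm => Submodule.sum_mem _ fun n hn =>
    Submodule.smul_mem _ _ (basisFun_mem_trigPoly (add_mem_freqBox hm hn))

lemma const_mem_trigPoly (R : ℕ) (c : ℂ) : (fun _ => c) ∈ trigPoly R := by
  have h2 : (2 * Real.pi : ℂ) ≠ 0 := by exact_mod_cast Real.two_pi_pos.ne'
  have e : (fun _ : Torus => c) = (c * (2 * Real.pi : ℂ)) • basisFun 0 := by
    funext x
    simp only [Pi.smul_apply, smul_eq_mul, basisFun, mono_zero]
    field_simp
  rw [e]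
  exact Submodule.smul_mem _ _ (basisFun_mem_trigPoly (by simp [mem_freqBox]))

lemma hermiteVar_mem_trigPoly {R : ℕ} {f : Torus → ℝ} (hf : (fun x => (f x : ℂ)) ∈ trigPoly R)
    (s : ℝ) (ℓ : ℕ) : (fun x => (hermiteVar ℓ (f x) s : ℂ)) ∈ trigPoly (ℓ * R) := by
  induction ℓ using Nat.twoStepInduction with
  | zero => simpa [hermiteVar] using const_mem_trigPoly (0 * R) 1
  | one => simpa [hermiteVar] using hf
  | more k h1 h2 =>
    have e : (fun x => (hermiteVar (k + 2) (f x) s : ℂ))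
        = (fun x => (f x : ℂ) * (hermiteVar (k + 1) (f x) s : ℂ))
          - (((k + 1) * s : ℝ) : ℂ) • fun x => (hermiteVar k (f x) s : ℂ) := by
      funext x
      simp [hermiteVar]
    rw [e]
    refine Submodule.sub_mem _ ?_ (Submodule.smul_mem _ _ (trigPoly_mono ?_ h1))
    · exact trigPoly_mono (by ring_nf; rfl) (mul_mem_trigPoly hf h2)
    · exact Nat.mul_le_mul_right _ (by omega)

/-- Quadrature: finitely many weighted point evaluations that reproduce given linear functionals
on trigonometric polynomials. -/
lemma exists_quadrature (R : ℕ) (φ : Freq → ℂ) :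
    ∃ ψ : Torus →₀ ℂ, (∀ n ∈ freqBox R, ∑ y ∈ ψ.support, ψ y * basisFun n y = φ n) ∧
      ∀ f ∈ trigPoly R, ∑ y ∈ ψ.support, ψ y * f y = ∑ n ∈ freqBox R, φ n * torusCoeff f n := by
  set e : Torus → (freqBox R → ℂ) := fun x n => basisFun n.1 x with he
  -- A functional that annihilates all vectors (eₙ(x))ₙ is a trigonometric polynomial vanishing at
  -- every x, so all its coefficients vanish.
  have htop : Submodule.span ℂ (Set.range e) = ⊤ := by
    rw [← Submodule.dualAnnihilator_eq_bot_iff, eq_bot_iff]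
    intro L hL
    rw [Submodule.mem_dualAnnihilator] at hL
    have h0 : ∀ x, ∑ n : freqBox R, L (Pi.single n 1) * basisFun n.1 x = 0 := by
      intro x
      rw [← hL (e x) (Submodule.subset_span ⟨x, rfl⟩)]
      conv_rhs => rw [pi_eq_sum_univ' (e x)]
      rw [map_sum]
      refine Finset.sum_congr rfl fun n _ => ?_
      rw [map_smul, smul_eq_mul, mul_comm]
    have h1 : ∀ n : freqBox R, L (Pi.single n 1) = 0 := by
      classical
      intro n
      have := torusCoeff_basisFun_sum (freqBox R)
        (fun m => if h : m ∈ freqBox R then L (Pi.single ⟨m, h⟩ 1) else 0) n.1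
      rw [if_pos n.2, dif_pos n.2] at this
      rw [← this]
      have hz : (fun x => ∑ m ∈ freqBox R,
          (if h : m ∈ freqBox R then L (Pi.single ⟨m, h⟩ 1) else 0) * basisFun m x)
          = fun _ => 0 := by
        funext x
        rw [← h0 x, ← Finset.sum_coe_sort (freqBox R)]
        refine Finset.sum_congr rfl fun m _ => ?_
        rw [dif_pos m.2]
      rw [hz]
      simp [torusCoeff]
    rw [Submodule.mem_bot]
    refine LinearMap.pi_ext fun n c => ?_
    have : (Pi.single n c : freqBox R → ℂ) = c • Pi.single n 1 := by
      rw [← Pi.single_smul, smul_eq_mul, mul_one]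
    rw [this, map_smul, h1]
    simp
  have hmem : (fun n : freqBox R => φ n.1) ∈ Submodule.span ℂ (Set.range e) := by
    rw [htop]; trivial
  obtain ⟨ψ, hψ⟩ := Finsupp.mem_span_range_iff_exists_finsupp.1 hmem
  have h1 : ∀ n ∈ freqBox R, ∑ y ∈ ψ.support, ψ y * basisFun n y = φ n := by
    intro n hn
    have := congrFun hψ ⟨n, hn⟩
    simpa [Finsupp.sum, he] using this
  refine ⟨ψ, h1, fun f hf => ?_⟩
  have e2 : ∀ y ∈ ψ.support, ψ y * f y
      = ∑ n ∈ freqBox R, torusCoeff f n * (ψ y * basisFun n y) := by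
    intro y _
    rw [trigPoly_eq_sum hf y, Finset.mul_sum]
    exact Finset.sum_congr rfl fun n _ => by ring
  rw [Finset.sum_congr rfl e2, Finset.sum_comm]
  refine Finset.sum_congr rfl fun n hn => ?_
  rw [← Finset.mul_sum, h1 n hn, mul_comm]

end Trig

/-! ### Truncated fields and Wick powers as trigonometric polynomials -/

section Field

variable {Ω : Type*} {B : Freq → ℝ≥0 → Ω → ℂ} {χ : ℝ → ℝ}

/-- The real part is the average of the complex sum and its conjugate, and the conjugate has its
frequencies in the same symmetric box. This holds for every ω, without the reality of the noise. -/
lemma truncConv_mem_trigPoly (hχ : IsCutoff χ) {N : ℕ} (hN : 1 ≤ N) (z : ℝ × ℝ) (ω : Ω) :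
    (fun x => (truncConv χ B N z.1 z.2 ω x : ℂ)) ∈ trigPoly (2 * N) := by
  have e : (fun x => (truncConv χ B N z.1 z.2 ω x : ℂ))
      = (2⁻¹ : ℂ) • ((fun x => ∑ n ∈ freqBox (2 * N),
          (χ (bracket n / N) : ℂ) * stochConv B z.1 z.2 ω n * basisFun n x)
        + fun x => ∑ n ∈ freqBox (2 * N),
          conj ((χ (bracket (-n) / N) : ℂ) * stochConv B z.1 z.2 ω (-n)) * basisFun n x) := by
    funext x
    have h1 : ∑ n ∈ freqBox (2 * N),
          conj ((χ (bracket (-n) / N) : ℂ) * stochConv B z.1 z.2 ω (-n)) * basisFun n x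
        = conj (∑ n ∈ freqBox (2 * N),
          (χ (bracket n / N) : ℂ) * stochConv B z.1 z.2 ω n * basisFun n x) := by
      rw [map_sum]
      refine Finset.sum_nbij' (fun n => -n) (fun n => -n) (fun _ => neg_mem_freqBox)
        (fun _ => neg_mem_freqBox) (fun n _ => neg_neg n) (fun n _ => neg_neg n) fun n _ => ?_
      rw [map_mul _ _ (basisFun _ x), basisFun_neg, Complex.conj_conj]
    rw [truncConv, tsum_eq_sum (s := freqBox (2 * N)), Pi.smul_apply, Pi.add_apply, h1,
      Complex.add_conj, smul_eq_mul]
    · push_cast; ring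
    · intro n hn
      rw [hχ.eq_zero_of_notMem hN le_rfl hn]
      simp
  rw [e]
  exact Submodule.smul_mem _ _ (Submodule.add_mem _ (sum_mem_trigPoly subset_rfl _)
    (sum_mem_trigPoly subset_rfl _))

/-- The variance of the truncated stochastic convolution. -/
noncomputable def truncVar (χ : ℝ → ℝ) (N : ℕ) (z : ℝ × ℝ) : ℝ :=
  ((2 * Real.pi) ^ 2)⁻¹ * ∑ n ∈ freqBox (2 * N), χ (bracket n / N) ^ 2 * modeCov n z z

lemma basisFun_mul_conj_self (n : Freq) (x : Torus) :
    basisFun n x * conj (basisFun n x) = (((2 * Real.pi) ^ 2)⁻¹ : ℝ) := by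
  rw [Complex.mul_conj, Complex.normSq_eq_norm_sq, basisFun, norm_mul, norm_mono, mul_one,
    norm_inv, norm_mul, Complex.norm_real, Complex.norm_ofNat, Real.norm_of_nonneg Real.pi_pos.le,
    inv_pow]

/-- The parameter set `[0,1] × [0,T]`. -/
abbrev paramSet (T : ℝ) : Set (ℝ × ℝ) := Set.Icc (0 : ℝ) 1 ×ˢ Set.Icc (0 : ℝ) T

lemma nonneg_of_mem_paramSet {T : ℝ} {z : ℝ × ℝ} (hz : z ∈ paramSet T) : 0 ≤ z.1 ∧ 0 ≤ z.2 :=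
  ⟨hz.1.1, hz.2.1⟩

lemma continuousOn_truncConv (hχ : IsCutoff χ) (T : ℝ) {N : ℕ} (hN : 1 ≤ N) {ω : Ω}
    (hω : ∀ n, Continuous fun t => B n t ω) (x : Torus) :
    ContinuousOn (fun z : ℝ × ℝ => truncConv χ B N z.1 z.2 ω x) (paramSet T) := by
  have h : ContinuousOn (fun z => modeSum B (freqBox (2 * N))
      (fun n => χ (bracket n / N) * basisFun n x) z ω) (paramSet T) := by
    refine Complex.continuous_re.comp_continuousOn (continuousOn_finsetSum _ fun n _ =>
      continuousOn_const.mul (continuousOn_pathConv T n ?_))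
    exact (hω n).comp continuous_real_toNNReal
  exact h.congr fun z hz => truncConv_eq_modeSum hχ hN le_rfl (nonneg_of_mem_paramSet hz) hω x

variable [MeasurableSpace Ω] {P : Measure Ω} [IsProbabilityMeasure P]

lemma integral_truncConv_sq (hB : IsCylindricalWiener B P) (hχ : IsCutoff χ) {N : ℕ} (hN : 1 ≤ N)
    {z : ℝ × ℝ} (hz : 0 ≤ z.1 ∧ 0 ≤ z.2) (x : Torus) :
    ∫ ω, truncConv χ B N z.1 z.2 ω x ^ 2 ∂P = truncVar χ N z := by
  have h := (hasGaussianLaw_truncConv hB hχ (J := Unit) (N := fun _ => N) (fun _ => hN)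
    (fun _ => le_rfl) (fun _ => hz) (fun _ => x)).2.2 () ()
  simp only [basisFun_mul_conj_self, ← Complex.ofReal_mul, ← Complex.ofReal_sum] at h
  rw [Complex.ofReal_inj] at h
  simp only [sq]
  rw [h, truncVar, Finset.mul_sum]
  exact Finset.sum_congr rfl fun n _ => by ring

lemma wickFun_eq (hB : IsCylindricalWiener B P) (hχ : IsCutoff χ) (ℓ : ℕ) {N : ℕ} (hN : 1 ≤ N)
    {z : ℝ × ℝ} (hz : 0 ≤ z.1 ∧ 0 ≤ z.2) (ω : Ω) (x : Torus) :
    wickFun P χ B ℓ N z.1 z.2 ω x = hermiteVar ℓ (truncConv χ B N z.1 z.2 ω x) (truncVar χ N z) := by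
  rw [wickFun, integral_truncConv_sq hB hχ hN hz]

lemma wickFun_mem_trigPoly (hB : IsCylindricalWiener B P) (hχ : IsCutoff χ) (ℓ : ℕ) {N : ℕ}
    (hN : 1 ≤ N) {z : ℝ × ℝ} (hz : 0 ≤ z.1 ∧ 0 ≤ z.2) (ω : Ω) :
    (fun x => (wickFun P χ B ℓ N z.1 z.2 ω x : ℂ)) ∈ trigPoly (ℓ * (2 * N)) := by
  simp_rw [wickFun_eq hB hχ ℓ hN hz]
  exact hermiteVar_mem_trigPoly (truncConv_mem_trigPoly hχ hN z ω) _ ℓ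

lemma continuousOn_modeCov_self (T : ℝ) (n : Freq) :
    ContinuousOn (fun z => modeCov n z z) (paramSet T) := by
  intro z hz
  rw [ContinuousWithinAt, tendsto_iff_dist_tendsto_zero]
  refine squeeze_zero' (g := fun z' => 2 * (Real.sqrt (T + 8) * Real.sqrt (dist z' z)))
    (Eventually.of_forall fun _ => dist_nonneg) ?_ ?_
  · filter_upwards [self_mem_nhdsWithin] with z' hz'
    have h1 := abs_modeCov_sub_le hz' hz hz' n
    have h2 := abs_modeCov_sub_le hz' hz hz n
    have h3 := modeCov_comm n z' z
    rw [Real.dist_eq]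
    calc _ = |(modeCov n z' z' - modeCov n z' z) + (modeCov n z z' - modeCov n z z)| := by
          rw [h3]; ring_nf
      _ ≤ _ := abs_add_le _ _
      _ ≤ _ := by linarith
  · have : Continuous fun z' : ℝ × ℝ => 2 * (Real.sqrt (T + 8) * Real.sqrt (dist z' z)) := by
      fun_prop
    have h0 := this.tendsto z
    simp only [dist_self, Real.sqrt_zero, mul_zero] at h0
    exact h0.mono_left nhdsWithin_le_nhds

lemma continuousOn_truncVar (T : ℝ) (N : ℕ) : ContinuousOn (truncVar χ N) (paramSet T) :=
  continuousOn_const.mul (continuousOn_finsetSum _ fun n _ =>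
    continuousOn_const.mul (continuousOn_modeCov_self T n))

lemma continuous_hermiteVar_uncurry (ℓ : ℕ) :
    Continuous fun p : ℝ × ℝ => hermiteVar ℓ p.1 p.2 := by
  induction ℓ using Nat.twoStepInduction with
  | zero => exact continuous_const
  | one => exact continuous_fst
  | more k h1 h2 => simp only [hermiteVar]; fun_prop

lemma continuousOn_wickFun (hB : IsCylindricalWiener B P) (hχ : IsCutoff χ) (ℓ : ℕ) (T : ℝ) {N : ℕ}
    (hN : 1 ≤ N) {ω : Ω} (hω : ∀ n, Continuous fun t => B n t ω) (x : Torus) :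
    ContinuousOn (fun z : ℝ × ℝ => wickFun P χ B ℓ N z.1 z.2 ω x) (paramSet T) := by
  have h := (continuous_hermiteVar_uncurry ℓ).comp_continuousOn
    ((continuousOn_truncConv hχ T hN hω x).prodMk (continuousOn_truncVar (χ := χ) T N))
  exact h.congr fun z hz => wickFun_eq hB hχ ℓ hN (nonneg_of_mem_paramSet hz) ω x

lemma aemeasurable_wickFun (hB : IsCylindricalWiener B P) (hχ : IsCutoff χ) (ℓ : ℕ) {N : ℕ}
    (hN : 1 ≤ N) {z : ℝ × ℝ} (hz : 0 ≤ z.1 ∧ 0 ≤ z.2) (x : Torus) :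
    AEMeasurable (fun ω => wickFun P χ B ℓ N z.1 z.2 ω x) P := by
  have h := ((hasGaussianLaw_truncConv hB hχ (J := Unit) (N := fun _ => N) (fun _ => hN)
    (fun _ => le_rfl) (fun _ => hz) (fun _ => x)).1.eval ()).aemeasurable
  exact (continuous_hermiteVar ℓ _).measurable.comp_aemeasurable h

/-- A finite linear combination of the Fourier coefficients of a Wick power. -/
noncomputable def wickForm (P : Measure Ω) (χ : ℝ → ℝ) (B : Freq → ℝ≥0 → Ω → ℂ) (ℓ M N : ℕ)
    (φ : Freq → ℂ) (z : ℝ × ℝ) (ω : Ω) : ℂ :=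
  ∑ n ∈ freqBox (ℓ * (2 * M)), φ n * wickDist P χ B ℓ N z.1 z.2 ω n

/-- Quadrature turns a functional of Fourier coefficients into a finite combination of point values,
so that moments reduce to those of a finite Gaussian vector. The weights depend on φ and M only: the
same ones work for all N ≤ M, all parameters and all ω. -/
lemma exists_wickForm_eq (hB : IsCylindricalWiener B P) (hχ : IsCutoff χ) (ℓ M : ℕ)
    (φ : Freq → ℂ) : ∃ ψ : Torus →₀ ℂ,
      (∀ n ∈ freqBox (ℓ * (2 * M)), ∑ y ∈ ψ.support, ψ y * basisFun n y = φ n) ∧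
      ∀ N, 1 ≤ N → N ≤ M → ∀ z : ℝ × ℝ, 0 ≤ z.1 ∧ 0 ≤ z.2 → ∀ ω,
        wickForm P χ B ℓ M N φ z ω
          = ∑ y ∈ ψ.support, ψ y * (wickFun P χ B ℓ N z.1 z.2 ω y : ℂ) := by
  obtain ⟨ψ, h1, h2⟩ := exists_quadrature (ℓ * (2 * M)) φ
  refine ⟨ψ, h1, fun N hN hNM z hz ω => ?_⟩
  exact (h2 _ (trigPoly_mono (Nat.mul_le_mul_left _ (Nat.mul_le_mul_left _ hNM))
    (wickFun_mem_trigPoly hB hχ ℓ hN hz ω))).symm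

/-- Coefficients outside the smaller box vanish. Two truncation levels can therefore be compared in
a common box. -/
lemma wickForm_eq_of_le (hB : IsCylindricalWiener B P) (hχ : IsCutoff χ) (ℓ : ℕ) {M N : ℕ}
    (hN : 1 ≤ N) (hM : N ≤ M) (φ : Freq → ℂ) {z : ℝ × ℝ} (hz : 0 ≤ z.1 ∧ 0 ≤ z.2) (ω : Ω) :
    wickForm P χ B ℓ M N φ z ω = wickForm P χ B ℓ N N φ z ω := by
  refine (Finset.sum_subset ?_ fun n _ hn => ?_).symm
  · intro n hn
    rw [mem_freqBox] at hn ⊢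
    exact fun i => (hn i).trans (by gcongr)
  · rw [wickDist, torusCoeff_eq_zero (wickFun_mem_trigPoly hB hχ ℓ hN hz ω) hn, mul_zero]

lemma aemeasurable_wickForm (hB : IsCylindricalWiener B P) (hχ : IsCutoff χ) (ℓ : ℕ) {M N : ℕ}
    (hN : 1 ≤ N) (hM : N ≤ M) (φ : Freq → ℂ) {z : ℝ × ℝ} (hz : 0 ≤ z.1 ∧ 0 ≤ z.2) :
    AEMeasurable (wickForm P χ B ℓ M N φ z) P := by
  obtain ⟨ψ, -, h⟩ := exists_wickForm_eq hB hχ ℓ M φ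
  have e : wickForm P χ B ℓ M N φ z
      = fun ω => ∑ y ∈ ψ.support, ψ y * (wickFun P χ B ℓ N z.1 z.2 ω y : ℂ) :=
    funext fun ω => h N hN hM z hz ω
  rw [e]
  exact Finset.aemeasurable_fun_sum _ fun y _ =>
    ((aemeasurable_wickFun hB hχ ℓ hN hz y).complex_ofReal).const_mul _

/-- Each coefficient is a finite combination of point values, so continuity in (ε,t) is inherited
pointwise in x, without exchanging a limit and an integral. -/
lemma continuousOn_wickDist (hB : IsCylindricalWiener B P) (hχ : IsCutoff χ) (ℓ : ℕ) (T : ℝ) {N : ℕ}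
    (hN : 1 ≤ N) {ω : Ω} (hω : ∀ n, Continuous fun t => B n t ω) (n : Freq) :
    ContinuousOn (fun z : ℝ × ℝ => wickDist P χ B ℓ N z.1 z.2 ω n) (paramSet T) := by
  by_cases hn : n ∈ freqBox (ℓ * (2 * N))
  · obtain ⟨ψ, -, h⟩ := exists_wickForm_eq hB hχ ℓ N (Pi.single n 1)
    have hc : ContinuousOn (fun z : ℝ × ℝ => ∑ y ∈ ψ.support,
        ψ y * (wickFun P χ B ℓ N z.1 z.2 ω y : ℂ)) (paramSet T) :=
      continuousOn_finsetSum _ fun y _ => continuousOn_const.mul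
        (Complex.continuous_ofReal.comp_continuousOn (continuousOn_wickFun hB hχ ℓ T hN hω y))
    refine hc.congr fun z hz => ?_
    simp only [← h N hN le_rfl z (nonneg_of_mem_paramSet hz) ω, wickForm]
    rw [Finset.sum_eq_single n]
    · simp
    · intro m _ hm
      simp [Pi.single_eq_of_ne hm]
    · exact fun h' => absurd hn h'
  · refine (continuousOn_const (c := (0 : ℂ))).congr fun z hz => ?_
    exact torusCoeff_eq_zero (wickFun_mem_trigPoly hB hχ ℓ hN (nonneg_of_mem_paramSet hz) ω) hn

end Field

/-! ### Moments of Wick powers -/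

section Moments

variable {Ω : Type*} [MeasurableSpace Ω] {P : Measure Ω}
  {B : Freq → ℝ≥0 → Ω → ℂ} {χ : ℝ → ℝ}

/-- The Fourier coefficients of the covariance of `Ψ_{N}(z)` and `Ψ_{N'}(z')`. -/
noncomputable def covCoef (χ : ℝ → ℝ) (i j : ℕ × (ℝ × ℝ)) (n : Freq) : ℝ :=
  χ (bracket n / i.1) * χ (bracket n / j.1) * modeCov n i.2 j.2

lemma prod_basisFun {ℓ : ℕ} (v : Fin ℓ → Freq) (x : Torus) :
    ∏ k, basisFun (v k) x
      = ((2 * Real.pi : ℂ)⁻¹ ^ ℓ * (2 * Real.pi)) * basisFun (∑ k, v k) x := by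
  have h2 : (2 * Real.pi : ℂ) ≠ 0 := by exact_mod_cast Real.two_pi_pos.ne'
  induction ℓ with
  | zero => simp only [Finset.univ_eq_empty, Finset.prod_empty, Finset.sum_empty, pow_zero, basisFun,
      mono_zero]; field_simp
  | succ ℓ ih =>
    rw [Fin.prod_univ_succ, Fin.sum_univ_succ, ih]
    have := basisFun_mul (v 0) (∑ k : Fin ℓ, v k.succ) x
    rw [pow_succ]
    linear_combination (((2 * Real.pi : ℂ)⁻¹ ^ ℓ * (2 * Real.pi))) * this

/-- Second moments of linear combinations of jointly Gaussian Hermite variables with complex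
coefficients. -/
lemma integral_norm_sq_sum {J : Type*} [Fintype J] {h : J → Ω → ℝ} (hm : ∀ j, MemLp (h j) 2 P)
    (W : J → ℂ) :
    ((∫ ω, ‖∑ j, W j * (h j ω : ℂ)‖ ^ 2 ∂P : ℝ) : ℂ)
      = ∑ i, ∑ j, W i * conj (W j) * ((∫ ω, h i ω * h j ω ∂P : ℝ) : ℂ) := by
  have hi : ∀ i j, Integrable (fun ω => ((h i ω * h j ω : ℝ) : ℂ)) P := fun i j =>
    ((hm i).integrable_mul (hm j)).ofReal
  have e : ∀ ω, ((‖∑ j, W j * (h j ω : ℂ)‖ ^ 2 : ℝ) : ℂ)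
      = ∑ i, ∑ j, W i * conj (W j) * ((h i ω * h j ω : ℝ) : ℂ) := by
    intro ω
    push_cast
    rw [← Complex.mul_conj', map_sum, Finset.sum_mul_sum]
    refine Finset.sum_congr rfl fun i _ => Finset.sum_congr rfl fun j _ => ?_
    rw [map_mul, Complex.conj_ofReal]
    ring
  rw [← integral_complex_ofReal]
  simp_rw [e]
  rw [integral_finsetSum _ fun i _ => integrable_finsetSum _ fun j _ => (hi i j).const_mul _]
  refine Finset.sum_congr rfl fun i _ => ?_
  rw [integral_finsetSum _ fun j _ => (hi i j).const_mul _]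
  refine Finset.sum_congr rfl fun j _ => ?_
  rw [integral_const_mul, integral_complex_ofReal]

variable [IsProbabilityMeasure P]

/-- Second moment of a linear combination of Fourier coefficients of Wick powers. -/
theorem integral_norm_sq_wickForm (hB : IsCylindricalWiener B P) (hχ : IsCutoff χ) (ℓ M : ℕ)
    {I : Type*} [Fintype I] {Nz : I → ℕ × (ℝ × ℝ)} (hN : ∀ i, 1 ≤ (Nz i).1)
    (hM : ∀ i, (Nz i).1 ≤ M) (hz : ∀ i, 0 ≤ (Nz i).2.1 ∧ 0 ≤ (Nz i).2.2) (α : I → ℝ)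
    (φ : Freq → ℂ) :
    ∫ ω, ‖∑ i, (α i : ℂ) * wickForm P χ B ℓ M (Nz i).1 φ (Nz i).2 ω‖ ^ 2 ∂P
      = ∑ v ∈ Fintype.piFinset (fun _ : Fin ℓ => freqBox (2 * M)),
        ℓ.factorial * (∑ i, ∑ j, α i * α j * ∏ k, covCoef χ (Nz i) (Nz j) (v k))
          * ‖((2 * Real.pi : ℂ)⁻¹ ^ ℓ * (2 * Real.pi)) * φ (∑ k, v k)‖ ^ 2 := by
  obtain ⟨ψ, hψ, hW⟩ := exists_wickForm_eq (P := P) (B := B) hB hχ ℓ M φ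
  have hR : ∀ i, 2 * (Nz i).1 ≤ 2 * M := fun i => Nat.mul_le_mul_left _ (hM i)
  obtain ⟨hG, h0, hcov⟩ := hasGaussianLaw_truncConv hB hχ (J := I × ψ.support)
    (N := fun j => (Nz j.1).1) (fun j => hN j.1) (fun j => hR j.1) (z := fun j => (Nz j.1).2)
    (fun j => hz j.1) (fun j => j.2.1)
  set h : I × ψ.support → Ω → ℝ := fun j ω => wickFun P χ B ℓ (Nz j.1).1 (Nz j.1).2.1 (Nz j.1).2.2 ω
    j.2.1 with hh
  have hm : ∀ j, MemLp (h j) 2 P := fun j => memLp_hermiteVar hG h0 ℓ j (by norm_num)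
  have hmul : ∀ i j, ∫ ω, h i ω * h j ω ∂P = ℓ.factorial
      * (∫ ω, truncConv χ B (Nz i.1).1 (Nz i.1).2.1 (Nz i.1).2.2 ω i.2.1
          * truncConv χ B (Nz j.1).1 (Nz j.1).2.1 (Nz j.1).2.2 ω j.2.1 ∂P) ^ ℓ := fun i j =>
    integral_hermiteVar_mul_hermiteVar hG h0 ℓ i j
  have hsum : ∀ ω, ∑ i, (α i : ℂ) * wickForm P χ B ℓ M (Nz i).1 φ (Nz i).2 ω
      = ∑ j : I × ψ.support, ((α j.1 : ℂ) * ψ j.2.1) * (h j ω : ℂ) := by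
    intro ω
    rw [Fintype.sum_prod_type]
    refine Finset.sum_congr rfl fun i _ => ?_
    rw [hW _ (hN i) (hM i) _ (hz i), Finset.mul_sum, ← Finset.sum_coe_sort ψ.support]
    exact Finset.sum_congr rfl fun y _ => by simp only [hh]; ring
  simp_rw [hsum]
  rw [← Complex.ofReal_inj, integral_norm_sq_sum hm]
  set D : ℂ := (2 * Real.pi : ℂ)⁻¹ ^ ℓ * (2 * Real.pi) with hD
  -- expand the powers of the covariances
  have hpow : ∀ i j, ((∫ ω, h i ω * h j ω ∂P : ℝ) : ℂ)
      = ∑ v ∈ Fintype.piFinset (fun _ : Fin ℓ => freqBox (2 * M)),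
        (ℓ.factorial : ℂ) * ((∏ k, covCoef χ (Nz i.1) (Nz j.1) (v k) : ℝ) : ℂ)
          * ((D * basisFun (∑ k, v k) i.2.1) * conj (D * basisFun (∑ k, v k) j.2.1)) := by
    intro i j
    rw [hmul, Complex.ofReal_mul, Complex.ofReal_pow, hcov i j, Finset.sum_pow', Finset.mul_sum,
      Complex.ofReal_natCast]
    refine Finset.sum_congr rfl fun v _ => ?_
    rw [Finset.prod_mul_distrib, Finset.prod_mul_distrib, prod_basisFun, ← map_prod, prod_basisFun,
      Complex.ofReal_prod]
    simp only [covCoef]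
    ring
  simp_rw [hpow]
  push_cast
  simp_rw [Finset.mul_sum]
  rw [Finset.sum_congr rfl fun i _ => Finset.sum_comm, Finset.sum_comm]
  refine Finset.sum_congr rfl fun v hv => ?_
  -- The quadrature weights reproduce φ at the frequency ∑vₖ, which lies in the box of size ℓ·2M.
  have hφ : ∑ y : ψ.support, ψ y.1 * (D * basisFun (∑ k, v k) y.1) = D * φ (∑ k, v k) := by
    rw [← hψ _ (sum_mem_freqBox (Fintype.mem_piFinset.1 hv)), Finset.mul_sum,
      ← Finset.sum_coe_sort ψ.support]
    exact Finset.sum_congr rfl fun y _ => by ring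
  rw [Fintype.sum_prod_type, ← Complex.mul_conj', ← hφ, map_sum]
  simp_rw [Fintype.sum_prod_type]
  have e1 : ∀ i : I, ∑ y : ψ.support, ∑ j : I, ∑ y' : ψ.support,
      (α i : ℂ) * ψ y.1 * conj ((α j : ℂ) * ψ y'.1) * ((ℓ.factorial : ℂ)
        * (∏ k, (covCoef χ (Nz i) (Nz j) (v k) : ℂ))
        * ((D * basisFun (∑ k, v k) y.1) * conj (D * basisFun (∑ k, v k) y'.1)))
      = ∑ j : I, ((ℓ.factorial : ℂ) * ((α i : ℂ) * α j
          * ∏ k, (covCoef χ (Nz i) (Nz j) (v k) : ℂ)))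
        * ((∑ y : ψ.support, ψ y.1 * (D * basisFun (∑ k, v k) y.1))
          * ∑ y : ψ.support, conj (ψ y.1 * (D * basisFun (∑ k, v k) y.1))) := by
    intro i
    rw [Finset.sum_comm]
    refine Finset.sum_congr rfl fun j _ => ?_
    rw [Finset.sum_mul_sum, Finset.mul_sum]
    refine Finset.sum_congr rfl fun y _ => ?_
    rw [Finset.mul_sum]
    refine Finset.sum_congr rfl fun y' _ => ?_
    simp only [map_mul, Complex.conj_ofReal]
    ring
  have e2 := Finset.sum_congr (rfl : (Finset.univ : Finset I) = Finset.univ) fun i _ => e1 i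
  refine Eq.trans ?_ (e2.trans ?_)
  · rfl
  · simp only [← Finset.sum_mul]

/-- Hypercontractivity for linear combinations of Fourier coefficients of Wick powers. -/
theorem integral_norm_pow_wickForm_le (hB : IsCylindricalWiener B P) (hχ : IsCutoff χ) (ℓ M k : ℕ)
    {I : Type*} [Fintype I] {Nz : I → ℕ × (ℝ × ℝ)} (hN : ∀ i, 1 ≤ (Nz i).1)
    (hM : ∀ i, (Nz i).1 ≤ M) (hz : ∀ i, 0 ≤ (Nz i).2.1 ∧ 0 ≤ (Nz i).2.2) (α : I → ℝ)
    (φ : Freq → ℂ) :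
    Integrable (fun ω => ‖∑ i, (α i : ℂ) * wickForm P χ B ℓ M (Nz i).1 φ (Nz i).2 ω‖
        ^ (2 * (k + 1))) P ∧
    ∫ ω, ‖∑ i, (α i : ℂ) * wickForm P χ B ℓ M (Nz i).1 φ (Nz i).2 ω‖ ^ (2 * (k + 1)) ∂P
      ≤ 2 ^ (k + 1) * ((2 * k + 1 : ℝ) ^ ℓ
        * ∫ ω, ‖∑ i, (α i : ℂ) * wickForm P χ B ℓ M (Nz i).1 φ (Nz i).2 ω‖ ^ 2 ∂P) ^ (k + 1) := by
  obtain ⟨ψ, hψ, hW⟩ := exists_wickForm_eq (P := P) (B := B) hB hχ ℓ M φ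
  have hR : ∀ i, 2 * (Nz i).1 ≤ 2 * M := fun i => Nat.mul_le_mul_left _ (hM i)
  obtain ⟨hG, h0, hcov⟩ := hasGaussianLaw_truncConv hB hχ (J := I × ψ.support)
    (N := fun j => (Nz j.1).1) (fun j => hN j.1) (fun j => hR j.1) (z := fun j => (Nz j.1).2)
    (fun j => hz j.1) (fun j => j.2.1)
  set h : I × ψ.support → Ω → ℝ := fun j ω => wickFun P χ B ℓ (Nz j.1).1 (Nz j.1).2.1 (Nz j.1).2.2 ω
    j.2.1 with hh
  have hm : ∀ (q : ℝ≥0∞), q ≠ ∞ → ∀ j, MemLp (h j) q P := fun q hq j =>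
    memLp_hermiteVar hG h0 ℓ j hq
  have hyp : ∀ w : I × ψ.support → ℝ, ∫ ω, (∑ j, w j * h j ω) ^ (2 * (k + 1)) ∂P
      ≤ ((2 * k + 1 : ℝ) ^ ℓ * ∫ ω, (∑ j, w j * h j ω) ^ 2 ∂P) ^ (k + 1) := fun w =>
    integral_hermite_sum_pow_le hG h0 ℓ k w
  have hsum : ∀ ω, ∑ i, (α i : ℂ) * wickForm P χ B ℓ M (Nz i).1 φ (Nz i).2 ω
      = ∑ j : I × ψ.support, ((α j.1 : ℂ) * ψ j.2.1) * (h j ω : ℂ) := by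
    intro ω
    rw [Fintype.sum_prod_type]
    refine Finset.sum_congr rfl fun i _ => ?_
    rw [hW _ (hN i) (hM i) _ (hz i), Finset.mul_sum, ← Finset.sum_coe_sort ψ.support]
    exact Finset.sum_congr rfl fun y _ => by simp only [hh]; ring
  simp_rw [hsum]
  set W : I × ψ.support → ℂ := fun j => (α j.1 : ℂ) * ψ j.2.1 with hWdef
  set X : Ω → ℝ := fun ω => ∑ j, (W j).re * h j ω with hX
  set Y : Ω → ℝ := fun ω => ∑ j, (W j).im * h j ω with hY
  -- The available hypercontractivity concerns real combinations, so it is applied to the real and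
  -- the imaginary part separately.
  have hZ : ∀ ω, ‖∑ j, W j * (h j ω : ℂ)‖ ^ 2 = X ω ^ 2 + Y ω ^ 2 := by
    intro ω
    rw [← Complex.normSq_eq_norm_sq, Complex.normSq_apply, Complex.re_sum, Complex.im_sum]
    simp only [Complex.re_mul_ofReal, Complex.im_mul_ofReal, hX, hY]
    ring
  have mX : ∀ q : ℝ≥0∞, q ≠ ∞ → MemLp X q P := fun q hq =>
    memLp_finsetSum _ fun j _ => (hm q hq j).const_mul _
  have mY : ∀ q : ℝ≥0∞, q ≠ ∞ → MemLp Y q P := fun q hq =>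
    memLp_finsetSum _ fun j _ => (hm q hq j).const_mul _
  have hpowi : ∀ {X : Ω → ℝ}, (∀ q : ℝ≥0∞, q ≠ ∞ → MemLp X q P) → ∀ m : ℕ,
      Integrable (fun ω => X ω ^ (2 * m)) P := by
    intro X hX m
    have := (hX ((2 * m : ℕ) : ℝ≥0∞) (ENNReal.natCast_ne_top _)).integrable_norm_pow'
    refine this.congr (Eventually.of_forall fun ω => ?_)
    simp only [Real.norm_eq_abs, pow_mul, sq_abs]
  have mZ : ∀ q : ℝ≥0∞, q ≠ ∞ → MemLp (fun ω => ‖∑ j, W j * (h j ω : ℂ)‖) q P := fun q hq =>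
    (memLp_finsetSum _ fun j _ => ((hm q hq j).ofReal (K := ℂ)).const_mul (W j)).norm
  have iX := hpowi mX
  have iY := hpowi mY
  have iX2 : Integrable (fun ω => X ω ^ 2) P := by simpa using iX 1
  have iY2 : Integrable (fun ω => Y ω ^ 2) P := by simpa using iY 1
  refine ⟨hpowi mZ (k + 1), ?_⟩
  have hsplit : ∫ ω, ‖∑ j, W j * (h j ω : ℂ)‖ ^ 2 ∂P = ∫ ω, X ω ^ 2 ∂P + ∫ ω, Y ω ^ 2 ∂P := by
    simp_rw [hZ]
    exact integral_add iX2 iY2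
  have nX : 0 ≤ ∫ ω, X ω ^ 2 ∂P := integral_nonneg fun _ => sq_nonneg _
  have nY : 0 ≤ ∫ ω, Y ω ^ 2 ∂P := integral_nonneg fun _ => sq_nonneg _
  have hc : 0 ≤ (2 * k + 1 : ℝ) ^ ℓ := by positivity
  -- The factor 2^(k+1) is 2^k from the convexity inequality for (X² + Y²)^(k+1), times 2 for the
  -- two parts, each of which is bounded by the full second moment.
  calc ∫ ω, ‖∑ j, W j * (h j ω : ℂ)‖ ^ (2 * (k + 1)) ∂P
      ≤ ∫ ω, (2 : ℝ) ^ k * (X ω ^ (2 * (k + 1)) + Y ω ^ (2 * (k + 1))) ∂P := by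
        refine integral_mono (hpowi mZ (k + 1)) (((iX (k + 1)).add (iY (k + 1))).const_mul _)
          fun ω => ?_
        simp only [pow_mul, hZ]
        have := add_pow_le (sq_nonneg (X ω)) (sq_nonneg (Y ω)) (k + 1)
        simpa using this
    _ = 2 ^ k * (∫ ω, X ω ^ (2 * (k + 1)) ∂P + ∫ ω, Y ω ^ (2 * (k + 1)) ∂P) := by
        rw [integral_const_mul, integral_add (iX _) (iY _)]
    _ ≤ 2 ^ k * (((2 * k + 1 : ℝ) ^ ℓ * ∫ ω, ‖∑ j, W j * (h j ω : ℂ)‖ ^ 2 ∂P) ^ (k + 1)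
          + ((2 * k + 1 : ℝ) ^ ℓ * ∫ ω, ‖∑ j, W j * (h j ω : ℂ)‖ ^ 2 ∂P) ^ (k + 1)) := by
        refine mul_le_mul_of_nonneg_left (add_le_add ?_ ?_) (by positivity)
        · refine (hyp _).trans (pow_le_pow_left₀ (mul_nonneg hc nX)
            (mul_le_mul_of_nonneg_left ?_ hc) _)
          rw [hsplit]; linarith
        · refine (hyp _).trans (pow_le_pow_left₀ (mul_nonneg hc nY)
            (mul_le_mul_of_nonneg_left ?_ hc) _)
          rw [hsplit]; linarith
    _ = _ := by ring

end Moments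

/-! ### Bounds for covariances and moments of differences -/

section Bounds

variable {Ω : Type*} [MeasurableSpace Ω] {P : Measure Ω}
  {B : Freq → ℝ≥0 → Ω → ℂ} {χ : ℝ → ℝ}

lemma IsCutoff.exists_bound (hχ : IsCutoff χ) : ∃ C : ℝ, 1 ≤ C ∧ ∀ x, |χ x| ≤ C := by
  have hc : HasCompactSupport χ := isCompact_Icc.of_isClosed_subset (isClosed_tsupport χ) hχ.supp
  obtain ⟨C, hC⟩ := hc.exists_bound_of_continuous hχ.smooth.continuous
  exact ⟨max C 1, le_max_right _ _, fun x => (hC x).trans (le_max_left _ _)⟩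

lemma norm_quadratureConst_sq_le (ℓ : ℕ) :
    ‖((2 * Real.pi : ℂ)⁻¹ ^ ℓ * (2 * Real.pi))‖ ^ 2 ≤ (2 * Real.pi) ^ 2 := by
  refine pow_le_pow_left₀ (norm_nonneg _) ?_ 2
  rw [norm_mul, norm_pow, norm_inv, norm_mul, Complex.norm_real, Complex.norm_ofNat,
    Real.norm_of_nonneg Real.pi_pos.le]
  refine mul_le_of_le_one_left Real.two_pi_pos.le (pow_le_one₀ (by positivity) ?_)
  exact inv_le_one_of_one_le₀ (by linarith [Real.pi_gt_three])

/-- The common last step of all second moment bounds: a majorant of the products of covariances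
combines with the decay of the test sequence into the lattice sum bounded by C₀. The constants K and
L carry the smallness coming from the covariances and from the test sequence respectively. -/
lemma sum_wick_le {ℓ : ℕ} {η s C₀ A K L : ℝ} (hA : 0 ≤ A) (hL : 0 ≤ L) (hK : 0 ≤ K)
    (hC₀ : ∀ S : Finset Freq, ∑ v ∈ Fintype.piFinset (fun _ : Fin ℓ => S),
      (∏ i, bracket (v i) ^ (-2 + η)) * bracket (∑ i, v i) ^ (-s) ≤ C₀)
    {F : (Fin ℓ → Freq) → ℝ} (hF : ∀ v, F v ≤ K * ∏ k, (A * bracket (v k) ^ (-2 + η)))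
    {φ : Freq → ℂ} (hφ : ∀ m, ‖φ m‖ ^ 2 ≤ L * bracket m ^ (-s)) (S : Finset Freq) :
    ∑ v ∈ Fintype.piFinset (fun _ : Fin ℓ => S),
        ℓ.factorial * F v * ‖((2 * Real.pi : ℂ)⁻¹ ^ ℓ * (2 * Real.pi)) * φ (∑ k, v k)‖ ^ 2
      ≤ ℓ.factorial * (2 * Real.pi) ^ 2 * A ^ ℓ * C₀ * (K * L) := by
  have hb : ∀ (n : Freq) (a : ℝ), 0 ≤ bracket n ^ a := fun n a => Real.rpow_nonneg (bracket_pos n).le a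
  have hterm : ∀ v ∈ Fintype.piFinset (fun _ : Fin ℓ => S),
      ℓ.factorial * F v * ‖((2 * Real.pi : ℂ)⁻¹ ^ ℓ * (2 * Real.pi)) * φ (∑ k, v k)‖ ^ 2
      ≤ ℓ.factorial * (2 * Real.pi) ^ 2 * A ^ ℓ * (K * L)
        * ((∏ i, bracket (v i) ^ (-2 + η)) * bracket (∑ i, v i) ^ (-s)) := by
    intro v _
    have hprod : ∏ k, (A * bracket (v k) ^ (-2 + η)) = A ^ ℓ * ∏ k, bracket (v k) ^ (-2 + η) := by
      rw [Finset.prod_mul_distrib, Finset.prod_const, Finset.card_univ, Fintype.card_fin]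
    have hp : 0 ≤ ∏ k, bracket (v k) ^ (-2 + η) := Finset.prod_nonneg fun k _ => hb _ _
    rw [norm_mul, mul_pow]
    calc ℓ.factorial * F v
          * (‖((2 * Real.pi : ℂ)⁻¹ ^ ℓ * (2 * Real.pi))‖ ^ 2 * ‖φ (∑ k, v k)‖ ^ 2)
        ≤ ℓ.factorial * (K * ∏ k, (A * bracket (v k) ^ (-2 + η)))
          * (‖((2 * Real.pi : ℂ)⁻¹ ^ ℓ * (2 * Real.pi))‖ ^ 2 * ‖φ (∑ k, v k)‖ ^ 2) := by
          gcongr; exact hF v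
      _ ≤ ℓ.factorial * (K * ∏ k, (A * bracket (v k) ^ (-2 + η)))
          * ((2 * Real.pi) ^ 2 * (L * bracket (∑ i, v i) ^ (-s))) := by
          have h1 := norm_quadratureConst_sq_le ℓ
          have h2 := hφ (∑ k, v k)
          rw [hprod]
          gcongr
      _ = _ := by rw [hprod]; ring
  refine (Finset.sum_le_sum hterm).trans ?_
  rw [← Finset.mul_sum]
  refine (mul_le_mul_of_nonneg_left (hC₀ S) (by positivity)).trans_eq (by ring)

lemma abs_covCoef_le {C : ℝ} (hC : ∀ x, |χ x| ≤ C) {i j : ℕ × (ℝ × ℝ)}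
    (hi : 0 ≤ i.2.1 ∧ 0 ≤ i.2.2) (hj : 0 ≤ j.2.1 ∧ 0 ≤ j.2.2) {η : ℝ} (hη : 0 ≤ η) (n : Freq) :
    |covCoef χ i j n| ≤ C ^ 2 * bracket n ^ (-2 + η) := by
  have hC0 : 0 ≤ C := (abs_nonneg _).trans (hC 0)
  have h1 : (bracket n ^ 2)⁻¹ ≤ bracket n ^ (-2 + η) := by
    rw [← Real.rpow_natCast, ← Real.rpow_neg (bracket_pos n).le]
    refine Real.rpow_le_rpow_of_exponent_le (one_le_bracket n) ?_
    push_cast; linarith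
  rw [covCoef, abs_mul, abs_mul, sq]
  have h2 := abs_modeCov_le hi.1 hi.2 hj.1 hj.2 n
  exact mul_le_mul (mul_le_mul (hC _) (hC _) (abs_nonneg _) hC0) (h2.trans h1) (abs_nonneg _)
    (by positivity)

/-- Interpolation between the Hölder bound, uniform in n but without decay, and the decay ⟨n⟩⁻²: a
share η/2 of the first gives the distance to the power η/4, and the remaining share of the second
gives ⟨n⟩^{-2+η}. -/
lemma abs_covCoef_sub_le_dist {C : ℝ} (hC : ∀ x, |χ x| ≤ C) (N : ℕ) {T : ℝ} {z z' : ℝ × ℝ}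
    (hz : z ∈ paramSet T) (hz' : z' ∈ paramSet T) {η : ℝ} (hη : 0 ≤ η) (hη1 : η ≤ 1) (n : Freq) :
    |covCoef χ (N, z) (N, z) n - covCoef χ (N, z) (N, z') n|
      ≤ 2 * (T + 8) * dist z z' ^ (η / 4) * (C ^ 2 * bracket n ^ (-2 + η)) := by
  have hC0 : 0 ≤ C := (abs_nonneg _).trans (hC 0)
  have hT : 0 ≤ T := hz.2.1.trans hz.2.2
  have hb := bracket_pos n
  set m := |modeCov n z z - modeCov n z z'| with hm
  have h1 : m ≤ Real.sqrt (T + 8) * Real.sqrt (dist z z') := abs_modeCov_sub_le hz hz' hz n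
  have h2 : m ≤ 2 * bracket n ^ (-2 : ℝ) := by
    have b1 := nonneg_of_mem_paramSet hz
    have b2 := nonneg_of_mem_paramSet hz'
    have a1 := abs_modeCov_le b1.1 b1.2 b1.1 b1.2 n
    have a2 := abs_modeCov_le b1.1 b1.2 b2.1 b2.2 n
    have e : bracket n ^ (-2 : ℝ) = (bracket n ^ 2)⁻¹ := by
      rw [Real.rpow_neg hb.le]; norm_cast
    rw [e]
    exact (abs_sub _ _).trans (by linarith)
  have hm0 : 0 ≤ m := abs_nonneg _
  have h3 : m ≤ 2 * (T + 8) * dist z z' ^ (η / 4) * bracket n ^ (-2 + η) := by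
    have e1 : m = m ^ (η / 2) * m ^ (1 - η / 2) := by
      rw [← Real.rpow_add_of_nonneg hm0 (by linarith) (by linarith)]
      simp
    have g1 : m ^ (η / 2) ≤ (T + 8) * dist z z' ^ (η / 4) := by
      calc m ^ (η / 2) ≤ (Real.sqrt (T + 8) * Real.sqrt (dist z z')) ^ (η / 2) :=
            Real.rpow_le_rpow hm0 h1 (by linarith)
        _ = (T + 8) ^ (η / 4) * dist z z' ^ (η / 4) := by
            rw [Real.mul_rpow (Real.sqrt_nonneg _) (Real.sqrt_nonneg _), Real.sqrt_eq_rpow,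
              Real.sqrt_eq_rpow, ← Real.rpow_mul (by linarith), ← Real.rpow_mul dist_nonneg]
            ring_nf
        _ ≤ _ := by
            refine mul_le_mul_of_nonneg_right ?_ (Real.rpow_nonneg dist_nonneg _)
            calc (T + 8) ^ (η / 4) ≤ (T + 8) ^ (1 : ℝ) :=
                  Real.rpow_le_rpow_of_exponent_le (by linarith) (by linarith)
              _ = T + 8 := Real.rpow_one _
    have g2 : m ^ (1 - η / 2) ≤ 2 * bracket n ^ (-2 + η) := by
      calc m ^ (1 - η / 2) ≤ (2 * bracket n ^ (-2 : ℝ)) ^ (1 - η / 2) :=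
            Real.rpow_le_rpow hm0 h2 (by linarith)
        _ = 2 ^ (1 - η / 2) * bracket n ^ (-2 + η) := by
            rw [Real.mul_rpow (by norm_num) (Real.rpow_nonneg hb.le _), ← Real.rpow_mul hb.le]
            ring_nf
        _ ≤ _ := by
            refine mul_le_mul_of_nonneg_right ?_ (Real.rpow_nonneg hb.le _)
            calc (2 : ℝ) ^ (1 - η / 2) ≤ 2 ^ (1 : ℝ) :=
                  Real.rpow_le_rpow_of_exponent_le (by norm_num) (by linarith)
              _ = 2 := Real.rpow_one _
    calc m = m ^ (η / 2) * m ^ (1 - η / 2) := e1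
      _ ≤ (T + 8) * dist z z' ^ (η / 4) * (2 * bracket n ^ (-2 + η)) :=
          mul_le_mul g1 g2 (Real.rpow_nonneg hm0 _) (mul_nonneg (by linarith)
            (Real.rpow_nonneg dist_nonneg _))
      _ = _ := by ring
  have e : covCoef χ (N, z) (N, z) n - covCoef χ (N, z) (N, z') n
      = χ (bracket n / N) * χ (bracket n / N) * (modeCov n z z - modeCov n z z') := by
    simp only [covCoef]; ring
  rw [e, abs_mul, abs_mul, ← hm]
  calc |χ (bracket n / N)| * |χ (bracket n / N)| * m
      ≤ C * C * (2 * (T + 8) * dist z z' ^ (η / 4) * bracket n ^ (-2 + η)) :=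
        mul_le_mul (mul_le_mul (hC _) (hC _) (abs_nonneg _) hC0) h3 hm0 (by positivity)
    _ = _ := by ring

/-- For ⟨n⟩ ≤ K both cutoffs equal 1. Otherwise (⟨n⟩/K)^η ≥ 1 and the trivial bound suffices. -/
lemma IsCutoff.abs_sub_le (hχ : IsCutoff χ) {C : ℝ} (hC : ∀ x, |χ x| ≤ C) {K N M : ℕ} (hK : 1 ≤ K)
    (hKN : K ≤ N) (hKM : K ≤ M) {η : ℝ} (hη : 0 ≤ η) (n : Freq) :
    |χ (bracket n / N) - χ (bracket n / M)| ≤ 2 * C * (K : ℝ) ^ (-η) * bracket n ^ η := by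
  have hC0 : 0 ≤ C := (abs_nonneg _).trans (hC 0)
  have hK' : (0 : ℝ) < K := by exact_mod_cast hK
  have hb := bracket_pos n
  rcases le_or_gt (bracket n) K with h | h
  · have h1 : ∀ N : ℕ, K ≤ N → χ (bracket n / N) = 1 := by
      intro N hN
      have hN' : (K : ℝ) ≤ N := by exact_mod_cast hN
      refine hχ.eq_one _ ?_
      rw [abs_of_nonneg (by positivity), div_le_one (hK'.trans_le hN')]
      exact h.trans hN'
    rw [h1 N hKN, h1 M hKM, sub_self, abs_zero]
    positivity
  · have h1 : 1 ≤ (K : ℝ) ^ (-η) * bracket n ^ η := by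
      rw [Real.rpow_neg hK'.le, inv_mul_eq_div, one_le_div (by positivity)]
      exact Real.rpow_le_rpow hK'.le h.le hη
    calc _ ≤ |χ (bracket n / N)| + |χ (bracket n / M)| := abs_sub _ _
      _ ≤ 2 * C * 1 := by linarith [hC (bracket n / N), hC (bracket n / M)]
      _ ≤ 2 * C * ((K : ℝ) ^ (-η) * bracket n ^ η) := by gcongr
      _ = _ := by ring

lemma abs_covCoef_sub_le_cutoff (hχ : IsCutoff χ) {C : ℝ} (hC : ∀ x, |χ x| ≤ C) {K N M : ℕ}
    (hK : 1 ≤ K) (hKN : K ≤ N) (hKM : K ≤ M) {z : ℝ × ℝ} (hz : 0 ≤ z.1 ∧ 0 ≤ z.2) {η : ℝ}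
    (hη : 0 ≤ η) (n : Freq) :
    |covCoef χ (N, z) (N, z) n - covCoef χ (N, z) (M, z) n|
      ≤ 2 * (K : ℝ) ^ (-η) * (C ^ 2 * bracket n ^ (-2 + η)) := by
  have hC0 : 0 ≤ C := (abs_nonneg _).trans (hC 0)
  have hb := bracket_pos n
  have e : covCoef χ (N, z) (N, z) n - covCoef χ (N, z) (M, z) n
      = χ (bracket n / N) * (χ (bracket n / N) - χ (bracket n / M)) * modeCov n z z := by
    simp only [covCoef]; ring
  have h1 := hχ.abs_sub_le hC hK hKN hKM hη n
  have h2 := abs_modeCov_le hz.1 hz.2 hz.1 hz.2 n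
  have h3 : (bracket n ^ 2)⁻¹ * bracket n ^ η = bracket n ^ (-2 + η) := by
    rw [Real.rpow_add hb, Real.rpow_neg hb.le]; norm_cast
  rw [e, abs_mul, abs_mul]
  calc _ ≤ C * (2 * C * (K : ℝ) ^ (-η) * bracket n ^ η) * (bracket n ^ 2)⁻¹ :=
        mul_le_mul (mul_le_mul (hC _) h1 (abs_nonneg _) hC0) h2 (abs_nonneg _) (by positivity)
    _ = 2 * (K : ℝ) ^ (-η) * (C ^ 2 * ((bracket n ^ 2)⁻¹ * bracket n ^ η)) := by ring
    _ = _ := by rw [h3]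

variable [IsProbabilityMeasure P]

/-- Moments of a single Wick power. -/
theorem integral_norm_pow_wickForm_single_le (hB : IsCylindricalWiener B P) (hχ : IsCutoff χ)
    (ℓ k : ℕ) {η s C₀ C L : ℝ} (hη : 0 ≤ η) (hC : ∀ x, |χ x| ≤ C) (hL : 0 ≤ L)
    (hC₀ : ∀ S : Finset Freq, ∑ v ∈ Fintype.piFinset (fun _ : Fin ℓ => S),
      (∏ i, bracket (v i) ^ (-2 + η)) * bracket (∑ i, v i) ^ (-s) ≤ C₀)
    {φ : Freq → ℂ} (hφ : ∀ m, ‖φ m‖ ^ 2 ≤ L * bracket m ^ (-s)) {M N : ℕ} (hN : 1 ≤ N)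
    (hM : N ≤ M) {z : ℝ × ℝ} (hz : 0 ≤ z.1 ∧ 0 ≤ z.2) :
    Integrable (fun ω => ‖wickForm P χ B ℓ M N φ z ω‖ ^ (2 * (k + 1))) P ∧
    ∫ ω, ‖wickForm P χ B ℓ M N φ z ω‖ ^ (2 * (k + 1)) ∂P
      ≤ (2 * (2 * k + 1 : ℝ) ^ ℓ * (ℓ.factorial * (2 * Real.pi) ^ 2 * (C ^ 2) ^ ℓ * C₀)) ^ (k + 1)
        * L ^ (k + 1) := by
  obtain ⟨h1, h2⟩ := integral_norm_pow_wickForm_le hB hχ ℓ M k (I := Unit)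
    (Nz := fun _ => (N, z)) (fun _ => hN) (fun _ => hM) (fun _ => hz) (fun _ => 1) φ
  have h3 := integral_norm_sq_wickForm hB hχ ℓ M (I := Unit)
    (Nz := fun _ => (N, z)) (fun _ => hN) (fun _ => hM) (fun _ => hz) (fun _ => 1) φ
  have h4 := sum_wick_le (A := C ^ 2) (K := 1) (by positivity) hL zero_le_one hC₀
    (F := fun v => ∏ k, covCoef χ (N, z) (N, z) (v k)) (fun v => by
      rw [one_mul]
      refine (le_abs_self _).trans ?_
      rw [Finset.abs_prod]
      exact Finset.prod_le_prod (fun _ _ => abs_nonneg _)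
        fun k _ => abs_covCoef_le hC hz hz hη (v k)) hφ (freqBox (2 * M))
  simp only [Finset.univ_unique, Finset.sum_const, Finset.card_singleton, one_smul,
    Complex.ofReal_one, one_mul] at h1 h2 h3 h4
  refine ⟨h1, h2.trans ?_⟩
  rw [← mul_pow, ← mul_pow]
  refine pow_le_pow_left₀ (by positivity) ?_ _
  rw [h3]
  calc _ ≤ 2 * ((2 * k + 1 : ℝ) ^ ℓ * (ℓ.factorial * (2 * Real.pi) ^ 2 * (C ^ 2) ^ ℓ * C₀ * L)) := by
        gcongr
    _ = _ := by ring

/-- Moments of a difference of Wick powers. -/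
theorem integral_norm_pow_wickForm_sub_le (hB : IsCylindricalWiener B P) (hχ : IsCutoff χ)
    (ℓ k : ℕ) {η s C₀ C L κ : ℝ} (hη : 0 ≤ η) (hC : ∀ x, |χ x| ≤ C) (hL : 0 ≤ L) (hκ : 0 ≤ κ)
    (hC₀ : ∀ S : Finset Freq, ∑ v ∈ Fintype.piFinset (fun _ : Fin ℓ => S),
      (∏ i, bracket (v i) ^ (-2 + η)) * bracket (∑ i, v i) ^ (-s) ≤ C₀)
    {φ : Freq → ℂ} (hφ : ∀ m, ‖φ m‖ ^ 2 ≤ L * bracket m ^ (-s)) {M : ℕ} {i j : ℕ × (ℝ × ℝ)}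
    (hi : 1 ≤ i.1) (hj : 1 ≤ j.1) (hiM : i.1 ≤ M) (hjM : j.1 ≤ M)
    (hzi : 0 ≤ i.2.1 ∧ 0 ≤ i.2.2) (hzj : 0 ≤ j.2.1 ∧ 0 ≤ j.2.2)
    (hij : ∀ n, |covCoef χ i i n - covCoef χ i j n| ≤ κ * (C ^ 2 * bracket n ^ (-2 + η)))
    (hji : ∀ n, |covCoef χ j j n - covCoef χ j i n| ≤ κ * (C ^ 2 * bracket n ^ (-2 + η))) :
    Integrable (fun ω => ‖wickForm P χ B ℓ M i.1 φ i.2 ω - wickForm P χ B ℓ M j.1 φ j.2 ω‖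
      ^ (2 * (k + 1))) P ∧
    ∫ ω, ‖wickForm P χ B ℓ M i.1 φ i.2 ω - wickForm P χ B ℓ M j.1 φ j.2 ω‖ ^ (2 * (k + 1)) ∂P
      ≤ (2 * (2 * k + 1 : ℝ) ^ ℓ * (ℓ.factorial * (2 * Real.pi) ^ 2 * (C ^ 2) ^ ℓ * C₀)
        * (2 * ℓ)) ^ (k + 1) * (κ * L) ^ (k + 1) := by
  have hN : ∀ b : Fin 2, 1 ≤ ((![i, j] : Fin 2 → ℕ × (ℝ × ℝ)) b).1 := by
    simp [Fin.forall_fin_two, hi, hj]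
  have hM : ∀ b : Fin 2, ((![i, j] : Fin 2 → ℕ × (ℝ × ℝ)) b).1 ≤ M := by
    simp [Fin.forall_fin_two, hiM, hjM]
  have hz : ∀ b : Fin 2, 0 ≤ ((![i, j] : Fin 2 → ℕ × (ℝ × ℝ)) b).2.1
      ∧ 0 ≤ ((![i, j] : Fin 2 → ℕ × (ℝ × ℝ)) b).2.2 := by
    simp [Fin.forall_fin_two, hzi, hzj]
  obtain ⟨h1, h2⟩ := integral_norm_pow_wickForm_le hB hχ ℓ M k hN hM hz ![1, -1] φ
  have h3 := integral_norm_sq_wickForm hB hχ ℓ M hN hM hz ![1, -1] φ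
  have hd : ∀ {i j : ℕ × (ℝ × ℝ)}, (0 ≤ i.2.1 ∧ 0 ≤ i.2.2) → (0 ≤ j.2.1 ∧ 0 ≤ j.2.2) →
      (∀ n, |covCoef χ i i n - covCoef χ i j n| ≤ κ * (C ^ 2 * bracket n ^ (-2 + η))) →
      ∀ v : Fin ℓ → Freq, ∏ k, covCoef χ i i (v k) - ∏ k, covCoef χ i j (v k)
        ≤ ℓ * κ * ∏ k, (C ^ 2 * bracket (v k) ^ (-2 + η)) := by
    intro i j hi hj h v
    refine (le_abs_self _).trans ?_
    have := abs_prod_sub_prod_le (Finset.univ : Finset (Fin ℓ)) (a := fun k => covCoef χ i i (v k))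
      (b := fun k => covCoef χ i j (v k)) (A := fun k => C ^ 2 * bracket (v k) ^ (-2 + η)) (κ := κ)
      (fun k _ => abs_covCoef_le hC hi hi hη (v k)) (fun k _ => abs_covCoef_le hC hi hj hη (v k))
      (fun k _ => h (v k))
    simpa using this
  -- The second moment of a difference is the sum of cᵢᵢ - cᵢⱼ and cⱼⱼ - cⱼᵢ, each a difference of
  -- products of ℓ factors; hence the constant 2ℓκ.
  have h4 := sum_wick_le (A := C ^ 2) (K := 2 * ℓ * κ) (by positivity) hL (by positivity) hC₀
    (F := fun v => (∏ k, covCoef χ i i (v k) - ∏ k, covCoef χ i j (v k))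
      + (∏ k, covCoef χ j j (v k) - ∏ k, covCoef χ j i (v k))) (fun v => by
      have a1 := hd hzi hzj hij v
      have a2 := hd hzj hzi hji v
      linarith) hφ (freqBox (2 * M))
  simp only [Fin.sum_univ_two, Matrix.cons_val_zero, Matrix.cons_val_one, Complex.ofReal_one,
    one_mul, Complex.ofReal_neg, neg_mul, ← sub_eq_add_neg, mul_neg, mul_one] at h1 h2 h3
  refine ⟨h1, h2.trans ?_⟩
  rw [← mul_pow, ← mul_pow]
  refine pow_le_pow_left₀ (by positivity) ?_ _
  rw [h3]
  refine le_trans (mul_le_mul_of_nonneg_left (mul_le_mul_of_nonneg_left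
    (le_trans (le_of_eq (Finset.sum_congr rfl fun v _ => ?_)) h4) (by positivity))
    (by norm_num)) (le_of_eq (by ring))
  ring

end Bounds

/-! ### Coordinates on the unit cube and regularity in space -/

section Moments

/-- The parameter `(ε, t)` encoded by a point of the unit cube. -/
noncomputable def cubeParam (T : ℝ) (p : Fin 4 → ℝ) : ℝ × ℝ := (p 0, T * p 1)

/-- The point of the torus encoded by a point of the unit cube. -/
noncomputable def cubePoint (p : Fin 4 → ℝ) : Torus :=
  ![((2 * Real.pi * p 2 : ℝ) : AddCircle (2 * Real.pi)),
    ((2 * Real.pi * p 3 : ℝ) : AddCircle (2 * Real.pi))]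

lemma cubeParam_mem {T : ℝ} (hT : 0 ≤ T) {p : Fin 4 → ℝ} (hp : p ∈ Set.Icc 0 1) :
    cubeParam T p ∈ paramSet T := by
  have h0 := hp.1 0; have h1 := hp.2 0; have h2 := hp.1 1; have h3 := hp.2 1
  simp only [Pi.zero_apply, Pi.one_apply] at h0 h1 h2 h3
  exact ⟨⟨h0, h1⟩, mul_nonneg hT h2, mul_le_of_le_one_right hT h3⟩

lemma dist_cubeParam_le {T : ℝ} (hT : 0 ≤ T) (p p' : Fin 4 → ℝ) :
    dist (cubeParam T p) (cubeParam T p') ≤ (T + 1) * dist p p' := by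
  have h : ∀ i, dist (p i) (p' i) ≤ dist p p' := fun i => dist_le_pi_dist p p' i
  have hd : 0 ≤ dist p p' := dist_nonneg
  rw [Prod.dist_eq]
  refine max_le ?_ ?_
  · refine (h 0).trans ?_
    nlinarith
  · have : dist (T * p 1) (T * p' 1) = T * dist (p 1) (p' 1) := by
      rw [Real.dist_eq, Real.dist_eq, ← mul_sub, abs_mul, abs_of_nonneg hT]
    refine this.trans_le ?_
    nlinarith [h 1]

lemma norm_fourier_sub_le (a : ℤ) (u v : ℝ) :
    ‖(fourier a ((2 * Real.pi * u : ℝ) : AddCircle (2 * Real.pi)) : ℂ)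
      - fourier a ((2 * Real.pi * v : ℝ) : AddCircle (2 * Real.pi))‖
      ≤ 2 * Real.pi * (|(a : ℝ)| * |u - v|) := by
  have hpi := Real.pi_pos.ne'
  have h : ∀ u : ℝ, (fourier a ((2 * Real.pi * u : ℝ) : AddCircle (2 * Real.pi)) : ℂ)
      = Complex.exp (Complex.I * ((2 * Real.pi * (a * u) : ℝ) : ℂ)) := by
    intro u
    rw [fourier_coe_apply]
    congr 1
    push_cast
    have : (Real.pi : ℂ) ≠ 0 := by exact_mod_cast hpi
    field_simp
  have e : (2 * Real.pi * (a * u) : ℝ) = 2 * Real.pi * (a * v) + 2 * Real.pi * (a * (u - v)) := by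
    ring
  rw [h, h, e, Complex.ofReal_add, mul_add, Complex.exp_add, ← mul_sub_one, norm_mul,
    mul_comm Complex.I, Complex.norm_exp_ofReal_mul_I, one_mul]
  refine (Real.norm_exp_I_mul_ofReal_sub_one_le).trans_eq ?_
  rw [Real.norm_eq_abs, abs_mul, abs_mul, abs_mul, abs_of_pos Real.pi_pos]
  norm_num

lemma norm_mono_cubePoint_sub_le (n : Freq) (p p' : Fin 4 → ℝ) :
    ‖mono n (cubePoint p) - mono n (cubePoint p')‖ ≤ 4 * Real.pi * bracket n * dist p p' := by
  have hd : ∀ i, |p i - p' i| ≤ dist p p' := fun i => dist_le_pi_dist p p' i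
  have e : ∀ p, mono n (cubePoint p)
      = fourier (n 0) ((2 * Real.pi * p 2 : ℝ) : AddCircle (2 * Real.pi))
        * fourier (n 1) ((2 * Real.pi * p 3 : ℝ) : AddCircle (2 * Real.pi)) := by
    intro p
    simp [mono, cubePoint, Fin.prod_univ_two]
  have hn : ∀ (a : ℤ) (x : AddCircle (2 * Real.pi)), ‖(fourier a x : ℂ)‖ = 1 := by
    intro a x; rw [fourier_apply]; exact Circle.norm_coe _
  set A := (fourier (n 0) ((2 * Real.pi * p 2 : ℝ) : AddCircle (2 * Real.pi)) : ℂ)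
  set A' := (fourier (n 0) ((2 * Real.pi * p' 2 : ℝ) : AddCircle (2 * Real.pi)) : ℂ)
  set D := (fourier (n 1) ((2 * Real.pi * p 3 : ℝ) : AddCircle (2 * Real.pi)) : ℂ)
  set D' := (fourier (n 1) ((2 * Real.pi * p' 3 : ℝ) : AddCircle (2 * Real.pi)) : ℂ)
  have e' : A * D - A' * D' = (A - A') * D + A' * (D - D') := by ring
  rw [e, e, e']
  have h0 := abs_le_bracket n 0
  have h1 := abs_le_bracket n 1
  have hb := (bracket_pos n).le
  calc _ ≤ ‖(A - A') * D‖ + ‖A' * (D - D')‖ := norm_add_le _ _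
    _ = ‖A - A'‖ + ‖D - D'‖ := by rw [norm_mul, norm_mul, hn, hn, mul_one, one_mul]
    _ ≤ 2 * Real.pi * (|(n 0 : ℝ)| * |p 2 - p' 2|) + 2 * Real.pi * (|(n 1 : ℝ)| * |p 3 - p' 3|) :=
        add_le_add (norm_fourier_sub_le _ _ _) (norm_fourier_sub_le _ _ _)
    _ ≤ 2 * Real.pi * (bracket n * dist p p') + 2 * Real.pi * (bracket n * dist p p') := by
        have := hd 2; have := hd 3
        have := Real.pi_pos
        gcongr
    _ = _ := by ring

/-- The test sequence producing the values of `⟨∇⟩^{-s} u` at `x`. -/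
noncomputable def besselTest (s : ℝ) (x : Torus) (n : Freq) : ℂ :=
  ((bracket n ^ (-s) : ℝ) : ℂ) * basisFun n x

lemma norm_sq_two_pi_inv_mul (z : ℂ) :
    ‖(2 * Real.pi : ℂ)⁻¹ * z‖ ^ 2 = ((2 * Real.pi) ^ 2)⁻¹ * ‖z‖ ^ 2 := by
  rw [norm_mul, norm_inv, norm_mul, Complex.norm_real, Complex.norm_ofNat,
    Real.norm_of_nonneg Real.pi_pos.le]
  ring

lemma norm_sq_besselTest_le {s : ℝ} (hs : 0 ≤ s) (x : Torus) (n : Freq) :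
    ‖besselTest s x n‖ ^ 2 ≤ 1 * bracket n ^ (-s) := by
  have hb := bracket_pos n
  have h1 : bracket n ^ (-s) ≤ 1 := Real.rpow_le_one_of_one_le_of_nonpos (one_le_bracket n)
    (by linarith)
  have h0 : 0 ≤ bracket n ^ (-s) := Real.rpow_nonneg hb.le _
  have hpi : ((2 * Real.pi) ^ 2)⁻¹ ≤ 1 := by
    refine inv_le_one_of_one_le₀ ?_
    nlinarith [Real.pi_gt_three]
  rw [besselTest, norm_mul, mul_pow, Complex.norm_real, Real.norm_of_nonneg h0, basisFun,
    norm_sq_two_pi_inv_mul, norm_mono]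
  nlinarith

/-- The square carries ⟨n⟩^{-2s}. One half is kept for the lattice sum. The other absorbs the ⟨n⟩^θ,
θ = min s 1, that arises from interpolating between the Lipschitz bound and the trivial bound for
the characters. -/
lemma norm_sq_besselTest_sub_le {s : ℝ} (hs : 0 ≤ s) (n : Freq) (p p' : Fin 4 → ℝ) :
    ‖besselTest s (cubePoint p) n - besselTest s (cubePoint p') n‖ ^ 2
      ≤ 2 * dist p p' ^ min s 1 * bracket n ^ (-s) := by
  have hb := bracket_pos n
  have h0 : 0 ≤ bracket n ^ (-s) := Real.rpow_nonneg hb.le _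
  set θ := min s 1 with hθ
  have hθ0 : 0 ≤ θ := le_min hs zero_le_one
  have hθ1 : θ ≤ 1 := min_le_right _ _
  have hθs : θ ≤ s := min_le_left _ _
  set m := ‖mono n (cubePoint p) - mono n (cubePoint p')‖ with hm
  have hm0 : 0 ≤ m := norm_nonneg _
  have hm2 : m ≤ 2 := by
    refine (norm_sub_le _ _).trans_eq ?_
    rw [norm_mono, norm_mono]; norm_num
  have hm1 : m ≤ 4 * Real.pi * bracket n * dist p p' := norm_mono_cubePoint_sub_le n p p'
  have hpi := Real.pi_gt_three
  have h1 : m ^ 2 ≤ 16 * Real.pi * (bracket n ^ θ * dist p p' ^ θ) := by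
    have e : m ^ 2 = m ^ θ * m ^ (2 - θ) := by
      rw [← Real.rpow_add_of_nonneg hm0 hθ0 (by linarith)]
      norm_num
    have a1 : m ^ θ ≤ 4 * Real.pi * (bracket n ^ θ * dist p p' ^ θ) := by
      calc m ^ θ ≤ (4 * Real.pi * bracket n * dist p p') ^ θ := Real.rpow_le_rpow hm0 hm1 hθ0
        _ = (4 * Real.pi) ^ θ * (bracket n ^ θ * dist p p' ^ θ) := by
            rw [Real.mul_rpow (by positivity) dist_nonneg, Real.mul_rpow (by positivity) hb.le]
            ring
        _ ≤ _ := by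
            refine mul_le_mul_of_nonneg_right ?_ (by positivity)
            calc (4 * Real.pi) ^ θ ≤ (4 * Real.pi) ^ (1 : ℝ) :=
                  Real.rpow_le_rpow_of_exponent_le (by linarith) hθ1
              _ = _ := Real.rpow_one _
    have a2 : m ^ (2 - θ) ≤ 4 := by
      calc m ^ (2 - θ) ≤ 2 ^ (2 - θ) := Real.rpow_le_rpow hm0 hm2 (by linarith)
        _ ≤ 2 ^ (2 : ℝ) := Real.rpow_le_rpow_of_exponent_le (by norm_num) (by linarith)
        _ = 4 := by norm_num
    rw [e]
    calc _ ≤ 4 * Real.pi * (bracket n ^ θ * dist p p' ^ θ) * 4 :=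
          mul_le_mul a1 a2 (Real.rpow_nonneg hm0 _) (by positivity)
      _ = _ := by ring
  have e : besselTest s (cubePoint p) n - besselTest s (cubePoint p') n
      = ((bracket n ^ (-s) : ℝ) : ℂ)
        * ((2 * Real.pi : ℂ)⁻¹ * (mono n (cubePoint p) - mono n (cubePoint p'))) := by
    simp only [besselTest, basisFun]; ring
  have h2 : bracket n ^ (-s) * bracket n ^ θ ≤ 1 := by
    rw [← Real.rpow_add hb]
    exact Real.rpow_le_one_of_one_le_of_nonpos (one_le_bracket n) (by linarith)
  have hd : 0 ≤ dist p p' ^ θ := Real.rpow_nonneg dist_nonneg _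
  rw [e, norm_mul, mul_pow, Complex.norm_real, Real.norm_of_nonneg h0, norm_sq_two_pi_inv_mul,
    ← hm]
  calc (bracket n ^ (-s)) ^ 2 * (((2 * Real.pi) ^ 2)⁻¹ * m ^ 2)
      ≤ (bracket n ^ (-s)) ^ 2
        * (((2 * Real.pi) ^ 2)⁻¹ * (16 * Real.pi * (bracket n ^ θ * dist p p' ^ θ))) := by gcongr
    _ = (((2 * Real.pi) ^ 2)⁻¹ * (16 * Real.pi)) * (bracket n ^ (-s) * bracket n ^ θ)
        * (dist p p' ^ θ * bracket n ^ (-s)) := by ring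
    _ ≤ 2 * 1 * (dist p p' ^ θ * bracket n ^ (-s)) := by
        have : ((2 * Real.pi) ^ 2)⁻¹ * (16 * Real.pi) ≤ 2 := by
          rw [inv_mul_le_iff₀ (by positivity)]
          nlinarith
        gcongr
    _ = _ := by ring

lemma lintegral_enorm_pow_add_le {Ω : Type*} [MeasurableSpace Ω] {P : Measure Ω} {f g : Ω → ℂ}
    (hf : AEMeasurable f P) (q : ℕ) :
    ∫⁻ ω, ‖f ω + g ω‖ₑ ^ q ∂P ≤ 2 ^ q * (∫⁻ ω, ‖f ω‖ₑ ^ q ∂P + ∫⁻ ω, ‖g ω‖ₑ ^ q ∂P) := by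
  rw [← lintegral_add_left' (hf.enorm.pow_const q), ← lintegral_const_mul' _ _ (by simp)]
  refine lintegral_mono fun ω => ?_
  calc ‖f ω + g ω‖ₑ ^ q ≤ (2 * max ‖f ω‖ₑ ‖g ω‖ₑ) ^ q := by
        gcongr
        rw [two_mul]
        exact (enorm_add_le _ _).trans (add_le_add (le_max_left _ _) (le_max_right _ _))
    _ ≤ 2 ^ q * (‖f ω‖ₑ ^ q + ‖g ω‖ₑ ^ q) := by
        rw [mul_pow]
        gcongr
        rcases max_cases ‖f ω‖ₑ ‖g ω‖ₑ with h | h <;> rw [h.1] <;> simp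

lemma lintegral_enorm_pow_le_of_integral_le {Ω : Type*} [MeasurableSpace Ω] {P : Measure Ω}
    {f : Ω → ℂ} {q : ℕ} {c : ℝ}
    (h : Integrable (fun ω => ‖f ω‖ ^ q) P ∧ ∫ ω, ‖f ω‖ ^ q ∂P ≤ c) :
    ∫⁻ ω, ‖f ω‖ₑ ^ q ∂P ≤ ENNReal.ofReal c := by
  have e : ∀ ω, ‖f ω‖ₑ ^ q = ENNReal.ofReal (‖f ω‖ ^ q) := fun ω => by
    rw [ENNReal.ofReal_pow (norm_nonneg _), ofReal_norm]
  simp_rw [e]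
  rw [← ofReal_integral_eq_lintegral_ofReal h.1 (Eventually.of_forall fun ω => by positivity)]
  exact ENNReal.ofReal_le_ofReal h.2

end Moments

/-! ### Moments of the smoothed Wick powers -/

section WickField

variable {Ω : Type*} [MeasurableSpace Ω] {P : Measure Ω}
  {B : Freq → ℝ≥0 → Ω → ℂ} {χ : ℝ → ℝ}

/-- The value at `x` of `⟨∇⟩^{-s} :Ψ_{ε,N}^ℓ(t):`, with `z = (ε, t)`. -/
noncomputable def wickField (P : Measure Ω) (χ : ℝ → ℝ) (B : Freq → ℝ≥0 → Ω → ℂ) (s : ℝ) (ℓ N : ℕ)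
    (z : ℝ × ℝ) (x : Torus) (ω : Ω) : ℂ :=
  wickForm P χ B ℓ N N (besselTest s x) z ω

lemma wickForm_sub (ℓ M N : ℕ) (φ ψ : Freq → ℂ) (z : ℝ × ℝ) (ω : Ω) :
    wickForm P χ B ℓ M N φ z ω - wickForm P χ B ℓ M N ψ z ω
      = wickForm P χ B ℓ M N (fun n => φ n - ψ n) z ω := by
  simp only [wickForm, ← Finset.sum_sub_distrib, sub_mul]

variable [IsProbabilityMeasure P]

/-- Moment bounds for the smoothed Wick powers, over the unit cube of parameters. -/
theorem exists_wickField_moment_le (hB : IsCylindricalWiener B P) (hχ : IsCutoff χ) (ℓ : ℕ)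
    {s T : ℝ} (hs : 0 < s) (hT : 0 ≤ T) :
    ∃ δ : ℝ, 0 < δ ∧ ∀ k : ℕ, ∃ C : ℝ, 0 ≤ C ∧
      (∀ N, 1 ≤ N → ∀ p ∈ Set.Icc (0 : Fin 4 → ℝ) 1,
        ∫⁻ ω, ‖wickField P χ B s ℓ N (cubeParam T p) (cubePoint p) ω‖ₑ ^ (2 * (k + 1)) ∂P
          ≤ ENNReal.ofReal C) ∧
      (∀ N, 1 ≤ N → ∀ p ∈ Set.Icc (0 : Fin 4 → ℝ) 1, ∀ p' ∈ Set.Icc (0 : Fin 4 → ℝ) 1,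
        ∫⁻ ω, ‖wickField P χ B s ℓ N (cubeParam T p) (cubePoint p) ω
            - wickField P χ B s ℓ N (cubeParam T p') (cubePoint p') ω‖ₑ ^ (2 * (k + 1)) ∂P
          ≤ ENNReal.ofReal (C * (dist p p' ^ δ) ^ (k + 1))) ∧
      (∀ N M, 1 ≤ N → N ≤ M → ∀ p ∈ Set.Icc (0 : Fin 4 → ℝ) 1,
        ∫⁻ ω, ‖wickField P χ B s ℓ N (cubeParam T p) (cubePoint p) ω
            - wickField P χ B s ℓ M (cubeParam T p) (cubePoint p) ω‖ₑ ^ (2 * (k + 1)) ∂P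
          ≤ ENNReal.ofReal (C * ((N : ℝ) ^ (-δ)) ^ (k + 1))) := by
  obtain ⟨η, hη, hη1, C₀, hC₀, hsum⟩ := exists_sum_prod_bracket_le ℓ hs
  obtain ⟨Cχ, hCχ1, hCχ⟩ := hχ.exists_bound
  have hθ : 0 < min s 1 := lt_min hs one_pos
  -- The smaller of the exponents available for the regularity in x and in (ε,t). It also lies below
  -- the exponent η of the decay in N.
  have hδ : 0 < min (min s 1) (η / 4) := lt_min hθ (by linarith)
  refine ⟨min (min s 1) (η / 4), hδ, fun k => ?_⟩
  set δ := min (min s 1) (η / 4) with hδdef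
  set A : ℝ := 2 * (2 * k + 1 : ℝ) ^ ℓ * (ℓ.factorial * (2 * Real.pi) ^ 2 * (Cχ ^ 2) ^ ℓ * C₀)
    with hA
  have hA0 : 0 ≤ A := by positivity
  set κ : ℝ := 2 * (T + 8) * (T + 1) with hκ
  have hκ0 : 0 ≤ κ := by positivity
  have hκ2 : 2 ≤ κ := by rw [hκ]; nlinarith
  set C : ℝ := 2 ^ (2 * (k + 1)) * ((A * (2 * ℓ)) ^ (k + 1) * κ ^ (k + 1) + A ^ (k + 1) * κ ^ (k + 1))
    + A ^ (k + 1) + (A * (2 * ℓ)) ^ (k + 1) * κ ^ (k + 1) with hC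
  refine ⟨C, by positivity, ?_, ?_, ?_⟩
  · intro N hN p hp
    have hz := nonneg_of_mem_paramSet (cubeParam_mem hT hp)
    have h := integral_norm_pow_wickForm_single_le hB hχ ℓ k hη.le hCχ zero_le_one hsum
      (norm_sq_besselTest_le hs.le (cubePoint p)) hN le_rfl hz
    refine (lintegral_enorm_pow_le_of_integral_le h).trans (ENNReal.ofReal_le_ofReal ?_)
    rw [one_pow, mul_one, hC]
    have h1 : 0 ≤ 2 ^ (2 * (k + 1)) * ((A * (2 * ℓ)) ^ (k + 1) * κ ^ (k + 1)
      + A ^ (k + 1) * κ ^ (k + 1)) := by positivity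
    have h2 : 0 ≤ (A * (2 * ℓ)) ^ (k + 1) * κ ^ (k + 1) := by positivity
    linarith
  · intro N hN p hp p' hp'
    have hz := cubeParam_mem hT hp
    have hz' := cubeParam_mem hT hp'
    have hd1 : dist p p' ≤ 1 := by
      refine (dist_pi_le_iff zero_le_one).2 fun i => ?_
      have a1 := hp.1 i; have a2 := hp.2 i; have a3 := hp'.1 i; have a4 := hp'.2 i
      simp only [Pi.zero_apply, Pi.one_apply] at a1 a2 a3 a4
      rw [Real.dist_eq, abs_le]
      constructor <;> linarith
    have hd : 0 ≤ dist p p' := dist_nonneg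
    have hdz : dist (cubeParam T p) (cubeParam T p') ^ (η / 4) ≤ (T + 1) * dist p p' ^ δ := by
      calc _ ≤ ((T + 1) * dist p p') ^ (η / 4) :=
            Real.rpow_le_rpow dist_nonneg (dist_cubeParam_le hT p p') (by linarith)
        _ = (T + 1) ^ (η / 4) * dist p p' ^ (η / 4) := Real.mul_rpow (by linarith) hd
        _ ≤ (T + 1) * dist p p' ^ δ := by
            refine mul_le_mul ?_ ?_ (Real.rpow_nonneg hd _) (by linarith)
            · calc (T + 1) ^ (η / 4) ≤ (T + 1) ^ (1 : ℝ) :=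
                  Real.rpow_le_rpow_of_exponent_le (by linarith) (by linarith)
                _ = T + 1 := Real.rpow_one _
            · exact Real.rpow_le_rpow_of_exponent_ge_of_imp hd hd1 (min_le_right _ _)
                fun _ h => absurd h (by positivity)
    have hdx : dist p p' ^ min s 1 ≤ dist p p' ^ δ :=
      Real.rpow_le_rpow_of_exponent_ge_of_imp hd hd1 (min_le_left _ _)
        fun _ h => absurd h hθ.ne'
    have hdδ : 0 ≤ dist p p' ^ δ := Real.rpow_nonneg hd _
    have hc : ∀ {z z' : ℝ × ℝ}, z ∈ paramSet T → z' ∈ paramSet T →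
        dist z z' ^ (η / 4) ≤ (T + 1) * dist p p' ^ δ → ∀ n,
        |covCoef χ (N, z) (N, z) n - covCoef χ (N, z) (N, z') n|
          ≤ (κ * dist p p' ^ δ) * (Cχ ^ 2 * bracket n ^ (-2 + η)) := by
      intro z z' hz hz' hzz n
      refine (abs_covCoef_sub_le_dist hCχ N hz hz' hη.le hη1 n).trans ?_
      have := Real.rpow_nonneg (bracket_pos n).le (-2 + η)
      refine mul_le_mul_of_nonneg_right ?_ (by positivity)
      rw [hκ]
      nlinarith [mul_le_mul_of_nonneg_left hzz (show 0 ≤ 2 * (T + 8) by linarith)]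
    have h1 := integral_norm_pow_wickForm_sub_le hB hχ ℓ k hη.le hCχ zero_le_one
      (mul_nonneg hκ0 hdδ) hsum (norm_sq_besselTest_le hs.le (cubePoint p))
      (i := (N, cubeParam T p)) (j := (N, cubeParam T p')) hN hN le_rfl le_rfl
      (nonneg_of_mem_paramSet hz) (nonneg_of_mem_paramSet hz') (hc hz hz' hdz)
      (hc hz' hz (by rwa [dist_comm]))
    have h2 := integral_norm_pow_wickForm_single_le hB hχ ℓ k hη.le hCχ (M := N) (N := N)
      (L := κ * dist p p' ^ δ) (mul_nonneg hκ0 hdδ) hsum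
      (φ := fun n => besselTest s (cubePoint p) n - besselTest s (cubePoint p') n)
      (fun n => (norm_sq_besselTest_sub_le hs.le n p p').trans (by
        have := Real.rpow_nonneg (bracket_pos n).le (-s)
        gcongr)) hN le_rfl (nonneg_of_mem_paramSet hz')
    -- First (ε,t) moves with the point x fixed, then x moves with (ε,t) fixed. The first difference
    -- is one of covariances and the second one of test sequences.
    have e : ∀ ω, wickField P χ B s ℓ N (cubeParam T p) (cubePoint p) ω
            - wickField P χ B s ℓ N (cubeParam T p') (cubePoint p') ω
        = (wickForm P χ B ℓ N N (besselTest s (cubePoint p)) (cubeParam T p) ω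
            - wickForm P χ B ℓ N N (besselTest s (cubePoint p)) (cubeParam T p') ω)
          + wickForm P χ B ℓ N N
            (fun n => besselTest s (cubePoint p) n - besselTest s (cubePoint p') n)
            (cubeParam T p') ω := by
      intro ω
      rw [← wickForm_sub]
      simp only [wickField]
      ring
    simp_rw [e]
    refine (lintegral_enorm_pow_add_le ((aemeasurable_wickForm hB hχ ℓ hN le_rfl _
      (nonneg_of_mem_paramSet hz)).sub (aemeasurable_wickForm hB hχ ℓ hN le_rfl _
      (nonneg_of_mem_paramSet hz'))) _).trans ?_
    refine (mul_le_mul_right (add_le_add (lintegral_enorm_pow_le_of_integral_le h1)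
      (lintegral_enorm_pow_le_of_integral_le h2)) _).trans ?_
    rw [← hA, ← ENNReal.ofReal_add (by positivity) (by positivity),
      show (2 : ℝ≥0∞) ^ (2 * (k + 1)) = ENNReal.ofReal (2 ^ (2 * (k + 1))) by
        rw [ENNReal.ofReal_pow (by norm_num)]; norm_num,
      ← ENNReal.ofReal_mul (by positivity)]
    refine ENNReal.ofReal_le_ofReal ?_
    rw [mul_one, mul_pow κ, hC]
    have h3 : 0 ≤ A ^ (k + 1) + (A * (2 * ℓ)) ^ (k + 1) * κ ^ (k + 1) := by positivity
    have h4 : 0 ≤ (dist p p' ^ δ) ^ (k + 1) := by positivity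
    nlinarith [mul_nonneg h3 h4]
  · intro N M hN hM p hp
    have hz := nonneg_of_mem_paramSet (cubeParam_mem hT hp)
    have hN' : (1 : ℝ) ≤ N := by exact_mod_cast hN
    have hNη : (N : ℝ) ^ (-η) ≤ (N : ℝ) ^ (-δ) :=
      Real.rpow_le_rpow_of_exponent_le hN' (by
        have : δ ≤ η / 4 := min_le_right _ _
        linarith)
    have hNδ : 0 ≤ (N : ℝ) ^ (-δ) := by positivity
    have hc : ∀ {K L : ℕ}, N ≤ K → N ≤ L → ∀ n,
        |covCoef χ (K, cubeParam T p) (K, cubeParam T p) n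
          - covCoef χ (K, cubeParam T p) (L, cubeParam T p) n|
          ≤ (κ * (N : ℝ) ^ (-δ)) * (Cχ ^ 2 * bracket n ^ (-2 + η)) := by
      intro K L hK hL n
      refine (abs_covCoef_sub_le_cutoff hχ hCχ hN hK hL hz hη.le n).trans ?_
      have := Real.rpow_nonneg (bracket_pos n).le (-2 + η)
      gcongr
    have h1 := integral_norm_pow_wickForm_sub_le hB hχ ℓ k hη.le hCχ zero_le_one
      (mul_nonneg hκ0 hNδ) hsum (norm_sq_besselTest_le hs.le (cubePoint p))
      (i := (N, cubeParam T p)) (j := (M, cubeParam T p)) hN (hN.trans hM) hM le_rfl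
      hz hz (hc le_rfl hM) (hc hM le_rfl)
    have e : ∀ ω, wickField P χ B s ℓ N (cubeParam T p) (cubePoint p) ω
        = wickForm P χ B ℓ M N (besselTest s (cubePoint p)) (cubeParam T p) ω := fun ω =>
      (wickForm_eq_of_le hB hχ ℓ hN hM _ hz ω).symm
    simp_rw [e]
    refine (lintegral_enorm_pow_le_of_integral_le h1).trans (ENNReal.ofReal_le_ofReal ?_)
    rw [← hA, mul_one, mul_pow κ, hC]
    have h3 : 0 ≤ 2 ^ (2 * (k + 1)) * ((A * (2 * ℓ)) ^ (k + 1) * κ ^ (k + 1)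
      + A ^ (k + 1) * κ ^ (k + 1)) + A ^ (k + 1) := by positivity
    have h4 : 0 ≤ ((N : ℝ) ^ (-δ)) ^ (k + 1) := by positivity
    nlinarith [mul_nonneg h3 h4]

end WickField

/-! ### Dyadic chaining on the unit cube -/

section Chaining

/-- The indices of the dyadic grid of mesh `2^{-k}` in the unit cube. -/
def dyadicGrid (d k : ℕ) : Finset (Fin d → ℕ) := Fintype.piFinset fun _ => Finset.range (2 ^ k + 1)

/-- The points of the dyadic grids. -/
noncomputable def dyadicPoint {d : ℕ} (k : ℕ) (a : Fin d → ℕ) : Fin d → ℝ := fun i => a i / 2 ^ k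

/-- The index of the lower dyadic approximation of a point. -/
noncomputable def dyadicFloor {d : ℕ} (k : ℕ) (s : Fin d → ℝ) : Fin d → ℕ := fun i => ⌊s i * 2 ^ k⌋₊

variable {d : ℕ}

lemma dyadicPoint_mem {k : ℕ} {a : Fin d → ℕ} (ha : a ∈ dyadicGrid d k) :
    dyadicPoint k a ∈ Set.Icc (0 : Fin d → ℝ) 1 := by
  refine ⟨fun i => by simp only [dyadicPoint, Pi.zero_apply]; positivity, fun i => ?_⟩
  have h := Finset.mem_range.1 (Fintype.mem_piFinset.1 ha i)
  simp only [dyadicPoint, Pi.one_apply]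
  rw [div_le_one (by positivity)]
  exact_mod_cast Nat.lt_succ_iff.1 h

lemma half_mem_dyadicGrid {k : ℕ} {a : Fin d → ℕ} (ha : a ∈ dyadicGrid d (k + 1)) :
    (fun i => a i / 2) ∈ dyadicGrid d k := by
  refine Fintype.mem_piFinset.2 fun i => Finset.mem_range.2 ?_
  have h := Finset.mem_range.1 (Fintype.mem_piFinset.1 ha i)
  rw [pow_succ] at h
  omega

lemma edist_dyadicPoint_half_le (k : ℕ) (a : Fin d → ℕ) :
    edist (dyadicPoint (k + 1) a) (dyadicPoint k fun i => a i / 2) ≤ 2⁻¹ ^ (k + 1) := by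
  refine edist_pi_le_iff.2 fun i => ?_
  rw [edist_dist, Real.dist_eq]
  have e : (2⁻¹ : ℝ≥0∞) ^ (k + 1) = ENNReal.ofReal ((2⁻¹ : ℝ) ^ (k + 1)) := by
    rw [ENNReal.ofReal_pow (by norm_num), ENNReal.ofReal_inv_of_pos (by norm_num)]
    norm_num
  rw [e]
  refine ENNReal.ofReal_le_ofReal ?_
  have h : (a i : ℝ) = 2 * (a i / 2 : ℕ) + (a i % 2 : ℕ) := by exact_mod_cast (Nat.div_add_mod _ 2).symm
  have h2 : ((a i % 2 : ℕ) : ℝ) ≤ 1 := by exact_mod_cast Nat.lt_succ_iff.1 (Nat.mod_lt _ two_pos)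
  have e2 : dyadicPoint (k + 1) a i - dyadicPoint k (fun i => a i / 2) i
      = ((a i % 2 : ℕ) : ℝ) * 2⁻¹ ^ (k + 1) := by
    simp only [dyadicPoint]
    rw [h, pow_succ, inv_pow, pow_succ]
    field_simp
    ring
  rw [e2, abs_of_nonneg (by positivity)]
  exact mul_le_of_le_one_left (by positivity) h2

lemma dyadicFloor_mem {s : Fin d → ℝ} (hs : s ∈ Set.Icc (0 : Fin d → ℝ) 1) (k : ℕ) :
    dyadicFloor k s ∈ dyadicGrid d k := by
  refine Fintype.mem_piFinset.2 fun i => Finset.mem_range.2 (Nat.lt_succ_iff.2 ?_)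
  have h1 := hs.2 i
  simp only [Pi.one_apply] at h1
  refine Nat.floor_le_of_le ?_
  push_cast
  exact mul_le_of_le_one_left (by positivity) h1

/-- Halving the index of the fine lower approximation gives the coarse one, so consecutive
approximations of a point are the pairs compared in the chaining majorant. -/
lemma half_dyadicFloor (s : Fin d → ℝ) (k : ℕ) :
    (fun i => dyadicFloor (k + 1) s i / 2) = dyadicFloor k s := by
  funext i
  simp only [dyadicFloor]
  rw [← Nat.floor_div_ofNat, pow_succ]
  congr 1
  ring

lemma tendsto_dyadicPoint_floor {s : Fin d → ℝ} (hs : s ∈ Set.Icc (0 : Fin d → ℝ) 1) :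
    Tendsto (fun k => dyadicPoint k (dyadicFloor k s)) atTop (𝓝 s) := by
  refine tendsto_pi_nhds.2 fun i => ?_
  have h0 := hs.1 i
  simp only [Pi.zero_apply] at h0
  have := (tendsto_nat_floor_mul_div_atTop h0).comp (tendsto_pow_atTop_atTop_of_one_lt (one_lt_two (α := ℝ)))
  refine this.congr fun k => ?_
  simp [dyadicPoint, dyadicFloor]

variable {E : Type*} [NormedAddCommGroup E]

/-- The chaining majorant of a function on the unit cube. -/
noncomputable def chainSum (q : ℕ) (g : (Fin d → ℝ) → E) : ℝ≥0∞ :=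
  ∑ a ∈ dyadicGrid d 0, ‖g (dyadicPoint 0 a)‖ₑ ^ q
    + ∑' k, ∑ a ∈ dyadicGrid d (k + 1),
      2 ^ k * ‖g (dyadicPoint (k + 1) a) - g (dyadicPoint k fun i => a i / 2)‖ₑ ^ q

/-- The constant of the chaining bound. -/
noncomputable def chainConst (q : ℕ) : ℝ≥0∞ := 1 + (1 - (2⁻¹ : ℝ≥0∞) ^ (1 / q : ℝ))⁻¹

lemma chainConst_ne_top {q : ℕ} (hq : q ≠ 0) : chainConst q ≠ ∞ := by
  have : (2⁻¹ : ℝ≥0∞) ^ (1 / q : ℝ) < 1 := ENNReal.rpow_lt_one (by norm_num) (by positivity)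
  refine ENNReal.add_ne_top.2 ⟨ENNReal.one_ne_top, ENNReal.inv_ne_top.2 ?_⟩
  exact (tsub_pos_of_lt this).ne'

/-- By continuity the value at a point is the telescoping sum along its dyadic approximations. The
weight 2^k bounds the k-th increment by R^{1/q} 2^{-k/q}, a geometric series. The majorant uses
countably many values and does not depend on the point, so it controls the supremum. -/
lemma enorm_pow_le_chainSum {q : ℕ} (hq : q ≠ 0) {g : (Fin d → ℝ) → E}
    (hg : ContinuousOn g (Set.Icc 0 1)) {s : Fin d → ℝ} (hs : s ∈ Set.Icc (0 : Fin d → ℝ) 1) :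
    ‖g s‖ₑ ^ q ≤ chainConst q ^ q * chainSum q g := by
  set R := chainSum q g with hR
  set r : ℝ≥0∞ := (2⁻¹ : ℝ≥0∞) ^ (1 / q : ℝ) with hr
  have hq' : (0 : ℝ) < 1 / q := by positivity
  have hroot : ∀ x y : ℝ≥0∞, x ^ q ≤ y → x ≤ y ^ (1 / q : ℝ) := by
    intro x y h
    calc x = (x ^ q) ^ (1 / q : ℝ) := by
          rw [← ENNReal.rpow_natCast, ← ENNReal.rpow_mul, mul_one_div_cancel (by positivity),
            ENNReal.rpow_one]
      _ ≤ _ := ENNReal.rpow_le_rpow h hq'.le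
  have h0 : ‖g (dyadicPoint 0 (dyadicFloor 0 s))‖ₑ ≤ R ^ (1 / q : ℝ) := by
    refine hroot _ _ (le_trans ?_ le_self_add)
    exact Finset.single_le_sum (f := fun a => ‖g (dyadicPoint 0 a)‖ₑ ^ q) (fun _ _ => zero_le)
      (dyadicFloor_mem hs 0)
  have h1 : ∀ k, ‖g (dyadicPoint (k + 1) (dyadicFloor (k + 1) s))
      - g (dyadicPoint k (dyadicFloor k s))‖ₑ ≤ R ^ (1 / q : ℝ) * r ^ k := by
    intro k
    have h : 2 ^ k * ‖g (dyadicPoint (k + 1) (dyadicFloor (k + 1) s))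
      - g (dyadicPoint k (dyadicFloor k s))‖ₑ ^ q ≤ R := by
      refine le_trans ?_ le_add_self
      refine le_trans ?_ (ENNReal.le_tsum k)
      have := Finset.single_le_sum (f := fun a =>
        2 ^ k * ‖g (dyadicPoint (k + 1) a) - g (dyadicPoint k fun i => a i / 2)‖ₑ ^ q)
        (fun _ _ => zero_le) (dyadicFloor_mem hs (k + 1))
      simpa only [half_dyadicFloor] using this
    have h2 : ‖g (dyadicPoint (k + 1) (dyadicFloor (k + 1) s))
      - g (dyadicPoint k (dyadicFloor k s))‖ₑ ^ q ≤ R * 2⁻¹ ^ k := by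
      rw [← ENNReal.inv_pow, ← div_eq_mul_inv,
        ENNReal.le_div_iff_mul_le (Or.inl (by positivity)) (Or.inl (by simp)), mul_comm]
      exact h
    refine (hroot _ _ h2).trans_eq ?_
    rw [ENNReal.mul_rpow_of_nonneg _ _ hq'.le, hr, ← ENNReal.rpow_natCast, ← ENNReal.rpow_natCast,
      ← ENNReal.rpow_mul, ← ENNReal.rpow_mul, mul_comm (k : ℝ)]
  have h2 : ∀ k, ‖g (dyadicPoint k (dyadicFloor k s))‖ₑ
      ≤ R ^ (1 / q : ℝ) + ∑ j ∈ Finset.range k, R ^ (1 / q : ℝ) * r ^ j := by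
    intro k
    induction k with
    | zero => simpa using h0
    | succ k ih =>
      rw [Finset.sum_range_succ, ← add_assoc]
      calc _ = ‖g (dyadicPoint k (dyadicFloor k s))
            + (g (dyadicPoint (k + 1) (dyadicFloor (k + 1) s))
              - g (dyadicPoint k (dyadicFloor k s)))‖ₑ := by
            rw [add_sub_cancel]
        _ ≤ _ := (enorm_add_le _ _).trans (add_le_add ih (h1 k))
  have h3 : ∀ k, ‖g (dyadicPoint k (dyadicFloor k s))‖ₑ ≤ R ^ (1 / q : ℝ) * chainConst q := by
    intro k
    refine (h2 k).trans ?_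
    rw [← Finset.mul_sum, chainConst, mul_add, mul_one, ← ENNReal.tsum_geometric]
    gcongr
    exact ENNReal.sum_le_tsum _
  have h4 : Tendsto (fun k => ‖g (dyadicPoint k (dyadicFloor k s))‖ₑ) atTop (𝓝 ‖g s‖ₑ) := by
    have : Tendsto (fun k => dyadicPoint k (dyadicFloor k s)) atTop (𝓝[Set.Icc 0 1] s) :=
      tendsto_nhdsWithin_iff.2 ⟨tendsto_dyadicPoint_floor hs,
        Eventually.of_forall fun k => dyadicPoint_mem (dyadicFloor_mem hs k)⟩
    exact ((hg s hs).tendsto.comp this).enorm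
  have h5 := le_of_tendsto' h4 h3
  calc ‖g s‖ₑ ^ q ≤ (R ^ (1 / q : ℝ) * chainConst q) ^ q := by gcongr
    _ = chainConst q ^ q * R := by
        rw [mul_pow, ← ENNReal.rpow_natCast (R ^ _), ← ENNReal.rpow_mul,
          one_div_mul_cancel (by positivity), ENNReal.rpow_one, mul_comm]

/-- Moment bounds on increments control the chaining majorant. -/
theorem lintegral_chainSum_le {Ω : Type*} [MeasurableSpace Ω] {P : Measure Ω}
    [MeasurableSpace E] [BorelSpace E] [MeasurableSub₂ E] {q : ℕ} {f : (Fin d → ℝ) → Ω → E}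
    (hf : ∀ p ∈ Set.Icc (0 : Fin d → ℝ) 1, AEMeasurable (f p) P) {A : ℝ≥0∞}
    (h0 : ∀ p ∈ Set.Icc (0 : Fin d → ℝ) 1, ∫⁻ ω, ‖f p ω‖ₑ ^ q ∂P ≤ A)
    (h1 : ∀ p ∈ Set.Icc (0 : Fin d → ℝ) 1, ∀ p' ∈ Set.Icc (0 : Fin d → ℝ) 1,
      ∫⁻ ω, ‖f p ω - f p' ω‖ₑ ^ q ∂P ≤ A * edist p p' ^ (d + 2)) :
    ∫⁻ ω, chainSum q (fun p => f p ω) ∂P ≤ (2 ^ d + 4 ^ d) * A := by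
  have hcard : ∀ k, (dyadicGrid d k).card = (2 ^ k + 1) ^ d := by
    intro k
    simp [dyadicGrid]
  have hm : ∀ k, ∀ a ∈ dyadicGrid d (k + 1), AEMeasurable (fun ω =>
      2 ^ k * ‖f (dyadicPoint (k + 1) a) ω - f (dyadicPoint k fun i => a i / 2) ω‖ₑ ^ q) P := by
    intro k a ha
    exact (((hf _ (dyadicPoint_mem ha)).sub
      (hf _ (dyadicPoint_mem (half_mem_dyadicGrid ha)))).enorm.pow_const q).const_mul _
  have hm0 : ∀ a ∈ dyadicGrid d 0, AEMeasurable (fun ω => ‖f (dyadicPoint 0 a) ω‖ₑ ^ q) P :=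
    fun a ha => (hf _ (dyadicPoint_mem ha)).enorm.pow_const q
  simp only [chainSum]
  rw [lintegral_add_left' (Finset.aemeasurable_fun_sum _ hm0), lintegral_finsetSum' _ hm0,
    lintegral_tsum fun k => Finset.aemeasurable_fun_sum _ (hm k), add_mul]
  refine add_le_add ?_ ?_
  · refine (Finset.sum_le_sum fun a ha => h0 _ (dyadicPoint_mem ha)).trans_eq ?_
    rw [Finset.sum_const, hcard, nsmul_eq_mul]
    norm_num
  · have hk : ∀ k, ∫⁻ ω, ∑ a ∈ dyadicGrid d (k + 1),
        2 ^ k * ‖f (dyadicPoint (k + 1) a) ω - f (dyadicPoint k fun i => a i / 2) ω‖ₑ ^ q ∂P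
        ≤ 4 ^ d * A * (2⁻¹ * 2⁻¹ ^ k) := by
      intro k
      rw [lintegral_finsetSum' _ (hm k)]
      -- The exponent d + 2 pays for about 2^{kd} grid points, for the weight 2^k, and leaves one
      -- factor 2^{-k} for the sum over levels.
      calc _ ≤ ∑ a ∈ dyadicGrid d (k + 1), 2 ^ k * (A * (2⁻¹ ^ (k + 1)) ^ (d + 2)) := by
            refine Finset.sum_le_sum fun a ha => ?_
            rw [lintegral_const_mul' _ _ (by simp)]
            gcongr
            refine (h1 _ (dyadicPoint_mem ha) _ (dyadicPoint_mem (half_mem_dyadicGrid ha))).trans ?_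
            gcongr
            exact edist_dyadicPoint_half_le k a
        _ = ((2 ^ (k + 1) + 1) ^ d : ℕ) * (2 ^ k * (A * (2⁻¹ ^ (k + 1)) ^ (d + 2))) := by
            rw [Finset.sum_const, hcard, nsmul_eq_mul]
        _ ≤ ((2 * 2 ^ (k + 1)) ^ d : ℕ) * (2 ^ k * (A * (2⁻¹ ^ (k + 1)) ^ (d + 2))) := by
            gcongr
            have := Nat.one_le_two_pow (n := k + 1)
            omega
        _ = 2 ^ d * A * (2 ^ k * 2⁻¹ ^ k) * (2 ^ (k + 1) * 2⁻¹ ^ (k + 1)) ^ d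
              * (2⁻¹ * 2⁻¹ ^ k) * 2⁻¹ := by
            push_cast
            generalize (2 : ℝ≥0∞)⁻¹ = y
            generalize (2 : ℝ≥0∞) = x
            ring
        _ ≤ 2 ^ d * A * 1 * 1 ^ d * (2⁻¹ * 2⁻¹ ^ k) * 1 := by
            have : ∀ n, (2 : ℝ≥0∞) ^ n * 2⁻¹ ^ n = 1 := fun n => by
              rw [← mul_pow, ENNReal.mul_inv_cancel (by norm_num) (by norm_num), one_pow]
            rw [this, this]
            gcongr
            norm_num
        _ ≤ _ := by
            simp only [one_pow, mul_one]
            gcongr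
            norm_num
    refine (ENNReal.tsum_le_tsum hk).trans_eq ?_
    rw [ENNReal.tsum_mul_left, ENNReal.tsum_mul_left, ENNReal.tsum_geometric,
      ENNReal.one_sub_inv_two, inv_inv, ENNReal.inv_mul_cancel (by norm_num) (by norm_num), mul_one]

end Chaining

/-! ### Chaining bounds for the smoothed Wick powers -/

section CubeField

variable {Ω : Type*} [MeasurableSpace Ω] {P : Measure Ω}
  {B : Freq → ℝ≥0 → Ω → ℂ} {χ : ℝ → ℝ}

/-- The smoothed Wick power as a random field on the unit cube. -/
noncomputable def cubeField (P : Measure Ω) (χ : ℝ → ℝ) (B : Freq → ℝ≥0 → Ω → ℂ) (s T : ℝ)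
    (ℓ N : ℕ) (p : Fin 4 → ℝ) (ω : Ω) : ℂ :=
  wickField P χ B s ℓ N (cubeParam T p) (cubePoint p) ω

lemma dist_le_one_of_mem_cube {p p' : Fin 4 → ℝ} (hp : p ∈ Set.Icc (0 : Fin 4 → ℝ) 1)
    (hp' : p' ∈ Set.Icc (0 : Fin 4 → ℝ) 1) : dist p p' ≤ 1 := by
  refine (dist_pi_le_iff zero_le_one).2 fun i => ?_
  have a1 := hp.1 i; have a2 := hp.2 i; have a3 := hp'.1 i; have a4 := hp'.2 i
  simp only [Pi.zero_apply, Pi.one_apply] at a1 a2 a3 a4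
  rw [Real.dist_eq, abs_le]
  constructor <;> linarith

lemma ofReal_mul_dist_pow_le {A d : ℝ} (hA : 0 ≤ A) (p p' : Fin 4 → ℝ)
    (hd : d ≤ dist p p' ^ 6) :
    ENNReal.ofReal (A * d) ≤ ENNReal.ofReal A * edist p p' ^ (4 + 2) := by
  rw [ENNReal.ofReal_mul hA, edist_dist, ← ENNReal.ofReal_pow dist_nonneg]
  gcongr

variable [IsProbabilityMeasure P]

lemma aemeasurable_cubeField (hB : IsCylindricalWiener B P) (hχ : IsCutoff χ) (ℓ : ℕ) (s : ℝ)
    {T : ℝ} (hT : 0 ≤ T) {N : ℕ} (hN : 1 ≤ N) {p : Fin 4 → ℝ}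
    (hp : p ∈ Set.Icc (0 : Fin 4 → ℝ) 1) :
    AEMeasurable (cubeField P χ B s T ℓ N p) P :=
  aemeasurable_wickForm hB hχ ℓ hN le_rfl _ (nonneg_of_mem_paramSet (cubeParam_mem hT hp))

/-- Moment bounds for the chaining majorants of the smoothed Wick powers. -/
theorem exists_lintegral_chainSum_cubeField_le (hB : IsCylindricalWiener B P) (hχ : IsCutoff χ)
    (ℓ : ℕ) {s T : ℝ} (hs : 0 < s) (hT : 0 ≤ T) :
    ∃ δ : ℝ, 0 < δ ∧ ∃ k₀ : ℕ, ∀ k, k₀ ≤ k → ∃ C : ℝ≥0∞, C ≠ ∞ ∧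
      (∀ N, 1 ≤ N → ∫⁻ ω, chainSum (2 * (k + 1)) (fun p => cubeField P χ B s T ℓ N p ω) ∂P ≤ C) ∧
      (∀ N M, 1 ≤ N → N ≤ M → ∫⁻ ω, chainSum (2 * (k + 1))
          (fun p => cubeField P χ B s T ℓ N p ω - cubeField P χ B s T ℓ M p ω) ∂P
        ≤ C * ENNReal.ofReal (((N : ℝ) ^ (-δ)) ^ (k + 1))) := by
  obtain ⟨δ, hδ, hmom⟩ := exists_wickField_moment_le hB hχ ℓ hs hT
  obtain ⟨k₀, hk₀⟩ := exists_nat_ge (12 / δ)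
  refine ⟨δ / 2, by positivity, k₀, fun k hk => ?_⟩
  -- Six is d + 2 with d = 4. The moment must be high enough for half of the Hölder exponent to
  -- suffice, the other half being exchanged for decay in N.
  have hkδ : 6 ≤ δ / 2 * (k + 1) := by
    have h1 : 12 / δ ≤ k + 1 := hk₀.trans (by
      have : (k₀ : ℝ) ≤ k := by exact_mod_cast hk
      linarith)
    rw [div_le_iff₀ hδ] at h1
    linarith
  obtain ⟨C, hC, h1, h2, h3⟩ := hmom k
  have hdpow : ∀ {p p' : Fin 4 → ℝ}, p ∈ Set.Icc (0 : Fin 4 → ℝ) 1 →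
      p' ∈ Set.Icc (0 : Fin 4 → ℝ) 1 → (dist p p' ^ (δ / 2)) ^ (k + 1) ≤ dist p p' ^ 6 := by
    intro p p' hp hp'
    rw [← Real.rpow_natCast, ← Real.rpow_mul dist_nonneg, ← Real.rpow_natCast (dist p p') 6]
    refine Real.rpow_le_rpow_of_exponent_ge_of_imp dist_nonneg (dist_le_one_of_mem_cube hp hp')
      (by push_cast; linarith) fun _ h => absurd h (by push_cast; positivity)
  set C' : ℝ := 2 ^ (2 * (k + 1)) * (C + C) + C with hC'
  have hCC' : C ≤ C' := by rw [hC']; linarith [show 0 ≤ 2 ^ (2 * (k + 1)) * (C + C) by positivity]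
  have hC0' : 0 ≤ C' := hC.trans hCC'
  refine ⟨(2 ^ 4 + 4 ^ 4) * ENNReal.ofReal C', ENNReal.mul_ne_top (by norm_num)
    ENNReal.ofReal_ne_top, fun N hN => ?_, fun N M hN hM => ?_⟩
  · refine lintegral_chainSum_le (fun p hp => aemeasurable_cubeField hB hχ ℓ s hT hN hp)
      (fun p hp => (h1 N hN p hp).trans (ENNReal.ofReal_le_ofReal hCC')) fun p hp p' hp' => ?_
    refine (h2 N hN p hp p' hp').trans (le_trans (ENNReal.ofReal_le_ofReal
      (mul_le_mul_of_nonneg_right hCC' (by positivity))) ?_)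
    refine ofReal_mul_dist_pow_le hC0' p p' (le_trans ?_ (hdpow hp hp'))
    gcongr ?_ ^ (k + 1)
    exact Real.rpow_le_rpow_of_exponent_ge_of_imp dist_nonneg (dist_le_one_of_mem_cube hp hp')
      (by linarith) fun _ h => absurd h (by positivity)
  · have hN1 : (1 : ℝ) ≤ N := by exact_mod_cast hN
    have hN0 : (0 : ℝ) ≤ N := by linarith
    set x : ℝ := (N : ℝ) ^ (-(δ / 2)) with hx
    have hx0 : 0 ≤ x := by positivity
    have hx1 : x ≤ 1 := Real.rpow_le_one_of_one_le_of_nonpos hN1 (by linarith)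
    have hxx : (N : ℝ) ^ (-δ) = x * x := by
      rw [hx, ← Real.rpow_add (by linarith)]
      congr 1; ring
    have hm := fun (N : ℕ) (hN : 1 ≤ N) (p : Fin 4 → ℝ) (hp : p ∈ Set.Icc (0 : Fin 4 → ℝ) 1) =>
      aemeasurable_cubeField hB hχ ℓ s hT hN hp
    have hM1 := hN.trans hM
    have h0 : ∀ p ∈ Set.Icc (0 : Fin 4 → ℝ) 1,
        ∫⁻ ω, ‖cubeField P χ B s T ℓ N p ω - cubeField P χ B s T ℓ M p ω‖ₑ ^ (2 * (k + 1)) ∂P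
          ≤ ENNReal.ofReal (C * (x * x) ^ (k + 1)) := by
      intro p hp
      rw [← hxx]
      exact h3 N M hN hM p hp
    rw [mul_assoc, ← ENNReal.ofReal_mul hC0']
    refine lintegral_chainSum_le (fun p hp => (hm N hN p hp).sub (hm M hM1 p hp))
      (fun p hp => (h0 p hp).trans (ENNReal.ofReal_le_ofReal ?_)) fun p hp p' hp' => ?_
    · have : (x * x) ^ (k + 1) ≤ x ^ (k + 1) := by
        gcongr
        exact mul_le_of_le_one_left hx0 hx1
      gcongr
    · set y := dist p p' ^ (δ / 2) with hy
      have hy0 : 0 ≤ y := Real.rpow_nonneg dist_nonneg _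
      have hyy : dist p p' ^ δ = y * y := by
        rw [hy, ← Real.rpow_add_of_nonneg dist_nonneg (by positivity) (by positivity)]
        congr 1; ring
      have hq : (2 : ℝ≥0∞) ^ (2 * (k + 1)) = ENNReal.ofReal (2 ^ (2 * (k + 1))) := by
        rw [ENNReal.ofReal_pow (by norm_num)]; norm_num
      have a1 : ∫⁻ ω, ‖cubeField P χ B s T ℓ N p ω - cubeField P χ B s T ℓ M p ω
          - (cubeField P χ B s T ℓ N p' ω - cubeField P χ B s T ℓ M p' ω)‖ₑ ^ (2 * (k + 1)) ∂P
          ≤ ENNReal.ofReal (C' * (x * x) ^ (k + 1)) := by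
        have := lintegral_enorm_pow_add_le ((hm N hN p hp).sub (hm M hM1 p hp)) (2 * (k + 1))
          (g := fun ω => -(cubeField P χ B s T ℓ N p' ω - cubeField P χ B s T ℓ M p' ω))
        simp only [enorm_neg, ← sub_eq_add_neg, Pi.sub_apply] at this
        refine this.trans ((mul_le_mul_right (add_le_add (h0 p hp) (h0 p' hp')) _).trans ?_)
        rw [← ENNReal.ofReal_add (by positivity) (by positivity), hq,
          ← ENNReal.ofReal_mul (by positivity)]
        refine ENNReal.ofReal_le_ofReal ?_
        rw [hC', ← add_mul, ← mul_assoc]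
        gcongr
        linarith
      have a2 : ∫⁻ ω, ‖cubeField P χ B s T ℓ N p ω - cubeField P χ B s T ℓ M p ω
          - (cubeField P χ B s T ℓ N p' ω - cubeField P χ B s T ℓ M p' ω)‖ₑ ^ (2 * (k + 1)) ∂P
          ≤ ENNReal.ofReal (C' * (y * y) ^ (k + 1)) := by
        have := lintegral_enorm_pow_add_le ((hm N hN p hp).sub (hm N hN p' hp')) (2 * (k + 1))
          (g := fun ω => -(cubeField P χ B s T ℓ M p ω - cubeField P χ B s T ℓ M p' ω))
        simp only [enorm_neg, ← sub_eq_add_neg, Pi.sub_apply] at this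
        simp_rw [sub_sub_sub_comm (cubeField P χ B s T ℓ N p _)]
        refine this.trans ((mul_le_mul_right (add_le_add (h2 N hN p hp p' hp')
          (h2 M hM1 p hp p' hp')) _).trans ?_)
        rw [hyy, ← ENNReal.ofReal_add (by positivity) (by positivity), hq,
          ← ENNReal.ofReal_mul (by positivity)]
        refine ENNReal.ofReal_le_ofReal ?_
        rw [hC', ← add_mul, ← mul_assoc]
        gcongr
        linarith
      -- Here x² is the decay in N and y² the Hölder factor. The increment of the difference obeys
      -- both bounds, hence their geometric mean, which keeps half of each exponent.
      have a3 : min (x * x) (y * y) ≤ x * y := by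
        rcases le_total x y with h | h
        · exact (min_le_left _ _).trans (mul_le_mul_of_nonneg_left h hx0)
        · exact (min_le_right _ _).trans (mul_le_mul_of_nonneg_right h hy0)
      have a4 : ∫⁻ ω, ‖cubeField P χ B s T ℓ N p ω - cubeField P χ B s T ℓ M p ω
          - (cubeField P χ B s T ℓ N p' ω - cubeField P χ B s T ℓ M p' ω)‖ₑ ^ (2 * (k + 1)) ∂P
          ≤ ENNReal.ofReal (C' * (x * y) ^ (k + 1)) := by
        rcases min_choice (x * x) (y * y) with h | h <;> rw [h] at a3
        · exact a1.trans (ENNReal.ofReal_le_ofReal (by gcongr))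
        · exact a2.trans (ENNReal.ofReal_le_ofReal (by gcongr))
      refine a4.trans ?_
      rw [mul_pow, ← mul_assoc]
      exact ofReal_mul_dist_pow_le (by positivity) p p' (hdpow hp hp')

lemma continuousOn_cubeField (hB : IsCylindricalWiener B P) (hχ : IsCutoff χ) (ℓ : ℕ) (s : ℝ)
    {T : ℝ} (hT : 0 ≤ T) {N : ℕ} (hN : 1 ≤ N) {ω : Ω} (hω : ∀ n, Continuous fun t => B n t ω) :
    ContinuousOn (fun p => cubeField P χ B s T ℓ N p ω) (Set.Icc (0 : Fin 4 → ℝ) 1) := by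
  have hz : Continuous (cubeParam T) := by unfold cubeParam; fun_prop
  have hx : Continuous cubePoint := by
    refine continuous_pi fun i => ?_
    fin_cases i
    · exact (AddCircle.continuous_mk' _).comp (by fun_prop : Continuous fun p : Fin 4 → ℝ =>
        2 * Real.pi * p 2)
    · exact (AddCircle.continuous_mk' _).comp (by fun_prop : Continuous fun p : Fin 4 → ℝ =>
        2 * Real.pi * p 3)
  unfold cubeField wickField wickForm
  refine continuousOn_finsetSum _ fun n _ => ContinuousOn.mul ?_ ?_
  · exact (continuous_const.mul ((continuous_basisFun n).comp hx)).continuousOn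
  · exact (continuousOn_wickDist hB hχ ℓ T hN hω n).comp hz.continuousOn
      fun p hp => cubeParam_mem hT hp

/-- The unit cube covers the rectangle times the torus, so a supremum over the cube dominates the
sup norm of the path. The time coordinate is rescaled by T, whence T > 0. -/
lemma exists_cube_eq {T : ℝ} (hT : 0 < T) {z : ℝ × ℝ} (hz : z ∈ paramSet T) (x : Torus) :
    ∃ p ∈ Set.Icc (0 : Fin 4 → ℝ) 1, cubeParam T p = z ∧ cubePoint p = x := by
  have h : ∀ y : AddCircle (2 * Real.pi), ∃ u ∈ Set.Icc (0 : ℝ) 1,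
      ((2 * Real.pi * u : ℝ) : AddCircle (2 * Real.pi)) = y := by
    intro y
    obtain ⟨a, ha, rfl⟩ := AddCircle.coe_image_Icc_eq (2 * Real.pi) 0 ▸ Set.mem_univ y
    rw [zero_add] at ha
    have hpi := Real.two_pi_pos
    refine ⟨a / (2 * Real.pi), ⟨div_nonneg ha.1 hpi.le, (div_le_one hpi).2 ha.2⟩, ?_⟩
    rw [mul_div_cancel₀ _ hpi.ne']
  obtain ⟨u, hu, hu'⟩ := h (x 0)
  obtain ⟨v, hv, hv'⟩ := h (x 1)
  refine ⟨![z.1, z.2 / T, u, v], ⟨fun i => ?_, fun i => ?_⟩, ?_, ?_⟩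
  · fin_cases i
    · exact hz.1.1
    · exact div_nonneg hz.2.1 hT.le
    · exact hu.1
    · exact hv.1
  · fin_cases i
    · exact hz.1.2
    · exact (div_le_one hT).2 hz.2.2
    · exact hu.2
    · exact hv.2
  · simp [cubeParam, mul_div_cancel₀ _ hT.ne']
  · funext i
    fin_cases i
    · exact hu'
    · exact hv'

end CubeField

/-! ### Measurability and norms of random continuous functions -/

section ContinuousMapMeasurability

/-- Random continuous functions with measurable values are measurable. -/
lemma aemeasurable_continuousMap_of_eval {Ω K : Type*} [MeasurableSpace Ω] {P : Measure Ω}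
    [TopologicalSpace K] [CompactSpace K] [SecondCountableTopology K] [R1Space K]
    [MeasurableSpace C(K, ℂ)]
    [BorelSpace C(K, ℂ)] {f : Ω → C(K, ℂ)} (hf : ∀ z, AEMeasurable (fun ω => f ω z) P) :
    AEMeasurable f P := by
  obtain ⟨D, hDc, hD⟩ := TopologicalSpace.exists_countable_dense K
  have : Countable D := hDc
  let ρ : C(K, ℂ) → D → ℂ := fun g z => g z
  have hρ : Continuous ρ := continuous_pi fun z => continuous_eval_const z.1
  have hinj : Function.Injective ρ := fun g h hgh =>
    DFunLike.coe_injective (g.continuous.ext_on hD h.continuous fun z hz => congrFun hgh ⟨z, hz⟩)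
  -- By the Lusin–Souslin theorem: restriction to a countable dense set is a continuous injection.
  have hemb : MeasurableEmbedding ρ := hρ.measurableEmbedding hinj
  exact hemb.aemeasurable_comp_iff.1 (aemeasurable_pi_iff.2 fun z => hf z)

lemma enorm_continuousMap_le {K E : Type*} [TopologicalSpace K] [CompactSpace K]
    [NormedAddCommGroup E] (f : C(K, E)) {r : ℝ≥0∞} (h : ∀ z, ‖f z‖ₑ ≤ r) : ‖f‖ₑ ≤ r := by
  rcases eq_or_ne r ∞ with rfl | hr
  · exact le_top
  · have h1 : ‖f‖ ≤ r.toReal := (ContinuousMap.norm_le f ENNReal.toReal_nonneg).2 fun z => by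
      rw [← toReal_enorm]
      exact ENNReal.toReal_mono hr (h z)
    rw [← ofReal_norm]
    exact ENNReal.ofReal_le_of_le_toReal h1

end ContinuousMapMeasurability

/-! ### Wick powers as random elements of a space of continuous functions -/

section WickPath

variable {Ω : Type*} [MeasurableSpace Ω] {P : Measure Ω}
  {B : Freq → ℝ≥0 → Ω → ℂ} {χ : ℝ → ℝ}

/-- A Fourier coefficient of a Wick power as a continuous function of `(ε, t)`. -/
noncomputable def wickCoeffPath (P : Measure Ω) (χ : ℝ → ℝ) (B : Freq → ℝ≥0 → Ω → ℂ) (T : ℝ)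
    (ℓ N : ℕ) (n : Freq) (ω : Ω) : C(paramSet T, ℂ) :=
  -- Continuity is known for those ω for which all Brownian paths are continuous; elsewhere the
  -- value is irrelevant, and 0 is chosen.
  open Classical in
  if h : Continuous fun z : paramSet T => wickDist P χ B ℓ N z.1.1 z.1.2 ω n then ⟨_, h⟩ else 0

/-- The function `eₙ` as a continuous function on the torus. -/
noncomputable def basisMap (n : Freq) : C(Torus, ℂ) := ⟨basisFun n, continuous_basisFun n⟩

/-- The smoothed Wick power `⟨∇⟩^{-s} :Ψ_{ε,N}^ℓ(t):` as a continuous function of `(ε, t)` with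
values in the continuous functions on the torus. -/
noncomputable def wickPath (P : Measure Ω) (χ : ℝ → ℝ) (B : Freq → ℝ≥0 → Ω → ℂ) (s T : ℝ)
    (ℓ N : ℕ) (ω : Ω) : C(paramSet T, C(Torus, ℂ)) :=
  ∑ n ∈ freqBox (ℓ * (2 * N)),
    (ContinuousLinearMap.toSpanSingleton ℂ (((bracket n ^ (-s) : ℝ) : ℂ) •
      basisMap n)).compLeftContinuous ℂ (paramSet T) (wickCoeffPath P χ B T ℓ N n ω)

instance compactSpace_paramSet (T : ℝ) : CompactSpace (paramSet T) :=
  isCompact_iff_compactSpace.1 (isCompact_Icc.prod isCompact_Icc)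

lemma wickPath_apply (s T : ℝ) (ℓ N : ℕ) (ω : Ω) (z : paramSet T) :
    wickPath P χ B s T ℓ N ω z = ∑ n ∈ freqBox (ℓ * (2 * N)),
      wickCoeffPath P χ B T ℓ N n ω z • ((bracket n ^ (-s) : ℝ) : ℂ) • basisMap n := by
  rw [wickPath, ContinuousMap.coe_sum, Finset.sum_apply]
  rfl

/-- The chaining bound holds at every point of the cube, so taking q-th roots bounds both suprema in
the norm of g. -/
lemma enorm_pow_le_chainSum_of_cube {T : ℝ} (hT : 0 < T) {q : ℕ} (hq : q ≠ 0) {g : C(paramSet T, C(Torus, ℂ))}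
    {f : (Fin 4 → ℝ) → ℂ} (hf : ContinuousOn f (Set.Icc 0 1))
    (hgf : ∀ (z : paramSet T) (x : Torus) (p : Fin 4 → ℝ), cubeParam T p = z → cubePoint p = x →
      g z x = f p) :
    ‖g‖ₑ ^ q ≤ chainConst q ^ q * chainSum q f := by
  have hq' : (0 : ℝ) < 1 / q := by positivity
  have key : ‖g‖ₑ ≤ (chainConst q ^ q * chainSum q f) ^ (1 / q : ℝ) := by
    refine enorm_continuousMap_le _ fun z => enorm_continuousMap_le _ fun x => ?_
    obtain ⟨p, hp, hpz, hpx⟩ := exists_cube_eq hT z.2 x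
    rw [hgf z x p hpz hpx]
    calc ‖f p‖ₑ = (‖f p‖ₑ ^ q) ^ (1 / q : ℝ) := by
          rw [← ENNReal.rpow_natCast, ← ENNReal.rpow_mul, mul_one_div_cancel (by positivity),
            ENNReal.rpow_one]
      _ ≤ _ := ENNReal.rpow_le_rpow (enorm_pow_le_chainSum hq hf hp) hq'.le
  calc ‖g‖ₑ ^ q ≤ ((chainConst q ^ q * chainSum q f) ^ (1 / q : ℝ)) ^ q := by gcongr
    _ = _ := by
        rw [← ENNReal.rpow_natCast, ← ENNReal.rpow_mul, one_div_mul_cancel (by positivity),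
          ENNReal.rpow_one]

variable [IsProbabilityMeasure P]

lemma wickCoeffPath_apply (hB : IsCylindricalWiener B P) (hχ : IsCutoff χ) (ℓ : ℕ) {T : ℝ}
    {N : ℕ} (hN : 1 ≤ N) {ω : Ω} (hω : ∀ n, Continuous fun t => B n t ω) (n : Freq)
    (z : paramSet T) :
    wickCoeffPath P χ B T ℓ N n ω z = wickDist P χ B ℓ N z.1.1 z.1.2 ω n := by
  have h : Continuous fun z : paramSet T => wickDist P χ B ℓ N z.1.1 z.1.2 ω n :=
    continuousOn_iff_continuous_domRestrict.1 (continuousOn_wickDist hB hχ ℓ T hN hω n)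
  rw [wickCoeffPath, dif_pos h]
  rfl

lemma wickPath_apply_apply (hB : IsCylindricalWiener B P) (hχ : IsCutoff χ) (ℓ : ℕ) (s : ℝ) {T : ℝ}
    {N : ℕ} (hN : 1 ≤ N) {ω : Ω} (hω : ∀ n, Continuous fun t => B n t ω)
    (z : paramSet T) (x : Torus) :
    wickPath P χ B s T ℓ N ω z x = wickField P χ B s ℓ N z.1 x ω := by
  rw [wickPath_apply, ContinuousMap.coe_sum, Finset.sum_apply, wickField, wickForm]
  refine Finset.sum_congr rfl fun n _ => ?_
  rw [wickCoeffPath_apply hB hχ ℓ hN hω]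
  simp only [ContinuousMap.coe_smul, Pi.smul_apply, smul_eq_mul, basisMap, ContinuousMap.coe_mk,
    besselTest]
  ring

lemma torusCoeff_wickPath (hB : IsCylindricalWiener B P) (hχ : IsCutoff χ) (ℓ : ℕ) (s : ℝ) {T : ℝ}
    {N : ℕ} (hN : 1 ≤ N) {ω : Ω} (hω : ∀ n, Continuous fun t => B n t ω)
    (z : paramSet T) (n : Freq) :
    torusCoeff (wickPath P χ B s T ℓ N ω z) n
      = ((bracket n ^ (-s) : ℝ) : ℂ) * wickDist P χ B ℓ N z.1.1 z.1.2 ω n := by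
  have e : (wickPath P χ B s T ℓ N ω z : Torus → ℂ) = fun x => ∑ n ∈ freqBox (ℓ * (2 * N)),
      (((bracket n ^ (-s) : ℝ) : ℂ) * wickDist P χ B ℓ N z.1.1 z.1.2 ω n) * basisFun n x := by
    funext x
    rw [wickPath_apply_apply hB hχ ℓ s hN hω, wickField, wickForm]
    refine Finset.sum_congr rfl fun n _ => ?_
    rw [besselTest]
    ring
  rw [e, torusCoeff_basisFun_sum]
  split_ifs with h
  · rfl
  · rw [wickDist, torusCoeff_eq_zero (wickFun_mem_trigPoly hB hχ ℓ hN
      (nonneg_of_mem_paramSet z.2) ω) h, mul_zero]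

/-- The path is a finite sum of scalar continuous paths times fixed functions of x, so measurability
reduces to scalar paths, where evaluation at points decides it. -/
lemma aestronglyMeasurable_wickPath (hB : IsCylindricalWiener B P) (hχ : IsCutoff χ) (ℓ : ℕ)
    (s T : ℝ) {N : ℕ} (hN : 1 ≤ N) :
    AEStronglyMeasurable (wickPath P χ B s T ℓ N) P := by
  unfold wickPath
  refine Finset.aestronglyMeasurable_fun_sum _ fun n _ => ?_
  borelize C(paramSet T, ℂ)
  refine (ContinuousLinearMap.continuous _).comp_aestronglyMeasurable
    (aemeasurable_continuousMap_of_eval fun z => ?_).aestronglyMeasurable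
  have hz := nonneg_of_mem_paramSet z.2
  refine (aemeasurable_wickForm hB hχ ℓ hN le_rfl (Pi.single n 1) hz).congr ?_
  filter_upwards [hB.ae_continuous] with ω hω
  rw [wickCoeffPath_apply hB hχ ℓ hN hω, wickForm]
  by_cases hn : n ∈ freqBox (ℓ * (2 * N))
  · rw [Finset.sum_eq_single n (fun m _ h => by rw [Pi.single_eq_of_ne h, zero_mul])
      fun h => absurd hn h]
    simp
  · rw [show wickDist P χ B ℓ N z.1.1 z.1.2 ω n = 0 from
      torusCoeff_eq_zero (wickFun_mem_trigPoly hB hχ ℓ hN hz ω) hn]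
    refine Finset.sum_eq_zero fun m hm => ?_
    rw [Pi.single_eq_of_ne (ne_of_mem_of_not_mem hm hn), zero_mul]

/-- Moments of the smoothed Wick powers in the space of continuous functions. -/
theorem exists_lintegral_enorm_wickPath_le (hB : IsCylindricalWiener B P) (hχ : IsCutoff χ)
    (ℓ : ℕ) {s T : ℝ} (hs : 0 < s) (hT : 0 < T) :
    ∃ δ : ℝ, 0 < δ ∧ ∃ k₀ : ℕ, ∀ k, k₀ ≤ k → ∃ C : ℝ≥0∞, C ≠ ∞ ∧
      (∀ N, 1 ≤ N → ∫⁻ ω, ‖wickPath P χ B s T ℓ N ω‖ₑ ^ (2 * (k + 1)) ∂P ≤ C) ∧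
      (∀ N M, 1 ≤ N → N ≤ M →
        ∫⁻ ω, ‖wickPath P χ B s T ℓ N ω - wickPath P χ B s T ℓ M ω‖ₑ ^ (2 * (k + 1)) ∂P
          ≤ C * ENNReal.ofReal (((N : ℝ) ^ (-δ)) ^ (k + 1))) := by
  obtain ⟨δ, hδ, k₀, h⟩ := exists_lintegral_chainSum_cubeField_le hB hχ ℓ hs hT.le
  refine ⟨δ, hδ, k₀, fun k hk => ?_⟩
  obtain ⟨C, hC, h1, h2⟩ := h k hk
  have hq : 2 * (k + 1) ≠ 0 := by omega
  have hc : chainConst (2 * (k + 1)) ^ (2 * (k + 1)) ≠ ∞ := ENNReal.pow_ne_top (chainConst_ne_top hq)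
  refine ⟨chainConst (2 * (k + 1)) ^ (2 * (k + 1)) * C, ENNReal.mul_ne_top hc hC,
    fun N hN => ?_, fun N M hN hM => ?_⟩
  · refine le_trans ?_ (mul_le_mul_right (h1 N hN) _)
    rw [← lintegral_const_mul' _ _ hc]
    refine lintegral_mono_ae ?_
    filter_upwards [hB.ae_continuous] with ω hω
    refine enorm_pow_le_chainSum_of_cube hT hq (continuousOn_cubeField hB hχ ℓ s hT.le hN hω)
      fun z x p hz hx => ?_
    rw [wickPath_apply_apply hB hχ ℓ s hN hω, cubeField, hz, hx]
  · rw [mul_assoc]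
    refine le_trans ?_ (mul_le_mul_right (h2 N M hN hM) _)
    rw [← lintegral_const_mul' _ _ hc]
    refine lintegral_mono_ae ?_
    filter_upwards [hB.ae_continuous] with ω hω
    have hM1 := hN.trans hM
    refine enorm_pow_le_chainSum_of_cube hT hq
      ((continuousOn_cubeField hB hχ ℓ s hT.le hN hω).sub
        (continuousOn_cubeField hB hχ ℓ s hT.le hM1 hω)) fun z x p hz hx => ?_
    rw [ContinuousMap.sub_apply, ContinuousMap.sub_apply, wickPath_apply_apply hB hχ ℓ s hN hω,
      wickPath_apply_apply hB hχ ℓ s hM1 hω, cubeField, cubeField, hz, hx]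

end WickPath

/-! ### Convergence from polynomially decaying moments -/

section AbstractLimit

/-- A sequence of random variables whose increments have arbitrarily high moments of polynomial
decay converges almost surely and in all `L^p`. -/
theorem exists_limit_of_lintegral_pow_le {Ω E : Type*} [MeasurableSpace Ω] {P : Measure Ω}
    [IsProbabilityMeasure P] [NormedAddCommGroup E] [CompleteSpace E] {X : ℕ → Ω → E}
    (hX : ∀ N, 1 ≤ N → AEStronglyMeasurable (X N) P) {δ : ℝ} (hδ : 0 < δ) {k₀ : ℕ}
    (h : ∀ k, k₀ ≤ k → ∃ C : ℝ≥0∞, C ≠ ∞ ∧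
      (∀ N, 1 ≤ N → ∫⁻ ω, ‖X N ω‖ₑ ^ (2 * (k + 1)) ∂P ≤ C) ∧
      (∀ N M, 1 ≤ N → N ≤ M → ∫⁻ ω, ‖X N ω - X M ω‖ₑ ^ (2 * (k + 1)) ∂P
          ≤ C * ENNReal.ofReal (((N : ℝ) ^ (-δ)) ^ (k + 1)))) :
    ∃ Y : Ω → E, (∀ᵐ ω ∂P, Tendsto (fun N => X N ω) atTop (𝓝 (Y ω))) ∧
      ∀ p : ℝ≥0∞, p ≠ ∞ → (∀ N, 1 ≤ N → MemLp (X N) p P) ∧ MemLp Y p P ∧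
        Tendsto (fun N => eLpNorm (X N - Y) p P) atTop (𝓝 0) := by
  have hnorm : ∀ (f : Ω → E) (k : ℕ), eLpNorm f ((2 * (k + 1) : ℕ) : ℝ≥0∞) P ^ (2 * (k + 1))
      = ∫⁻ ω, ‖f ω‖ₑ ^ (2 * (k + 1)) ∂P := by
    intro f k
    have := eLpNorm_nnreal_pow_eq_lintegral (f := f) (μ := P) (p := ((2 * (k + 1) : ℕ) : ℝ≥0))
      (by positivity)
    rw [NNReal.coe_natCast] at this
    simpa only [ENNReal.rpow_natCast, ENNReal.coe_natCast] using this
  have hdecay : ∀ k, Tendsto (fun N : ℕ => ENNReal.ofReal (((N : ℝ) ^ (-δ)) ^ (k + 1))) atTop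
      (𝓝 0) := by
    intro k
    have h1 : Tendsto (fun N : ℕ => ((N : ℝ) ^ (-δ)) ^ (k + 1)) atTop (𝓝 0) := by
      simpa using ((tendsto_rpow_neg_atTop hδ).comp tendsto_natCast_atTop_atTop).pow (k + 1)
    simpa using ENNReal.tendsto_ofReal h1
  have hmem : ∀ N, 1 ≤ N → ∀ k, k₀ ≤ k → MemLp (X N) ((2 * (k + 1) : ℕ) : ℝ≥0∞) P := by
    intro N hN k hk
    obtain ⟨C, hC, h1, -⟩ := h k hk
    refine ⟨hX N hN, ?_⟩
    have h2 : eLpNorm (X N) ((2 * (k + 1) : ℕ) : ℝ≥0∞) P ^ (2 * (k + 1)) < ∞ := by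
      rw [hnorm]; exact (h1 N hN).trans_lt hC.lt_top
    exact (ENNReal.pow_lt_top_iff.1 h2).resolve_right (by omega)
  have hroot : ∀ (k : ℕ) (u : ℕ → ℝ≥0∞), Tendsto (fun N => u N ^ (2 * (k + 1))) atTop (𝓝 0) →
      Tendsto u atTop (𝓝 0) := by
    intro k u hu
    have h1 := (ENNReal.continuous_rpow_const (y := (1 / (2 * (k + 1) : ℕ) : ℝ))).tendsto 0
    have h2 := h1.comp hu
    rw [ENNReal.zero_rpow_of_pos (by positivity)] at h2
    refine h2.congr fun N => ?_
    rw [Function.comp, ← ENNReal.rpow_natCast, ← ENNReal.rpow_mul,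
      mul_one_div_cancel (by positivity), ENNReal.rpow_one]
  -- One exponent is fixed with δ(k+1) ≥ 2, so that the moments of the increments are summable in N.
  -- The limit is constructed there and afterwards shown to work for all exponents.
  obtain ⟨k₁, hk₁⟩ := exists_nat_ge (2 / δ)
  set k := max k₀ k₁ with hk
  have hkδ : 2 ≤ δ * (k + 1) := by
    have h1 : 2 / δ ≤ k + 1 := hk₁.trans (by
      have : (k₁ : ℝ) ≤ k := by exact_mod_cast le_max_right _ _
      linarith)
    rw [div_le_iff₀ hδ] at h1
    linarith
  obtain ⟨C, hC, -, hd⟩ := h k (le_max_left _ _)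
  set q : ℝ≥0∞ := ((2 * (k + 1) : ℕ) : ℝ≥0∞) with hq
  have : Fact (1 ≤ q) := ⟨by rw [hq]; exact_mod_cast (by omega : 1 ≤ 2 * (k + 1))⟩
  -- The index is shifted by one, because nothing is assumed about N = 0.
  set a : ℕ → Lp E q P := fun N => (hmem (N + 1) (by omega) k (le_max_left _ _)).toLp _ with ha
  have hcau : CauchySeq a := by
    refine EMetric.cauchySeq_iff.2 fun e he => ?_
    have h1 : Tendsto (fun N : ℕ => C * ENNReal.ofReal ((((N + 1 : ℕ) : ℝ) ^ (-δ)) ^ (k + 1))) atTop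
        (𝓝 0) := by
      simpa using ENNReal.Tendsto.const_mul ((tendsto_add_atTop_iff_nat 1).2 (hdecay k))
        (Or.inr hC)
    have hsm : ∀ n m : ℕ, n ≤ m → edist (a n) (a m) ^ (2 * (k + 1))
        ≤ C * ENNReal.ofReal ((((n + 1 : ℕ) : ℝ) ^ (-δ)) ^ (k + 1)) := by
      intro n m hnm
      rw [ha, Lp.edist_toLp_toLp, hnorm]
      exact hd (n + 1) (m + 1) (by omega) (by omega)
    have he' : 0 < e ^ (2 * (k + 1)) := by positivity
    obtain ⟨N, hN⟩ := eventually_atTop.1 (h1.eventually (gt_mem_nhds he'))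
    have hlt : ∀ n m : ℕ, N ≤ n → n ≤ m → edist (a n) (a m) < e := fun n m hn hnm =>
      lt_of_pow_lt_pow_left' _ ((hsm n m hnm).trans_lt (hN n hn))
    refine ⟨N, fun m hm n hn => ?_⟩
    rcases le_total m n with hmn | hmn
    · exact hlt m n hm hmn
    · rw [edist_comm]; exact hlt n m hn hmn
  obtain ⟨Y', hY⟩ := cauchySeq_tendsto_of_complete hcau
  let Y : Ω → E := fun ω => Y' ω
  have hYm : AEStronglyMeasurable Y P := Lp.aestronglyMeasurable Y'
  have hbound : ∀ N : ℕ, ∫⁻ ω, ‖X (N + 1) ω - Y ω‖ₑ ^ (2 * (k + 1)) ∂P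
      ≤ C * ENNReal.ofReal ((((N + 1 : ℕ) : ℝ) ^ (-δ)) ^ (k + 1)) := by
    intro N
    have h1 : Tendsto (fun M => edist (a N) (a M) ^ (2 * (k + 1))) atTop
        (𝓝 (edist (a N) Y' ^ (2 * (k + 1)))) :=
      ((ENNReal.continuous_pow _).tendsto _).comp (tendsto_const_nhds.edist hY)
    have h2 : edist (a N) Y' ^ (2 * (k + 1))
        ≤ C * ENNReal.ofReal ((((N + 1 : ℕ) : ℝ) ^ (-δ)) ^ (k + 1)) := by
      refine le_of_tendsto h1 (eventually_atTop.2 ⟨N, fun M hM => ?_⟩)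
      rw [ha, Lp.edist_toLp_toLp, hnorm]
      exact hd (N + 1) (M + 1) (by omega) (by omega)
    refine le_trans (le_of_eq ?_) h2
    rw [Lp.edist_def]
    refine ((hnorm _ k).trans ?_).symm
    refine lintegral_congr_ae ?_
    filter_upwards [MemLp.coeFn_toLp (hmem (N + 1) (by omega) k (le_max_left _ _))] with ω hω
    rw [Pi.sub_apply, ← hω]
  have hae : ∀ᵐ ω ∂P, Tendsto (fun N => X N ω) atTop (𝓝 (Y ω)) := by
    -- A convergent series of moments forces the series of powers of the errors to converge almost
    -- surely, and hence its terms to vanish along the full sequence.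
    have hsum : ∑' N : ℕ, ∫⁻ ω, ‖X (N + 1) ω - Y ω‖ₑ ^ (2 * (k + 1)) ∂P ≠ ∞ := by
      refine ne_top_of_le_ne_top ?_ (ENNReal.tsum_le_tsum hbound)
      rw [ENNReal.tsum_mul_left]
      refine ENNReal.mul_ne_top hC ?_
      have hs : Summable fun N : ℕ => (((N + 1 : ℕ) : ℝ) ^ (-δ)) ^ (k + 1) := by
        refine (summable_nat_add_iff 1 (f := fun N : ℕ => ((N : ℝ) ^ (-δ)) ^ (k + 1))).2 ?_
        have e : ∀ N : ℕ, ((N : ℝ) ^ (-δ)) ^ (k + 1) = (N : ℝ) ^ (-(δ * (k + 1))) := by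
          intro N
          rw [← Real.rpow_natCast, ← Real.rpow_mul (Nat.cast_nonneg N)]
          push_cast
          ring_nf
        simp_rw [e]
        exact Real.summable_nat_rpow.2 (by linarith)
      exact hs.tsum_ofReal_ne_top
    have hmeas : ∀ N : ℕ, AEMeasurable (fun ω => ‖X (N + 1) ω - Y ω‖ₑ ^ (2 * (k + 1))) P :=
      fun N => ((hX (N + 1) (by omega)).sub hYm).enorm.pow_const _
    rw [← lintegral_tsum hmeas] at hsum
    have hfin := ae_lt_top' (AEMeasurable.tsum hmeas) hsum
    filter_upwards [hfin] with ω hω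
    have h1 := hroot k _ (ENNReal.tendsto_atTop_zero_of_tsum_ne_top hω.ne)
    refine (tendsto_add_atTop_iff_nat 1).1 ?_
    rw [tendsto_iff_edist_tendsto_0]
    simpa only [edist_eq_enorm_sub] using h1
  refine ⟨Y, hae, fun p hp => ?_⟩
  obtain ⟨k₂, hk₂⟩ := exists_nat_ge p.toReal
  set j := max k₀ k₂ with hj
  have hpj : p ≤ ((2 * (j + 1) : ℕ) : ℝ≥0∞) := by
    rw [← ENNReal.ofReal_toReal hp, ← ENNReal.ofReal_natCast]
    refine ENNReal.ofReal_le_ofReal (hk₂.trans ?_)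
    have h1 : k₂ ≤ j := le_max_right _ _
    exact_mod_cast (by omega : k₂ ≤ 2 * (j + 1))
  obtain ⟨C', hC', -, hd'⟩ := h j (le_max_left _ _)
  have hb : ∀ N, 1 ≤ N → ∫⁻ ω, ‖X N ω - Y ω‖ₑ ^ (2 * (j + 1)) ∂P
      ≤ C' * ENNReal.ofReal (((N : ℝ) ^ (-δ)) ^ (j + 1)) := by
    intro N hN
    -- Fatou's lemma: almost sure convergence carries the increment bound for the higher moment over
    -- to the limit.
    have h1 : ∫⁻ ω, ‖X N ω - Y ω‖ₑ ^ (2 * (j + 1)) ∂P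
        = ∫⁻ ω, liminf (fun M => ‖X N ω - X (M + 1) ω‖ₑ ^ (2 * (j + 1))) atTop ∂P := by
      refine lintegral_congr_ae ?_
      filter_upwards [hae] with ω hω
      have h2 : Tendsto (fun M => ‖X N ω - X (M + 1) ω‖ₑ ^ (2 * (j + 1))) atTop
          (𝓝 (‖X N ω - Y ω‖ₑ ^ (2 * (j + 1)))) :=
        ((ENNReal.continuous_pow _).tendsto _).comp
          (tendsto_const_nhds.sub ((tendsto_add_atTop_iff_nat 1).2 hω)).enorm
      exact h2.liminf_eq.symm
    rw [h1]
    refine (lintegral_liminf_le' fun M =>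
      ((hX N hN).sub (hX (M + 1) (by omega))).enorm.pow_const _).trans ?_
    refine liminf_le_of_frequently_le' (Eventually.frequently (eventually_atTop.2 ⟨N, fun M hM => ?_⟩))
    exact hd' N (M + 1) hN (by omega)
  have ht : Tendsto (fun N => eLpNorm (X N - Y) ((2 * (j + 1) : ℕ) : ℝ≥0∞) P) atTop (𝓝 0) := by
    refine hroot j _ ?_
    have h1 : Tendsto (fun N : ℕ => C' * ENNReal.ofReal (((N : ℝ) ^ (-δ)) ^ (j + 1))) atTop
        (𝓝 0) := by
      simpa using ENNReal.Tendsto.const_mul (hdecay j) (Or.inr hC')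
    refine tendsto_of_tendsto_of_tendsto_of_le_of_le' tendsto_const_nhds h1
      (Eventually.of_forall fun _ => zero_le) (eventually_atTop.2 ⟨1, fun N hN => ?_⟩)
    rw [hnorm]
    exact hb N hN
  have hm1 := hmem 1 le_rfl j (le_max_left _ _)
  have hXY : MemLp (X 1 - Y) ((2 * (j + 1) : ℕ) : ℝ≥0∞) P := by
    refine ⟨(hX 1 le_rfl).sub hYm, ?_⟩
    have h2 : eLpNorm (X 1 - Y) ((2 * (j + 1) : ℕ) : ℝ≥0∞) P ^ (2 * (j + 1)) < ∞ := by
      rw [hnorm]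
      exact (hb 1 le_rfl).trans_lt (ENNReal.mul_lt_top hC'.lt_top ENNReal.ofReal_lt_top)
    exact (ENNReal.pow_lt_top_iff.1 h2).resolve_right (by omega)
  have hYp : MemLp Y ((2 * (j + 1) : ℕ) : ℝ≥0∞) P := by
    simpa using hm1.sub hXY
  refine ⟨fun N hN => (hmem N hN j (le_max_left _ _)).mono_exponent hpj, hYp.mono_exponent hpj, ?_⟩
  refine tendsto_of_tendsto_of_tendsto_of_le_of_le' tendsto_const_nhds ht
    (Eventually.of_forall fun _ => zero_le) (eventually_atTop.2 ⟨1, fun N hN => ?_⟩)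
  exact eLpNorm_le_eLpNorm_of_exponent_le hpj ((hX N hN).sub hYm)

end AbstractLimit

/-! ### From continuous paths to the Sobolev and Bochner spaces -/

section Sobolev

lemma norm_sobolevInfty {s : ℝ} (u : SobolevInfty s) : ‖u‖ = ‖besselEquiv s u‖ := rfl

/-- The map `g ↦ ⟨∇⟩^{-s} g` from the continuous functions to `W^{s,∞}`. -/
noncomputable def sobolevOf (s : ℝ) : C(Torus, ℂ) →L[ℂ] SobolevInfty s :=
  LinearMap.mkContinuous ((besselEquiv s).symm.toLinearMap
    ∘ₗ (ContinuousMap.toLp (E := ℂ) ∞ (volume : Measure Torus) ℂ).toLinearMap)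
    ‖ContinuousMap.toLp (E := ℂ) ∞ (volume : Measure Torus) ℂ‖ fun g => by
      rw [norm_sobolevInfty]
      simp only [LinearMap.comp_apply, LinearEquiv.coe_coe, LinearEquiv.apply_symm_apply]
      exact ContinuousLinearMap.le_opNorm _ _

lemma toDist_sobolevOf (s : ℝ) (g : C(Torus, ℂ)) (n : Freq) :
    (sobolevOf s g).toDist n = ((bracket n ^ (-s) : ℝ) : ℂ) * torusCoeff g n := by
  have h : (sobolevOf s g).toDist
      = besselMap s (ContinuousMap.toLp (E := ℂ) ∞ (volume : Measure Torus) ℂ g) := rfl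
  rw [h]
  change _ * torusCoeff _ n = _
  congr 1
  refine integral_congr_ae ?_
  filter_upwards [ContinuousMap.coeFn_toLp (𝕜 := ℂ) (p := ∞) (volume : Measure Torus) g] with x hx
  rw [hx]

lemma tendsto_torusCoeff {ι : Type*} {l : Filter ι} {f : ι → C(Torus, ℂ)} {g : C(Torus, ℂ)}
    (h : Tendsto f l (𝓝 g)) (n : Freq) :
    Tendsto (fun i => torusCoeff (f i) n) l (𝓝 (torusCoeff g n)) := by
  have hint : ∀ g : C(Torus, ℂ), Integrable (fun x => g x * conj (basisFun n x)) := fun g =>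
    integrable_torus (g.continuous.mul (Complex.continuous_conj.comp (continuous_basisFun n)))
  set c : ℝ := ‖(2 * Real.pi : ℂ)⁻¹‖ * (volume : Measure Torus).real Set.univ with hc
  rw [tendsto_iff_norm_sub_tendsto_zero] at h ⊢
  have h2 : Tendsto (fun i => ‖f i - g‖ * c) l (𝓝 0) := by simpa using h.mul_const c
  refine squeeze_zero (fun _ => norm_nonneg _) (fun i => ?_) h2
  rw [torusCoeff, torusCoeff, ← integral_sub (hint _) (hint _), hc, ← mul_assoc]
  refine norm_integral_le_of_norm_le_const (Eventually.of_forall fun x => ?_)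
  rw [← sub_mul, norm_mul, RCLike.norm_conj, basisFun, norm_mul, norm_mono, mul_one]
  gcongr
  exact (f i - g).norm_coe_le_norm x

section PathToLp

variable {S K : Type*} [MeasurableSpace S] [TopologicalSpace K] [CompactSpace K]
  [MeasurableSpace K] [BorelSpace K] (μ : Measure S) [IsFiniteMeasure μ] (s : ℝ) (q : ℝ≥0∞)

lemma norm_sobolevOf_path_le {S K : Type*} [TopologicalSpace K] [CompactSpace K] (s : ℝ) (ι : S → K)
    (g : C(K, C(Torus, ℂ))) (z : S) : ‖sobolevOf s (g (ι z))‖ ≤ ‖sobolevOf s‖ * ‖g‖ :=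
  ((sobolevOf s).le_opNorm _).trans
    (mul_le_mul_of_nonneg_left (g.norm_coe_le_norm _) (norm_nonneg _))

lemma memLp_sobolevOf_path {ι : S → K} (hι : Measurable ι) (g : C(K, C(Torus, ℂ))) :
    MemLp (fun z => sobolevOf s (g (ι z))) q μ := by
  borelize C(Torus, ℂ)
  exact MemLp.of_bound ((sobolevOf s).continuous.comp_aestronglyMeasurable
    (g.continuous.measurable.comp hι).aestronglyMeasurable) _
    (Eventually.of_forall (norm_sobolevOf_path_le s ι g))

variable [Fact (1 ≤ q)]

/-- The embedding of continuous paths in `L^q`, along a measurable parametrization. -/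
noncomputable def pathToLp {ι : S → K} (hι : Measurable ι) :
    C(K, C(Torus, ℂ)) →L[ℂ] Lp (SobolevInfty s) q μ :=
  LinearMap.mkContinuous
    { toFun := fun g => (memLp_sobolevOf_path μ s q hι g).toLp _
      map_add' := fun g h => by
        rw [← MemLp.toLp_add]
        refine MemLp.toLp_congr _ _ (Eventually.of_forall fun z => ?_)
        simp
      map_smul' := fun c g => by
        rw [RingHom.id_apply, ← MemLp.toLp_const_smul]
        refine MemLp.toLp_congr _ _ (Eventually.of_forall fun z => ?_)
        simp }
    ((measureUnivNNReal μ : ℝ) ^ (q.toReal⁻¹) * ‖sobolevOf s‖) fun g => by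
      rw [mul_assoc]
      refine Lp.norm_le_of_ae_bound (by positivity) ?_
      filter_upwards [(memLp_sobolevOf_path μ s q hι g).coeFn_toLp] with z hz
      simp only [LinearMap.coe_mk, AddHom.coe_mk]
      rw [hz]
      exact norm_sobolevOf_path_le s ι g z

lemma pathToLp_apply {ι : S → K} (hι : Measurable ι) (g : C(K, C(Torus, ℂ))) :
    ∀ᵐ z ∂μ, pathToLp μ s q hι g z = sobolevOf s (g (ι z)) :=
  (memLp_sobolevOf_path μ s q hι g).coeFn_toLp

end PathToLp

end Sobolev

/-! ### Identification of the limit and the modes of convergence -/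

section Limit

variable {Ω : Type*} [MeasurableSpace Ω] {P : Measure Ω}
  {B : Freq → ℝ≥0 → Ω → ℂ} {χ : ℝ → ℝ}

/-- The limiting Wick power. -/
noncomputable def wickLimit (P : Measure Ω) (χ : ℝ → ℝ) (B : Freq → ℝ≥0 → Ω → ℂ) (ℓ : ℕ)
    (ε t : ℝ) (ω : Ω) : Dist :=
  fun n => limUnder atTop fun N : ℕ => wickDist P χ B ℓ N ε t ω n

variable [IsProbabilityMeasure P]

lemma toDist_sobolevOf_wickPath (hB : IsCylindricalWiener B P) (hχ : IsCutoff χ) (ℓ : ℕ) (s : ℝ)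
    {T : ℝ} {N : ℕ} (hN : 1 ≤ N) {ω : Ω} (hω : ∀ n, Continuous fun t => B n t ω)
    (z : paramSet T) :
    (sobolevOf (-s) (wickPath P χ B s T ℓ N ω z)).toDist = wickDist P χ B ℓ N z.1.1 z.1.2 ω := by
  funext n
  rw [toDist_sobolevOf, torusCoeff_wickPath hB hχ ℓ s hN hω, ← mul_assoc, ← Complex.ofReal_mul,
    ← Real.rpow_add (bracket_pos n), neg_add_cancel, Real.rpow_zero, Complex.ofReal_one, one_mul]

/-- Uniform convergence passes to Fourier coefficients, which identify the limit. The right-hand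
side involves neither s nor T, so the limits obtained for different s and T define the same
distribution. -/
lemma toDist_sobolevOf_limit (hB : IsCylindricalWiener B P) (hχ : IsCutoff χ) (ℓ : ℕ) (s : ℝ)
    {T : ℝ} {ω : Ω} (hω : ∀ n, Continuous fun t => B n t ω) {g : C(paramSet T, C(Torus, ℂ))}
    (hg : Tendsto (fun N => wickPath P χ B s T ℓ N ω) atTop (𝓝 g)) (z : paramSet T) :
    (sobolevOf (-s) (g z)).toDist = wickLimit P χ B ℓ z.1.1 z.1.2 ω := by
  funext n
  have h1 : Tendsto (fun N => wickPath P χ B s T ℓ N ω z) atTop (𝓝 (g z)) :=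
    ((continuous_eval_const z).tendsto g).comp hg
  have h2 := (tendsto_torusCoeff h1 n).const_mul ((bracket n ^ (-(-s)) : ℝ) : ℂ)
  rw [toDist_sobolevOf]
  refine (Tendsto.limUnder_eq (h2.congr' (eventually_atTop.2 ⟨1, fun N hN => ?_⟩))).symm
  rw [← toDist_sobolevOf, toDist_sobolevOf_wickPath hB hχ ℓ s hN hω]

lemma exists_wickPath_limit (hB : IsCylindricalWiener B P) (hχ : IsCutoff χ) (ℓ : ℕ) {s T : ℝ}
    (hs : 0 < s) (hT : 0 < T) :
    ∃ Y : Ω → C(paramSet T, C(Torus, ℂ)),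
      (∀ᵐ ω ∂P, Tendsto (fun N => wickPath P χ B s T ℓ N ω) atTop (𝓝 (Y ω))) ∧
      ∀ p : ℝ≥0∞, p ≠ ∞ → (∀ N, 1 ≤ N → MemLp (wickPath P χ B s T ℓ N) p P) ∧ MemLp Y p P ∧
        Tendsto (fun N => eLpNorm (wickPath P χ B s T ℓ N - Y) p P) atTop (𝓝 0) := by
  obtain ⟨δ, hδ, k₀, h⟩ := exists_lintegral_enorm_wickPath_le hB hχ ℓ hs hT
  exact exists_limit_of_lintegral_pow_le
    (fun N hN => aestronglyMeasurable_wickPath hB hχ ℓ s T hN) hδ h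

/-- Convergence in `L^p(Ω; L^q)` along any measurable parametrization of the parameter set. -/
theorem tendstoLpLq_wickDist (hB : IsCylindricalWiener B P) (hχ : IsCutoff χ) (ℓ : ℕ) {s T : ℝ}
    (hs : 0 < s) (hT : 0 < T) {p q : ℝ≥0∞} [Fact (1 ≤ p)] [Fact (1 ≤ q)] (hp : p ≠ ∞)
    {S : Type*} [MeasurableSpace S] (μ : Measure S) [IsFiniteMeasure μ] {ι : S → paramSet T}
    (hι : Measurable ι) {e : S → ℝ × ℝ} (he : ∀ᵐ z ∂μ, (ι z : ℝ × ℝ) = e z) :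
    TendstoLpLq P μ (-s) p q (fun N z ω => wickDist P χ B ℓ N (e z).1 (e z).2 ω)
      (fun z ω => wickLimit P χ B ℓ (e z).1 (e z).2 ω) := by
  obtain ⟨Y, hY, hYp⟩ := exists_wickPath_limit hB hχ ℓ hs hT
  obtain ⟨h1, h2, h3⟩ := hYp p hp
  set L := pathToLp μ (-s) q hι
  -- Bounds are available for N ≥ 1, so index 0 is replaced by 1; this affects neither the
  -- convergence nor the identification for N ≥ 1.
  have hX : ∀ N, MemLp (wickPath P χ B s T ℓ (max N 1)) p P := fun N => h1 _ (le_max_right _ _)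
  refine ⟨fun N => L.compLpL p P ((hX N).toLp _), L.compLpL p P (h2.toLp _), fun N hN => ?_, ?_, ?_⟩
  · filter_upwards [L.coeFn_compLpL ((hX N).toLp _), (hX N).coeFn_toLp, hB.ae_continuous]
      with ω a1 a2 a3
    rw [a1, a2]
    filter_upwards [pathToLp_apply μ (-s) q hι (wickPath P χ B s T ℓ (max N 1) ω), he] with z b1 b2
    rw [b1, toDist_sobolevOf_wickPath hB hχ ℓ s (le_max_right _ _) a3, b2, max_eq_left hN]
  · filter_upwards [L.coeFn_compLpL (h2.toLp _), h2.coeFn_toLp, hB.ae_continuous, hY]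
      with ω a1 a2 a3 a4
    rw [a1, a2]
    filter_upwards [pathToLp_apply μ (-s) q hι (Y ω), he] with z b1 b2
    rw [b1, toDist_sobolevOf_limit hB hχ ℓ s a3 a4, b2]
  · refine ((L.compLpL p P).continuous.tendsto _).comp ?_
    rw [Lp.tendsto_Lp_iff_tendsto_eLpNorm'']
    refine h3.congr' (eventually_atTop.2 ⟨1, fun N hN => ?_⟩)
    simp only [max_eq_left hN]

/-- Almost sure uniform convergence. -/
theorem ae_tendstoC_wickDist (hB : IsCylindricalWiener B P) (hχ : IsCutoff χ) (ℓ : ℕ) {s T : ℝ}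
    (hs : 0 < s) (hT : 0 < T) :
    ∀ᵐ ω ∂P, TendstoC (K := paramSet T) (-s)
      (fun N z => wickDist P χ B ℓ N z.1.1 z.1.2 ω) (fun z => wickLimit P χ B ℓ z.1.1 z.1.2 ω) := by
  obtain ⟨Y, hY, -⟩ := exists_wickPath_limit hB hχ ℓ hs hT
  filter_upwards [hY, hB.ae_continuous] with ω h1 h2
  set L := (sobolevOf (-s)).compLeftContinuous ℂ (paramSet T)
  exact ⟨fun N => L (wickPath P χ B s T ℓ N ω), L (Y ω),
    fun N hN z => toDist_sobolevOf_wickPath hB hχ ℓ s hN h2 z,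
    fun z => toDist_sobolevOf_limit hB hχ ℓ s h2 h1 z, (L.continuous.tendsto _).comp h1⟩

end Limit

/-! ### Parametrizations and conclusion -/

/-- The nearest-point projection onto the parameter rectangle. -/
noncomputable def projParam {T : ℝ} (hT : 0 ≤ T) (z : ℝ × ℝ) : paramSet T :=
  ⟨(Set.projIcc 0 1 zero_le_one z.1, Set.projIcc 0 T hT z.2),
    (Set.projIcc 0 1 zero_le_one z.1).2, (Set.projIcc 0 T hT z.2).2⟩

lemma continuous_projParam {T : ℝ} (hT : 0 ≤ T) : Continuous (projParam hT) := by
  refine Continuous.subtype_mk (Continuous.prodMk ?_ ?_) _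
  · exact continuous_subtype_val.comp (continuous_projIcc.comp continuous_fst)
  · exact continuous_subtype_val.comp (continuous_projIcc.comp continuous_snd)

lemma projParam_of_mem {T : ℝ} (hT : 0 ≤ T) {z : ℝ × ℝ} (hz : z ∈ paramSet T) :
    (projParam hT z : ℝ × ℝ) = z := by
  refine Prod.ext ?_ ?_
  · exact congrArg Subtype.val (Set.projIcc_of_mem zero_le_one hz.1)
  · exact congrArg Subtype.val (Set.projIcc_of_mem hT hz.2)

end WickDampedWave



theorem proposition4p1 {Ω : Type*} [MeasurableSpace Ω] (P : Measure Ω) [IsProbabilityMeasure P]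
    (B : Freq → ℝ≥0 → Ω → ℂ) (hB : IsCylindricalWiener B P)
    (χ : ℝ → ℝ) (hχ : IsCutoff χ) (ℓ : ℕ) :
    ∃ Z : ℝ → ℝ → Ω → Dist,
      (∀ (p q : ℝ≥0∞) [Fact (1 ≤ p)] [Fact (1 ≤ q)], p ≠ ∞ → q ≠ ∞ →
        ∀ T : ℝ, 0 < T → ∀ σ : ℝ, 0 < σ → ∀ ε ∈ Set.Icc (0 : ℝ) 1,
          TendstoLpLq P (volume.restrict (Set.Icc (0 : ℝ) T)) (-σ) p q
            (fun N t ω => wickDist P χ B ℓ N ε t ω) (fun t ω => Z ε t ω)) ∧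
      (∀ (p q : ℝ≥0∞) [Fact (1 ≤ p)] [Fact (1 ≤ q)], p ≠ ∞ → q ≠ ∞ →
        ∀ T : ℝ, 0 < T → ∀ σ : ℝ, 0 < σ →
          TendstoLpLq P (volume.restrict (Set.Icc (0 : ℝ) 1 ×ˢ Set.Icc (0 : ℝ) T)) (-σ) p q
            (fun N z ω => wickDist P χ B ℓ N z.1 z.2 ω) (fun z ω => Z z.1 z.2 ω)) ∧
      (∀ T : ℝ, 0 < T → ∀ σ : ℝ, 0 < σ → ∀ᵐ ω ∂P,
          TendstoC (K := ↥(Set.Icc (0 : ℝ) 1 ×ˢ Set.Icc (0 : ℝ) T)) (-σ)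
            (fun N z => wickDist P χ B ℓ N z.1.1 z.1.2 ω) (fun z => Z z.1.1 z.1.2 ω)) := by
  refine ⟨wickLimit P χ B ℓ, ?_, ?_, ?_⟩
  · intro p q _ _ hp _ T hT σ hσ ε hε
    -- Fixed ε is the slice t ↦ (ε,t) of the rectangle, since the underlying convergence is uniform
    -- in both parameters. The projection only makes this map total; it is the identity for almost
    -- every t of the restricted measure.
    refine tendstoLpLq_wickDist hB hχ ℓ hσ hT hp _ (ι := fun t => projParam hT.le (ε, t))
      ((continuous_projParam hT.le).comp (by fun_prop)).measurable (e := fun t => (ε, t)) ?_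
    filter_upwards [ae_restrict_mem measurableSet_Icc] with t ht
    exact projParam_of_mem hT.le ⟨hε, ht⟩
  · intro p q _ _ hp _ T hT σ hσ
    have : IsFiniteMeasure
        ((volume : Measure (ℝ × ℝ)).restrict (Set.Icc (0 : ℝ) 1 ×ˢ Set.Icc (0 : ℝ) T)) :=
      isFiniteMeasure_restrict.2 (isCompact_Icc.prod isCompact_Icc).measure_ne_top
    refine tendstoLpLq_wickDist hB hχ ℓ hσ hT hp _ (ι := projParam hT.le)
      (continuous_projParam hT.le).measurable (e := fun z => z) ?_
    filter_upwards [ae_restrict_mem (measurableSet_Icc.prod measurableSet_Icc)] with z hz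
    exact projParam_of_mem hT.le hz
  · intro T hT σ hσ
    exact ae_tendstoC_wickDist hB hχ ℓ hσ hT
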